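/- **Setting.** Let $H\in C^\infty(\mathbb R)$ be even with $H(0)=1$, $H(\pm1)=0$, $0<H(\xi)$ for $|\xi|<1$, $H(\xi)<1$ for $0<|\xi|\le 1$, $H''(0)<0<H''(1)$. Put $\Xi=[-1,1]$, $k=\frac1\pi\sqrt{|H''(0)|\,H''(1)}$, $\kappa=1/k$, $\mathrm S=[-\kappa,\kappa]$. For $\varepsilon>0$ let $g_\varepsilon=Z_\varepsilon^{-1}e^{-H/\varepsilon}$ with $Z_\varepsilon=\int_{-1}^1e^{-H/\varepsilon}\,d\xi$, $\gamma_\varepsilon=g_\varepsilon\mathscr L^1|_{\Xi}$, and $\tau_\varepsilon=\frac1{2\kappa}\int_{-1}^1\frac{d\xi}{g_\varepsilon}$. Finite nonnegative measures on $\Xi$ (the space $\mathscr M(\Xi)$, with weak-$*$ convergence) are extended by zero to $\mathbb R$. For $\rho=u\gamma_\varepsilon$ of mass $m$ let $\mathcal E_\varepsilon(\rho)=\int u\log u\,d\gamma_\varepsilon-m\log m$ ($+\infty$ if $\rho\not\ll\gamma_\varepsilon$). A velocity field of a curve $\rho\in C([0,T];\mathscr M(\Xi))$ is a Borel $v$ with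 $\int_0^T\!\int|v|\,d\rho_t\,dt<\infty$ and $\partial_t\rho+\partial_\xi(\rho v)=0$ in $\mathscr D'((0,T)\times\mathbb R)$; it is unique up to null sets. With it, $$\mathcal J_\varepsilon(\rho)=\int_0^T\Big(\int\frac{v^2}{2\tau_\varepsilon}\,d\rho_t+2\tau_\varepsilon\int|\partial_\xi\sqrt{u}|^2\,d\gamma_\varepsilon\Big)dt$$ ($+\infty$ if there is no velocity field; the second integral is $+\infty$ where $\rho_t\not\ll\gamma_\varepsilon$ or $\sqrt u\notin W^{1,2}(-1,1)$), and $\mathcal A_\varepsilon(\rho)=\mathcal E_\varepsilon(\rho(T))-\mathcal E_\varepsilon(\rho(0))+\mathcal J_\varepsilon(\rho)$. A *solution* on $[0,T]$ of the Fokker–Planck problem $\partial_t\rho=\tau_\varepsilon\partial_\xi(\partial_\xi\rho+\frac1\varepsilon\rho\,\partial_\xi H)$ with no-flux boundary conditions is a curve $\rho\in C([0,T];\mathscr M(\Xi))$ with $\mathcal E_\varepsilon(\rho(0))<\infty$ and $\mathcal A_\varepsilon(\rho)=0$. Let $\hat s_\varepsilon(\xi)=\int_0^\xi\frac{d\eta}{\tau_\varepsilon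 g_\varepsilon(\eta)}$, a bijection $\Xi\to\mathrm S$ with inverse $\hat\xi_\varepsilon$; set $\hat\rho_\varepsilon=(\hat s_\varepsilon)_\#\rho_\varepsilon$, $\hat u_\varepsilon=u_\varepsilon\circ\hat\xi_\varepsilon$, $\hat g_\varepsilon=\tau_\varepsilon g_\varepsilon^2\circ\hat\xi_\varepsilon$, $\hat v_\varepsilon=\frac{v_\varepsilon\circ\hat\xi_\varepsilon}{\tau_\varepsilon g_\varepsilon\circ\hat\xi_\varepsilon}$, $\hat w_\varepsilon=\hat u_\varepsilon\hat v_\varepsilon\hat g_\varepsilon$. For $u^\pm\ge0$ let $\mathcal E_0(u^\pm)=\frac12(u^+\log u^++u^-\log u^-)-m\log m$ with $m=\frac12(u^++u^-)$, and $$M(w;u^\pm)=\inf\Big\{\int_{-\kappa}^{\kappa}\frac{w^2+(u')^2}{2u}\,ds:\ 0\le u\in H^1(-\kappa,\kappa),\ u(\pm\kappa)=u^\pm\Big\}\qquad(a/0=\infty\text{ for }a>0,\ 0/0=0).$$ For curves let $\mathcal J_0(u^\pm)=\int_0^TM(w(t);u^\pm(t))\,dt$ if $u^\pm$ are absolutely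 continuous on $[0,T]$ and $w=\frac12\dot u^-=-\frac12\dot u^+$ a.e., $\mathcal J_0=+\infty$ otherwise, and $\mathcal A_0(u^\pm)=\mathcal E_0(u^\pm(T))-\mathcal E_0(u^\pm(0))+\mathcal J_0(u^\pm)$. **Theorem.** Let $T>0$, $m>0$, let $\varepsilon\to0$ along a sequence of positive numbers, and let $\rho_\varepsilon=u_\varepsilon\gamma_\varepsilon$ be solutions on $[0,T]$ with mass $\rho_\varepsilon(0,\Xi)=m$ such that $\mathcal E_\varepsilon(\rho_\varepsilon(0))$ converges to a finite limit. Then there are a subsequence (not relabeled) and functions $u_0^\pm:[0,T]\to[0,\infty)$ such that $\rho_0=\frac12u_0^-\delta_{-1}+\frac12u_0^+\delta_1$ belongs to $C([0,T];\mathscr M(\Xi))$ and 1. $\rho_\varepsilon(t)\rightharpoonup^*\rho_0(t)$ for every $t\in[0,T]$; 2. for a.e. $t$ the density $u_\varepsilon(t,\cdot)$ has a continuous version on $\Xi$ (used from now on), and $u_\varepsilon(\cdot,\pm1)\to u_0^\pm$ strongly in $L^1(0,T)$; 3. for every $0<\delta<1$, $u_\varepsilon\to u_0^-$ in $L^1(0,T;L^\infty(-1,-\delta))$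 and $u_\varepsilon\to u_0^+$ in $L^1(0,T;L^\infty(\delta,1))$. Moreover there are $\hat u_0\in L^1(0,T;W^{1,1}(\mathrm S))$, $\hat w_0\in L^1((0,T)\times\mathrm S)$, a finite measure $\lambda^\perp$ on $[0,T]$ singular to $\mathscr L^1$ and, with $\Lambda^\perp=\lambda^\perp\otimes\mathscr L^1|_{\mathrm S}$, a function $\hat m_0\in L^\infty_{\Lambda^\perp}([0,T]\times\mathrm S)$ with $\partial_s\hat m_0\in L^2_{\Lambda^\perp}([0,T]\times\mathrm S)$, such that 4. $\hat u_\varepsilon,\partial_s\hat u_\varepsilon,\hat w_\varepsilon$ are integrable on $(0,T)\times\mathrm S$, and $\hat u_\varepsilon\rightharpoonup^*\hat u_0+\hat m_0\Lambda^\perp$, $\partial_s\hat u_\varepsilon\rightharpoonup^*\partial_s\hat u_0+\partial_s\hat m_0\,\Lambda^\perp$, $\hat w_\varepsilon\rightharpoonup^*\hat w_0$ in duality with $C([0,T]\times\mathrm S)$; 5. $\hat u_0(t,\pm\kappa)=u_0^\pm(t)$ for a.e. $t\in(0,T)$, and $\hat m_0(t,\pm\kappa)=0$ for $\lambda^\perp$-a.e.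 $t$ (in the sense of traces); 6. $\hat\rho_\varepsilon(t)\rightharpoonup^*\hat\rho_0(t)=\frac12\big(u_0^-(t)\delta_{-\kappa}+u_0^+(t)\delta_\kappa\big)$ for every $t\in[0,T]$; 7. $\hat w_0(t,s)=\frac12\dot u_0^+(t)$ for a.e. $t\in(0,T)$ and a.e. $s\in\mathrm S$, and $\partial_t\hat\rho_0+\partial_s\big(\hat w_0\mathscr L^2|_{(0,T)\times\mathrm S}\big)=0$ in $\mathscr D'((0,T)\times\mathbb R)$; 8. for a.e. $t\in(0,T)$ and all $s\in\mathrm S$, $\hat u_0(t,s)=\frac{\kappa+s}{2\kappa}\hat u_0(t,\kappa)+\frac{\kappa-s}{2\kappa}\hat u_0(t,-\kappa)$; 9. $\mathcal A_0(u_0^\pm)=0$, and $u_0^\pm$ are differentiable on $[0,T]$ (one-sidedly at the end points) with $\dot u_0^-=k(u_0^+-u_0^-)$ and $\dot u_0^+=k(u_0^--u_0^+)$. -/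

import Mathlib

open Set Filter MeasureTheory
open scoped Topology NNReal ENNReal ContDiff

noncomputable section

namespace Kramers

/-- Smooth, even double-well potential with its wells at the end points of `[-1, 1]` and its
unique, nondegenerate maximum (over `[-1, 1]`) at `0`. -/
structure IsDoubleWell (H : ℝ → ℝ) : Prop where
  smooth : ContDiff ℝ ∞ H
  even : ∀ x, H (-x) = H x
  max_zero : H 0 = 1
  min_one : H 1 = 0
  lt_max : ∀ x ∈ Icc (-1 : ℝ) 1, x ≠ 0 → H x < 1
  min_lt : ∀ x ∈ Ioo (-1 : ℝ) 1, 0 < H x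
  nondeg_zero : iteratedDeriv 2 H 0 < 0
  nondeg_one : 0 < iteratedDeriv 2 H 1

/-- The reaction rate `k`. -/
def rate (H : ℝ → ℝ) : ℝ :=
  1 / Real.pi * Real.sqrt (|iteratedDeriv 2 H 0| * iteratedDeriv 2 H 1)

/-- `κ = 1 / k`. -/
def kap (H : ℝ → ℝ) : ℝ := 1 / rate H

/-- Normalization constant `Z_ε`. -/
def Zc (H : ℝ → ℝ) (ε : ℝ) : ℝ := ∫ ξ in (-1 : ℝ)..1, Real.exp (-H ξ / ε)

/-- Lebesgue density `g_ε` of the invariant measure on `[-1, 1]`. -/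
def g (H : ℝ → ℝ) (ε ξ : ℝ) : ℝ := (Zc H ε)⁻¹ * Real.exp (-H ξ / ε)

/-- The invariant probability measure `γ_ε`, extended by zero outside `[-1, 1]`. -/
def gam (H : ℝ → ℝ) (ε : ℝ) : Measure ℝ :=
  (volume.restrict (Icc (-1) 1)).withDensity fun ξ => ENNReal.ofReal (g H ε ξ)

/-- The time scale `τ_ε`. -/
def tau (H : ℝ → ℝ) (ε : ℝ) : ℝ := 1 / (2 * kap H) * ∫ ξ in (-1 : ℝ)..1, 1 / g H ε ξ

/-! Finite measures on `[-1, 1]` are represented by finite measures on `ℝ` that give no mass to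
the complement of `[-1, 1]`; `FiniteMeasure ℝ` carries the topology of weak convergence. -/

open Classical in
/-- The free energy `∫ u log u dγ_ε - m log m` with `u = dρ/dγ_ε` and `m` the mass of `ρ`; it is
`+∞` if `ρ` is not absolutely continuous or `u log u` is not integrable. -/
def energy (H : ℝ → ℝ) (ε : ℝ) (ρ : FiniteMeasure ℝ) : EReal :=
  if (ρ : Measure ℝ) ≪ gam H ε ∧
      Integrable (fun ξ => ((ρ : Measure ℝ).rnDeriv (gam H ε) ξ).toReal *
        Real.log ((ρ : Measure ℝ).rnDeriv (gam H ε) ξ).toReal) (gam H ε) then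
    (((∫ ξ, ((ρ : Measure ℝ).rnDeriv (gam H ε) ξ).toReal *
        Real.log ((ρ : Measure ℝ).rnDeriv (gam H ε) ξ).toReal ∂(gam H ε))
      - (ρ.mass : ℝ) * Real.log (ρ.mass : ℝ) : ℝ) : EReal)
  else ⊤

/-- `p` is (the absolutely continuous representative of) a function in `W^{1,1}(a, b)`, `a ≤ b`,
with weak derivative `q`; its traces are `p a` and `p b`. -/
def HasW11Deriv (a b : ℝ) (p q : ℝ → ℝ) : Prop :=
  IntervalIntegrable q volume a b ∧ ∀ x ∈ Icc a b, p x = p a + ∫ y in a..x, q y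

/-- `∫ |∂_ξ √u|² dγ_ε` if `ρ = u γ_ε` and `p = √u` is weakly differentiable with derivative `q`;
`+∞` if `√u` is not in `W^{1,2}(-1, 1)`. -/
def fisher (H : ℝ → ℝ) (ε : ℝ) (ρ : Measure ℝ) : ℝ≥0∞ :=
  ⨅ (p : ℝ → ℝ) (q : ℝ → ℝ) (_ : HasW11Deriv (-1) 1 p q) (_ : ∀ ξ ∈ Icc (-1 : ℝ) 1, 0 ≤ p ξ)
    (_ : ρ = (gam H ε).withDensity fun ξ => ENNReal.ofReal (p ξ ^ 2)),
    ∫⁻ ξ, ENNReal.ofReal (q ξ ^ 2) ∂(gam H ε)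

/-- The equation `∂_t ρ + ∂_ξ ν = 0` in `𝒟'((0, T) × ℝ)`, for the flux
`ν(dt dξ) = f(t, ξ) σ_t(dξ) dt`. -/
def ContinuityEq (T : ℝ) (ρ : ℝ → FiniteMeasure ℝ) (σ : ℝ → Measure ℝ) (f : ℝ → ℝ → ℝ) : Prop :=
  ∀ φ : ℝ × ℝ → ℝ, ContDiff ℝ ∞ φ → HasCompactSupport φ → tsupport φ ⊆ Ioo 0 T ×ˢ univ →
    ∫ t in Ioo 0 T, ((∫ ξ, fderiv ℝ φ (t, ξ) (1, 0) ∂(ρ t : Measure ℝ)) +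
      ∫ ξ, fderiv ℝ φ (t, ξ) (0, 1) * f t ξ ∂(σ t)) = 0

/-- `v` is a Borel velocity field for the curve `ρ`. -/
structure IsVelocity (T : ℝ) (ρ : ℝ → FiniteMeasure ℝ) (v : ℝ → ℝ → ℝ) : Prop where
  measurable : Measurable (Function.uncurry v)
  finite : ∫⁻ t in Ioo 0 T, ∫⁻ ξ, ENNReal.ofReal |v t ξ| ∂(ρ t : Measure ℝ) < ⊤
  eqn : ContinuityEq T ρ (fun t => (ρ t : Measure ℝ)) v

/-- The Wasserstein dissipation functional `𝒥_ε(ρ; 0, T)`; it is `+∞` if `ρ` has no velocity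
field. (The velocity field is unique up to null sets.) -/
def dissipation (H : ℝ → ℝ) (ε T : ℝ) (ρ : ℝ → FiniteMeasure ℝ) : ℝ≥0∞ :=
  ⨅ (v : ℝ → ℝ → ℝ) (_ : IsVelocity T ρ v),
    ∫⁻ t in Ioo 0 T, ((∫⁻ ξ, ENNReal.ofReal (1 / (2 * tau H ε) * v t ξ ^ 2) ∂(ρ t : Measure ℝ)) +
      ENNReal.ofReal (2 * tau H ε) * fisher H ε (ρ t : Measure ℝ))

/-- The action `𝒜_ε(ρ; 0, T)`. -/
def action (H : ℝ → ℝ) (ε T : ℝ) (ρ : ℝ → FiniteMeasure ℝ) : EReal :=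
  energy H ε (ρ T) - energy H ε (ρ 0) + (dissipation H ε T ρ : EReal)

/-- `ρ` is a Wasserstein gradient-flow solution of the Fokker-Planck problem on `[0, T]`. -/
structure IsSolution (H : ℝ → ℝ) (ε T : ℝ) (ρ : ℝ → FiniteMeasure ℝ) : Prop where
  continuousOn : ContinuousOn ρ (Icc 0 T)
  supported : ∀ t ∈ Icc 0 T, (ρ t : Measure ℝ) (Icc (-1) 1)ᶜ = 0
  energy_lt_top : energy H ε (ρ 0) < ⊤
  action_eq_zero : action H ε T ρ = 0

/-- `f` is the (nonnegative) continuous version on `[-1, 1]` of the density of `μ` with respect to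
`γ_ε`; it is unique on `[-1, 1]`. -/
structure IsContDensity (H : ℝ → ℝ) (ε : ℝ) (μ : Measure ℝ) (f : ℝ → ℝ) : Prop where
  continuousOn : ContinuousOn f (Icc (-1) 1)
  nonneg : ∀ ξ ∈ Icc (-1 : ℝ) 1, 0 ≤ f ξ
  eq_withDensity : μ = (gam H ε).withDensity fun ξ => ENNReal.ofReal (f ξ)

open Classical in
/-- The density `u = dμ/dγ_ε`: its continuous version on `[-1, 1]` whenever there is one. -/
def density (H : ℝ → ℝ) (ε : ℝ) (μ : Measure ℝ) : ℝ → ℝ :=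
  if h : ∃ f, IsContDensity H ε μ f then h.choose else fun ξ => (μ.rnDeriv (gam H ε) ξ).toReal

/-- The rescaling `ŝ_ε : [-1, 1] → [-κ, κ]`. -/
def sHat (H : ℝ → ℝ) (ε ξ : ℝ) : ℝ := ∫ η in (0 : ℝ)..ξ, 1 / (tau H ε * g H ε η)

/-- The inverse `ξ̂_ε : [-κ, κ] → [-1, 1]` of `ŝ_ε`. -/
def xiHat (H : ℝ → ℝ) (ε : ℝ) : ℝ → ℝ := Function.invFunOn (sHat H ε) (Icc (-1) 1)

/-- The rescaled density `û = u ∘ ξ̂_ε`. -/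
def uHat (H : ℝ → ℝ) (ε : ℝ) (μ : Measure ℝ) (s : ℝ) : ℝ := density H ε μ (xiHat H ε s)

/-- The Lebesgue density `ĝ_ε = τ_ε g_ε² ∘ ξ̂_ε` of the rescaled invariant measure. -/
def gHat (H : ℝ → ℝ) (ε s : ℝ) : ℝ := tau H ε * g H ε (xiHat H ε s) ^ 2

/-- The rescaled velocity `v̂ = (v ∘ ξ̂_ε) / (τ_ε g_ε ∘ ξ̂_ε)`. -/
def vHat (H : ℝ → ℝ) (ε : ℝ) (v : ℝ → ℝ) (s : ℝ) : ℝ :=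
  v (xiHat H ε s) / (tau H ε * g H ε (xiHat H ε s))

/-- The rescaled flux `ŵ = û v̂ ĝ_ε`. -/
def wHat (H : ℝ → ℝ) (ε : ℝ) (μ : Measure ℝ) (v : ℝ → ℝ) (s : ℝ) : ℝ :=
  uHat H ε μ s * vHat H ε v s * gHat H ε s

/-- The measure `½ u⁻ δ_{-a} + ½ u⁺ δ_a`. -/
def twoPoint (a : ℝ) (um up : ℝ≥0) : FiniteMeasure ℝ :=
  ⟨(um / 2) • Measure.dirac (-a) + (up / 2) • Measure.dirac a, inferInstance⟩

/-- Limit energy `½ (u⁺ log u⁺ + u⁻ log u⁻) - m log m`, `m = ½ (u⁺ + u⁻)`. -/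
def limitEnergy (um up : ℝ) : ℝ :=
  1 / 2 * (up * Real.log up + um * Real.log um) - (um + up) / 2 * Real.log ((um + up) / 2)

/-- The function `M(w; u^±)`: the infimum of `∫ (w² / (2u) + (u')² / (2u)) ds` over all nonnegative
`u ∈ H¹(-κ, κ)` with the boundary values `u^±`. In `ℝ≥0∞`, `a / 0 = ∞` for `a ≠ 0` and
`0 / 0 = 0`. -/
def M (κ w um up : ℝ) : ℝ≥0∞ :=
  ⨅ (u : ℝ → ℝ) (u' : ℝ → ℝ) (_ : HasW11Deriv (-κ) κ u u')
    (_ : MemLp u' 2 (volume.restrict (Icc (-κ) κ))) (_ : ∀ s ∈ Icc (-κ) κ, 0 ≤ u s)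
    (_ : u (-κ) = um) (_ : u κ = up),
    ∫⁻ s in Icc (-κ) κ, (ENNReal.ofReal (w ^ 2) / ENNReal.ofReal (2 * u s) +
      ENNReal.ofReal (u' s ^ 2) / ENNReal.ofReal (2 * u s))

open Classical in
/-- The limit dissipation functional `𝒥₀` of the curve `t ↦ ½ u⁻(t) δ_{-1} + ½ u⁺(t) δ_1`. -/
def limitDissipation (κ T : ℝ) (um up : ℝ → ℝ) : ℝ≥0∞ :=
  if AbsolutelyContinuousOnInterval um 0 T ∧ AbsolutelyContinuousOnInterval up 0 T ∧
      ∀ᵐ t ∂(volume.restrict (Ioo 0 T)), deriv um t = -deriv up t then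
    ∫⁻ t in Ioo 0 T, M κ (1 / 2 * deriv um t) (um t) (up t)
  else ⊤

/-- The limit action `𝒜₀`. -/
def limitAction (κ T : ℝ) (um up : ℝ → ℝ) : EReal :=
  ((limitEnergy (um T) (up T) - limitEnergy (um 0) (up 0) : ℝ) : EReal) +
    (limitDissipation κ T um up : EReal)

end Kramers

end

open Kramers

noncomputable section

namespace Kramers

/-! ### Weights, time scale and the rescaled space variable -/

variable {H : ℝ → ℝ} {ε : ℝ}

/-! The variable `s = sHat H ε ξ` stretches the barrier over `[-κ, κ]` and collapses the wells onto
the end points. For a solution, `∂_s û = -ŵ` holds at almost every time: the flux through the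
barrier is minus the slope of the density. Integrating over `s`, the first moment `A(t) = ∫ sHat
dρ_t` has the derivative `-(u(1) - u(-1))`.

The Fisher information makes the density Hölder continuous with exponent 1/2 in `s`, with a constant
that is integrable in time. Since `γ_ε` concentrates at the wells, replacing the density by the
affine function of `s` with the same end values changes mass and first moment by a vanishing amount
(`IsRegular.affine`). Hence `m ≈ (u(1) + u(-1)) / 2` and `A ≈ κ (u(1) - u(-1)) / 2`, so that `A' =
-(2 / κ) A` up to an error that is small in `L¹` in time. Duhamel's formula gives `A(t) → α exp (-2
t / κ)` uniformly in time along any subsequence with `A(0) → α`. This subsequence is the only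
compactness in the passage to the limit; everything else is explicit, with limit masses `m - gap`
and `m + gap`.

The energy bound and Young's inequality force the mass into the wells at every time, so mass and
first moment determine the limit measures (`tendsto_integral_of_concentration`). The two approximate
relations above, solved for `u(1)` and `u(-1)`, give strong convergence of the traces, and the
Hölder bound spreads it over the wells. The continuity equation, integrated over time intervals,
gives weak convergence of the fluxes; the rescaled densities are rebuilt from their left trace and
their flux. All limits are functions, so the singular measure `λ^⊥` can be taken to be zero. The
limit dissipation is computed with the affine profile, for which Young's inequality is an equality
(`M_eq`), and the limit action vanishes.

The longest part derives `∂_s û = -ŵ` from the definition of a solution, which is only an energy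
balance over `[0, T]`. The chain rule `IsFiniteAction.entropy_sub_eq` writes the change of entropy
as a time integral; zero action then says that the integral of a perfect square vanishes
(`IsSolution.exists_isFlow`). For the chain rule the logarithm is truncated and the density is
replaced by averages against hat functions, so that the discretized entropy is a `C¹` function of
finitely many absolutely continuous pairings. The grid is refined first, using weak `L²` convergence
of the discrete slopes; the truncation is removed afterwards, using bounds that do not depend on it.
-/

lemma IsDoubleWell.continuous (hH : IsDoubleWell H) : Continuous H := hH.smooth.continuous

lemma rate_pos (hH : IsDoubleWell H) : 0 < rate H := by
  have h1 := hH.nondeg_zero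
  have h2 := hH.nondeg_one
  have h3 : 0 < |iteratedDeriv 2 H 0| := abs_pos.2 h1.ne
  unfold rate
  have := Real.pi_pos
  positivity

lemma kap_pos (hH : IsDoubleWell H) : 0 < kap H := one_div_pos.2 (rate_pos hH)

lemma continuous_exp_neg_div (hH : IsDoubleWell H) (ε : ℝ) :
    Continuous fun ξ => Real.exp (-H ξ / ε) := by
  have := hH.continuous
  fun_prop

lemma Zc_pos (hH : IsDoubleWell H) (ε : ℝ) : 0 < Zc H ε :=
  intervalIntegral.intervalIntegral_pos_of_pos
    ((continuous_exp_neg_div hH ε).intervalIntegrable _ _) (fun _ => Real.exp_pos _) (by norm_num)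

lemma g_pos (hH : IsDoubleWell H) (ε ξ : ℝ) : 0 < g H ε ξ :=
  mul_pos (inv_pos.2 (Zc_pos hH ε)) (Real.exp_pos _)

lemma continuous_g (hH : IsDoubleWell H) (ε : ℝ) : Continuous (g H ε) :=
  continuous_const.mul (continuous_exp_neg_div hH ε)

lemma g_neg (hH : IsDoubleWell H) (ε ξ : ℝ) : g H ε (-ξ) = g H ε ξ := by
  simp only [g, hH.even]

lemma continuous_one_div_g (hH : IsDoubleWell H) (ε : ℝ) : Continuous fun ξ => 1 / g H ε ξ :=
  continuous_const.div (continuous_g hH ε) fun x => (g_pos hH ε x).ne'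

lemma integral_g (hH : IsDoubleWell H) (ε : ℝ) : ∫ ξ in (-1 : ℝ)..1, g H ε ξ = 1 := by
  simp only [g, intervalIntegral.integral_const_mul]
  exact inv_mul_cancel₀ (Zc_pos hH ε).ne'

lemma lintegral_gam (hH : IsDoubleWell H) (ε : ℝ) (f : ℝ → ℝ≥0∞) :
    ∫⁻ ξ, f ξ ∂(gam H ε) = ∫⁻ ξ in Icc (-1) 1, ENNReal.ofReal (g H ε ξ) * f ξ :=
  lintegral_withDensity_eq_lintegral_mul_non_measurable₀ _
    (continuous_g hH ε).measurable.ennreal_ofReal.aemeasurable (by simp) f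

lemma integral_gam (hH : IsDoubleWell H) (ε : ℝ) (f : ℝ → ℝ) :
    ∫ ξ, f ξ ∂(gam H ε) = ∫ ξ in Icc (-1) 1, g H ε ξ * f ξ := by
  rw [gam, integral_withDensity_eq_integral_toReal_smul
    (continuous_g hH ε).measurable.ennreal_ofReal (by simp)]
  refine integral_congr_ae (Eventually.of_forall fun x => ?_)
  simp [ENNReal.toReal_ofReal (g_pos hH ε x).le]

lemma integrable_gam_iff (hH : IsDoubleWell H) (ε : ℝ) (f : ℝ → ℝ) :
    Integrable f (gam H ε) ↔ IntegrableOn (fun ξ => g H ε ξ * f ξ) (Icc (-1) 1) := by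
  rw [gam, integrable_withDensity_iff_integrable_smul'
    (continuous_g hH ε).measurable.ennreal_ofReal (by simp)]
  refine integrable_congr (Eventually.of_forall fun x => ?_)
  simp [ENNReal.toReal_ofReal (g_pos hH ε x).le]

lemma gam_absolutelyContinuous (H : ℝ → ℝ) (ε : ℝ) :
    gam H ε ≪ volume.restrict (Icc (-1) 1) := withDensity_absolutelyContinuous _ _

lemma absolutelyContinuous_gam (hH : IsDoubleWell H) (ε : ℝ) :
    volume.restrict (Icc (-1) 1) ≪ gam H ε :=
  withDensity_absolutelyContinuous' (continuous_g hH ε).measurable.ennreal_ofReal.aemeasurable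
    (Eventually.of_forall fun x => by simp [g_pos hH ε x])

lemma isProbabilityMeasure_gam (hH : IsDoubleWell H) (ε : ℝ) : IsProbabilityMeasure (gam H ε) := by
  refine ⟨?_⟩
  have h := lintegral_gam hH ε (fun _ => 1)
  rw [lintegral_one] at h
  rw [h]
  simp only [mul_one]
  rw [← ofReal_integral_eq_lintegral_ofReal, integral_Icc_eq_integral_Ioc,
    ← intervalIntegral.integral_of_le (by norm_num), integral_g hH, ENNReal.ofReal_one]
  · exact (continuous_g hH ε).continuousOn.integrableOn_compact isCompact_Icc
  · exact Eventually.of_forall fun x => (g_pos hH ε x).le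

lemma gam_compl (H : ℝ → ℝ) (ε : ℝ) : gam H ε (Icc (-1) 1)ᶜ = 0 :=
  gam_absolutelyContinuous H ε (by simp [Measure.restrict_apply measurableSet_Icc.compl])

lemma ae_gam_mem (H : ℝ → ℝ) (ε : ℝ) : ∀ᵐ ξ ∂(gam H ε), ξ ∈ Icc (-1 : ℝ) 1 :=
  gam_compl H ε

lemma tau_pos (hH : IsDoubleWell H) (ε : ℝ) : 0 < tau H ε := by
  refine mul_pos (one_div_pos.2 (mul_pos two_pos (kap_pos hH))) ?_
  exact intervalIntegral.intervalIntegral_pos_of_pos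
    ((continuous_one_div_g hH ε).intervalIntegrable _ _)
    (fun x => one_div_pos.2 (g_pos hH ε x)) (by norm_num)

lemma tau_mul_g_pos (hH : IsDoubleWell H) (ε ξ : ℝ) : 0 < tau H ε * g H ε ξ :=
  mul_pos (tau_pos hH ε) (g_pos hH ε ξ)

lemma continuous_one_div_tau_g (hH : IsDoubleWell H) (ε : ℝ) :
    Continuous fun ξ => 1 / (tau H ε * g H ε ξ) :=
  continuous_const.div (continuous_const.mul (continuous_g hH ε))
    fun x => (tau_mul_g_pos hH ε x).ne'

lemma hasDerivAt_sHat (hH : IsDoubleWell H) (ε ξ : ℝ) :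
    HasDerivAt (sHat H ε) (1 / (tau H ε * g H ε ξ)) ξ :=
  intervalIntegral.integral_hasDerivAt_right
    ((continuous_one_div_tau_g hH ε).intervalIntegrable _ _)
    ((continuous_one_div_tau_g hH ε).stronglyMeasurableAtFilter _ _)
    (continuous_one_div_tau_g hH ε).continuousAt

lemma continuous_sHat (hH : IsDoubleWell H) (ε : ℝ) : Continuous (sHat H ε) :=
  continuous_iff_continuousAt.2 fun x => (hasDerivAt_sHat hH ε x).continuousAt

lemma strictMono_sHat (hH : IsDoubleWell H) (ε : ℝ) : StrictMono (sHat H ε) :=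
  strictMono_of_hasDerivAt_pos (hasDerivAt_sHat hH ε)
    fun x => one_div_pos.2 (tau_mul_g_pos hH ε x)

lemma sHat_sub (hH : IsDoubleWell H) (ε x y : ℝ) :
    sHat H ε y - sHat H ε x = ∫ η in x..y, 1 / (tau H ε * g H ε η) :=
  intervalIntegral.integral_interval_sub_left
    ((continuous_one_div_tau_g hH ε).intervalIntegrable _ _)
    ((continuous_one_div_tau_g hH ε).intervalIntegrable _ _)

lemma sHat_neg (hH : IsDoubleWell H) (ε ξ : ℝ) : sHat H ε (-ξ) = -sHat H ε ξ := by
  have h := intervalIntegral.integral_comp_neg (a := 0) (b := ξ)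
    (fun η => 1 / (tau H ε * g H ε η))
  simp only [g_neg hH, neg_zero] at h
  rw [sHat, sHat, h, intervalIntegral.integral_symm]

/-- The normalization of `tau` is exactly what gives the image of `[-1, 1]` the length `2 * kap H`;
oddness of `sHat` splits it evenly. -/
lemma sHat_one (hH : IsDoubleWell H) (ε : ℝ) : sHat H ε 1 = kap H := by
  have h1 := sHat_sub hH ε (-1) 1
  rw [sHat_neg hH] at h1
  have h2 : ∫ η in (-1 : ℝ)..1, 1 / (tau H ε * g H ε η) = 2 * kap H := by
    have h3 : ∀ η, 1 / (tau H ε * g H ε η) = (tau H ε)⁻¹ * (1 / g H ε η) := fun η => by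
      rw [one_div, mul_inv, one_div]
    simp only [h3, intervalIntegral.integral_const_mul]
    have h4 : ∫ η in (-1 : ℝ)..1, 1 / g H ε η = tau H ε * (2 * kap H) := by
      have := kap_pos hH
      rw [tau]; field_simp
    rw [h4, inv_mul_cancel_left₀ (tau_pos hH ε).ne']
  linarith

lemma sHat_neg_one (hH : IsDoubleWell H) (ε : ℝ) : sHat H ε (-1) = -kap H := by
  rw [sHat_neg hH, sHat_one hH]

lemma sHat_zero (H : ℝ → ℝ) (ε : ℝ) : sHat H ε 0 = 0 := by simp [sHat]

lemma sHat_mem (hH : IsDoubleWell H) (ε : ℝ) {ξ : ℝ} (hξ : ξ ∈ Icc (-1 : ℝ) 1) :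
    sHat H ε ξ ∈ Icc (-kap H) (kap H) := by
  rw [← sHat_one hH ε, ← sHat_neg hH]
  exact ⟨(strictMono_sHat hH ε).monotone hξ.1, (strictMono_sHat hH ε).monotone hξ.2⟩

lemma sHat_image (hH : IsDoubleWell H) (ε : ℝ) {x y : ℝ} (hxy : x ≤ y) :
    sHat H ε '' Icc x y = Icc (sHat H ε x) (sHat H ε y) :=
  (continuous_sHat hH ε).continuousOn.image_Icc_of_monotoneOn hxy
    ((strictMono_sHat hH ε).monotone.monotoneOn _)

lemma sHat_image_Icc (hH : IsDoubleWell H) (ε : ℝ) :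
    sHat H ε '' Icc (-1) 1 = Icc (-kap H) (kap H) := by
  rw [sHat_image hH ε (by norm_num), sHat_neg_one hH, sHat_one hH]

lemma xiHat_mem (hH : IsDoubleWell H) (ε : ℝ) {s : ℝ} (hs : s ∈ Icc (-kap H) (kap H)) :
    xiHat H ε s ∈ Icc (-1 : ℝ) 1 := by
  rw [← sHat_image_Icc hH ε] at hs
  exact Function.invFunOn_mem hs

lemma sHat_xiHat (hH : IsDoubleWell H) (ε : ℝ) {s : ℝ} (hs : s ∈ Icc (-kap H) (kap H)) :
    sHat H ε (xiHat H ε s) = s := by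
  rw [← sHat_image_Icc hH ε] at hs
  exact Function.invFunOn_eq hs

lemma xiHat_sHat (hH : IsDoubleWell H) (ε : ℝ) {ξ : ℝ} (hξ : ξ ∈ Icc (-1 : ℝ) 1) :
    xiHat H ε (sHat H ε ξ) = ξ :=
  (strictMono_sHat hH ε).injective (sHat_xiHat hH ε (sHat_mem hH ε hξ))

lemma xiHat_kap (hH : IsDoubleWell H) (ε : ℝ) : xiHat H ε (kap H) = 1 := by
  rw [← sHat_one hH ε]; exact xiHat_sHat hH ε (by norm_num)

lemma xiHat_neg_kap (hH : IsDoubleWell H) (ε : ℝ) : xiHat H ε (-kap H) = -1 := by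
  rw [← sHat_neg_one hH ε]; exact xiHat_sHat hH ε (by norm_num)

lemma strictMonoOn_xiHat (hH : IsDoubleWell H) (ε : ℝ) :
    StrictMonoOn (xiHat H ε) (Icc (-kap H) (kap H)) := fun x hx y hy hxy => by
  rw [← (strictMono_sHat hH ε).lt_iff_lt, sHat_xiHat hH ε hx, sHat_xiHat hH ε hy]
  exact hxy

lemma measurable_xiHat (hH : IsDoubleWell H) (ε : ℝ) :
    AEMeasurable (xiHat H ε) (volume.restrict (Icc (-kap H) (kap H))) :=
  aemeasurable_restrict_of_monotoneOn measurableSet_Icc (strictMonoOn_xiHat hH ε).monotoneOn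

/-- Change of variables `s = ŝ_ε(ξ)`. -/
lemma setIntegral_sHat (hH : IsDoubleWell H) (ε : ℝ) {A : Set ℝ} (hA : MeasurableSet A)
    (f : ℝ → ℝ) : ∫ s in sHat H ε '' A, f s =
      ∫ ξ in A, 1 / (tau H ε * g H ε ξ) * f (sHat H ε ξ) := by
  rw [integral_image_eq_integral_abs_deriv_smul hA
    (fun x _ => (hasDerivAt_sHat hH ε x).hasDerivWithinAt) (strictMono_sHat hH ε).injective.injOn]
  refine integral_congr_ae (Eventually.of_forall fun x => ?_)
  simp only [smul_eq_mul]
  rw [abs_of_pos (one_div_pos.2 (tau_mul_g_pos hH ε x))]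

lemma integrableOn_sHat_image (hH : IsDoubleWell H) (ε : ℝ) {A : Set ℝ} (hA : MeasurableSet A)
    (f : ℝ → ℝ) : IntegrableOn f (sHat H ε '' A) ↔
      IntegrableOn (fun ξ => 1 / (tau H ε * g H ε ξ) * f (sHat H ε ξ)) A := by
  rw [integrableOn_image_iff_integrableOn_abs_deriv_smul hA
    (fun x _ => (hasDerivAt_sHat hH ε x).hasDerivWithinAt) (strictMono_sHat hH ε).injective.injOn]
  refine integrable_congr (Eventually.of_forall fun x => ?_)
  simp only [smul_eq_mul]
  rw [abs_of_pos (one_div_pos.2 (tau_mul_g_pos hH ε x))]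

/-! ### Concentration of exponential weights -/

/-- A weight `exp (V / ε)` concentrates where `V` is largest. -/
lemma integral_exp_div_le {V : ℝ → ℝ} (hV : Continuous V) {a b c d x y α β : ℝ} (hε : 0 < ε)
    (hab : a ≤ b) (hcd : c < d) (hac : x ≤ c) (hdb : d ≤ y)
    (hα : ∀ ξ ∈ Icc a b, V ξ ≤ α) (hβ : ∀ ξ ∈ Icc c d, β ≤ V ξ) :
    ∫ ξ in a..b, Real.exp (V ξ / ε) ≤
      (b - a) / (d - c) * Real.exp (-(β - α) / ε) * ∫ ξ in x..y, Real.exp (V ξ / ε) := by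
  have hc : Continuous fun ξ => Real.exp (V ξ / ε) := by fun_prop
  have h1 : ∫ ξ in a..b, Real.exp (V ξ / ε) ≤ ∫ _ in a..b, Real.exp (α / ε) :=
    intervalIntegral.integral_mono_on hab (hc.intervalIntegrable _ _) (by simp)
      fun ξ hξ => Real.exp_le_exp.2 (div_le_div_of_nonneg_right (hα ξ hξ) hε.le)
  have h2 : ∫ _ in c..d, Real.exp (β / ε) ≤ ∫ ξ in c..d, Real.exp (V ξ / ε) :=
    intervalIntegral.integral_mono_on hcd.le (by simp) (hc.intervalIntegrable _ _)
      fun ξ hξ => Real.exp_le_exp.2 (div_le_div_of_nonneg_right (hβ ξ hξ) hε.le)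
  have h3 : ∫ ξ in c..d, Real.exp (V ξ / ε) ≤ ∫ ξ in x..y, Real.exp (V ξ / ε) :=
    intervalIntegral.integral_mono_interval hac hcd.le hdb
      (Eventually.of_forall fun ξ => (Real.exp_pos _).le) (hc.intervalIntegrable _ _)
  simp only [intervalIntegral.integral_const, smul_eq_mul] at h1 h2
  have h4 : Real.exp (α / ε) = Real.exp (-(β - α) / ε) * Real.exp (β / ε) := by
    rw [← Real.exp_add]; congr 1; ring
  have hdc : 0 < d - c := sub_pos.2 hcd
  calc _ ≤ (b - a) * Real.exp (α / ε) := h1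
    _ = (b - a) / (d - c) * Real.exp (-(β - α) / ε) * ((d - c) * Real.exp (β / ε)) := by
      rw [h4]; field_simp
    _ ≤ _ := by
      refine mul_le_mul_of_nonneg_left (h2.trans h3) ?_
      have : 0 ≤ b - a := sub_nonneg.2 hab
      positivity

lemma tendsto_exp_neg_div {c : ℝ} (hc : 0 < c) {ε : ℕ → ℝ} (hε : ∀ n, 0 < ε n)
    (hε0 : Tendsto ε atTop (𝓝 0)) : Tendsto (fun n => Real.exp (-c / ε n)) atTop (𝓝 0) := by
  refine Real.tendsto_exp_atBot.comp ?_
  have : Tendsto ε atTop (𝓝[>] 0) :=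
    tendsto_nhdsWithin_iff.2 ⟨hε0, Eventually.of_forall fun n => hε n⟩
  have h2 := (tendsto_inv_nhdsGT_zero.comp this).const_mul_atTop_of_neg (neg_lt_zero.2 hc)
  simpa [div_eq_mul_inv] using h2

/-- The integrand of `sHat` is proportional to `exp (H / ε)`. Since `H` stays away from its maximum
on `[δ, 1]`, the part over `[δ, 1]` is exponentially small compared with the total `2 * kap H`. -/
lemma tendsto_sHat (hH : IsDoubleWell H) {ε : ℕ → ℝ} (hε : ∀ n, 0 < ε n)
    (hε0 : Tendsto ε atTop (𝓝 0)) {δ : ℝ} (hδ : δ ∈ Ioo (0 : ℝ) 1) :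
    Tendsto (fun n => sHat H (ε n) δ) atTop (𝓝 (kap H)) := by
  obtain ⟨z, hz, hzmax⟩ := isCompact_Icc.exists_isMaxOn (nonempty_Icc.2 hδ.2.le)
    hH.continuous.continuousOn
  have hz1 : H z < 1 := hH.lt_max z ⟨by linarith [hz.1, hδ.1], hz.2⟩ (by linarith [hz.1, hδ.1])
  set α := H z
  -- The midpoint between `α` and `H 0 = 1` leaves the positive gap `(1 + α) / 2 - α` in the
  -- exponent.
  have hev : ∀ᶠ x in 𝓝 (0 : ℝ), (1 + α) / 2 < H x :=
    hH.continuous.continuousAt.eventually_const_lt (by rw [hH.max_zero]; linarith)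
  obtain ⟨d, hd0, hd⟩ := Metric.eventually_nhds_iff.1 hev
  set e := min (d / 2) (1 / 2)
  have he0 : 0 < e := lt_min (by linarith) (by norm_num)
  have key : ∀ n, kap H - sHat H (ε n) δ ≤
      (1 - δ) / (e - 0) * Real.exp (-((1 + α) / 2 - α) / ε n) * (2 * kap H) := fun n => by
    have h := integral_exp_div_le hH.continuous (hε n) hδ.2.le he0 (x := -1) (y := 1)
      (by norm_num) ((min_le_right _ _).trans (by norm_num)) (α := α) (β := (1 + α) / 2)
      (fun ξ hξ => hzmax hξ) (fun ξ hξ => (hd (by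
        rw [Real.dist_eq, sub_zero, abs_of_nonneg hξ.1]
        exact (hξ.2.trans (min_le_left _ _)).trans_lt (by linarith))).le)
    have h1 : ∀ η, 1 / (tau H (ε n) * g H (ε n) η) =
        Zc H (ε n) / tau H (ε n) * Real.exp (H η / ε n) := fun η => by
      rw [g, neg_div, Real.exp_neg]
      have := (Zc_pos hH (ε n)).ne'
      have := (tau_pos hH (ε n)).ne'
      field_simp
    have h2 := sHat_sub hH (ε n) δ 1
    have h3 := sHat_sub hH (ε n) (-1) 1
    simp only [h1, intervalIntegral.integral_const_mul, sHat_one hH, sHat_neg_one hH] at h2 h3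
    have h4 : 0 < Zc H (ε n) / tau H (ε n) := div_pos (Zc_pos hH _) (tau_pos hH _)
    calc _ = _ := h2
      _ ≤ _ := mul_le_mul_of_nonneg_left h h4.le
      _ = (1 - δ) / (e - 0) * Real.exp (-((1 + α) / 2 - α) / ε n) * (kap H - -kap H) := by
        rw [h3]; ring
      _ = _ := by ring
  have h5 : Tendsto (fun n => (1 - δ) / (e - 0) * Real.exp (-((1 + α) / 2 - α) / ε n) *
      (2 * kap H)) atTop (𝓝 0) := by
    have := ((tendsto_exp_neg_div (c := (1 + α) / 2 - α) (by linarith) hε hε0).const_mul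
      ((1 - δ) / (e - 0))).mul_const (2 * kap H)
    simpa using this
  have h6 : Tendsto (fun n => kap H - sHat H (ε n) δ) atTop (𝓝 0) :=
    squeeze_zero (fun n => by
      have := (sHat_mem hH (ε n) (ξ := δ) ⟨by linarith [hδ.1], hδ.2.le⟩).2
      linarith) key h5
  simpa using h6.const_sub (kap H)

/-- The same concentration, now for the weight `exp (-H / ε)`: the middle interval `|ξ| ≤ 1 - η`
carries exponentially little mass, and outside of it the integrand is at most `η`. -/
lemma tendsto_integral_gam (hH : IsDoubleWell H) {ε : ℕ → ℝ} (hε : ∀ n, 0 < ε n)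
    (hε0 : Tendsto ε atTop (𝓝 0)) :
    Tendsto (fun n => ∫ ξ, (1 - |ξ|) ∂(gam H (ε n))) atTop (𝓝 0) := by
  have hnn : ∀ n, 0 ≤ ∫ ξ, (1 - |ξ|) ∂(gam H (ε n)) := fun n =>
    integral_nonneg_of_ae ((ae_gam_mem H (ε n)).mono fun ξ hξ => by
      have := abs_le.2 hξ
      simp only [Pi.zero_apply]; linarith)
  refine (tendsto_order.2 ⟨fun c hc => Eventually.of_forall fun n => hc.trans_le (hnn n),
    fun c hc => ?_⟩)
  set η := min (c / 2) (1 / 2)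
  have hη0 : 0 < η := lt_min (by linarith) (by norm_num)
  have hη1 : η ≤ 1 / 2 := min_le_right _ _
  have hηc : η ≤ c / 2 := min_le_left _ _
  obtain ⟨z, hz, hzmin⟩ := isCompact_Icc.exists_isMinOn
    (nonempty_Icc.2 (show -(1 - η) ≤ 1 - η by linarith)) hH.continuous.continuousOn
  have hz0 : 0 < H z := hH.min_lt z ⟨by linarith [hz.1], by linarith [hz.2]⟩
  -- One well is enough for comparison: near `1` the potential is below half of its minimum over the
  -- middle interval.
  have hev : ∀ᶠ x in 𝓝 (1 : ℝ), H x < H z / 2 :=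
    hH.continuous.continuousAt.eventually_lt_const (by rw [hH.min_one]; linarith)
  obtain ⟨d, hd0, hd⟩ := Metric.eventually_nhds_iff.1 hev
  set e := min (d / 2) (1 / 2)
  have he0 : 0 < e := lt_min (by linarith) (by norm_num)
  have he1 : e ≤ 1 / 2 := min_le_right _ _
  have hed : e ≤ d / 2 := min_le_left _ _
  have key : ∀ n, ∫ ξ, (1 - |ξ|) ∂(gam H (ε n)) ≤ η +
      (1 - η - -(1 - η)) / (1 - (1 - e)) * Real.exp (-(-(H z / 2) - -H z) / ε n) := fun n => by
    have h := integral_exp_div_le (V := fun x => -H x) hH.continuous.neg (hε n)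
      (show -(1 - η) ≤ 1 - η by linarith) (show 1 - e < 1 by linarith) (x := -1) (y := 1)
      (by linarith) le_rfl (α := -H z) (β := -(H z / 2))
      (fun ξ hξ => neg_le_neg (hzmin hξ)) (fun ξ hξ => neg_le_neg (hd (by
        rw [Real.dist_eq, abs_sub_comm, abs_of_nonneg (by linarith [hξ.2])]
        linarith [hξ.1])).le)
    have hcg := continuous_g hH (ε n)
    have h1 : ∫ ξ in (-(1 - η))..(1 - η), g H (ε n) ξ ≤
        (1 - η - -(1 - η)) / (1 - (1 - e)) * Real.exp (-(-(H z / 2) - -H z) / ε n) := by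
      have h2 := mul_le_mul_of_nonneg_left h (inv_nonneg.2 (Zc_pos hH (ε n)).le)
      simp only [g, intervalIntegral.integral_const_mul]
      refine h2.trans_eq ?_
      have : (∫ ξ in (-1 : ℝ)..1, Real.exp (-H ξ / ε n)) = Zc H (ε n) := rfl
      rw [this]
      have := (Zc_pos hH (ε n)).ne'
      field_simp
    rw [integral_gam hH, integral_Icc_eq_integral_Ioc]
    have h3 : ∫ ξ in Ioc (-1 : ℝ) 1, g H (ε n) ξ * (1 - |ξ|) ≤
        ∫ ξ in Ioc (-1 : ℝ) 1, (η * g H (ε n) ξ +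
          (Ioc (-(1 - η)) (1 - η)).indicator (g H (ε n)) ξ) := by
      have hi : IntegrableOn (g H (ε n)) (Ioc (-1) 1) :=
        (hcg.continuousOn.integrableOn_compact isCompact_Icc).mono_set Ioc_subset_Icc_self
      refine setIntegral_mono_ae_restrict ?_ ((hi.const_mul η).add
        (hi.indicator measurableSet_Ioc)) ?_
      · exact ((hcg.mul (by fun_prop)).continuousOn.integrableOn_compact isCompact_Icc).mono_set
          Ioc_subset_Icc_self
      · refine (ae_restrict_iff' measurableSet_Ioc).2 ?_
        have : ∀ᵐ ξ : ℝ, ξ ≠ -(1 - η) := by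
          simp [ae_iff]
        filter_upwards [this] with ξ hne hξ
        have hg := g_pos hH (ε n) ξ
        by_cases hm : ξ ∈ Ioc (-(1 - η)) (1 - η)
        · rw [indicator_of_mem hm]
          nlinarith [mul_nonneg hη0.le hg.le, mul_nonneg (abs_nonneg ξ) hg.le]
        · rw [indicator_of_notMem hm, add_zero, mul_comm]
          refine mul_le_mul_of_nonneg_right ?_ hg.le
          by_contra hcon
          push Not at hcon
          have := abs_lt.1 (show |ξ| < 1 - η by linarith)
          exact hm ⟨this.1, this.2.le⟩
    refine h3.trans ?_
    have hi : IntegrableOn (g H (ε n)) (Ioc (-1) 1) :=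
      (hcg.continuousOn.integrableOn_compact isCompact_Icc).mono_set Ioc_subset_Icc_self
    rw [integral_add (hi.const_mul η) (hi.indicator measurableSet_Ioc), integral_const_mul,
      ← intervalIntegral.integral_of_le (by norm_num), integral_g hH, mul_one,
      setIntegral_indicator measurableSet_Ioc, inter_eq_right.2
        (Ioc_subset_Ioc (by linarith) (by linarith)),
      ← intervalIntegral.integral_of_le (by linarith)]
    linarith
  have h5 : Tendsto (fun n => η + (1 - η - -(1 - η)) / (1 - (1 - e)) *
      Real.exp (-(-(H z / 2) - -H z) / ε n)) atTop (𝓝 η) := by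
    have := (tendsto_exp_neg_div (c := -(H z / 2) - -H z) (by linarith) hε hε0).const_mul
      ((1 - η - -(1 - η)) / (1 - (1 - e)))
    simpa using this.const_add η
  filter_upwards [h5.eventually_lt_const (show η < c by linarith)] with n hn
  exact (key n).trans_lt hn

/-! ### Absolutely continuous functions and their derivatives -/

section W11

variable {a b : ℝ} {p q : ℝ → ℝ}

lemma _root_.AbsolutelyContinuousOnInterval.congr {p r : ℝ → ℝ}
    (hp : AbsolutelyContinuousOnInterval p a b) (h : EqOn p r (uIcc a b)) :
    AbsolutelyContinuousOnInterval r a b := by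
  refine Tendsto.congr' ?_ hp
  filter_upwards [mem_inf_of_right (mem_principal_self _)] with E hE
  exact Finset.sum_congr rfl fun i hi => by rw [h (hE.1 i hi).1, h (hE.1 i hi).2]

lemma _root_.LipschitzOnWith.comp_absolutelyContinuousOnInterval {F : ℝ → ℝ} {K : ℝ≥0}
    {s : Set ℝ} (hF : LipschitzOnWith K F s) (hp : AbsolutelyContinuousOnInterval p a b)
    (hs : MapsTo p (uIcc a b) s) : AbsolutelyContinuousOnInterval (F ∘ p) a b := by
  have h := Tendsto.const_mul (K : ℝ) hp
  rw [mul_zero] at h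
  refine squeeze_zero' (Eventually.of_forall fun E => Finset.sum_nonneg fun _ _ => dist_nonneg)
    ?_ h
  filter_upwards [mem_inf_of_right (mem_principal_self _)] with E hE
  rw [Finset.mul_sum]
  exact Finset.sum_le_sum fun i hi => hF.dist_le_mul _ (hs (hE.1 i hi).1) _ (hs (hE.1 i hi).2)

namespace HasW11Deriv

lemma absCont (h : HasW11Deriv a b p q) (hab : a ≤ b) : AbsolutelyContinuousOnInterval p a b := by
  have h1 := h.1.absolutelyContinuousOnInterval_intervalIntegral (left_mem_uIcc (b := b))
  have h2 : AbsolutelyContinuousOnInterval (fun _ : ℝ => p a) a b :=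
    LipschitzOnWith.absolutelyContinuousOnInterval (K := 0) (fun x _ y _ => by simp)
  refine (h2.add h1).congr fun x hx => ?_
  rw [uIcc_of_le hab] at hx
  exact (h.2 x hx).symm

lemma continuousOn (h : HasW11Deriv a b p q) (hab : a ≤ b) : ContinuousOn p (Icc a b) := by
  have := (h.absCont hab).continuousOn
  rwa [uIcc_of_le hab] at this

lemma intervalIntegrable (h : HasW11Deriv a b p q) {x y : ℝ} (hx : x ∈ Icc a b)
    (hy : y ∈ Icc a b) : IntervalIntegrable q volume x y :=
  h.1.mono_set (uIcc_subset_uIcc (Icc_subset_uIcc hx) (Icc_subset_uIcc hy))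

lemma integrableOn (h : HasW11Deriv a b p q) (hab : a ≤ b) : IntegrableOn q (Icc a b) :=
  (intervalIntegrable_iff_integrableOn_Icc_of_le hab).1 h.1

lemma sub_eq (h : HasW11Deriv a b p q) {x y : ℝ} (hx : x ∈ Icc a b) (hy : y ∈ Icc a b) :
    p y - p x = ∫ z in x..y, q z := by
  have hab := hx.1.trans hx.2
  have ha := left_mem_Icc.2 hab
  rw [h.2 y hy, h.2 x hx, add_sub_add_left_eq_sub, intervalIntegral.integral_interval_sub_left
    (h.intervalIntegrable ha hy) (h.intervalIntegrable ha hx)]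

lemma ae_hasDerivAt (h : HasW11Deriv a b p q) :
    ∀ᵐ x ∂(volume.restrict (Ioo a b)), HasDerivAt p (q x) x := by
  rw [ae_restrict_iff' measurableSet_Ioo]
  filter_upwards [h.1.ae_hasDerivAt_integral] with x hx hxab
  have hxI : x ∈ Icc a b := Ioo_subset_Icc_self hxab
  refine ((hx (Icc_subset_uIcc hxI) a left_mem_uIcc).const_add (p a)).congr_of_eventuallyEq ?_
  filter_upwards [isOpen_Ioo.mem_nhds hxab] with y hy
  exact h.2 y (Ioo_subset_Icc_self hy)

/-- Together with `absCont` and `ae_hasDerivAt`, this identifies `HasW11Deriv` with absolute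
continuity plus a derivative almost everywhere. Products, compositions and changes of the derivative
then only need a pointwise check almost everywhere. -/
lemma of_absCont (h : AbsolutelyContinuousOnInterval p a b) (hab : a ≤ b)
    (hd : ∀ᵐ x ∂(volume.restrict (Ioo a b)), HasDerivAt p (q x) x) : HasW11Deriv a b p q := by
  have hde : ∀ᵐ x ∂(volume.restrict (Ioc a b)), deriv p x = q x := by
    rw [← restrict_Ioo_eq_restrict_Ioc]
    exact hd.mono fun x hx => hx.deriv
  have hq : IntervalIntegrable q volume a b := by
    rw [intervalIntegrable_iff_integrableOn_Ioc_of_le hab]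
    exact ((intervalIntegrable_iff_integrableOn_Ioc_of_le hab).1
      h.intervalIntegrable_deriv).congr hde
  refine ⟨hq, fun x hx => ?_⟩
  have h1 := (h.mono (uIcc_subset_uIcc left_mem_uIcc (Icc_subset_uIcc hx))).integral_deriv_eq_sub
  have h2 : ∫ y in a..x, deriv p y = ∫ y in a..x, q y := by
    rw [intervalIntegral.integral_of_le hx.1, intervalIntegral.integral_of_le hx.1]
    exact integral_congr_ae (ae_restrict_of_ae_restrict_of_subset (Ioc_subset_Ioc_right hx.2) hde)
  linarith

lemma congr_deriv (h : HasW11Deriv a b p q) (hab : a ≤ b) {q' : ℝ → ℝ}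
    (hq : ∀ᵐ x ∂(volume.restrict (Icc a b)), q x = q' x) : HasW11Deriv a b p q' := by
  refine of_absCont (h.absCont hab) hab ?_
  filter_upwards [h.ae_hasDerivAt, ae_restrict_of_ae_restrict_of_subset Ioo_subset_Icc_self hq]
    with x h1 h2
  rwa [← h2]

lemma congr_fun (h : HasW11Deriv a b p q) (hab : a ≤ b) {r : ℝ → ℝ} (hr : EqOn p r (Icc a b)) :
    HasW11Deriv a b r q :=
  ⟨h.1, fun x hx => by rw [← hr hx, ← hr (left_mem_Icc.2 hab), h.2 x hx]⟩

lemma deriv_ae_unique {q' : ℝ → ℝ} (h : HasW11Deriv a b p q) (h' : HasW11Deriv a b p q') :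
    ∀ᵐ x ∂(volume.restrict (Icc a b)), q x = q' x := by
  rw [← restrict_Ioo_eq_restrict_Icc]
  filter_upwards [h.ae_hasDerivAt, h'.ae_hasDerivAt] with x h1 h2
  exact h1.unique h2

lemma comp (h : HasW11Deriv a b p q) (hab : a ≤ b) {F F' : ℝ → ℝ} {K : ℝ≥0} {s : Set ℝ}
    (hF : LipschitzOnWith K F s) (hs : MapsTo p (Icc a b) s)
    (hF' : ∀ y ∈ s, HasDerivAt F (F' y) y) :
    HasW11Deriv a b (fun x => F (p x)) (fun x => F' (p x) * q x) := by
  refine of_absCont (hF.comp_absolutelyContinuousOnInterval (h.absCont hab)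
    (by rwa [uIcc_of_le hab])) hab ?_
  filter_upwards [h.ae_hasDerivAt, ae_restrict_mem measurableSet_Ioo] with x hx hxm
  exact (hF' _ (hs (Ioo_subset_Icc_self hxm))).comp x hx

lemma sq (h : HasW11Deriv a b p q) (hab : a ≤ b) :
    HasW11Deriv a b (fun x => p x ^ 2) (fun x => 2 * p x * q x) := by
  refine of_absCont (((h.absCont hab).mul (h.absCont hab)).congr fun x _ => by
    simp [pow_two]) hab ?_
  filter_upwards [h.ae_hasDerivAt] with x hx
  simpa using hx.fun_pow 2

lemma of_hasDerivAt_off_countable {p q : ℝ → ℝ} (hab : a ≤ b) {s : Set ℝ} (hs : s.Countable)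
    (hp : ContinuousOn p (Icc a b)) (hd : ∀ x ∈ Ioo a b \ s, HasDerivAt p (q x) x)
    (hq : IntegrableOn q (Icc a b)) : HasW11Deriv a b p q := by
  have hqi := (intervalIntegrable_iff_integrableOn_Icc_of_le hab).2 hq
  refine ⟨hqi, fun x hx => ?_⟩
  rw [integral_eq_of_hasDerivAt_off_countable_of_le p q hx.1 hs
    (hp.mono (Icc_subset_Icc_right hx.2)) (fun y hy => hd y ⟨⟨hy.1.1, hy.1.2.trans_le hx.2⟩, hy.2⟩)
    (hqi.mono_set (uIcc_subset_uIcc left_mem_uIcc (Icc_subset_uIcc hx)))]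
  ring

end HasW11Deriv

end W11

/-! ### Curves of measures as transition kernels -/

/-- A weakly continuous curve of finite measures on `[-1, 1]`. -/
structure IsCurve (T : ℝ) (ρ : ℝ → FiniteMeasure ℝ) : Prop where
  pos : 0 < T
  continuousOn : ContinuousOn ρ (Icc 0 T)
  supported : ∀ t ∈ Icc 0 T, (ρ t : Measure ℝ) (Icc (-1) 1)ᶜ = 0

section Curve

variable {T : ℝ} {ρ : ℝ → FiniteMeasure ℝ}

/-- Closed sets form a generating π-system, and the measure of a closed set is the limit of the
integrals of its thickened indicators, which depend continuously on time. -/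
lemma measurable_coe_of_continuous {ρ : ℝ → FiniteMeasure ℝ} (hρ : Continuous ρ) :
    Measurable fun t => (ρ t : Measure ℝ) := by
  have hint : ∀ f : BoundedContinuousFunction ℝ ℝ≥0,
      Continuous fun t => ∫⁻ x, f x ∂(ρ t : Measure ℝ) := fun f =>
    continuous_iff_continuousAt.2 fun t =>
      FiniteMeasure.tendsto_iff_forall_lintegral_tendsto.1 (hρ.tendsto t) f
  refine Measurable.measure_of_isPiSystem (borel_eq_generateFrom_isClosed (α := ℝ) ▸
    (BorelSpace.measurable_eq (α := ℝ))) isPiSystem_isClosed (fun s hs => ?_) ?_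
  · have hn : ∀ n : ℕ, (0 : ℝ) < 1 / ((n : ℝ) + 1) := fun n => Nat.one_div_pos_of_nat
    refine measurable_of_tendsto_metrizable
      (f := fun n t => ∫⁻ x, (thickenedIndicator (hn n) s x : ℝ≥0∞) ∂(ρ t : Measure ℝ))
      (fun n => (hint _).measurable) ?_
    rw [tendsto_pi_nhds]
    exact fun t => tendsto_lintegral_thickenedIndicator_of_isClosed _ hs hn
      tendsto_one_div_add_atTop_nhds_zero_nat
  · have h := hint 1
    simpa using h.measurable

/-- The restriction of a curve to `[0, T]`, extended by constants. -/
def curveExt (T : ℝ) (ρ : ℝ → FiniteMeasure ℝ) (t : ℝ) : FiniteMeasure ℝ := ρ (max 0 (min t T))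

lemma curveExt_eq {t : ℝ} (ht : t ∈ Icc 0 T) : curveExt T ρ t = ρ t := by
  rw [curveExt, min_eq_left ht.2, max_eq_right ht.1]

lemma clamp_mem (hT : 0 ≤ T) (t : ℝ) : max 0 (min t T) ∈ Icc 0 T :=
  ⟨le_max_left _ _, max_le hT (min_le_right _ _)⟩

namespace IsCurve

lemma continuous_ext (h : IsCurve T ρ) : Continuous (curveExt T ρ) :=
  h.continuousOn.comp_continuous (by fun_prop) fun t => clamp_mem h.pos.le t

/-- A curve of measures as a transition kernel. -/
def kernel (h : IsCurve T ρ) : ProbabilityTheory.Kernel ℝ ℝ :=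
  ⟨fun t => (curveExt T ρ t : Measure ℝ), measurable_coe_of_continuous h.continuous_ext⟩

lemma kernel_apply (h : IsCurve T ρ) {t : ℝ} (ht : t ∈ Icc 0 T) :
    h.kernel t = (ρ t : Measure ℝ) := by
  change (curveExt T ρ t : Measure ℝ) = _
  rw [curveExt_eq ht]

lemma exists_mass_le (h : IsCurve T ρ) : ∃ C : ℝ≥0, ∀ t ∈ Icc 0 T, (ρ t).mass ≤ C := by
  have hc : ContinuousOn (fun t => (ρ t).mass) (Icc 0 T) :=
    FiniteMeasure.continuous_mass.comp_continuousOn h.continuousOn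
  obtain ⟨t, -, ht⟩ := isCompact_Icc.exists_isMaxOn (nonempty_Icc.2 h.pos.le) hc
  exact ⟨_, fun s hs => ht hs⟩

instance isFiniteKernel (h : IsCurve T ρ) : ProbabilityTheory.IsFiniteKernel h.kernel := by
  obtain ⟨C, hC⟩ := h.exists_mass_le
  refine ⟨⟨C, ENNReal.coe_lt_top, fun t => ?_⟩⟩
  have := hC _ (clamp_mem h.pos.le t)
  change (ρ (max 0 (min t T)) : Measure ℝ) univ ≤ C
  rw [← FiniteMeasure.ennreal_mass]
  exact_mod_cast this

lemma ae_mem (h : IsCurve T ρ) {t : ℝ} (ht : t ∈ Icc 0 T) :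
    ∀ᵐ ξ ∂(ρ t : Measure ℝ), ξ ∈ Icc (-1 : ℝ) 1 := h.supported t ht

/-- The measure `ρ_t(dξ) dt` on `(0, T) × ℝ`. -/
def joint (h : IsCurve T ρ) : Measure (ℝ × ℝ) := (volume.restrict (Ioo 0 T)).compProd h.kernel

lemma lintegral_joint (h : IsCurve T ρ) {f : ℝ × ℝ → ℝ≥0∞} (hf : Measurable f) :
    ∫⁻ x, f x ∂h.joint = ∫⁻ t in Ioo 0 T, ∫⁻ ξ, f (t, ξ) ∂(ρ t : Measure ℝ) := by
  rw [joint, Measure.lintegral_compProd hf]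
  exact setLIntegral_congr_fun measurableSet_Ioo fun t ht => by
    rw [h.kernel_apply (Ioo_subset_Icc_self ht)]

lemma integral_joint (h : IsCurve T ρ) {f : ℝ × ℝ → ℝ} (hf : Integrable f h.joint) :
    ∫ x, f x ∂h.joint = ∫ t in Ioo 0 T, ∫ ξ, f (t, ξ) ∂(ρ t : Measure ℝ) := by
  rw [joint, Measure.integral_compProd hf]
  exact setIntegral_congr_fun measurableSet_Ioo fun t ht => by
    simp only [h.kernel_apply (Ioo_subset_Icc_self ht)]

lemma integrable_of_joint (h : IsCurve T ρ) {f : ℝ × ℝ → ℝ} (hf : Integrable f h.joint) :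
    (∀ᵐ t ∂(volume.restrict (Ioo 0 T)), Integrable (fun ξ => f (t, ξ)) (ρ t : Measure ℝ)) ∧
      IntegrableOn (fun t => ∫ ξ, f (t, ξ) ∂(ρ t : Measure ℝ)) (Ioo 0 T) := by
  have h1 := (Measure.integrable_compProd_iff hf.1).1 hf
  have h2 : IntegrableOn (fun t => ∫ ξ, f (t, ξ) ∂(h.kernel t)) (Ioo 0 T) :=
    Integrable.mono' h1.2 (by
      have := AEStronglyMeasurable.integral_kernel_compProd
        (κ := ProbabilityTheory.Kernel.const Unit (volume.restrict (Ioo 0 T)))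
        (η := ProbabilityTheory.Kernel.prodMkLeft Unit h.kernel) (a := ()) hf.1
      simpa using this)
      (Eventually.of_forall fun t => norm_integral_le_integral_norm _)
  refine ⟨?_, h2.congr_fun (fun t ht => ?_) measurableSet_Ioo⟩
  · filter_upwards [h1.1, ae_restrict_mem measurableSet_Ioo] with t ht hm
    rwa [h.kernel_apply (Ioo_subset_Icc_self hm)] at ht
  · simp only [h.kernel_apply (Ioo_subset_Icc_self ht)]

lemma continuousOn_integral (h : IsCurve T ρ) {ψ : ℝ → ℝ} (hψ : ContinuousOn ψ (Icc (-1) 1)) :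
    ContinuousOn (fun t => ∫ ξ, ψ ξ ∂(ρ t : Measure ℝ)) (Icc 0 T) := by
  -- The measures do not charge the complement of `[-1, 1]`, so a test function continuous only
  -- there may be replaced by its constant extension, which is bounded and continuous.
  set e := IccExtend (show (-1 : ℝ) ≤ 1 by norm_num) (domRestrict (Icc (-1) 1) ψ) with he
  have hec : Continuous e := (continuousOn_iff_continuous_domRestrict.1 hψ).Icc_extend'
  obtain ⟨C, hC⟩ := isCompact_Icc.exists_bound_of_continuousOn hψ
  let F : BoundedContinuousFunction ℝ ℝ := BoundedContinuousFunction.ofNormedAddCommGroup e hec C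
    fun x => hC _ (Subtype.coe_prop _)
  have h1 : ∀ t ∈ Icc 0 T, ∫ ξ, ψ ξ ∂(ρ t : Measure ℝ) = ∫ ξ, F ξ ∂(ρ t : Measure ℝ) :=
    fun t ht => integral_congr_ae ((h.ae_mem ht).mono fun ξ hξ => by
      change ψ ξ = e ξ
      rw [he, IccExtend_of_mem _ _ hξ]; rfl)
  refine ContinuousOn.congr (fun t ht => ?_) h1
  exact FiniteMeasure.tendsto_iff_forall_integral_tendsto.1 (h.continuousOn t ht) F

end IsCurve

end Curve

/-! ### The continuity equation and velocity fields -/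

/-- The du Bois-Reymond lemma, for a weak derivative on an interval. -/
lemma sub_eq_integral_of_weak_deriv {T : ℝ} (hT : 0 < T) {y f : ℝ → ℝ}
    (hy : ContinuousOn y (Icc 0 T)) (hf : IntegrableOn f (Ioo 0 T))
    (h : ∀ η : ℝ → ℝ, ContDiff ℝ ∞ η → HasCompactSupport η → tsupport η ⊆ Ioo 0 T →
      ∫ t in Ioo 0 T, (deriv η t * y t + η t * f t) = 0) :
    HasW11Deriv 0 T y f := by
  have hfi : IntervalIntegrable f volume 0 T :=
    (intervalIntegrable_iff_integrableOn_Ioo_of_le hT.le).2 hf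
  set F : ℝ → ℝ := fun t => ∫ s in 0..t, f s with hF
  have hFW : HasW11Deriv 0 T F f := ⟨hfi, fun x _ => by simp [hF]⟩
  have hFac := hFW.absCont hT.le
  have hFc := hFW.continuousOn hT.le
  set Y : ℝ → ℝ := fun t => y t - F t with hYdef
  have hYc : ContinuousOn Y (Icc 0 T) := hy.sub hFc
  have hYi : IntegrableOn Y (Ioo 0 T) :=
    (hYc.integrableOn_compact isCompact_Icc).mono_set Ioo_subset_Icc_self
  have hYl : LocallyIntegrableOn Y (Ioo 0 T) := hYi.locallyIntegrableOn
  have hmulint : ∀ {ζ z : ℝ → ℝ}, Continuous ζ → HasCompactSupport ζ → IntegrableOn z (Ioo 0 T) →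
      IntegrableOn (fun t => ζ t * z t) (Ioo 0 T) := fun {ζ z} hζ hζc hz => by
    obtain ⟨C, hC⟩ := hζ.bounded_above_of_compact_support hζc
    exact hz.bdd_mul hζ.aestronglyMeasurable (Eventually.of_forall hC)
  have hyi : IntegrableOn y (Ioo 0 T) :=
    (hy.integrableOn_compact isCompact_Icc).mono_set Ioo_subset_Icc_self
  have hFi : IntegrableOn F (Ioo 0 T) :=
    (hFc.integrableOn_compact isCompact_Icc).mono_set Ioo_subset_Icc_self
  -- Subtracting the primitive `F` of `f` leaves a function `Y` whose weak derivative is zero; it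
  -- remains to show that `Y` is constant.
  have hY0 : ∀ η : ℝ → ℝ, ContDiff ℝ ∞ η → HasCompactSupport η → tsupport η ⊆ Ioo 0 T →
      ∫ t in Ioo 0 T, deriv η t * Y t = 0 := fun η hη hηc hηs => by
    have hdc : Continuous (deriv η) := hη.continuous_deriv (by simp)
    have hη0 : η 0 = 0 := image_eq_zero_of_notMem_tsupport fun h0 => (hηs h0).1.false
    have hηT : η T = 0 := image_eq_zero_of_notMem_tsupport fun h0 => (hηs h0).2.false
    have hηac : AbsolutelyContinuousOnInterval η 0 T :=
      (hη.of_le (by simp)).contDiffOn.absolutelyContinuousOnInterval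
    have hparts := hηac.integral_mul_deriv_eq_deriv_mul hFac
    rw [hη0, hηT] at hparts
    have hFd : ∫ t in Ioo 0 T, η t * f t = - ∫ t in Ioo 0 T, deriv η t * F t := by
      rw [← integral_Ioc_eq_integral_Ioo, ← integral_Ioc_eq_integral_Ioo,
        ← intervalIntegral.integral_of_le hT.le, ← intervalIntegral.integral_of_le hT.le]
      have : ∫ t in 0..T, η t * f t = ∫ t in 0..T, η t * deriv F t := by
        rw [intervalIntegral.integral_of_le hT.le, intervalIntegral.integral_of_le hT.le,
          integral_Ioc_eq_integral_Ioo, integral_Ioc_eq_integral_Ioo]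
        refine integral_congr_ae ?_
        filter_upwards [hFW.ae_hasDerivAt] with t ht
        rw [ht.deriv]
      rw [this, hparts]; ring
    have h1 := h η hη hηc hηs
    rw [integral_add (hmulint hdc hηc.deriv hyi) (hmulint hη.continuous hηc hf), hFd] at h1
    simp only [hYdef, mul_sub]
    rw [integral_sub (hmulint hdc hηc.deriv hyi) (hmulint hdc hηc.deriv hFi)]
    linarith
  obtain ⟨η₀, hη₀s, hη₀c, hη₀d, hη₀1⟩ : ∃ η₀ : ℝ → ℝ, tsupport η₀ ⊆ Ioo 0 T ∧
      HasCompactSupport η₀ ∧ ContDiff ℝ ∞ η₀ ∧ ∫ t in Ioo 0 T, η₀ t = 1 := by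
    let b : ContDiffBump (T / 2) := ⟨T / 8, T / 4, by positivity, by linarith⟩
    refine ⟨b.normed volume, ?_, b.hasCompactSupport_normed, b.contDiff_normed, ?_⟩
    · rw [b.tsupport_normed_eq, Real.closedBall_eq_Icc]
      exact fun x hx => ⟨by linarith [hx.1, show b.rOut = T / 4 from rfl],
        by linarith [hx.2, show b.rOut = T / 4 from rfl]⟩
    · rw [setIntegral_eq_integral_of_forall_compl_eq_zero, b.integral_normed]
      intro x hx
      refine image_eq_zero_of_notMem_tsupport fun hx' => hx ?_
      rw [b.tsupport_normed_eq, Real.closedBall_eq_Icc] at hx'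
      exact ⟨by linarith [hx'.1, show b.rOut = T / 4 from rfl],
        by linarith [hx'.2, show b.rOut = T / 4 from rfl]⟩
  set c := ∫ t in Ioo 0 T, η₀ t * Y t with hc
  have hYc0 : ∀ ζ : ℝ → ℝ, ContDiff ℝ ∞ ζ → HasCompactSupport ζ → tsupport ζ ⊆ Ioo 0 T →
      ∫ t, ζ t • (Y t - c) = 0 := fun ζ hζ hζc hζs => by
    set I := ∫ t in Ioo 0 T, ζ t with hI
    -- Correcting `ζ` by a multiple of the unit bump `η₀` makes its integral zero. Its primitive is
    -- then again a test function, to which `hY0` applies; the correction produces the constant `c`.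
    set χ : ℝ → ℝ := fun t => ζ t - I * η₀ t with hχ
    have hχd : ContDiff ℝ ∞ χ := hζ.sub (contDiff_const.mul hη₀d)
    obtain ⟨a, b, ha0, hab, hbT, hχs⟩ : ∃ a b, 0 < a ∧ a ≤ b ∧ b < T ∧
        ∀ x ∉ Icc a b, χ x = 0 := by
      have hK : IsCompact (tsupport ζ ∪ tsupport η₀) := hζc.isCompact.union hη₀c.isCompact
      have hKs : tsupport ζ ∪ tsupport η₀ ⊆ Ioo 0 T := union_subset hζs hη₀s
      have hKne : (tsupport ζ ∪ tsupport η₀).Nonempty := by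
        by_contra hne
        rw [not_nonempty_iff_eq_empty, union_empty_iff, tsupport_eq_empty_iff,
          tsupport_eq_empty_iff] at hne
        simp [hne.2] at hη₀1
      refine ⟨_, _, (hKs (hK.sInf_mem hKne)).1, csInf_le_csSup hKne hK.bddBelow hK.bddAbove,
        (hKs (hK.sSup_mem hKne)).2, fun x hx => ?_⟩
      have hx' : x ∉ tsupport ζ ∪ tsupport η₀ := fun hm =>
        hx ⟨csInf_le hK.bddBelow hm, le_csSup hK.bddAbove hm⟩
      rw [mem_union, not_or] at hx'
      simp [hχ, image_eq_zero_of_notMem_tsupport hx'.1, image_eq_zero_of_notMem_tsupport hx'.2]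
    have hζi : IntegrableOn ζ (Ioo 0 T) := (hζ.continuous.integrable_of_hasCompactSupport hζc).integrableOn
    have hη₀i : IntegrableOn η₀ (Ioo 0 T) :=
      (hη₀d.continuous.integrable_of_hasCompactSupport hη₀c).integrableOn
    have hχint : ∫ t in 0..T, χ t = 0 := by
      rw [intervalIntegral.integral_of_le hT.le, integral_Ioc_eq_integral_Ioo, hχ,
        integral_sub hζi (hη₀i.const_mul I), integral_const_mul, hη₀1]
      simp [hI]
    set η : ℝ → ℝ := fun t => ∫ s in 0..t, χ s with hη
    have hηd : ∀ t, HasDerivAt η (χ t) t := fun t =>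
      intervalIntegral.integral_hasDerivAt_right (hχd.continuous.intervalIntegrable _ _)
        (hχd.continuous.stronglyMeasurableAtFilter _ _) hχd.continuous.continuousAt
    have hderiv : deriv η = χ := funext fun t => (hηd t).deriv
    have hηsm : ContDiff ℝ ∞ η := by
      rw [contDiff_infty_iff_deriv]
      exact ⟨fun t => (hηd t).differentiableAt, by rw [hderiv]; exact hχd⟩
    -- Left of `a` the integrand vanishes; right of `b` the primitive equals the full integral of
    -- `χ`, which is zero.
    have hη0 : ∀ x ∉ Icc a b, η x = 0 := fun x hx => by
      rcases lt_or_ge x a with hxa | hxa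
      · refine intervalIntegral.integral_zero_ae (Eventually.of_forall fun s hs => hχs s fun hs' => ?_)
        rcases le_total 0 x with h0 | h0
        · rw [uIoc_of_le h0] at hs; linarith [hs.2, hs'.1]
        · rw [uIoc_of_ge h0] at hs; linarith [hs.2, hs'.1]
      · have hbx : b < x := by by_contra hcon; exact hx ⟨hxa, not_lt.1 hcon⟩
        have : ∫ s in x..T, χ s = 0 :=
          intervalIntegral.integral_zero_ae (Eventually.of_forall fun s hs => hχs s fun hs' => by
            rw [mem_uIoc] at hs
            rcases hs with hs | hs <;> linarith [hs.1, hs'.2])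
        have h2 := intervalIntegral.integral_add_adjacent_intervals
          (hχd.continuous.intervalIntegrable (μ := volume) 0 x)
          (hχd.continuous.intervalIntegrable (μ := volume) x T)
        rw [this, add_zero, hχint] at h2
        exact h2
    have hts : tsupport η ⊆ Icc a b :=
      closure_minimal (fun x hx => by_contra fun hn => hx (hη0 x hn)) isClosed_Icc
    have hηc : HasCompactSupport η := isCompact_Icc.of_isClosed_subset (isClosed_tsupport _) hts
    have hzero := hY0 η hηsm hηc (hts.trans fun x hx => ⟨ha0.trans_le hx.1, hx.2.trans_lt hbT⟩)
    rw [hderiv] at hzero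
    rw [← setIntegral_eq_integral_of_forall_compl_eq_zero (s := Ioo 0 T) (fun x hx => by
      rw [image_eq_zero_of_notMem_tsupport fun h' => hx (hζs h'), zero_smul])]
    simp only [hχ, sub_mul, mul_assoc, smul_eq_mul, mul_sub] at hzero ⊢
    rw [integral_sub (hmulint hζ.continuous hζc hYi)
      ((hmulint hη₀d.continuous hη₀c hYi).const_mul I), integral_const_mul, ← hc] at hzero
    rw [integral_sub (hmulint hζ.continuous hζc hYi) (hζi.mul_const c), integral_mul_const, ← hI]
    exact hzero
  have hae := isOpen_Ioo.ae_eq_zero_of_integral_contDiff_smul_eq_zero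
    (hYl.sub ((locallyIntegrable_const c).locallyIntegrableOn _)) hYc0
  have hYeq : EqOn Y (fun _ => c) (Icc 0 T) := by
    refine Measure.eqOn_Icc_of_ae_eq volume hT.ne ?_ hYc continuousOn_const
    rw [← restrict_Ioo_eq_restrict_Icc]
    refine (ae_restrict_iff' measurableSet_Ioo).2 (hae.mono fun x hx hm => ?_)
    have := hx hm
    simpa [sub_eq_zero] using this
  refine ⟨hfi, fun x hx => ?_⟩
  have h1 : y x - F x = c := hYeq hx
  have h2 : y 0 - F 0 = c := hYeq (left_mem_Icc.2 hT.le)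
  have h3 : F 0 = 0 := by simp [hF]
  have h4 : F x = ∫ s in 0..x, f s := rfl
  linarith

section Velocity

variable {T : ℝ} {ρ : ℝ → FiniteMeasure ℝ} {v : ℝ → ℝ → ℝ}

lemma IsCurve.ae_joint_mem (h : IsCurve T ρ) : ∀ᵐ x ∂h.joint, x.2 ∈ Icc (-1 : ℝ) 1 := by
  have hm : MeasurableSet {x : ℝ × ℝ | x.2 ∈ Icc (-1 : ℝ) 1} := measurable_snd measurableSet_Icc
  rw [IsCurve.joint, Measure.ae_compProd_iff hm]
  filter_upwards [ae_restrict_mem measurableSet_Ioo] with t ht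
  rw [h.kernel_apply (Ioo_subset_Icc_self ht)]
  exact h.ae_mem (Ioo_subset_Icc_self ht)

namespace IsVelocity

lemma integrable_joint (hv : IsVelocity T ρ v) (h : IsCurve T ρ) :
    Integrable (Function.uncurry v) h.joint := by
  refine ⟨hv.measurable.aestronglyMeasurable, ?_⟩
  have h1 := h.lintegral_joint (f := fun x => ‖Function.uncurry v x‖ₑ) hv.measurable.enorm
  rw [HasFiniteIntegral, h1]
  refine lt_of_le_of_lt (le_of_eq ?_) hv.finite
  simp only [Function.uncurry, Real.enorm_eq_ofReal_abs]

lemma integrable_mul_joint (hv : IsVelocity T ρ v) (h : IsCurve T ρ) {θ : ℝ → ℝ}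
    (hθ : Measurable θ) {C : ℝ} (hC : ∀ ξ ∈ Icc (-1 : ℝ) 1, |θ ξ| ≤ C) :
    Integrable (fun x : ℝ × ℝ => θ x.2 * v x.1 x.2) h.joint :=
  (hv.integrable_joint h).bdd_mul (hθ.comp measurable_snd).aestronglyMeasurable
    (h.ae_joint_mem.mono fun _ hx => hC _ hx)

lemma integrableOn_flux (hv : IsVelocity T ρ v) (h : IsCurve T ρ) {θ : ℝ → ℝ}
    (hθ : Measurable θ) {C : ℝ} (hC : ∀ ξ ∈ Icc (-1 : ℝ) 1, |θ ξ| ≤ C) :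
    IntegrableOn (fun t => ∫ ξ, θ ξ * v t ξ ∂(ρ t : Measure ℝ)) (Ioo 0 T) :=
  (h.integrable_of_joint (hv.integrable_mul_joint h hθ hC)).2

/-- Products `η(t) Ψ(ξ)` as test functions turn the distributional equation into a weak derivative
in time, to which the du Bois-Reymond lemma applies. -/
lemma hasW11Deriv_of_contDiff (hv : IsVelocity T ρ v) (h : IsCurve T ρ) {ψ : ℝ → ℝ}
    (hψ : ContDiff ℝ ∞ ψ) :
    HasW11Deriv 0 T (fun t => ∫ ξ, ψ ξ ∂(ρ t : Measure ℝ))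
      (fun t => ∫ ξ, deriv ψ ξ * v t ξ ∂(ρ t : Measure ℝ)) := by
  have hdc : Continuous (deriv ψ) := hψ.continuous_deriv (by simp)
  obtain ⟨C, hC⟩ := isCompact_Icc.exists_bound_of_continuousOn
    (hdc.continuousOn (s := Icc (-1) 1))
  have hfi := hv.integrableOn_flux h hdc.measurable hC
  have hyc := h.continuousOn_integral (hψ.continuous.continuousOn (s := Icc (-1) 1))
  refine sub_eq_integral_of_weak_deriv h.pos hyc hfi fun η hη hηc hηs => ?_
  -- The cutoff equals one on `[-2, 2]`, a neighbourhood of `[-1, 1]`, so that it changes neither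
  -- `ψ` nor its derivative where the measures live.
  let b : ContDiffBump (0 : ℝ) := ⟨2, 3, by norm_num, by norm_num⟩
  set Ψ : ℝ → ℝ := fun ξ => b ξ * ψ ξ with hΨ
  have hΨd : ContDiff ℝ ∞ Ψ := b.contDiff.mul hψ
  have hΨc : HasCompactSupport Ψ := b.hasCompactSupport.mul_right
  have hφd : ContDiff ℝ ∞ (fun x : ℝ × ℝ => η x.1 * Ψ x.2) :=
    (hη.comp contDiff_fst).mul (hΨd.comp contDiff_snd)
  have hsub : tsupport (fun x : ℝ × ℝ => η x.1 * Ψ x.2) ⊆ tsupport η ×ˢ tsupport Ψ := by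
    refine closure_minimal (fun x hx => ?_) ((isClosed_tsupport η).prod (isClosed_tsupport Ψ))
    have hx' : η x.1 * Ψ x.2 ≠ 0 := hx
    exact ⟨subset_tsupport _ (left_ne_zero_of_mul hx'), subset_tsupport _ (right_ne_zero_of_mul hx')⟩
  have hfd : ∀ t ξ, HasFDerivAt (fun x : ℝ × ℝ => η x.1 * Ψ x.2)
      (η t • (deriv Ψ ξ • ContinuousLinearMap.snd ℝ ℝ ℝ) +
        Ψ ξ • (deriv η t • ContinuousLinearMap.fst ℝ ℝ ℝ)) (t, ξ) := fun t ξ => by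
    have h1 : HasFDerivAt (fun x : ℝ × ℝ => η x.1)
        (deriv η t • ContinuousLinearMap.fst ℝ ℝ ℝ) (t, ξ) :=
      HasDerivAt.comp_hasFDerivAt (f := fun x : ℝ × ℝ => x.1) (t, ξ)
        ((hη.differentiable (by simp) t).hasDerivAt) hasFDerivAt_fst
    have h2 : HasFDerivAt (fun x : ℝ × ℝ => Ψ x.2)
        (deriv Ψ ξ • ContinuousLinearMap.snd ℝ ℝ ℝ) (t, ξ) :=
      HasDerivAt.comp_hasFDerivAt (f := fun x : ℝ × ℝ => x.2) (t, ξ)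
        ((hΨd.differentiable (by simp) ξ).hasDerivAt) hasFDerivAt_snd
    exact h1.mul h2
  have hΨeq : ∀ ξ ∈ Icc (-1 : ℝ) 1, Ψ ξ = ψ ξ ∧ deriv Ψ ξ = deriv ψ ξ := fun ξ hξ => by
    have : Ψ =ᶠ[𝓝 ξ] ψ := by
      have hnear : ∀ᶠ x in 𝓝 ξ, x ∈ Ioo (-2 : ℝ) 2 :=
        isOpen_Ioo.mem_nhds ⟨by linarith [hξ.1], by linarith [hξ.2]⟩
      filter_upwards [hnear] with x hx
      have hb : b x = 1 := b.one_of_mem_closedBall (by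
        rw [Real.closedBall_eq_Icc]
        exact ⟨by linarith [hx.1, show b.rIn = 2 from rfl],
          by linarith [hx.2, show b.rIn = 2 from rfl]⟩)
      simp [hΨ, hb]
    exact ⟨this.self_of_nhds, this.deriv_eq⟩
  have key := hv.eqn _ hφd (HasCompactSupport.of_support_subset_isCompact
    (hηc.isCompact.prod hΨc.isCompact) ((subset_tsupport _).trans hsub))
    (hsub.trans (prod_mono hηs (subset_univ _)))
  refine Eq.trans ?_ key
  refine setIntegral_congr_fun measurableSet_Ioo fun t ht => ?_
  have ht' := Ioo_subset_Icc_self ht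
  simp only [(hfd _ _).fderiv]
  simp only [_root_.add_apply, _root_.smul_apply,
    ContinuousLinearMap.coe_fst', ContinuousLinearMap.coe_snd', smul_eq_mul, mul_zero, mul_one,
    zero_add, add_zero]
  rw [← integral_const_mul, ← integral_const_mul]
  congr 1
  · exact integral_congr_ae ((h.ae_mem ht').mono fun ξ hξ => by
      simp only [(hΨeq ξ hξ).1]; ring)
  · exact integral_congr_ae ((h.ae_mem ht').mono fun ξ hξ => by
      simp only [(hΨeq ξ hξ).2]; ring)

/-- The continuity equation, tested with a Lipschitz function of space. -/
lemma hasW11Deriv (hv : IsVelocity T ρ v) (h : IsCurve T ρ) {ψ θ : ℝ → ℝ}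
    (hψ : HasW11Deriv (-1) 1 ψ θ) (hθ : Measurable θ) {C : ℝ}
    (hC : ∀ ξ ∈ Icc (-1 : ℝ) 1, |θ ξ| ≤ C) :
    HasW11Deriv 0 T (fun t => ∫ ξ, ψ ξ ∂(ρ t : Measure ℝ))
      (fun t => ∫ ξ, θ ξ * v t ξ ∂(ρ t : Measure ℝ)) := by
  have hfi := hv.integrableOn_flux h hθ hC
  refine ⟨(intervalIntegrable_iff_integrableOn_Ioo_of_le h.pos.le).2 hfi, fun t ht => ?_⟩
  have : IsFiniteMeasure (h.joint.withDensity fun x => ‖Function.uncurry v x‖ₑ) :=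
    isFiniteMeasure_withDensity (hv.integrable_joint h).2.ne
  -- The space marginal of `|v| ρ_t dt`. With Lebesgue measure added to it, a single `L¹(ν)`
  -- distance of slopes controls both the flux term and the test functions themselves.
  set ν₁ : Measure ℝ := (h.joint.withDensity fun x => ‖Function.uncurry v x‖ₑ).map Prod.snd
    with hν₁
  set ν : Measure ℝ := volume.restrict (Icc (-1) 1) + ν₁ with hν
  have hνmem : ∀ᵐ ξ ∂ν, ξ ∈ Icc (-1 : ℝ) 1 := by
    rw [hν, ae_add_measure_iff]
    refine ⟨ae_restrict_mem measurableSet_Icc, ?_⟩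
    rw [hν₁, ae_map_iff (p := fun x => x ∈ Icc (-1 : ℝ) 1) measurable_snd.aemeasurable measurableSet_Icc]
    exact (withDensity_absolutelyContinuous _ _).ae_le h.ae_joint_mem
  have hθν : Integrable θ ν := by
    refine (integrable_const C).mono' hθ.aestronglyMeasurable (hνmem.mono fun ξ hξ => hC ξ hξ)
  obtain ⟨Cm, hCm⟩ := h.exists_mass_le
  have hCm' : ∀ r ∈ Icc 0 T, (ρ r : Measure ℝ).real univ ≤ Cm := fun r hr => by
    have := hCm r hr
    rw [FiniteMeasure.mass, ← NNReal.coe_le_coe] at this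
    exact this
  -- the defect is bounded by the `L¹(ν)` norm of the slope
  have hbound : ∀ {ψ θ : ℝ → ℝ} {C : ℝ}, HasW11Deriv (-1) 1 ψ θ → Measurable θ →
      (∀ ξ ∈ Icc (-1 : ℝ) 1, |θ ξ| ≤ C) → ψ (-1) = 0 →
      |∫ ξ, ψ ξ ∂(ρ t : Measure ℝ) - ∫ ξ, ψ ξ ∂(ρ 0 : Measure ℝ) -
        ∫ r in 0..t, ∫ ξ, θ ξ * v r ξ ∂(ρ r : Measure ℝ)| ≤ (2 * Cm + 1) * ∫ ξ, |θ ξ| ∂ν := by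
    intro ψ θ C hψ hθ hC hψ0
    have hθν : Integrable θ ν :=
      (integrable_const C).mono' hθ.aestronglyMeasurable (hνmem.mono fun ξ hξ => hC ξ hξ)
    have hi1 : IntegrableOn (fun ξ => |θ ξ|) (Icc (-1) 1) :=
      (hθν.abs.mono_measure (Measure.le_add_right le_rfl) :)
    have hi2 : Integrable (fun ξ => |θ ξ|) ν₁ :=
      (hθν.abs.mono_measure (Measure.le_add_left le_rfl) :)
    have hsplit : ∫ ξ, |θ ξ| ∂ν = (∫ ξ in Icc (-1) 1, |θ ξ|) + ∫ ξ, |θ ξ| ∂ν₁ :=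
      integral_add_measure hi1 hi2
    have h0 : 0 ≤ ∫ ξ in Icc (-1 : ℝ) 1, |θ ξ| := integral_nonneg fun _ => abs_nonneg _
    have h0' : 0 ≤ ∫ ξ, |θ ξ| ∂ν₁ := integral_nonneg fun _ => abs_nonneg _
    have hψb : ∀ ξ ∈ Icc (-1 : ℝ) 1, |ψ ξ| ≤ ∫ ξ in Icc (-1) 1, |θ ξ| := fun ξ hξ => by
      rw [hψ.2 ξ hξ, hψ0, zero_add, intervalIntegral.integral_of_le hξ.1]
      refine abs_integral_le_integral_abs.trans (setIntegral_mono_set hi1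
        (Eventually.of_forall fun _ => abs_nonneg _) (LE.le.eventuallyLE ?_))
      exact fun x hx => ⟨hx.1.le, hx.2.trans hξ.2⟩
    have hA : ∀ r ∈ Icc 0 T, |∫ ξ, ψ ξ ∂(ρ r : Measure ℝ)| ≤
        (∫ ξ in Icc (-1) 1, |θ ξ|) * Cm := fun r hr =>
      (norm_integral_le_of_norm_le_const (f := ψ) ((h.ae_mem hr).mono hψb)).trans
        (mul_le_mul_of_nonneg_left (hCm' r hr) h0)
    have hB : |∫ r in 0..t, ∫ ξ, θ ξ * v r ξ ∂(ρ r : Measure ℝ)| ≤ ∫ ξ, |θ ξ| ∂ν₁ := by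
      have hij := hv.integrable_mul_joint h hθ hC
      have e1 : ∫ ξ, |θ ξ| ∂ν₁ = ∫ x, |θ x.2 * v x.1 x.2| ∂h.joint := by
        rw [hν₁, integral_map measurable_snd.aemeasurable hθ.abs.aestronglyMeasurable,
          integral_withDensity_eq_integral_toReal_smul hv.measurable.enorm (by simp)]
        refine integral_congr_ae (Eventually.of_forall fun x => ?_)
        simp only [toReal_enorm, Real.norm_eq_abs, smul_eq_mul, abs_mul, Function.uncurry]
        ring
      have hia : Integrable (fun x : ℝ × ℝ => |θ x.2 * v x.1 x.2|) h.joint := hij.abs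
      rw [e1, h.integral_joint hia, intervalIntegral.integral_of_le ht.1]
      refine abs_integral_le_integral_abs.trans ?_
      rw [integral_Ioc_eq_integral_Ioo]
      have hint := (h.integrable_of_joint hij).2
      have hint2 := (h.integrable_of_joint hia).2
      refine (setIntegral_mono_set hint.abs (Eventually.of_forall fun _ => abs_nonneg _)
        (LE.le.eventuallyLE (Ioo_subset_Ioo_right ht.2))).trans ?_
      exact integral_mono hint.abs hint2 fun r => abs_integral_le_integral_abs
    have h1 := hA t ht
    have h2 := hA 0 (left_mem_Icc.2 h.pos.le)
    have h3 : (0 : ℝ) ≤ Cm := Cm.2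
    rw [hsplit]
    rw [abs_le] at *
    constructor <;> nlinarith [mul_nonneg h3 h0']
  -- polynomial slopes have no defect
  have hpoly : ∀ P : Polynomial ℝ, ∃ Ψ : ℝ → ℝ, HasW11Deriv (-1) 1 Ψ (fun x => P.eval x) ∧
      Ψ (-1) = 0 ∧ ∫ ξ, Ψ ξ ∂(ρ t : Measure ℝ) - ∫ ξ, Ψ ξ ∂(ρ 0 : Measure ℝ) =
        ∫ r in 0..t, ∫ ξ, P.eval ξ * v r ξ ∂(ρ r : Measure ℝ) := fun P => by
    have hPd : ContDiff ℝ ∞ fun x => P.eval x := by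
      simpa using P.contDiff_aeval (𝕜 := ℝ) ∞
    have hd : ∀ x, HasDerivAt (fun x => ∫ y in (-1 : ℝ)..x, P.eval y) (P.eval x) x := fun x =>
      intervalIntegral.integral_hasDerivAt_right (hPd.continuous.intervalIntegrable _ _)
        (hPd.continuous.stronglyMeasurableAtFilter _ _) hPd.continuous.continuousAt
    have hde : deriv (fun x => ∫ y in (-1 : ℝ)..x, P.eval y) = fun x => P.eval x :=
      funext fun x => (hd x).deriv
    refine ⟨fun x => ∫ y in (-1 : ℝ)..x, P.eval y,
      ⟨hPd.continuous.intervalIntegrable _ _, fun x _ => by simp⟩, by simp, ?_⟩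
    have hsm : ContDiff ℝ ∞ fun x => ∫ y in (-1 : ℝ)..x, P.eval y := by
      rw [contDiff_infty_iff_deriv]
      exact ⟨fun x => (hd x).differentiableAt, by rw [hde]; exact hPd⟩
    have := (hv.hasW11Deriv_of_contDiff h hsm).2 t ht
    rw [hde] at this
    linarith
  -- constants have no defect
  have hconst : (ρ t : Measure ℝ).real univ = (ρ 0 : Measure ℝ).real univ := by
    have := (hv.hasW11Deriv_of_contDiff h (contDiff_const (c := (1 : ℝ)))).2 t ht
    simpa using this
  have hψc := hψ.continuousOn (by norm_num : (-1 : ℝ) ≤ 1)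
  obtain ⟨Cψ, hCψ⟩ := isCompact_Icc.exists_bound_of_continuousOn hψc
  have hψi : ∀ {ψ : ℝ → ℝ}, ContinuousOn ψ (Icc (-1) 1) → ∀ r ∈ Icc 0 T,
      Integrable ψ (ρ r : Measure ℝ) := fun {ψ} hψc r hr => by
    have hres : (ρ r : Measure ℝ).restrict (Icc (-1) 1) = ρ r :=
      Measure.restrict_eq_self_of_ae_mem (h.ae_mem hr)
    rw [← hres]
    exact hψc.integrableOn_compact isCompact_Icc
  -- `hbound` requires a function vanishing at `-1`; the subtracted constant is restored at the end
  -- by conservation of mass.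
  set ψ₀ : ℝ → ℝ := fun x => ψ x - ψ (-1) with hψ₀
  have hψ₀W : HasW11Deriv (-1) 1 ψ₀ θ := ⟨hψ.1, fun x hx => by simp [hψ₀, hψ.2 x hx]⟩
  have hdef : ∀ c > 0, |∫ ξ, ψ₀ ξ ∂(ρ t : Measure ℝ) - ∫ ξ, ψ₀ ξ ∂(ρ 0 : Measure ℝ) -
        ∫ r in 0..t, ∫ ξ, θ ξ * v r ξ ∂(ρ r : Measure ℝ)| ≤ (2 * Cm + 1) * c := by
    intro c hc
    -- Polynomial slopes are dense: `θ` is approximated in `L¹(ν)` by a continuous function, and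
    -- that one uniformly on `[-1, 1]` by a polynomial.
    obtain ⟨f, -, hf, hfc, hfi⟩ := hθν.exists_hasCompactSupport_integral_sub_le (half_pos hc)
    set N := ν.real univ + 1 with hN
    have hNpos : 0 < N := by have : 0 ≤ ν.real univ := measureReal_nonneg; linarith
    obtain ⟨P, hP⟩ := exists_polynomial_near_of_continuousOn (-1) 1 f hfc.continuousOn
      (c / 2 / N) (by positivity)
    obtain ⟨Ψ, hΨW, hΨ0, hΨ⟩ := hpoly P
    have hPm : Measurable fun x => P.eval x := P.continuous.measurable
    obtain ⟨CP, hCP⟩ := isCompact_Icc.exists_bound_of_continuousOn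
      (P.continuous.continuousOn (s := Icc (-1) 1))
    have hPν : Integrable (fun x => P.eval x) ν :=
      (integrable_const CP).mono' hPm.aestronglyMeasurable (hνmem.mono fun ξ hξ => hCP ξ hξ)
    have hb := hbound (ψ := fun x => ψ₀ x - Ψ x) (θ := fun x => θ x - P.eval x) (C := C + CP)
      ⟨hψ.1.sub hΨW.1, fun x hx => by
        have hx1 : IntervalIntegrable θ volume (-1) x := hψ.intervalIntegrable (by norm_num) hx
        have hx2 : IntervalIntegrable (fun x => P.eval x) volume (-1) x :=
          hΨW.intervalIntegrable (by norm_num) hx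
        simp only []
        rw [intervalIntegral.integral_sub hx1 hx2, hψ₀W.2 x hx, hΨW.2 x hx]; ring⟩
      (hθ.sub hPm) (fun ξ hξ => (abs_sub _ _).trans (add_le_add (hC ξ hξ) (hCP ξ hξ)))
      (by simp [hψ₀, hΨ0])
    have hψ₀c := hψ₀W.continuousOn (by norm_num : (-1 : ℝ) ≤ 1)
    have hΨc := hΨW.continuousOn (by norm_num : (-1 : ℝ) ≤ 1)
    have h0 := left_mem_Icc.2 h.pos.le
    have hfl : ∫ r in 0..t, ∫ ξ, (θ ξ - P.eval ξ) * v r ξ ∂(ρ r : Measure ℝ) =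
        (∫ r in 0..t, ∫ ξ, θ ξ * v r ξ ∂(ρ r : Measure ℝ)) -
          ∫ r in 0..t, ∫ ξ, P.eval ξ * v r ξ ∂(ρ r : Measure ℝ) := by
      have hI : ∀ {θ : ℝ → ℝ} {C : ℝ}, Measurable θ → (∀ ξ ∈ Icc (-1 : ℝ) 1, |θ ξ| ≤ C) →
          IntervalIntegrable (fun r => ∫ ξ, θ ξ * v r ξ ∂(ρ r : Measure ℝ)) volume 0 t :=
        fun hm hb => (intervalIntegrable_iff_integrableOn_Ioo_of_le ht.1).2
          ((hv.integrableOn_flux h hm hb).mono_set (Ioo_subset_Ioo_right ht.2))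
      rw [← intervalIntegral.integral_sub (hI hθ hC) (hI hPm hCP),
        intervalIntegral.integral_of_le ht.1, intervalIntegral.integral_of_le ht.1,
        integral_Ioc_eq_integral_Ioo, integral_Ioc_eq_integral_Ioo]
      refine integral_congr_ae ?_
      filter_upwards [ae_restrict_of_ae_restrict_of_subset (Ioo_subset_Ioo_right ht.2)
          (h.integrable_of_joint (hv.integrable_mul_joint h hθ hC)).1,
        ae_restrict_of_ae_restrict_of_subset (Ioo_subset_Ioo_right ht.2)
          (h.integrable_of_joint (hv.integrable_mul_joint h hPm hCP)).1] with r h1 h2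
      simp only [sub_mul]
      exact integral_sub h1 h2
    rw [integral_sub (hψi hψ₀c t ht) (hψi hΨc t ht), integral_sub (hψi hψ₀c 0 h0) (hψi hΨc 0 h0),
      hfl] at hb
    have hsmall : ∫ ξ, |θ ξ - P.eval ξ| ∂ν ≤ c := by
      have h1 : ∫ ξ, |θ ξ - P.eval ξ| ∂ν ≤ ∫ ξ, (‖θ ξ - f ξ‖ + c / 2 / N) ∂ν := by
        refine integral_mono_ae (hθν.sub hPν).abs ((hθν.sub hfi).norm.add (integrable_const _))
          (hνmem.mono fun ξ hξ => ?_)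
        have := (hP ξ hξ).le
        rw [abs_sub_comm] at this
        calc |θ ξ - P.eval ξ| ≤ |θ ξ - f ξ| + |f ξ - P.eval ξ| := abs_sub_le _ _ _
          _ ≤ _ := add_le_add le_rfl this
      rw [integral_add (f := fun ξ => ‖θ ξ - f ξ‖) (g := fun _ => c / 2 / N) (hθν.sub hfi).norm
        (integrable_const _), integral_const, smul_eq_mul] at h1
      have h2 : ν.real univ * (c / 2 / N) ≤ c / 2 := by
        rw [mul_div_assoc', div_le_iff₀ hNpos]
        nlinarith
      linarith
    have h3 : (0 : ℝ) ≤ 2 * Cm + 1 := by have : (0 : ℝ) ≤ Cm := Cm.2; linarith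
    have heq : ∀ a b c d e f : ℝ, b - d = f → a - b - (c - d) - (e - f) = a - c - e :=
      fun a b c d e f hh => by linarith
    rw [heq _ _ _ _ _ _ hΨ] at hb
    exact hb.trans (mul_le_mul_of_nonneg_left hsmall h3)
  have hzero : ∫ ξ, ψ₀ ξ ∂(ρ t : Measure ℝ) - ∫ ξ, ψ₀ ξ ∂(ρ 0 : Measure ℝ) -
        ∫ r in 0..t, ∫ ξ, θ ξ * v r ξ ∂(ρ r : Measure ℝ) = 0 := by
    have h3 : (0 : ℝ) < 2 * Cm + 1 := by have : (0 : ℝ) ≤ Cm := Cm.2; linarith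
    rw [← abs_nonpos_iff]
    refine le_of_forall_pos_le_add fun c hc => ?_
    have := hdef (c / (2 * Cm + 1)) (by positivity)
    rwa [mul_div_cancel₀ _ h3.ne', ← zero_add c] at this
  have h0 := left_mem_Icc.2 h.pos.le
  simp only [hψ₀] at hzero
  rw [integral_sub (hψi hψc t ht) (integrable_const _),
    integral_sub (hψi hψc 0 h0) (integrable_const _), integral_const, integral_const, hconst]
    at hzero
  linarith

/-- The total mass is conserved. -/
lemma mass_eq (hv : IsVelocity T ρ v) (h : IsCurve T ρ) {t : ℝ} (ht : t ∈ Icc 0 T) :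
    (ρ t).mass = (ρ 0).mass := by
  have := (hv.hasW11Deriv_of_contDiff h (contDiff_const (c := (1 : ℝ)))).2 t ht
  rw [← NNReal.coe_inj]
  simpa using this

/-- Testing with primitives of indicators of half-lines determines `∫ v dρ_t` over `Iic c`, for all
rational `c` at once, at almost every time. These half-lines generate the Borel sets, so both
velocities have the same integral over every Borel set. -/
lemma unique {v' : ℝ → ℝ → ℝ} (hv : IsVelocity T ρ v) (hv' : IsVelocity T ρ v')
    (h : IsCurve T ρ) :
    ∀ᵐ t ∂(volume.restrict (Ioo 0 T)), v t =ᵐ[(ρ t : Measure ℝ)] v' t := by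
  have hind : ∀ c : ℚ, ∀ᵐ t ∂(volume.restrict (Ioo 0 T)),
      ∫ ξ in Iic (c : ℝ), v t ξ ∂(ρ t : Measure ℝ) =
        ∫ ξ in Iic (c : ℝ), v' t ξ ∂(ρ t : Measure ℝ) := fun c => by
    set θ : ℝ → ℝ := (Iic (c : ℝ)).indicator 1 with hθ
    have hθm : Measurable θ := measurable_one.indicator measurableSet_Iic
    have hθb : ∀ ξ ∈ Icc (-1 : ℝ) 1, |θ ξ| ≤ 1 := fun ξ _ => by
      by_cases hm : ξ ∈ Iic (c : ℝ) <;> simp [hθ, hm]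
    have hθi : IntervalIntegrable θ volume (-1) 1 := by
      rw [intervalIntegrable_iff_integrableOn_Icc_of_le (by norm_num)]
      refine Measure.integrableOn_of_bounded (M := 1) (by simp) hθm.aestronglyMeasurable ?_
      exact (ae_restrict_mem measurableSet_Icc).mono hθb
    have hW : HasW11Deriv (-1) 1 (fun x => ∫ y in (-1 : ℝ)..x, θ y) θ :=
      ⟨hθi, fun x _ => by simp⟩
    have hd1 := (hv.hasW11Deriv h hW hθm hθb).deriv_ae_unique (hv'.hasW11Deriv h hW hθm hθb)
    filter_upwards [ae_restrict_of_ae_restrict_of_subset Ioo_subset_Icc_self hd1] with t ht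
    have e : ∀ w : ℝ → ℝ, ∫ ξ, θ ξ * w ξ ∂(ρ t : Measure ℝ) =
        ∫ ξ in Iic (c : ℝ), w ξ ∂(ρ t : Measure ℝ) := fun w => by
      rw [← integral_indicator measurableSet_Iic]
      refine integral_congr_ae (Eventually.of_forall fun ξ => ?_)
      by_cases hm : ξ ∈ Iic (c : ℝ) <;> simp [hθ, hm]
    rwa [e, e] at ht
  filter_upwards [ae_all_iff.2 hind, (h.integrable_of_joint (hv.integrable_joint h)).1,
    (h.integrable_of_joint (hv'.integrable_joint h)).1] with t ht hi hi'
  have hi : Integrable (v t) (ρ t : Measure ℝ) := hi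
  have hi' : Integrable (v' t) (ρ t : Measure ℝ) := hi'
  have hsub : ∀ s, MeasurableSet s → ∫ ξ in s, (v t ξ - v' t ξ) ∂(ρ t : Measure ℝ) = 0 := by
    have hgen : borel ℝ = MeasurableSpace.generateFrom (⋃ a : ℚ, {Iic (a : ℝ)}) :=
      Real.borel_eq_generateFrom_Iic_rat
    intro s hs
    induction s, hs using MeasurableSpace.induction_on_inter
      ((BorelSpace.measurable_eq (α := ℝ)).trans hgen) Real.isPiSystem_Iic_rat with
    | empty => simp
    | basic s hs =>
      simp only [mem_iUnion, mem_singleton_iff] at hs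
      obtain ⟨c, rfl⟩ := hs
      rw [integral_sub hi.integrableOn hi'.integrableOn, ht c, sub_self]
    | compl s hsm ihs =>
      have h1 := integral_add_compl hsm (hi.sub hi')
      simp only [Pi.sub_apply] at h1
      rw [ihs, zero_add] at h1
      rw [h1]
      -- Complements need the integral over the whole line, which is the limit of the integrals over
      -- the half-lines `Iic n`.
      have h2 : Tendsto (fun n : ℕ => ∫ ξ in Iic (n : ℝ), (v t ξ - v' t ξ) ∂(ρ t : Measure ℝ)) atTop
          (𝓝 (∫ ξ, (v t ξ - v' t ξ) ∂(ρ t : Measure ℝ))) := by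
        have := tendsto_setIntegral_of_monotone (μ := (ρ t : Measure ℝ))
          (f := fun ξ => v t ξ - v' t ξ) (s := fun n : ℕ => Iic (n : ℝ))
          (fun n => measurableSet_Iic) (fun i j hij => Iic_subset_Iic.2 (by exact_mod_cast hij))
          (hi.sub hi').integrableOn
        rwa [show (⋃ n : ℕ, Iic (n : ℝ)) = univ from iUnion_eq_univ_iff.2 fun x => exists_nat_ge x,
          setIntegral_univ] at this
      refine tendsto_nhds_unique h2 (tendsto_const_nhds.congr fun n => ?_)
      rw [integral_sub hi.integrableOn hi'.integrableOn]
      have := ht (n : ℚ)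
      push_cast at this
      rw [this, sub_self]
    | iUnion f hfd hfm ihf =>
      rw [integral_iUnion (f := fun ξ => v t ξ - v' t ξ) hfm hfd (hi.sub hi').integrableOn]
      simp [ihf]
  have := (hi.sub hi').ae_eq_zero_of_forall_setIntegral_eq_zero fun s hs _ => hsub s hs
  filter_upwards [this] with ξ hξ
  exact sub_eq_zero.1 hξ

end IsVelocity

end Velocity

/-! ### Square roots of densities -/

/-- The Cauchy-Schwarz inequality for integrals. -/
lemma sq_integral_mul_le {α : Type*} [MeasurableSpace α] {μ : Measure α} {f h : α → ℝ}
    (hf : MemLp f 2 μ) (hh : MemLp h 2 μ) :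
    (∫ x, f x * h x ∂μ) ^ 2 ≤ (∫ x, f x ^ 2 ∂μ) * ∫ x, h x ^ 2 ∂μ := by
  have h1 := integral_mul_norm_le_Lp_mul_Lq (μ := μ) (f := f) (g := h) (p := 2) (q := 2)
    Real.HolderConjugate.two_two (by simpa using hf) (by simpa using hh)
  have h2 : |∫ x, f x * h x ∂μ| ≤ ∫ x, ‖f x‖ * ‖h x‖ ∂μ := by
    rw [← Real.norm_eq_abs]
    refine (norm_integral_le_integral_norm fun x => f x * h x).trans_eq ?_
    simp only [norm_mul]
  have hA : 0 ≤ ∫ x, f x ^ 2 ∂μ := integral_nonneg fun _ => sq_nonneg _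
  have hB : 0 ≤ ∫ x, h x ^ 2 ∂μ := integral_nonneg fun _ => sq_nonneg _
  have e : ∀ u : ℝ, ‖u‖ ^ (2 : ℝ) = u ^ 2 := fun u => by
    rw [Real.rpow_two, Real.norm_eq_abs, sq_abs]
  simp only [e, ← Real.sqrt_eq_rpow] at h1
  rw [← sq_abs]
  calc _ ≤ (√(∫ x, f x ^ 2 ∂μ) * √(∫ x, h x ^ 2 ∂μ)) ^ 2 :=
        pow_le_pow_left₀ (abs_nonneg _) (h2.trans h1) 2
    _ = _ := by rw [mul_pow, Real.sq_sqrt hA, Real.sq_sqrt hB]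

/-- `p` is the square root of the density of `ρ`, with weak derivative `q`. -/
structure IsRoot (H : ℝ → ℝ) (ε : ℝ) (ρ : Measure ℝ) (p q : ℝ → ℝ) : Prop where
  deriv : HasW11Deriv (-1) 1 p q
  nonneg : ∀ ξ ∈ Icc (-1 : ℝ) 1, 0 ≤ p ξ
  eq : ρ = (gam H ε).withDensity fun ξ => ENNReal.ofReal (p ξ ^ 2)

section Root

variable {H : ℝ → ℝ} {ε : ℝ}

lemma aemeasurable_gam_of_continuousOn {f : ℝ → ℝ} (hf : ContinuousOn f (Icc (-1) 1)) (ε : ℝ) :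
    AEMeasurable f (gam H ε) :=
  (hf.aemeasurable measurableSet_Icc).mono_ac (gam_absolutelyContinuous H ε)

lemma integrable_gam_of_continuousOn (hH : IsDoubleWell H) {f : ℝ → ℝ}
    (hf : ContinuousOn f (Icc (-1) 1)) (ε : ℝ) : Integrable f (gam H ε) :=
  (integrable_gam_iff hH ε f).2
    (((continuous_g hH ε).continuousOn.mul hf).integrableOn_compact isCompact_Icc)

lemma integral_withDensity_gam {u : ℝ → ℝ} (hu : ContinuousOn u (Icc (-1) 1))
    (hu0 : ∀ ξ ∈ Icc (-1 : ℝ) 1, 0 ≤ u ξ) (f : ℝ → ℝ) :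
    ∫ ξ, f ξ ∂((gam H ε).withDensity fun ξ => ENNReal.ofReal (u ξ)) =
      ∫ ξ, u ξ * f ξ ∂(gam H ε) := by
  rw [integral_withDensity_eq_integral_toReal_smul₀
    (aemeasurable_gam_of_continuousOn hu ε).ennreal_ofReal (by simp)]
  refine integral_congr_ae ((ae_gam_mem H ε).mono fun ξ hξ => ?_)
  simp [ENNReal.toReal_ofReal (hu0 ξ hξ)]

lemma integrable_withDensity_gam {u : ℝ → ℝ} (hu : ContinuousOn u (Icc (-1) 1))
    (hu0 : ∀ ξ ∈ Icc (-1 : ℝ) 1, 0 ≤ u ξ) (f : ℝ → ℝ) :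
    Integrable f ((gam H ε).withDensity fun ξ => ENNReal.ofReal (u ξ)) ↔
      Integrable (fun ξ => u ξ * f ξ) (gam H ε) := by
  rw [integrable_withDensity_iff_integrable_smul₀'
    (aemeasurable_gam_of_continuousOn hu ε).ennreal_ofReal (by simp)]
  refine integrable_congr ((ae_gam_mem H ε).mono fun ξ hξ => ?_)
  simp [ENNReal.toReal_ofReal (hu0 ξ hξ)]

lemma eqOn_of_withDensity_eq (hH : IsDoubleWell H) {u w : ℝ → ℝ}
    (hu : ContinuousOn u (Icc (-1) 1)) (hw : ContinuousOn w (Icc (-1) 1))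
    (hu0 : ∀ ξ ∈ Icc (-1 : ℝ) 1, 0 ≤ u ξ) (hw0 : ∀ ξ ∈ Icc (-1 : ℝ) 1, 0 ≤ w ξ)
    (h : (gam H ε).withDensity (fun ξ => ENNReal.ofReal (u ξ)) =
      (gam H ε).withDensity fun ξ => ENNReal.ofReal (w ξ)) : EqOn u w (Icc (-1) 1) := by
  have hum := (aemeasurable_gam_of_continuousOn (H := H) hu ε).ennreal_ofReal
  have hwm := (aemeasurable_gam_of_continuousOn (H := H) hw ε).ennreal_ofReal
  have hae := (withDensity_eq_iff hum hwm
    ((integrable_gam_of_continuousOn hH hu ε).lintegral_lt_top).ne).1 h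
  refine Measure.eqOn_Icc_of_ae_eq volume (by norm_num) ?_ hu hw
  filter_upwards [(absolutelyContinuous_gam hH ε).ae_le hae, ae_restrict_mem measurableSet_Icc]
    with ξ h1 hm
  exact (ENNReal.ofReal_eq_ofReal_iff (hu0 ξ hm) (hw0 ξ hm)).1 h1

namespace IsRoot

variable {ρ : Measure ℝ} {p q : ℝ → ℝ}

lemma continuousOn (h : IsRoot H ε ρ p q) : ContinuousOn p (Icc (-1) 1) :=
  h.deriv.continuousOn (by norm_num)

lemma isContDensity (h : IsRoot H ε ρ p q) : IsContDensity H ε ρ fun ξ => p ξ ^ 2 :=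
  ⟨h.continuousOn.pow 2, fun _ _ => sq_nonneg _, h.eq⟩

/-- The infimum in `fisher` has a single competitor: the measure determines the continuous
nonnegative root on `[-1, 1]`, and the root determines its weak derivative almost everywhere. -/
lemma fisher_eq (h : IsRoot H ε ρ p q) (hH : IsDoubleWell H) :
    fisher H ε ρ = ∫⁻ ξ, ENNReal.ofReal (q ξ ^ 2) ∂(gam H ε) := by
  refine le_antisymm (iInf_le_of_le p (iInf_le_of_le q (iInf_le_of_le h.deriv
    (iInf_le_of_le h.nonneg (iInf_le_of_le h.eq le_rfl))))) ?_
  refine le_iInf fun p' => le_iInf fun q' => le_iInf fun hd => le_iInf fun hn => le_iInf fun he => ?_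
  have hc := hd.continuousOn (by norm_num)
  have heq := eqOn_of_withDensity_eq hH (h.continuousOn.pow 2) (hc.pow 2)
    (fun _ _ => sq_nonneg _) (fun _ _ => sq_nonneg _) (h.eq.symm.trans he)
  have hpp : EqOn p p' (Icc (-1) 1) := fun ξ hξ =>
    (pow_left_inj₀ (h.nonneg ξ hξ) (hn ξ hξ) two_ne_zero).1 (heq hξ)
  have hq := (h.deriv.congr_fun (by norm_num) hpp).deriv_ae_unique hd
  refine (lintegral_congr_ae ?_).le
  filter_upwards [(gam_absolutelyContinuous H ε).ae_le hq] with ξ hξ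
  rw [hξ]

lemma aestronglyMeasurable (h : IsRoot H ε ρ p q) : AEStronglyMeasurable q (gam H ε) :=
  ((h.deriv.integrableOn (by norm_num)).aestronglyMeasurable).mono_ac
    (gam_absolutelyContinuous H ε)

lemma memLp (h : IsRoot H ε ρ p q) (hH : IsDoubleWell H) (hf : fisher H ε ρ < ⊤) :
    MemLp q 2 (gam H ε) := by
  rw [memLp_two_iff_integrable_sq h.aestronglyMeasurable]
  rw [h.fisher_eq hH] at hf
  refine ⟨h.aestronglyMeasurable.pow 2, ?_⟩
  rw [hasFiniteIntegral_iff_ofReal (Eventually.of_forall fun _ => sq_nonneg _)]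
  exact hf

lemma toReal_fisher (h : IsRoot H ε ρ p q) (hH : IsDoubleWell H) :
    (fisher H ε ρ).toReal = ∫ ξ, q ξ ^ 2 ∂(gam H ε) := by
  rw [h.fisher_eq hH, integral_eq_lintegral_of_nonneg_ae
    (Eventually.of_forall fun _ => sq_nonneg _) (h.aestronglyMeasurable.pow 2)]

/-- Cauchy-Schwarz with the factors `√(τ g) |q|` and `1 / √(τ g)`; the square of the second
integrates to an increment of `sHat`. This is what makes `sHat` the natural variable: roots are
Hölder continuous in it with a constant free of `ε` apart from `τ` times the Fisher information. -/
lemma sq_integral_le (h : IsRoot H ε ρ p q) (hH : IsDoubleWell H) (hf : fisher H ε ρ < ⊤)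
    {x y : ℝ} (hx : -1 ≤ x) (hxy : x ≤ y) (hy : y ≤ 1) :
    (∫ z in x..y, |q z|) ^ 2 ≤
      tau H ε * (fisher H ε ρ).toReal * (sHat H ε y - sHat H ε x) := by
  have hgp := g_pos hH ε
  have hτ := tau_pos hH ε
  have hcg := continuous_g hH ε
  have hsub : Ioc x y ⊆ Icc (-1 : ℝ) 1 := fun z hz => ⟨by linarith [hz.1], hz.2.trans hy⟩
  have hqi := (memLp_two_iff_integrable_sq h.aestronglyMeasurable).1 (h.memLp hH hf)
  have hqi' : IntegrableOn (fun ξ => g H ε ξ * q ξ ^ 2) (Icc (-1) 1) :=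
    (integrable_gam_iff hH ε _).1 hqi
  have hqm : AEStronglyMeasurable q (volume.restrict (Ioc x y)) :=
    (h.deriv.integrableOn (by norm_num)).aestronglyMeasurable.mono_set hsub
  have e1 : ∀ ξ, (√(tau H ε * g H ε ξ) * |q ξ|) ^ 2 = tau H ε * (g H ε ξ * q ξ ^ 2) := fun ξ => by
    rw [mul_pow, Real.sq_sqrt (tau_mul_g_pos hH ε ξ).le, sq_abs]; ring
  have e2 : ∀ ξ, (1 / √(tau H ε * g H ε ξ)) ^ 2 = 1 / (tau H ε * g H ε ξ) := fun ξ => by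
    rw [div_pow, one_pow, Real.sq_sqrt (tau_mul_g_pos hH ε ξ).le]
  have hsc : Continuous fun ξ => √(tau H ε * g H ε ξ) := by fun_prop
  have hsp : ∀ ξ, 0 < √(tau H ε * g H ε ξ) := fun ξ => Real.sqrt_pos.2 (tau_mul_g_pos hH ε ξ)
  have hA : MemLp (fun ξ => √(tau H ε * g H ε ξ) * |q ξ|) 2 (volume.restrict (Ioc x y)) := by
    refine (memLp_two_iff_integrable_sq (hsc.aestronglyMeasurable.mul hqm.norm)).2 ?_
    simp only [Pi.mul_apply, Real.norm_eq_abs]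
    simp only [e1]
    exact (hqi'.mono_set hsub).const_mul _
  have hB : MemLp (fun ξ => 1 / √(tau H ε * g H ε ξ)) 2 (volume.restrict (Ioc x y)) := by
    refine (memLp_two_iff_integrable_sq
      (continuous_const.div hsc fun ξ => (hsp ξ).ne').aestronglyMeasurable).2 ?_
    simp only [Pi.div_apply, e2]
    exact ((continuous_one_div_tau_g hH ε).continuousOn.integrableOn_compact isCompact_Icc).mono_set
      (hsub)
  have hCS := sq_integral_mul_le hA hB
  simp only [e1, e2, integral_const_mul] at hCS
  have e3 : ∀ ξ, √(tau H ε * g H ε ξ) * |q ξ| * (1 / √(tau H ε * g H ε ξ)) = |q ξ| := fun ξ => by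
    have := (hsp ξ).ne'
    field_simp
  simp only [e3] at hCS
  rw [intervalIntegral.integral_of_le hxy, sHat_sub hH, intervalIntegral.integral_of_le hxy]
  refine hCS.trans (mul_le_mul_of_nonneg_right ?_ (integral_nonneg fun ξ =>
    (one_div_pos.2 (tau_mul_g_pos hH ε ξ)).le))
  rw [h.toReal_fisher hH, integral_gam hH]
  refine mul_le_mul_of_nonneg_left (setIntegral_mono_set hqi'
    (Eventually.of_forall fun ξ => mul_nonneg (hgp ξ).le (sq_nonneg _))
    (LE.le.eventuallyLE hsub)) hτ.le

lemma sq_sub_le (h : IsRoot H ε ρ p q) (hH : IsDoubleWell H) (hf : fisher H ε ρ < ⊤)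
    {x y : ℝ} (hx : -1 ≤ x) (hxy : x ≤ y) (hy : y ≤ 1) :
    (p y - p x) ^ 2 ≤ tau H ε * (fisher H ε ρ).toReal * (sHat H ε y - sHat H ε x) := by
  rw [h.deriv.sub_eq ⟨hx, hxy.trans hy⟩ ⟨hx.trans hxy, hy⟩]
  refine le_trans ?_ (h.sq_integral_le hH hf hx hxy hy)
  rw [← sq_abs]
  exact pow_le_pow_left₀ (abs_nonneg _) (intervalIntegral.abs_integral_le_integral_abs hxy) 2

lemma integral_sq (h : IsRoot H ε ρ p q) (f : ℝ → ℝ) :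
    ∫ ξ, f ξ ∂ρ = ∫ ξ, p ξ ^ 2 * f ξ ∂(gam H ε) := by
  rw [h.eq]
  exact integral_withDensity_gam (h.continuousOn.pow 2) (fun _ _ => sq_nonneg _) f

lemma mass_eq (h : IsRoot H ε ρ p q) : ρ.real univ = ∫ ξ, p ξ ^ 2 ∂(gam H ε) := by
  have := h.integral_sq (fun _ => 1)
  simpa using this

/-- As `γ_ε` is a probability measure, `p ^ 2` is at most the mass at some point `z`; the Hölder
estimate carries this bound to every `x`, the diameter in the variable `sHat` being `2 * kap H`. -/
lemma sq_le (h : IsRoot H ε ρ p q) (hH : IsDoubleWell H) (hf : fisher H ε ρ < ⊤)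
    {x : ℝ} (hx : x ∈ Icc (-1 : ℝ) 1) :
    p x ^ 2 ≤ 2 * ρ.real univ + 4 * kap H * (tau H ε * (fisher H ε ρ).toReal) := by
  have := isProbabilityMeasure_gam hH ε
  obtain ⟨z, hz, hzm⟩ : ∃ z ∈ Icc (-1 : ℝ) 1, p z ^ 2 ≤ ρ.real univ := by
    by_contra hcon
    push Not at hcon
    have hpc : ContinuousOn (fun ξ => p ξ ^ 2) (Icc (-1) 1) := h.continuousOn.pow 2
    obtain ⟨z, hz, hzmin⟩ := isCompact_Icc.exists_isMinOn (nonempty_Icc.2 (by norm_num)) hpc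
    have h1 : p z ^ 2 ≤ ∫ ξ, p ξ ^ 2 ∂(gam H ε) := by
      have hi := integrable_gam_of_continuousOn hH hpc ε
      have hle : ∀ᵐ ξ ∂(gam H ε), p z ^ 2 ≤ p ξ ^ 2 :=
        (ae_gam_mem H ε).mono fun ξ hξ => hzmin hξ
      have h3 : ∫ _, p z ^ 2 ∂(gam H ε) ≤ ∫ ξ, p ξ ^ 2 ∂(gam H ε) :=
        integral_mono_ae (integrable_const _) hi hle
      simpa using h3
    have h2 := hcon z hz
    rw [h.mass_eq] at h2
    linarith
  have hD : 0 ≤ tau H ε * (fisher H ε ρ).toReal :=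
    mul_nonneg (tau_pos hH ε).le ENNReal.toReal_nonneg
  have hd : (p x - p z) ^ 2 ≤ tau H ε * (fisher H ε ρ).toReal * (2 * kap H) := by
    have hsx := sHat_mem hH ε hx
    have hsz := sHat_mem hH ε hz
    rcases le_total z x with hzx | hzx
    · exact (h.sq_sub_le hH hf hz.1 hzx hx.2).trans
        (mul_le_mul_of_nonneg_left (by linarith [hsx.2, hsz.1]) hD)
    · rw [← neg_sub, neg_sq]
      exact (h.sq_sub_le hH hf hx.1 hzx hz.2).trans
        (mul_le_mul_of_nonneg_left (by linarith [hsz.2, hsx.1]) hD)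
  -- This square is the difference of the two sides of `p x ^ 2 ≤ 2 * p z ^ 2 + 2 * (p x - p z) ^
  -- 2`.
  nlinarith [sq_nonneg (p x - 2 * p z)]

end IsRoot

lemma exists_isRoot {ρ : Measure ℝ} (hf : fisher H ε ρ < ⊤) : ∃ p q, IsRoot H ε ρ p q := by
  simp only [fisher, iInf_lt_iff] at hf
  obtain ⟨p, q, hd, hn, he, -⟩ := hf
  exact ⟨p, q, hd, hn, he⟩

end Root

/-! ### Lower semicontinuity and measurability of the Fisher information -/

section Fisher

variable {H : ℝ → ℝ} {ε : ℝ}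

/-- The weight that turns integrals against `γ_ε` into integrals over `[-1, x]`. -/
def cutWeight (H : ℝ → ℝ) (ε x : ℝ) : ℝ → ℝ := (Icc (-1) x).indicator fun ξ => 1 / g H ε ξ

lemma memLp_cutWeight (hH : IsDoubleWell H) (ε x : ℝ) : MemLp (cutWeight H ε x) 2 (gam H ε) := by
  have := isProbabilityMeasure_gam hH ε
  have hc := continuous_one_div_g hH ε
  obtain ⟨C, hC⟩ := isCompact_Icc.exists_bound_of_continuousOn (hc.continuousOn (s := Icc (-1) 1))
  have hC0 : 0 ≤ C := (norm_nonneg _).trans (hC 0 (by norm_num))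
  refine MemLp.of_bound (hc.measurable.indicator measurableSet_Icc).aestronglyMeasurable C
    ((ae_gam_mem H ε).mono fun ξ hξ => ?_)
  unfold cutWeight
  by_cases hm : ξ ∈ Icc (-1) x
  · rw [indicator_of_mem hm]; exact hC ξ hξ
  · rw [indicator_of_notMem hm]; simpa using hC0

lemma integral_mul_cutWeight (hH : IsDoubleWell H) (ε : ℝ) {x : ℝ} (hx : x ∈ Icc (-1 : ℝ) 1)
    (f : ℝ → ℝ) : ∫ ξ, f ξ * cutWeight H ε x ξ ∂(gam H ε) = ∫ ξ in (-1)..x, f ξ := by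
  rw [integral_gam hH, intervalIntegral.integral_of_le hx.1, ← integral_Icc_eq_integral_Ioc,
    ← inter_eq_right.2 (Icc_subset_Icc_right hx.2), ← setIntegral_indicator measurableSet_Icc]
  refine integral_congr_ae (Eventually.of_forall fun ξ => ?_)
  have := (g_pos hH ε ξ).ne'
  unfold cutWeight
  by_cases hm : ξ ∈ Icc (-1) x
  · simp only [indicator_of_mem hm]; field_simp
  · simp only [indicator_of_notMem hm, mul_zero]

lemma integrableOn_of_integrable_gam (hH : IsDoubleWell H) {ε : ℝ} {f : ℝ → ℝ}
    (hf : Integrable f (gam H ε)) : IntegrableOn f (Icc (-1) 1) := by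
  have h1 := (integrable_gam_iff hH ε f).1 hf
  have hc := continuous_one_div_g hH ε
  obtain ⟨C, hC⟩ := isCompact_Icc.exists_bound_of_continuousOn (hc.continuousOn (s := Icc (-1) 1))
  have h2 : IntegrableOn (fun ξ => 1 / g H ε ξ * (g H ε ξ * f ξ)) (Icc (-1) 1) :=
    Integrable.bdd_mul h1 hc.aestronglyMeasurable
      ((ae_restrict_mem measurableSet_Icc).mono fun ξ hξ => hC ξ hξ)
  refine h2.congr (Eventually.of_forall fun ξ => ?_)
  have := (g_pos hH ε ξ).ne'
  simp only
  field_simp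

/-- Weak sequential compactness of balls of `L²(γ_ε)`. -/
lemma exists_weak_limit (hH : IsDoubleWell H) {q : ℕ → ℝ → ℝ} (hqL : ∀ n, MemLp (q n) 2 (gam H ε))
    {c : ℝ} (hc : 0 ≤ c) (hq : ∀ n, ∫ ξ, q n ξ ^ 2 ∂(gam H ε) ≤ c) :
    ∃ (φ : ℕ → ℕ) (Q₀ : ℝ → ℝ), StrictMono φ ∧ MemLp Q₀ 2 (gam H ε) ∧
      ∫ ξ, Q₀ ξ ^ 2 ∂(gam H ε) ≤ c ∧ ∀ w, MemLp w 2 (gam H ε) →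
        Tendsto (fun n => ∫ ξ, q (φ n) ξ * w ξ ∂(gam H ε)) atTop
          (𝓝 (∫ ξ, Q₀ ξ * w ξ ∂(gam H ε))) := by
  have := isProbabilityMeasure_gam hH ε
  set Q : ℕ → Lp ℝ 2 (gam H ε) := fun n => (hqL n).toLp (q n) with hQ
  have hQq : ∀ n, Q n =ᵐ[gam H ε] q n := fun n => (hqL n).coeFn_toLp
  have hnorm : ∀ n, ‖Q n‖ ≤ √c := fun n => by
    refine Real.le_sqrt_of_sq_le ?_
    rw [← real_inner_self_eq_norm_sq, L2.inner_def]
    have h1 : ∫ ξ, inner ℝ (Q n ξ) (Q n ξ) ∂(gam H ε) = ∫ ξ, q n ξ ^ 2 ∂(gam H ε) :=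
      integral_congr_ae ((hQq n).mono fun ξ hξ => by simp only [hξ]; simp [pow_two])
    rw [h1]
    exact hq n
  have hball : ∀ n, StrongDual.toWeakDual (innerSL ℝ (Q n)) ∈
      WeakDual.toStrongDual ⁻¹' Metric.closedBall (0 : StrongDual ℝ (Lp ℝ 2 (gam H ε)))
        (√c) := fun n => by
    simp only [mem_preimage, mem_closedBall_zero_iff]
    change ‖innerSL ℝ (Q n)‖ ≤ _
    rw [innerSL_apply_norm]
    exact hnorm n
  have : Fact ((2 : ℝ≥0∞) ≠ ⊤) := ⟨ENNReal.ofNat_ne_top⟩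
  have : SecondCountableTopology (Lp ℝ 2 (gam H ε)) := inferInstance
  -- Sequential Banach-Alaoglu in the dual of the separable space `L²(γ_ε)`; the Riesz isometry
  -- turns the limit functional back into a function.
  obtain ⟨ℓ, hℓ, φ, hφ, hlim⟩ := WeakDual.isSeqCompact_closedBall ℝ _ _ _ hball
  set Q₀ := (InnerProductSpace.toDual ℝ (Lp ℝ 2 (gam H ε))).symm (WeakDual.toStrongDual ℓ) with hQ₀
  have hQ₀n : ‖Q₀‖ ≤ √c := by
    rw [hQ₀, LinearIsometryEquiv.norm_map]
    simpa using hℓ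
  have e : ∀ (w : ℝ → ℝ) (hw : MemLp w 2 (gam H ε)) (F : Lp ℝ 2 (gam H ε)) (f : ℝ → ℝ),
      F =ᵐ[gam H ε] f → inner ℝ F (hw.toLp w) = ∫ ξ, f ξ * w ξ ∂(gam H ε) :=
    fun w hw F f hF => by
      rw [L2.inner_def]
      refine integral_congr_ae ?_
      filter_upwards [hF, hw.coeFn_toLp] with ξ h1 h2
      simp only [h1, h2]
      simp [mul_comm]
  refine ⟨φ, Q₀, hφ, Lp.memLp Q₀, ?_, fun w hw => ?_⟩
  · have h1 : ∫ ξ, Q₀ ξ ^ 2 ∂(gam H ε) = ‖Q₀‖ ^ 2 := by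
      rw [← real_inner_self_eq_norm_sq, L2.inner_def]
      exact integral_congr_ae (Eventually.of_forall fun ξ => by simp [pow_two])
    rw [h1]
    calc ‖Q₀‖ ^ 2 ≤ √c ^ 2 := pow_le_pow_left₀ (norm_nonneg _) hQ₀n 2
      _ = c := Real.sq_sqrt hc
  · have h1 := ((WeakDual.eval_continuous (hw.toLp w)).tendsto ℓ).comp hlim
    have h2 : inner ℝ Q₀ (hw.toLp w) = ℓ (hw.toLp w) := by
      rw [hQ₀, InnerProductSpace.toDual_symm_apply]; rfl
    have h3 : Tendsto (fun n => inner ℝ (Q (φ n)) (hw.toLp w)) atTop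
        (𝓝 (inner ℝ Q₀ (hw.toLp w))) := by
      rw [h2]
      exact h1
    rw [e w hw Q₀ Q₀ (ae_eq_refl _)] at h3
    exact h3.congr fun n => e w hw _ _ (hQq _)

/-- A bounded sequence of `L²(γ_ε)` converges weakly as soon as its primitives converge. -/
lemma tendsto_integral_mul_of_primitive (hH : IsDoubleWell H) {q : ℕ → ℝ → ℝ}
    (hqL : ∀ n, MemLp (q n) 2 (gam H ε)) {c : ℝ} (hc : 0 ≤ c)
    (hq : ∀ n, ∫ ξ, q n ξ ^ 2 ∂(gam H ε) ≤ c) {Q : ℝ → ℝ} (hQ : MemLp Q 2 (gam H ε))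
    (hlim : ∀ x ∈ Icc (-1 : ℝ) 1, Tendsto (fun n => ∫ ξ in (-1)..x, q n ξ) atTop
      (𝓝 (∫ ξ in (-1)..x, Q ξ))) {w : ℝ → ℝ} (hw : MemLp w 2 (gam H ε)) :
    Tendsto (fun n => ∫ ξ, q n ξ * w ξ ∂(gam H ε)) atTop (𝓝 (∫ ξ, Q ξ * w ξ ∂(gam H ε))) := by
  have := isProbabilityMeasure_gam hH ε
  -- Every subsequence has a weakly convergent further subsequence, and the limit of its primitives
  -- forces the weak limit to be `Q`.
  refine tendsto_of_subseq_tendsto fun ns hns => ?_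
  obtain ⟨φ, Q₀, hφ, hQ₀L, -, hweak⟩ := exists_weak_limit hH (fun n => hqL (ns n)) hc
    fun n => hq (ns n)
  refine ⟨φ, ?_⟩
  have hi : ∀ {f : ℝ → ℝ}, MemLp f 2 (gam H ε) → IntervalIntegrable f volume (-1) 1 := fun hf =>
    (intervalIntegrable_iff_integrableOn_Icc_of_le (by norm_num)).2
      (integrableOn_of_integrable_gam hH (hf.integrable (by norm_num)))
  have h1 : HasW11Deriv (-1) 1 (fun x => ∫ ξ in (-1)..x, Q ξ) Q := ⟨hi hQ, fun x _ => by simp⟩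
  have h2 : HasW11Deriv (-1) 1 (fun x => ∫ ξ in (-1)..x, Q ξ) Q₀ := by
    refine ⟨hi hQ₀L, fun x hx => ?_⟩
    simp only [intervalIntegral.integral_same, zero_add]
    have h3 := hweak _ (memLp_cutWeight hH ε x)
    simp only [integral_mul_cutWeight hH ε hx] at h3
    exact tendsto_nhds_unique ((hlim x hx).comp (hns.comp hφ.tendsto_atTop)) h3
  have h3 : ∀ᵐ ξ ∂(gam H ε), Q₀ ξ = Q ξ :=
    (gam_absolutelyContinuous H ε).ae_le (h2.deriv_ae_unique h1)
  rw [integral_congr_ae (g := fun ξ => Q₀ ξ * w ξ) (h3.mono fun ξ hξ => by simp only [hξ])]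
  exact hweak w hw

/-- The Fisher information is lower semicontinuous under weak convergence. -/
lemma fisher_le_of_tendsto (hH : IsDoubleWell H) {μ : ℕ → FiniteMeasure ℝ} {μ₀ : FiniteMeasure ℝ}
    (hμ : Tendsto μ atTop (𝓝 μ₀)) {c : ℝ≥0∞} (hc : c < ⊤)
    (hf : ∀ n, fisher H ε (μ n : Measure ℝ) ≤ c) : fisher H ε (μ₀ : Measure ℝ) ≤ c := by
  have := isProbabilityMeasure_gam hH ε
  have hlt : ∀ n, fisher H ε (μ n : Measure ℝ) < ⊤ := fun n => (hf n).trans_lt hc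
  choose p q hr using fun n => exists_isRoot (hlt n)
  have hqL := fun n => (hr n).memLp hH (hlt n)
  obtain ⟨φ, Q₀, hφ, hQ₀L, hQ₀n, hweak⟩ := exists_weak_limit hH hqL (c := c.toReal)
    ENNReal.toReal_nonneg fun n => by
      rw [← (hr n).toReal_fisher hH]
      exact ENNReal.toReal_mono hc.ne (hf n)
  have hcut : ∀ x ∈ Icc (-1 : ℝ) 1, Tendsto (fun n => ∫ ξ in (-1)..x, q (φ n) ξ) atTop
      (𝓝 (∫ ξ in (-1)..x, Q₀ ξ)) := fun x hx => by
    simpa only [integral_mul_cutWeight hH ε hx] using hweak _ (memLp_cutWeight hH ε x)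
  obtain ⟨B, hB⟩ : ∃ B : ℝ, ∀ n, (μ n : Measure ℝ).real univ ≤ B := by
    have h1 : Tendsto (fun n => ((μ n).mass : ℝ)) atTop (𝓝 μ₀.mass) :=
      (NNReal.continuous_coe.tendsto _).comp ((FiniteMeasure.continuous_mass.tendsto _).comp hμ)
    obtain ⟨B, hB⟩ := h1.bddAbove_range
    exact ⟨B, fun n => hB ⟨n, rfl⟩⟩
  set K := 2 * B + 4 * kap H * (tau H ε * c.toReal) with hK
  have hbd : ∀ n, ∀ x ∈ Icc (-1 : ℝ) 1, p n x ^ 2 ≤ K := fun n x hx => by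
    refine ((hr n).sq_le hH (hlt n) hx).trans ?_
    have h1 := ENNReal.toReal_mono hc.ne (hf n)
    have h2 := tau_pos hH ε
    have h3 := kap_pos hH
    have h4 := hB n
    rw [hK]
    gcongr
  have hm1 : (-1 : ℝ) ∈ Icc (-1 : ℝ) 1 := by norm_num
  -- The values at the left end point are bounded. Once they converge along a subsequence, weak
  -- convergence of the derivatives yields pointwise convergence of the roots on `[-1, 1]`.
  obtain ⟨p₀, -, ψ, hψ, hp₀⟩ := tendsto_subseq_of_bounded
    (x := fun n => p (φ n) (-1)) (Metric.isBounded_closedBall (x := (0 : ℝ)) (r := √K)) fun n => by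
      rw [mem_closedBall_zero_iff, Real.norm_eq_abs]
      exact Real.abs_le_sqrt (hbd _ _ hm1)
  set P : ℝ → ℝ := fun x => p₀ + ∫ ξ in (-1)..x, Q₀ ξ with hP
  have hQ₀i : IntegrableOn Q₀ (Icc (-1) 1) :=
    integrableOn_of_integrable_gam hH (hQ₀L.integrable (by norm_num))
  have hPW : HasW11Deriv (-1) 1 P Q₀ :=
    ⟨(intervalIntegrable_iff_integrableOn_Icc_of_le (by norm_num)).2 hQ₀i,
      fun x _ => by simp [hP]⟩
  have hpt : ∀ x ∈ Icc (-1 : ℝ) 1, Tendsto (fun n => p (φ (ψ n)) x) atTop (𝓝 (P x)) :=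
    fun x hx => by
      have h1 := hp₀.add ((hcut x hx).comp hψ.tendsto_atTop)
      refine h1.congr fun n => ?_
      exact ((hr _).deriv.2 x hx).symm
  have hP0 : ∀ x ∈ Icc (-1 : ℝ) 1, 0 ≤ P x := fun x hx =>
    ge_of_tendsto' (hpt x hx) fun n => (hr _).nonneg x hx
  have hPc := hPW.continuousOn (by norm_num)
  have hPc2 : ContinuousOn (fun ξ => P ξ ^ 2) (Icc (-1) 1) := hPc.pow 2
  have hroot : IsRoot H ε (μ₀ : Measure ℝ) P Q₀ := by
    refine ⟨hPW, hP0, ?_⟩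
    have hfin : IsFiniteMeasure ((gam H ε).withDensity fun ξ => ENNReal.ofReal (P ξ ^ 2)) :=
      isFiniteMeasure_withDensity_ofReal (integrable_gam_of_continuousOn hH hPc2 ε).2
    refine ext_of_forall_integral_eq_of_IsFiniteMeasure fun f => ?_
    rw [integral_withDensity_gam hPc2 fun _ _ => sq_nonneg _]
    have h1 := (FiniteMeasure.tendsto_iff_forall_integral_tendsto.1 hμ f).comp
      (hφ.comp hψ).tendsto_atTop
    refine tendsto_nhds_unique h1 ?_
    -- The roots are uniformly bounded by `√K`, so their squares converge under the integral and the
    -- limit `P` is the root of `μ₀`.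
    have h2 : Tendsto (fun n => ∫ ξ, p (φ (ψ n)) ξ ^ 2 * f ξ ∂(gam H ε)) atTop
        (𝓝 (∫ ξ, P ξ ^ 2 * f ξ ∂(gam H ε))) := by
      refine tendsto_integral_of_dominated_convergence (fun _ => K * ‖f‖) (fun n => ?_)
        (integrable_const _) (fun n => ?_) ?_
      · exact ((aemeasurable_gam_of_continuousOn ((hr _).continuousOn.pow 2)
          ε).aestronglyMeasurable).mul f.continuous.aestronglyMeasurable
      · filter_upwards [ae_gam_mem H ε] with ξ hξ
        rw [norm_mul, Real.norm_of_nonneg (sq_nonneg _)]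
        exact mul_le_mul (hbd _ _ hξ) (f.norm_coe_le_norm ξ) (norm_nonneg _)
          ((sq_nonneg _).trans (hbd 0 _ hξ))
      · filter_upwards [ae_gam_mem H ε] with ξ hξ
        exact ((hpt ξ hξ).pow 2).mul_const _
    exact h2.congr fun n => ((hr _).integral_sq f).symm
  rw [hroot.fisher_eq hH, ← ofReal_integral_eq_lintegral_ofReal hQ₀L.integrable_sq
    (Eventually.of_forall fun _ => sq_nonneg _), ← ENNReal.ofReal_toReal hc.ne]
  exact ENNReal.ofReal_le_ofReal hQ₀n

/-- Sublevel sets are closed, by weak continuity of the curve and lower semicontinuity. The extended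
curve is used because it is continuous on the whole line. -/
lemma IsCurve.measurable_fisher {T : ℝ} {ρ : ℝ → FiniteMeasure ℝ} (h : IsCurve T ρ)
    (hH : IsDoubleWell H) (ε : ℝ) :
    Measurable fun t => fisher H ε (curveExt T ρ t : Measure ℝ) := by
  refine measurable_of_Iic fun c => ?_
  rcases eq_top_or_lt_top c with rfl | hc
  · simp
  · refine IsClosed.measurableSet (isClosed_iff_clusterPt.2 fun t ht => ?_)
    obtain ⟨s, hs, hst⟩ := mem_closure_iff_seq_limit.1 (mem_closure_iff_clusterPt.2 ht)
    exact fisher_le_of_tendsto hH ((h.continuous_ext.tendsto t).comp hst) hc hs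

lemma IsCurve.aemeasurable_fisher {T : ℝ} {ρ : ℝ → FiniteMeasure ℝ} (h : IsCurve T ρ)
    (hH : IsDoubleWell H) (ε : ℝ) :
    AEMeasurable (fun t => fisher H ε (ρ t : Measure ℝ)) (volume.restrict (Ioo 0 T)) := by
  refine ⟨_, h.measurable_fisher hH ε, ?_⟩
  filter_upwards [ae_restrict_mem measurableSet_Ioo] with t ht
  rw [curveExt_eq (Ioo_subset_Icc_self ht)]

end Fisher

/-! ### The truncated logarithm and its entropy -/

section TruncatedEntropy

/-- The logarithm, smoothly truncated at height `log (1 / δ)`. -/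
def truncLog (δ y : ℝ) : ℝ := Real.log ((|y| + δ) / (1 + δ * |y|))

/-- The convex entropy density with derivative `truncLog δ`. -/
def truncEnt (δ y : ℝ) : ℝ := ∫ z in (1 : ℝ)..y, truncLog δ z

/-- The derivative of `s ↦ truncLog δ (s ^ 2)`. -/
def truncSlope (δ s : ℝ) : ℝ := 2 * s * (1 - δ ^ 2) / ((s ^ 2 + δ) * (1 + δ * s ^ 2))

variable {δ : ℝ}

lemma continuous_truncLog (hδ : 0 < δ) : Continuous (truncLog δ) := by
  have h1 : ∀ y : ℝ, 1 + δ * |y| ≠ 0 := fun y => by positivity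
  have h2 : ∀ y : ℝ, (|y| + δ) / (1 + δ * |y|) ≠ 0 := fun y => by positivity
  unfold truncLog
  fun_prop (disch := assumption)

/-- For `δ < 1` the quotient `(|y| + δ) / (1 + δ * |y|)` lies between `δ` and `1 / δ`. -/
lemma abs_truncLog_le (hδ : δ ∈ Ioo (0 : ℝ) 1) (y : ℝ) : |truncLog δ y| ≤ Real.log (1 / δ) := by
  have h0 := hδ.1
  have h1 := hδ.2
  have hy := abs_nonneg y
  rw [abs_le, truncLog, one_div, Real.log_inv, neg_neg]
  constructor
  · refine Real.log_le_log h0 ?_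
    rw [le_div_iff₀ (by positivity)]
    nlinarith [mul_nonneg hy (mul_nonneg h0.le h0.le), mul_nonneg hy (sub_nonneg.2 h1.le),
      mul_nonneg (mul_nonneg hy h0.le) (sub_nonneg.2 h1.le)]
  · rw [← Real.log_inv]
    refine Real.log_le_log (by positivity) ?_
    rw [div_le_iff₀ (by positivity)]
    have : δ⁻¹ * (1 + δ * |y|) = δ⁻¹ + |y| := by field_simp
    rw [this]
    have : 1 ≤ δ⁻¹ := (one_le_inv₀ h0).2 h1.le
    linarith

/-- For `y ≥ 1` the quotient inside the logarithm lies between `1` and `y`. Truncation keeps the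
sign of the logarithm and reduces its size, which supplies dominating functions as `δ → 0`. -/
lemma truncLog_nonneg (hδ : δ ∈ Ioo (0 : ℝ) 1) {y : ℝ} (hy : 1 ≤ y) :
    0 ≤ truncLog δ y ∧ truncLog δ y ≤ Real.log y := by
  have h0 := hδ.1
  have h1 := hδ.2
  have hy0 : 0 < y := by linarith
  rw [truncLog, abs_of_pos hy0]
  constructor
  · refine Real.log_nonneg ?_
    rw [le_div_iff₀ (by positivity)]
    nlinarith
  · refine Real.log_le_log (by positivity) ?_
    rw [div_le_iff₀ (by positivity)]
    nlinarith [mul_nonneg h0.le (by nlinarith : 0 ≤ y ^ 2 - 1)]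

lemma truncLog_nonpos (hδ : δ ∈ Ioo (0 : ℝ) 1) {y : ℝ} (hy0 : 0 < y) (hy : y ≤ 1) :
    Real.log y ≤ truncLog δ y ∧ truncLog δ y ≤ 0 := by
  have h0 := hδ.1
  have h1 := hδ.2
  rw [truncLog, abs_of_pos hy0]
  constructor
  · refine Real.log_le_log hy0 ?_
    rw [le_div_iff₀ (by positivity)]
    nlinarith [mul_nonneg h0.le (by nlinarith : 0 ≤ 1 - y ^ 2)]
  · refine Real.log_nonpos (by positivity) ?_
    rw [div_le_iff₀ (by positivity)]
    nlinarith

lemma hasDerivAt_truncEnt (hδ : 0 < δ) (y : ℝ) : HasDerivAt (truncEnt δ) (truncLog δ y) y :=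
  intervalIntegral.integral_hasDerivAt_right ((continuous_truncLog hδ).intervalIntegrable _ _)
    ((continuous_truncLog hδ).stronglyMeasurableAtFilter _ _) (continuous_truncLog hδ).continuousAt

lemma lipschitzWith_truncEnt (hδ : δ ∈ Ioo (0 : ℝ) 1) :
    LipschitzWith (Real.log (1 / δ)).toNNReal (truncEnt δ) := by
  refine lipschitzWith_of_nnnorm_deriv_le
    (fun y => (hasDerivAt_truncEnt hδ.1 y).differentiableAt) fun y => ?_
  rw [(hasDerivAt_truncEnt hδ.1 y).deriv, ← NNReal.coe_le_coe, coe_nnnorm, Real.norm_eq_abs]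
  exact (abs_truncLog_le hδ y).trans (Real.le_coe_toNNReal _)

lemma abs_truncEnt_sub_le (hδ : δ ∈ Ioo (0 : ℝ) 1) (x y : ℝ) :
    |truncEnt δ x - truncEnt δ y| ≤ Real.log (1 / δ) * |x - y| := by
  have h := (lipschitzWith_truncEnt hδ).dist_le_mul x y
  rwa [Real.dist_eq, Real.dist_eq, Real.coe_toNNReal] at h
  exact (abs_nonneg _).trans (abs_truncLog_le hδ 0)

/-- The upper bound is the integral of `Real.log` from `1` to `y`, and the two integrands are
compared on either side of `1`. -/
lemma truncEnt_nonneg_le (hδ : δ ∈ Ioo (0 : ℝ) 1) {y : ℝ} (hy : 0 ≤ y) :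
    0 ≤ truncEnt δ y ∧ truncEnt δ y ≤ y * Real.log y - y + 1 := by
  have hc := fun a b : ℝ => (continuous_truncLog hδ.1).intervalIntegrable (μ := volume) a b
  have hl := fun a b : ℝ => intervalIntegral.intervalIntegrable_log' (a := a) (b := b)
  have e : ∫ z in (1 : ℝ)..y, Real.log z = y * Real.log y - y + 1 := by
    rw [integral_log]; simp
  rcases le_total 1 y with h1 | h1
  · refine ⟨intervalIntegral.integral_nonneg h1 fun z hz => (truncLog_nonneg hδ hz.1).1, ?_⟩
    rw [← e]
    exact intervalIntegral.integral_mono_on h1 (hc _ _) (hl _ _)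
      fun z hz => (truncLog_nonneg hδ hz.1).2
  · rw [← e, truncEnt, intervalIntegral.integral_symm, intervalIntegral.integral_symm y 1]
    have h2 : ∀ᵐ z ∂(volume.restrict (Ioc y 1)), z ∈ Ioc y 1 := ae_restrict_mem measurableSet_Ioc
    simp only [intervalIntegral.integral_of_le h1]
    constructor
    · refine neg_nonneg.2 (integral_nonpos_of_ae (h2.mono fun z hz => ?_))
      exact (truncLog_nonpos hδ (hy.trans_lt hz.1) hz.2).2
    · refine neg_le_neg (integral_mono_ae (hl y 1).1 (hc y 1).1 (h2.mono fun z hz => ?_))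
      exact (truncLog_nonpos hδ (hy.trans_lt hz.1) hz.2).1

lemma truncLog_sq (δ s : ℝ) : truncLog δ (s ^ 2) = Real.log ((s ^ 2 + δ) / (1 + δ * s ^ 2)) := by
  rw [truncLog, abs_of_nonneg (sq_nonneg s)]

lemma hasDerivAt_truncLog_sq (hδ : 0 < δ) (s : ℝ) :
    HasDerivAt (fun s => truncLog δ (s ^ 2)) (truncSlope δ s) s := by
  simp only [truncLog_sq]
  have h1 : HasDerivAt (fun s : ℝ => s ^ 2) (2 * s) s := by simpa using hasDerivAt_pow 2 s
  have hp1 : 0 < s ^ 2 + δ := by positivity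
  have hp2 : 0 < 1 + δ * s ^ 2 := by positivity
  have h2 := ((h1.add_const δ).fun_div ((h1.const_mul δ).const_add 1) hp2.ne').log (by positivity)
  refine h2.congr_deriv ?_
  unfold truncSlope
  field_simp
  ring

/-- The second bound depends on `δ` and serves for Lipschitz estimates at fixed truncation. The
third is uniform in `δ` and is what survives the removal of the truncation. -/
lemma truncSlope_bounds (hδ : δ ∈ Ioo (0 : ℝ) 1) {s : ℝ} (hs : 0 ≤ s) :
    0 ≤ truncSlope δ s ∧ truncSlope δ s ≤ 2 / δ ∧ s * truncSlope δ s ≤ 2 := by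
  have h0 := hδ.1
  have h1 := hδ.2
  have hd : 0 ≤ 1 - δ ^ 2 := by nlinarith
  have hs2 := sq_nonneg s
  have hp : 0 < (s ^ 2 + δ) * (1 + δ * s ^ 2) := by positivity
  refine ⟨div_nonneg (by positivity) hp.le, ?_, ?_⟩
  · rw [truncSlope, div_le_div_iff₀ hp h0]
    have h2 : s * δ ≤ s ^ 2 + δ := by nlinarith [sq_nonneg (s - 1), mul_nonneg hs h0.le]
    have h3 : 1 ≤ 1 + δ * s ^ 2 := by nlinarith
    have h4 : s * δ * (1 - δ ^ 2) ≤ (s ^ 2 + δ) * (1 + δ * s ^ 2) :=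
      mul_le_mul h2 (by nlinarith) hd (by positivity)
    linarith
  · rw [truncSlope, mul_div_assoc', div_le_iff₀ hp]
    have h4 : s ^ 2 * (1 - δ ^ 2) ≤ (s ^ 2 + δ) * (1 + δ * s ^ 2) :=
      mul_le_mul (by linarith) (by nlinarith) hd (by positivity)
    linarith

lemma abs_truncLog_sq_sub_le (hδ : δ ∈ Ioo (0 : ℝ) 1) {c C r s : ℝ} (hc : 0 ≤ c) (hr : c ≤ r)
    (hs : c ≤ s) (hC : ∀ z, c ≤ z → truncSlope δ z ≤ C) :
    |truncLog δ (r ^ 2) - truncLog δ (s ^ 2)| ≤ C * |r - s| := by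
  have := (convex_Ici c).norm_image_sub_le_of_norm_hasDerivWithin_le (C := C)
    (f := fun s => truncLog δ (s ^ 2)) (f' := truncSlope δ)
    (fun z _ => (hasDerivAt_truncLog_sq hδ.1 z).hasDerivWithinAt) (fun z hz => by
      rw [Real.norm_of_nonneg (truncSlope_bounds hδ (hc.trans hz)).1]
      exact hC z hz) (mem_Ici.2 hs) (mem_Ici.2 hr)
  simpa using this

/-- Weighted and unweighted Lipschitz estimate for the truncated logarithm of squares. -/
lemma truncLog_sq_lipschitz (hδ : δ ∈ Ioo (0 : ℝ) 1) {r s w : ℝ} (hr : 0 ≤ r) (hs : 0 ≤ s)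
    (hw : |r - s| ≤ w) :
    |truncLog δ (r ^ 2) - truncLog δ (s ^ 2)| ≤ 2 / δ * w ∧
      s * |truncLog δ (r ^ 2) - truncLog δ (s ^ 2)| ≤ (4 + 4 * Real.log (1 / δ)) * w := by
  have h0 := hδ.1
  have hA : 0 ≤ Real.log (1 / δ) := (abs_nonneg _).trans (abs_truncLog_le hδ 0)
  have hw0 : 0 ≤ w := (abs_nonneg _).trans hw
  constructor
  · refine (abs_truncLog_sq_sub_le hδ le_rfl hr hs fun z hz =>
      (truncSlope_bounds hδ hz).2.1).trans ?_
    gcongr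
  · rcases hs.eq_or_lt with rfl | hs0
    · rw [zero_mul]; positivity
    -- If `r ≥ s / 2`, the slope is at most `4 / s` on the relevant half-line, because `z` times the
    -- slope at `z` is at most `2`. Otherwise `s / 2 ≤ |r - s| ≤ w`, and the bound on the truncated
    -- logarithm itself suffices.
    rcases le_total (s / 2) r with h | h
    · have h1 := abs_truncLog_sq_sub_le hδ (c := s / 2) (C := 4 / s) (by positivity) h
        (half_le_self hs0.le) fun z hz => by
          have h2 := truncSlope_bounds hδ ((by positivity : 0 ≤ s / 2).trans hz)
          rw [le_div_iff₀ hs0]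
          nlinarith
      calc s * |truncLog δ (r ^ 2) - truncLog δ (s ^ 2)| ≤ s * (4 / s * |r - s|) := by gcongr
        _ = 4 * |r - s| := by field_simp
        _ ≤ (4 + 4 * Real.log (1 / δ)) * w := by nlinarith
    · have h1 : s / 2 ≤ w := by
        rw [abs_sub_comm] at hw
        linarith [le_abs_self (s - r)]
      have h2 : |truncLog δ (r ^ 2) - truncLog δ (s ^ 2)| ≤ 2 * Real.log (1 / δ) := by
        have h3 := abs_truncLog_le hδ (r ^ 2)
        have h4 := abs_truncLog_le hδ (s ^ 2)
        have h5 := abs_sub (truncLog δ (r ^ 2)) (truncLog δ (s ^ 2))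
        linarith
      calc s * |truncLog δ (r ^ 2) - truncLog δ (s ^ 2)| ≤ (2 * w) * (2 * Real.log (1 / δ)) := by
            gcongr; linarith
        _ ≤ (4 + 4 * Real.log (1 / δ)) * w := by nlinarith

lemma tendsto_truncLog {δ : ℕ → ℝ} (hδ : Tendsto δ atTop (𝓝 0)) {y : ℝ} (hy : 0 < y) :
    Tendsto (fun n => truncLog (δ n) y) atTop (𝓝 (Real.log y)) := by
  simp only [truncLog, abs_of_pos hy]
  have h1 : Tendsto (fun n => (y + δ n) / (1 + δ n * y)) atTop (𝓝 ((y + 0) / (1 + 0 * y))) :=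
    (tendsto_const_nhds.add hδ).div (tendsto_const_nhds.add (hδ.mul_const y)) (by simp)
  rw [add_zero, zero_mul, add_zero, div_one] at h1
  exact h1.log hy.ne'

lemma abs_truncLog_le_abs_log (hδ : δ ∈ Ioo (0 : ℝ) 1) {y : ℝ} (hy : 0 < y) :
    |truncLog δ y| ≤ |Real.log y| := by
  rcases le_total 1 y with h1 | h1
  · have h := truncLog_nonneg hδ h1
    rw [abs_of_nonneg h.1]
    exact h.2.trans (le_abs_self _)
  · have h := truncLog_nonpos hδ hy h1
    rw [abs_of_nonpos h.2]
    exact (neg_le_neg h.1).trans (neg_le_abs _)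

lemma tendsto_truncEnt {δ : ℕ → ℝ} (hδ : Tendsto δ atTop (𝓝 0)) (hδ' : ∀ n, δ n ∈ Ioo (0 : ℝ) 1)
    {y : ℝ} (hy : 0 ≤ y) :
    Tendsto (fun n => truncEnt (δ n) y) atTop (𝓝 (y * Real.log y - y + 1)) := by
  have e : ∫ z in (1 : ℝ)..y, Real.log z = y * Real.log y - y + 1 := by
    rw [integral_log]; simp
  rw [← e]
  have hpos : ∀ z, z ∈ uIoc 1 y → 0 < z := fun z hz => by
    rcases le_total 1 y with h | h
    · rw [uIoc_of_le h] at hz; linarith [hz.1]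
    · rw [uIoc_of_ge h] at hz; linarith [hz.1]
  refine intervalIntegral.tendsto_integral_filter_of_dominated_convergence
    (fun z => |Real.log z|) (Eventually.of_forall fun n =>
      (continuous_truncLog (hδ' n).1).aestronglyMeasurable)
    (Eventually.of_forall fun n => Eventually.of_forall fun z hz => ?_)
    intervalIntegral.intervalIntegrable_log'.abs
    (Eventually.of_forall fun z hz => tendsto_truncLog hδ (hpos z hz))
  exact abs_truncLog_le_abs_log (hδ' n) (hpos z hz)

/-- The exceptional value at `s = 0` is harmless: where the limit is applied, the other factor
contains the root and vanishes with it. -/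
lemma tendsto_truncSlope {δ : ℕ → ℝ} (hδ : Tendsto δ atTop (𝓝 0)) (s : ℝ) :
    Tendsto (fun n => s * truncSlope (δ n) s) atTop (𝓝 (if s = 0 then 0 else 2)) := by
  split_ifs with hs
  · simp [hs]
  · unfold truncSlope
    have h1 : Tendsto (fun n => s * (2 * s * (1 - δ n ^ 2) / ((s ^ 2 + δ n) * (1 + δ n * s ^ 2))))
        atTop (𝓝 (s * (2 * s * (1 - 0 ^ 2) / ((s ^ 2 + 0) * (1 + 0 * s ^ 2))))) := by
      refine tendsto_const_nhds.mul (Tendsto.div ?_ ?_ (by simpa using hs))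
      · exact tendsto_const_nhds.mul (tendsto_const_nhds.sub (hδ.pow 2))
      · exact (tendsto_const_nhds.add hδ).mul (tendsto_const_nhds.add (hδ.mul_const _))
    convert h1 using 2
    field_simp
    ring

end TruncatedEntropy

lemma HasW11Deriv.const_mul {a b : ℝ} {p q : ℝ → ℝ} (h : HasW11Deriv a b p q) (c : ℝ) :
    HasW11Deriv a b (fun x => c * p x) (fun x => c * q x) :=
  ⟨h.1.const_mul c, fun x hx => by
    simp only [intervalIntegral.integral_const_mul]
    rw [h.2 x hx, mul_add]⟩

lemma HasW11Deriv.sum {ι : Type*} {a b : ℝ} {p q : ι → ℝ → ℝ} (s : Finset ι)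
    (h : ∀ i, HasW11Deriv a b (p i) (q i)) :
    HasW11Deriv a b (fun x => ∑ i ∈ s, p i x) (fun x => ∑ i ∈ s, q i x) := by
  have hsum : (fun x => ∑ i ∈ s, q i x) = ∑ i ∈ s, q i := by
    ext x; simp
  refine ⟨hsum ▸ IntervalIntegrable.sum _ fun i _ => (h i).1, fun x hx => ?_⟩
  have ha : a ∈ Icc a b := left_mem_Icc.2 (hx.1.trans hx.2)
  rw [intervalIntegral.integral_finsetSum fun i _ => (h i).intervalIntegrable ha hx,
    ← Finset.sum_add_distrib]
  exact Finset.sum_congr rfl fun i _ => (h i).2 x hx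

/-! ### Hat functions on a uniform grid -/

section Hats

/-- The hat functions of the uniform grid of `[-1, 1]` with `N` cells. -/
def hat (N j : ℕ) (ξ : ℝ) : ℝ := max 0 (1 - |(ξ + 1) * N / 2 - j|)

/-- The slopes of the hat functions. -/
def hatSlope (N j : ℕ) (ξ : ℝ) : ℝ :=
  N / 2 * ((if j = ⌊(ξ + 1) * N / 2⌋₊ + 1 then 1 else 0) -
    (if j = ⌊(ξ + 1) * N / 2⌋₊ then 1 else 0))

variable {N : ℕ}

lemma continuous_hat (N j : ℕ) : Continuous (hat N j) := by
  unfold hat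
  fun_prop

lemma hat_nonneg (N j : ℕ) (ξ : ℝ) : 0 ≤ hat N j ξ := le_max_left _ _

lemma hat_le_one (N j : ℕ) (ξ : ℝ) : hat N j ξ ≤ 1 :=
  max_le zero_le_one (by linarith [abs_nonneg ((ξ + 1) * N / 2 - j)])

lemma abs_lt_of_hat_ne_zero {j : ℕ} {ξ : ℝ} (h : hat N j ξ ≠ 0) : |(ξ + 1) * N / 2 - j| < 1 := by
  by_contra hcon
  exact h (max_eq_left (by linarith [not_lt.1 hcon]))

lemma measurable_hatSlope (N j : ℕ) : Measurable (hatSlope N j) := by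
  have h : Measurable fun ξ : ℝ => ⌊(ξ + 1) * N / 2⌋₊ := Nat.measurable_floor.comp (by fun_prop)
  unfold hatSlope
  refine measurable_const.mul (Measurable.sub ?_ ?_)
  · exact Measurable.ite (measurableSet_eq_fun measurable_const (h.add_const 1))
      measurable_const measurable_const
  · exact Measurable.ite (measurableSet_eq_fun measurable_const h) measurable_const
      measurable_const

lemma abs_hatSlope_le (N j : ℕ) (ξ : ℝ) : |hatSlope N j ξ| ≤ N := by
  rw [hatSlope, abs_mul, abs_of_nonneg (by positivity)]
  have : |(if j = ⌊(ξ + 1) * N / 2⌋₊ + 1 then (1 : ℝ) else 0) -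
      (if j = ⌊(ξ + 1) * N / 2⌋₊ then 1 else 0)| ≤ 2 := by
    split_ifs <;> norm_num
  nlinarith [Nat.cast_nonneg (α := ℝ) N]

/-- In the cell with left index `k` only the hats of its two end points are nonzero. The partition
of unity and all slopes are read off from this formula. -/
lemma hat_eq_of_mem {k j : ℕ} {ξ : ℝ} (h0 : (k : ℝ) ≤ (ξ + 1) * N / 2)
    (h1 : (ξ + 1) * N / 2 < k + 1) :
    hat N j ξ = (if j = k + 1 then (ξ + 1) * N / 2 - k else 0) +
      (if j = k then 1 - ((ξ + 1) * N / 2 - k) else 0) := by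
  unfold hat
  set z := (ξ + 1) * N / 2
  rcases lt_trichotomy j k with h | rfl | h
  · have h2 : (j : ℝ) + 1 ≤ k := by exact_mod_cast h
    rw [if_neg (by omega), if_neg (by omega), add_zero, max_eq_left]
    rw [abs_of_nonneg (by linarith)]
    linarith
  · rw [if_neg (by omega), if_pos rfl, abs_of_nonneg (by linarith), max_eq_right (by linarith)]
    ring
  · rcases eq_or_ne j (k + 1) with rfl | h'
    · rw [if_pos rfl, if_neg (by omega)]
      push_cast
      rw [abs_of_nonpos (by linarith), max_eq_right (by linarith)]
      ring
    · have h2 : (k : ℝ) + 2 ≤ j := by exact_mod_cast (by omega : k + 2 ≤ j)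
      rw [if_neg h', if_neg (by omega), add_zero, max_eq_left]
      rw [abs_of_nonpos (by linarith)]
      linarith

lemma floor_mem {ξ : ℝ} (hξ : -1 ≤ ξ) : (⌊(ξ + 1) * N / 2⌋₊ : ℝ) ≤ (ξ + 1) * N / 2 ∧
    (ξ + 1) * N / 2 < ⌊(ξ + 1) * N / 2⌋₊ + 1 := by
  have h0 : 0 ≤ (ξ + 1) * N / 2 := by
    have : 0 ≤ ξ + 1 := by linarith
    positivity
  exact ⟨Nat.floor_le h0, Nat.lt_floor_add_one _⟩

lemma sum_hat {ξ : ℝ} (hξ : ξ ∈ Icc (-1 : ℝ) 1) :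
    ∑ j ∈ Finset.range (N + 1), hat N j ξ = 1 := by
  obtain ⟨h0, h1⟩ := floor_mem (N := N) hξ.1
  simp only [hat_eq_of_mem h0 h1, Finset.sum_add_distrib, Finset.sum_ite_eq', Finset.mem_range]
  have h2 : (ξ + 1) * N / 2 ≤ N := by nlinarith [hξ.2, Nat.cast_nonneg (α := ℝ) N]
  have h3 : ⌊(ξ + 1) * N / 2⌋₊ ≤ N := by exact_mod_cast h0.trans h2
  rw [if_pos (by omega : ⌊(ξ + 1) * N / 2⌋₊ < N + 1)]
  rcases h3.eq_or_lt with h | h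
  · rw [if_neg (by omega)]
    rw [h] at h0 ⊢
    linarith
  · rw [if_pos (by omega)]
    ring

/-- The point `1` is excluded because the floor equals `N` there and the index `N + 1` falls outside
the sum. -/
lemma sum_mul_hatSlope (hN : 0 < N) (c : ℕ → ℝ) {ξ : ℝ} (hξ : ξ ∈ Ico (-1 : ℝ) 1) :
    ∑ j ∈ Finset.range (N + 1), c j * hatSlope N j ξ =
      N / 2 * (c (⌊(ξ + 1) * N / 2⌋₊ + 1) - c ⌊(ξ + 1) * N / 2⌋₊) := by
  obtain ⟨h0, h1⟩ := floor_mem (N := N) hξ.1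
  have hN' : (0 : ℝ) < N := by exact_mod_cast hN
  have h2 : (ξ + 1) * N / 2 < N := by nlinarith [hξ.2]
  have h3 : ⌊(ξ + 1) * N / 2⌋₊ < N := by exact_mod_cast h0.trans_lt h2
  have e : ∀ j, c j * hatSlope N j ξ = N / 2 * ((if j = ⌊(ξ + 1) * N / 2⌋₊ + 1 then c j else 0) -
      (if j = ⌊(ξ + 1) * N / 2⌋₊ then c j else 0)) := fun j => by
    unfold hatSlope
    split_ifs <;> ring
  simp only [e, ← Finset.mul_sum, Finset.sum_sub_distrib, Finset.sum_ite_eq', Finset.mem_range]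
  rw [if_pos (by omega), if_pos (by omega)]

lemma hasW11Deriv_hat (hN : 0 < N) (j : ℕ) : HasW11Deriv (-1) 1 (hat N j) (hatSlope N j) := by
  have hN' : (0 : ℝ) < N := by exact_mod_cast hN
  refine HasW11Deriv.of_hasDerivAt_off_countable (by norm_num)
    (s := range fun i : ℕ => 2 * (i : ℝ) / N - 1) (countable_range _)
    (continuous_hat N j).continuousOn (fun ξ hξ => ?_) ?_
  · obtain ⟨h0, h1⟩ := floor_mem (N := N) hξ.1.1.le
    set k := ⌊(ξ + 1) * N / 2⌋₊ with hk
    have h0' : (k : ℝ) < (ξ + 1) * N / 2 := by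
      refine lt_of_le_of_ne h0 fun h => hξ.2 ⟨k, ?_⟩
      simp only [h]
      field_simp
      ring
    have hz : Continuous fun y : ℝ => (y + 1) * N / 2 := by fun_prop
    have hev : ∀ᶠ y in 𝓝 ξ, (k : ℝ) < (y + 1) * N / 2 ∧ (y + 1) * N / 2 < k + 1 :=
      (hz.continuousAt.eventually_const_lt h0').and (hz.continuousAt.eventually_lt_const h1)
    have hd : HasDerivAt (fun y : ℝ => (y + 1) * N / 2) (N / 2) ξ := by
      simpa using (((hasDerivAt_id ξ).add_const 1).mul_const (N : ℝ)).div_const 2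
    have hlin : HasDerivAt (fun y : ℝ => (if j = k + 1 then (y + 1) * N / 2 - k else 0) +
        (if j = k then 1 - ((y + 1) * N / 2 - k) else 0)) (hatSlope N j ξ) ξ := by
      unfold hatSlope
      rw [← hk]
      split_ifs with ha hb hb
      · omega
      · exact ((hd.sub_const (k : ℝ)).add_const 0).congr_deriv (by ring)
      · exact (((hd.sub_const (k : ℝ)).const_sub 1).const_add 0).congr_deriv (by ring)
      · exact (hasDerivAt_const ξ _).congr_deriv (by ring)
    exact hlin.congr_of_eventuallyEq (hev.mono fun y hy => hat_eq_of_mem hy.1.le hy.2)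
  · exact Measure.integrableOn_of_bounded (M := N) (by simp) (measurable_hatSlope N j).aestronglyMeasurable
      (Eventually.of_forall fun ξ => abs_hatSlope_le N j ξ)

lemma hasW11Deriv_sum_hat (hN : 0 < N) (c : ℕ → ℝ) :
    HasW11Deriv (-1) 1 (fun ξ => ∑ j ∈ Finset.range (N + 1), c j * hat N j ξ)
      (fun ξ => ∑ j ∈ Finset.range (N + 1), c j * hatSlope N j ξ) :=
  HasW11Deriv.sum _ fun j => (hasW11Deriv_hat hN j).const_mul (c j)

end Hats

/-! ### Averages of densities and local oscillation of roots -/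

section Averages

variable {H : ℝ → ℝ} {ε : ℝ} {N : ℕ}

/-- The averages of the density of `μ` with respect to the hat functions. -/
def hatAvg (H : ℝ → ℝ) (ε : ℝ) (N j : ℕ) (μ : Measure ℝ) : ℝ :=
  (∫ ξ, hat N j ξ ∂μ) / ∫ ξ, hat N j ξ ∂(gam H ε)

lemma integrable_hat (N j : ℕ) (μ : Measure ℝ) [IsFiniteMeasure μ] : Integrable (hat N j) μ :=
  Integrable.of_bound (continuous_hat N j).aestronglyMeasurable 1 (Eventually.of_forall fun ξ => by
    rw [Real.norm_of_nonneg (hat_nonneg N j ξ)]; exact hat_le_one N j ξ)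

/-- A continuous nonnegative function with zero integral against `γ_ε` vanishes on `[-1, 1]`,
whereas the hat equals one at its node `2 * j / N - 1`. -/
lemma integral_hat_pos (hH : IsDoubleWell H) (ε : ℝ) (hN : 0 < N) {j : ℕ} (hj : j ≤ N) :
    0 < ∫ ξ, hat N j ξ ∂(gam H ε) := by
  have := isProbabilityMeasure_gam hH ε
  have hN' : (0 : ℝ) < N := by exact_mod_cast hN
  refine lt_of_le_of_ne (integral_nonneg fun ξ => hat_nonneg N j ξ) fun h => ?_
  have h1 := (integral_eq_zero_iff_of_nonneg (fun ξ => hat_nonneg N j ξ)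
    (integrable_hat N j _)).1 h.symm
  have h2 := Measure.eqOn_Icc_of_ae_eq volume (by norm_num : (-1 : ℝ) ≠ 1)
    ((absolutelyContinuous_gam hH ε).ae_le h1) (continuous_hat N j).continuousOn
    continuous_const.continuousOn
  have hx : 2 * (j : ℝ) / N - 1 ∈ Icc (-1 : ℝ) 1 := by
    have hj' : (j : ℝ) ≤ N := by exact_mod_cast hj
    constructor
    · have : 0 ≤ 2 * (j : ℝ) / N := by positivity
      linarith
    · rw [sub_le_iff_le_add, div_le_iff₀ hN']
      linarith
  have h3 := h2 hx
  have h4 : (2 * (j : ℝ) / N - 1 + 1) * N / 2 - j = 0 := by field_simp; ring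
  rw [hat, h4] at h3
  norm_num at h3

lemma hatAvg_nonneg (H : ℝ → ℝ) (ε : ℝ) (N j : ℕ) (μ : Measure ℝ) : 0 ≤ hatAvg H ε N j μ :=
  div_nonneg (integral_nonneg fun ξ => hat_nonneg N j ξ)
    (integral_nonneg fun ξ => hat_nonneg N j ξ)

variable {ρ : Measure ℝ} {p q : ℝ → ℝ}

/-- On the support of the hat `p ^ 2` lies between `(s - w) ^ 2` and `(s + w) ^ 2` (the lower bound
being needed for `s ≥ w` only), hence so does its average, and the square root of the average is
within `w` of `s`. -/
lemma IsRoot.abs_sqrt_hatAvg_sub_le (h : IsRoot H ε ρ p q) (hH : IsDoubleWell H) (hN : 0 < N)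
    {j : ℕ} (hj : j ≤ N) {s w : ℝ} (hs : 0 ≤ s)
    (hw : ∀ y ∈ Icc (-1 : ℝ) 1, hat N j y ≠ 0 → |p y - s| ≤ w) :
    |√(hatAvg H ε N j ρ) - s| ≤ w := by
  have := isProbabilityMeasure_gam hH ε
  have hm := integral_hat_pos hH ε hN hj
  have hpc : ContinuousOn (fun ξ => p ξ ^ 2 * hat N j ξ) (Icc (-1) 1) :=
    (h.continuousOn.pow 2).mul (continuous_hat N j).continuousOn
  have hi := integrable_gam_of_continuousOn hH hpc ε
  have hih := integrable_hat N j (gam H ε)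
  -- The hat is nonzero somewhere in `[-1, 1]`, since its integral is positive; there `hw` bounds an
  -- absolute value by `w`.
  have hw0 : 0 ≤ w := by
    by_contra hcon
    have h0 : ∀ y ∈ Icc (-1 : ℝ) 1, hat N j y = 0 := fun y hy => by
      by_contra hne
      exact hcon ((abs_nonneg _).trans (hw y hy hne))
    rw [integral_eq_zero_of_ae ((ae_gam_mem H ε).mono fun y hy => h0 y hy)] at hm
    exact lt_irrefl _ hm
  have hup : hatAvg H ε N j ρ ≤ (s + w) ^ 2 := by
    rw [hatAvg, div_le_iff₀ hm, h.integral_sq, ← integral_const_mul]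
    refine integral_mono_ae hi (hih.const_mul _) ((ae_gam_mem H ε).mono fun y hy => ?_)
    rcases eq_or_ne (hat N j y) 0 with h0 | h0
    · simp [h0]
    · have h1 := (abs_le.1 (hw y hy h0)).2
      exact mul_le_mul_of_nonneg_right (pow_le_pow_left₀ (h.nonneg y hy) (by linarith) 2)
        (hat_nonneg N j y)
  rw [abs_sub_le_iff]
  constructor
  · have := Real.sqrt_le_iff.2 ⟨by linarith, hup⟩
    linarith
  · rcases le_total s w with hsw | hsw
    · linarith [Real.sqrt_nonneg (hatAvg H ε N j ρ)]
    have hlo : (s - w) ^ 2 ≤ hatAvg H ε N j ρ := by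
      rw [hatAvg, le_div_iff₀ hm, h.integral_sq, ← integral_const_mul]
      refine integral_mono_ae (hih.const_mul _) hi ((ae_gam_mem H ε).mono fun y hy => ?_)
      rcases eq_or_ne (hat N j y) 0 with h0 | h0
      · simp [h0]
      · have h1 := (abs_le.1 (hw y hy h0)).1
        exact mul_le_mul_of_nonneg_right (pow_le_pow_left₀ (by linarith) (by linarith) 2)
          (hat_nonneg N j y)
    have := Real.le_sqrt_of_sq_le hlo
    linarith

/-- The integral of `|q|` over a neighbourhood of `ξ` of radius `4 / N`. -/
def localVar (N : ℕ) (q : ℝ → ℝ) (ξ : ℝ) : ℝ :=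
  ∫ y in Icc (-1) 1 ∩ Icc (ξ - 4 / N) (ξ + 4 / N), |q y|

lemma IsRoot.abs_sub_le_localVar (h : IsRoot H ε ρ p q) {x y : ℝ} (hx : x ∈ Icc (-1 : ℝ) 1)
    (hy : y ∈ Icc (-1 : ℝ) 1) (hxy : |y - x| ≤ 4 / N) : |p y - p x| ≤ localVar N q x := by
  rw [h.deriv.sub_eq hx hy]
  have hqi := h.deriv.integrableOn (by norm_num)
  rw [← Real.norm_eq_abs]
  refine (intervalIntegral.norm_integral_le_integral_norm_uIoc).trans ?_
  simp only [Real.norm_eq_abs]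
  refine setIntegral_mono_set ((hqi.mono_set inter_subset_left).abs)
    (Eventually.of_forall fun _ => abs_nonneg _) (LE.le.eventuallyLE fun z hz => ?_)
  have hz' := uIoc_subset_uIcc hz
  refine ⟨(ordConnected_Icc.uIcc_subset hx hy) hz', ?_⟩
  have h1 := abs_le.1 hxy
  have h4 : 0 ≤ 4 / (N : ℝ) := by positivity
  exact (ordConnected_Icc.uIcc_subset (s := Icc (x - 4 / N) (x + 4 / N))
    ⟨by linarith, by linarith⟩ ⟨by linarith, by linarith⟩) hz'

/-- Both points are within one cell, of length `2 / N`, of the node. This fixes the radius in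
`localVar`. -/
lemma abs_sub_le_of_hat {j : ℕ} (hN : 0 < N) {x y : ℝ}
    (hx : |(x + 1) * N / 2 - j| ≤ 1) (hy : hat N j y ≠ 0) : |y - x| ≤ 4 / N := by
  have hN' : (0 : ℝ) < N := by exact_mod_cast hN
  have h1 := (abs_lt_of_hat_ne_zero hy).le
  have e : |y - x| * N = |(y - x) * N| := by rw [abs_mul, abs_of_pos hN']
  rw [le_div_iff₀ hN', e]
  rw [abs_le] at *
  constructor <;> nlinarith

/-- Cauchy-Schwarz on a window of length at most `8 / N` gives `(N * localVar) ^ 2 ≤ 8 * N * ∫ q ^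
2` over the window. By Tonelli each point is counted in windows whose centres fill a length of at
most `8 / N`, so the powers of `N` cancel and leave the factor `64`. The constants `A` and `B` bound
`g` and `1 / g` on `[-1, 1]`; the result does not depend on `N`. -/
lemma lintegral_sq_localVar_le (hH : IsDoubleWell H) (ε : ℝ) :
    ∃ C : ℝ, 0 ≤ C ∧ ∀ (N : ℕ), 0 < N → ∀ q : ℝ → ℝ, MemLp q 2 (gam H ε) →
      ∫⁻ ξ, ENNReal.ofReal ((N * localVar N q ξ) ^ 2) ∂(gam H ε) ≤
        ENNReal.ofReal (C * ∫ ξ, q ξ ^ 2 ∂(gam H ε)) := by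
  have hcg := continuous_g hH ε
  obtain ⟨A, hA⟩ := isCompact_Icc.exists_bound_of_continuousOn (hcg.continuousOn (s := Icc (-1) 1))
  obtain ⟨B, hB⟩ := isCompact_Icc.exists_bound_of_continuousOn
    ((continuous_one_div_g hH ε).continuousOn (s := Icc (-1) 1))
  have hA0 : 0 ≤ A := (norm_nonneg _).trans (hA 0 (by norm_num))
  have hB0 : 0 ≤ B := (norm_nonneg _).trans (hB 0 (by norm_num))
  refine ⟨A * (64 * B), by positivity, fun N hN q hq => ?_⟩
  have hN' : (0 : ℝ) < N := by exact_mod_cast hN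
  set I : Set ℝ := Icc (-1) 1 with hI
  set h : ℝ := 4 / N with hh
  have hh0 : 0 < h := by positivity
  have hq2 : Integrable (fun ξ => q ξ ^ 2) (gam H ε) := hq.integrable_sq
  have hq2I : IntegrableOn (fun ξ => q ξ ^ 2) I := integrableOn_of_integrable_gam hH hq2
  have hqI : IntegrableOn q I := integrableOn_of_integrable_gam hH
    (by have := isProbabilityMeasure_gam hH ε; exact hq.integrable (by norm_num))
  set F : ℝ → ℝ≥0∞ := fun ξ => ENNReal.ofReal (q ξ ^ 2) with hF
  have hFm : AEMeasurable F (volume.restrict I) := hq2I.aemeasurable.ennreal_ofReal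
  have hpt : ∀ ξ, ENNReal.ofReal ((N * localVar N q ξ) ^ 2) ≤
      ENNReal.ofReal (8 * N) * ∫⁻ y in I, (Icc (ξ - h) (ξ + h)).indicator 1 y * F y := fun ξ => by
    set P := I ∩ Icc (ξ - h) (ξ + h) with hP
    have hPm : MeasurableSet P := measurableSet_Icc.inter measurableSet_Icc
    have hPv : volume.real P ≤ 2 * h := by
      refine (measureReal_mono inter_subset_right (by simp)).trans ?_
      rw [Real.volume_real_Icc_of_le (by linarith)]
      linarith
    have hPf : IsFiniteMeasure (volume.restrict P) :=
      ⟨by simpa using (measure_mono inter_subset_left).trans_lt (isCompact_Icc (a := (-1 : ℝ)) (b := 1)).measure_lt_top⟩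
    have h1 : MemLp (fun y => |q y|) 2 (volume.restrict P) := by
      refine (memLp_two_iff_integrable_sq
        (hqI.mono_set inter_subset_left).aestronglyMeasurable.norm).2 ?_
      simp only [Real.norm_eq_abs, sq_abs]
      exact hq2I.mono_set inter_subset_left
    have hCS := sq_integral_mul_le h1 (memLp_const (1 : ℝ))
    simp only [mul_one, sq_abs, one_pow, integral_const, measureReal_restrict_apply_univ,
      smul_eq_mul] at hCS
    have h2 : (N * localVar N q ξ) ^ 2 ≤ 8 * N * ∫ y in P, q y ^ 2 := by
      rw [mul_pow]
      calc (N : ℝ) ^ 2 * localVar N q ξ ^ 2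
          ≤ N ^ 2 * ((∫ y in P, q y ^ 2) * volume.real P) := by
            gcongr
            exact hCS
        _ ≤ N ^ 2 * ((∫ y in P, q y ^ 2) * (2 * h)) := by
            gcongr
        _ = 8 * N * ∫ y in P, q y ^ 2 := by rw [hh]; field_simp; ring
    refine (ENNReal.ofReal_le_ofReal h2).trans ?_
    rw [ENNReal.ofReal_mul (by positivity)]
    refine mul_le_mul_right (le_of_eq ?_) _
    rw [ofReal_integral_eq_lintegral_ofReal (hq2I.mono_set inter_subset_left)
      (Eventually.of_forall fun _ => sq_nonneg _), inter_comm,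
      ← Measure.restrict_restrict measurableSet_Icc, ← lintegral_indicator measurableSet_Icc]
    refine lintegral_congr fun y => ?_
    by_cases hy : y ∈ Icc (ξ - h) (ξ + h) <;> simp [hy, hF]
  have hswap : ∫⁻ ξ in I, ∫⁻ y in I, (Icc (ξ - h) (ξ + h)).indicator 1 y * F y ≤
      ENNReal.ofReal (2 * h) * ∫⁻ y in I, F y := by
    have hm : AEMeasurable (Function.uncurry fun ξ y : ℝ =>
        (Icc (ξ - h) (ξ + h)).indicator (1 : ℝ → ℝ≥0∞) y * F y)
        ((volume.restrict I).prod (volume.restrict I)) := by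
      refine AEMeasurable.mul (Measurable.aemeasurable ?_) hFm.comp_snd
      have hset : MeasurableSet {x : ℝ × ℝ | x.2 ∈ Icc (x.1 - h) (x.1 + h)} :=
        (measurableSet_le (measurable_fst.sub_const h) measurable_snd).inter
          (measurableSet_le measurable_snd (measurable_fst.add_const h))
      have e : (fun x : ℝ × ℝ => (Icc (x.1 - h) (x.1 + h)).indicator (1 : ℝ → ℝ≥0∞) x.2) =
          {x : ℝ × ℝ | x.2 ∈ Icc (x.1 - h) (x.1 + h)}.indicator 1 := by
        ext x; simp [indicator]
      rw [e]
      exact measurable_one.indicator hset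
    rw [lintegral_lintegral_swap hm, ← lintegral_const_mul'' _ hFm]
    refine lintegral_mono fun y => ?_
    have e : ∀ ξ, (Icc (ξ - h) (ξ + h)).indicator (1 : ℝ → ℝ≥0∞) y * F y =
        F y * (Icc (y - h) (y + h)).indicator 1 ξ := fun ξ => by
      have : y ∈ Icc (ξ - h) (ξ + h) ↔ ξ ∈ Icc (y - h) (y + h) := by
        constructor <;> rintro ⟨h1, h2⟩ <;> constructor <;> linarith
      by_cases hy : y ∈ Icc (ξ - h) (ξ + h)
      · rw [indicator_of_mem hy, indicator_of_mem (this.1 hy)]; simp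
      · rw [indicator_of_notMem hy, indicator_of_notMem (fun h' => hy (this.2 h'))]; simp
    simp only [e]
    rw [lintegral_const_mul _ (measurable_one.indicator measurableSet_Icc), mul_comm]
    refine mul_le_mul_left ?_ _
    rw [lintegral_indicator_one measurableSet_Icc]
    refine (Measure.restrict_apply_le _ _).trans ?_
    rw [Real.volume_Icc]
    exact ENNReal.ofReal_le_ofReal (by linarith)
  have hFγ : ∫⁻ y in I, F y ≤ ENNReal.ofReal (B * ∫ ξ, q ξ ^ 2 ∂(gam H ε)) := by
    rw [hF, ← ofReal_integral_eq_lintegral_ofReal hq2I (Eventually.of_forall fun _ => sq_nonneg _)]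
    refine ENNReal.ofReal_le_ofReal ?_
    rw [integral_gam hH, ← integral_const_mul]
    refine setIntegral_mono_on hq2I (((integrable_gam_iff hH ε _).1 hq2).const_mul _)
      measurableSet_Icc fun y hy => ?_
    have h1 := (le_abs_self _).trans (hB y hy)
    have h2 := g_pos hH ε y
    rw [div_le_iff₀ h2] at h1
    nlinarith [sq_nonneg (q y)]
  rw [lintegral_gam hH]
  calc ∫⁻ ξ in I, ENNReal.ofReal (g H ε ξ) * ENNReal.ofReal ((N * localVar N q ξ) ^ 2)
      ≤ ∫⁻ ξ in I, ENNReal.ofReal A * (ENNReal.ofReal (8 * N) *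
          ∫⁻ y in I, (Icc (ξ - h) (ξ + h)).indicator 1 y * F y) := by
        refine setLIntegral_mono' measurableSet_Icc fun ξ hξ => ?_
        exact mul_le_mul' (ENNReal.ofReal_le_ofReal ((le_abs_self _).trans (hA ξ hξ))) (hpt ξ)
    _ = ENNReal.ofReal A * (ENNReal.ofReal (8 * N) *
          ∫⁻ ξ in I, ∫⁻ y in I, (Icc (ξ - h) (ξ + h)).indicator 1 y * F y) := by
        rw [lintegral_const_mul' _ _ ENNReal.ofReal_ne_top,
          lintegral_const_mul' _ _ ENNReal.ofReal_ne_top]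
    _ ≤ ENNReal.ofReal A * (ENNReal.ofReal (8 * N) * (ENNReal.ofReal (2 * h) *
          ENNReal.ofReal (B * ∫ ξ, q ξ ^ 2 ∂(gam H ε)))) := by gcongr; exact hswap.trans (by gcongr)
    _ = ENNReal.ofReal (A * (64 * B) * ∫ ξ, q ξ ^ 2 ∂(gam H ε)) := by
        rw [← ENNReal.ofReal_mul (by positivity), ← ENNReal.ofReal_mul (by positivity),
          ← ENNReal.ofReal_mul (by positivity), hh]
        congr 1
        field_simp
        ring

end Averages

/-! ### Slopes of the discretized logarithm -/

section SpaceDiscretization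

variable {H : ℝ → ℝ} {ε δ : ℝ} {N : ℕ} {ρ : Measure ℝ} {p q : ℝ → ℝ}

/-- The slope of the piecewise affine interpolation of the truncated logarithm of the averages. -/
def entFlux (H : ℝ → ℝ) (ε δ : ℝ) (N : ℕ) (μ : Measure ℝ) (ξ : ℝ) : ℝ :=
  ∑ j ∈ Finset.range (N + 1), truncLog δ (hatAvg H ε N j μ) * hatSlope N j ξ

lemma measurable_entFlux (H : ℝ → ℝ) (ε δ : ℝ) (N : ℕ) (μ : Measure ℝ) :
    Measurable (entFlux H ε δ N μ) :=
  Finset.measurable_sum _ fun j _ => (measurable_hatSlope N j).const_mul _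

lemma ae_gam_mem_Ico (H : ℝ → ℝ) (ε : ℝ) : ∀ᵐ ξ ∂(gam H ε), ξ ∈ Ico (-1 : ℝ) 1 := by
  refine (gam_absolutelyContinuous H ε).ae_le ?_
  rw [← restrict_Ico_eq_restrict_Icc]
  exact ae_restrict_mem measurableSet_Ico

/-- On a cell the slope is `N / 2` times the difference of the truncated logarithms of two
neighbouring averages, and both are compared with the value at `ξ` itself. The unweighted bound
gives weak compactness for one density; the bound weighted by `p` is the one that pairs with `p * v`
and is controlled by the Fisher information alone. -/
lemma IsRoot.abs_entFlux_le (h : IsRoot H ε ρ p q) (hH : IsDoubleWell H) (hδ : δ ∈ Ioo (0 : ℝ) 1)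
    (hN : 0 < N) {ξ : ℝ} (hξ : ξ ∈ Ico (-1 : ℝ) 1) :
    |entFlux H ε δ N ρ ξ| ≤ 2 / δ * (N * localVar N q ξ) ∧
      |p ξ * entFlux H ε δ N ρ ξ| ≤ (4 + 4 * Real.log (1 / δ)) * (N * localVar N q ξ) := by
  have hξ' : ξ ∈ Icc (-1 : ℝ) 1 := Ico_subset_Icc_self hξ
  have hp := h.nonneg ξ hξ'
  have hN' : (0 : ℝ) < N := by exact_mod_cast hN
  rw [entFlux, sum_mul_hatSlope hN _ hξ]
  obtain ⟨h0, h1⟩ := floor_mem (N := N) hξ.1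
  have h2 : (ξ + 1) * N / 2 < N := by nlinarith [hξ.2]
  have h3 : ⌊(ξ + 1) * N / 2⌋₊ < N := by exact_mod_cast h0.trans_lt h2
  set k := ⌊(ξ + 1) * N / 2⌋₊
  set W := localVar N q ξ
  have key : ∀ j ≤ N, |(ξ + 1) * N / 2 - j| ≤ 1 →
      |truncLog δ (hatAvg H ε N j ρ) - truncLog δ (p ξ ^ 2)| ≤ 2 / δ * W ∧
      p ξ * |truncLog δ (hatAvg H ε N j ρ) - truncLog δ (p ξ ^ 2)| ≤
        (4 + 4 * Real.log (1 / δ)) * W := fun j hj hz => by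
    have h4 : |√(hatAvg H ε N j ρ) - p ξ| ≤ W := h.abs_sqrt_hatAvg_sub_le hH hN hj hp
      fun y hy hne => h.abs_sub_le_localVar hξ' hy (abs_sub_le_of_hat hN hz hne)
    have h5 := truncLog_sq_lipschitz hδ (Real.sqrt_nonneg _) hp h4
    rwa [Real.sq_sqrt (hatAvg_nonneg H ε N j ρ)] at h5
  obtain ⟨a1, a2⟩ := key k h3.le (by rw [abs_le]; constructor <;> linarith)
  obtain ⟨b1, b2⟩ := key (k + 1) h3 (by push_cast; rw [abs_le]; constructor <;> linarith)
  set x := truncLog δ (hatAvg H ε N k ρ)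
  set y := truncLog δ (hatAvg H ε N (k + 1) ρ)
  set z := truncLog δ (p ξ ^ 2)
  have h6 : |y - x| ≤ |y - z| + |x - z| := by
    rw [abs_sub_comm x z]
    exact abs_sub_le y z x
  rw [abs_mul, abs_mul, abs_mul, abs_of_nonneg hp, abs_of_pos (by positivity : (0 : ℝ) < N / 2)]
  constructor
  · calc (N : ℝ) / 2 * |y - x| ≤ N / 2 * (2 / δ * W + 2 / δ * W) := by gcongr; linarith
      _ = 2 / δ * (N * W) := by ring
  · calc p ξ * (N / 2 * |y - x|) ≤ p ξ * (N / 2 * (|y - z| + |x - z|)) := by gcongr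
      _ = N / 2 * (p ξ * |y - z| + p ξ * |x - z|) := by ring
      _ ≤ N / 2 * ((4 + 4 * Real.log (1 / δ)) * W + (4 + 4 * Real.log (1 / δ)) * W) := by gcongr
      _ = (4 + 4 * Real.log (1 / δ)) * (N * W) := by ring

lemma exists_sq_bound (hH : IsDoubleWell H) (ε : ℝ) :
    ∃ C : ℝ, 0 ≤ C ∧ ∀ (N : ℕ), 0 < N → ∀ q : ℝ → ℝ, MemLp q 2 (gam H ε) →
      ∀ (f : ℝ → ℝ) (c : ℝ), AEStronglyMeasurable f (gam H ε) → 0 ≤ c →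
        (∀ ξ ∈ Ico (-1 : ℝ) 1, |f ξ| ≤ c * (N * localVar N q ξ)) →
        MemLp f 2 (gam H ε) ∧
          ∫ ξ, f ξ ^ 2 ∂(gam H ε) ≤ c ^ 2 * (C * ∫ ξ, q ξ ^ 2 ∂(gam H ε)) := by
  obtain ⟨C, hC0, hC⟩ := lintegral_sq_localVar_le hH ε
  refine ⟨C, hC0, fun N hN q hq f c hf hc hb => ?_⟩
  have h1 : ∫⁻ ξ, ENNReal.ofReal (f ξ ^ 2) ∂(gam H ε) ≤
      ENNReal.ofReal (c ^ 2 * (C * ∫ ξ, q ξ ^ 2 ∂(gam H ε))) := by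
    rw [ENNReal.ofReal_mul (sq_nonneg c)]
    calc ∫⁻ ξ, ENNReal.ofReal (f ξ ^ 2) ∂(gam H ε)
        ≤ ∫⁻ ξ, ENNReal.ofReal (c ^ 2) * ENNReal.ofReal ((N * localVar N q ξ) ^ 2) ∂(gam H ε) := by
          refine lintegral_mono_ae ((ae_gam_mem_Ico H ε).mono fun ξ hξ => ?_)
          rw [← ENNReal.ofReal_mul (sq_nonneg c), ← mul_pow, ← sq_abs]
          exact ENNReal.ofReal_le_ofReal (pow_le_pow_left₀ (abs_nonneg _) (hb ξ hξ) 2)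
      _ = ENNReal.ofReal (c ^ 2) * ∫⁻ ξ, ENNReal.ofReal ((N * localVar N q ξ) ^ 2) ∂(gam H ε) :=
          lintegral_const_mul' _ _ ENNReal.ofReal_ne_top
      _ ≤ _ := by gcongr; exact hC N hN q hq
  refine ⟨(memLp_two_iff_integrable_sq hf).2 ⟨hf.pow 2, ?_⟩, ?_⟩
  · rw [hasFiniteIntegral_iff_ofReal (Eventually.of_forall fun _ => sq_nonneg _)]
    exact h1.trans_lt ENNReal.ofReal_lt_top
  · rw [integral_eq_lintegral_of_nonneg_ae (Eventually.of_forall fun _ => sq_nonneg _) (hf.pow 2)]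
    refine ENNReal.toReal_le_of_le_ofReal ?_ h1
    have : 0 ≤ ∫ ξ, q ξ ^ 2 ∂(gam H ε) := integral_nonneg fun _ => sq_nonneg _
    positivity

lemma IsRoot.hasW11Deriv_truncLog (h : IsRoot H ε ρ p q) (hδ : δ ∈ Ioo (0 : ℝ) 1) :
    HasW11Deriv (-1) 1 (fun ξ => truncLog δ (p ξ ^ 2)) (fun ξ => truncSlope δ (p ξ) * q ξ) := by
  have h0 : 0 < 2 / δ := div_pos two_pos hδ.1
  refine h.deriv.comp (by norm_num) (F := fun s => truncLog δ (s ^ 2)) (K := (2 / δ).toNNReal)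
    (s := Ici 0) ?_ (fun ξ hξ => h.nonneg ξ hξ) fun y _ => hasDerivAt_truncLog_sq hδ.1 y
  refine LipschitzOnWith.of_dist_le_mul fun x hx y hy => ?_
  rw [Real.dist_eq, Real.dist_eq, Real.coe_toNNReal _ h0.le]
  exact abs_truncLog_sq_sub_le hδ le_rfl hx hy fun z hz => (truncSlope_bounds hδ hz).2.1

lemma IsRoot.memLp_truncSlope (h : IsRoot H ε ρ p q) (hH : IsDoubleWell H)
    (hδ : δ ∈ Ioo (0 : ℝ) 1) (hf : fisher H ε ρ < ⊤) :
    MemLp (fun ξ => truncSlope δ (p ξ) * q ξ) 2 (gam H ε) := by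
  have hd := h.hasW11Deriv_truncLog hδ
  refine (h.memLp hH hf).of_le_mul (c := 2 / δ)
    ((hd.integrableOn (by norm_num)).aestronglyMeasurable.mono_ac (gam_absolutelyContinuous H ε))
    ((ae_gam_mem H ε).mono fun ξ hξ => ?_)
  have h1 := truncSlope_bounds hδ (h.nonneg ξ hξ)
  rw [norm_mul, Real.norm_of_nonneg h1.1]
  gcongr
  exact h1.2.1

lemma IsRoot.tendsto_sum_hat (h : IsRoot H ε ρ p q) (hH : IsDoubleWell H)
    (hδ : δ ∈ Ioo (0 : ℝ) 1) {x : ℝ} (hx : x ∈ Icc (-1 : ℝ) 1) :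
    Tendsto (fun n => ∑ j ∈ Finset.range (n + 1 + 1),
      truncLog δ (hatAvg H ε (n + 1) j ρ) * hat (n + 1) j x) atTop (𝓝 (truncLog δ (p x ^ 2))) := by
  have hp := h.nonneg x hx
  have h0 := hδ.1
  rw [Metric.tendsto_atTop]
  intro η hη
  -- The Lipschitz constant `2 / δ` of the truncated logarithm of squares turns the oscillation `η *
  -- δ / 4` into `η / 2`.
  obtain ⟨d, hd, hpd⟩ := Metric.continuousWithinAt_iff.1 (h.continuousOn x hx) (η * δ / 4)
    (by positivity)
  obtain ⟨n₀, hn₀⟩ := exists_nat_gt (4 / d)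
  refine ⟨n₀, fun n hn => ?_⟩
  have hN : (0 : ℝ) < (n + 1 : ℕ) := by positivity
  have hsmall : 4 / ((n + 1 : ℕ) : ℝ) < d := by
    rw [div_lt_comm₀ hN hd]
    refine hn₀.trans ?_
    exact_mod_cast Nat.lt_succ_of_le hn
  have e : ∑ j ∈ Finset.range (n + 1 + 1), truncLog δ (hatAvg H ε (n + 1) j ρ) * hat (n + 1) j x -
      truncLog δ (p x ^ 2) = ∑ j ∈ Finset.range (n + 1 + 1),
        (truncLog δ (hatAvg H ε (n + 1) j ρ) - truncLog δ (p x ^ 2)) * hat (n + 1) j x := by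
    simp only [sub_mul, Finset.sum_sub_distrib, ← Finset.mul_sum, sum_hat hx, mul_one]
  rw [Real.dist_eq, e]
  refine (Finset.abs_sum_le_sum_abs _ _).trans_lt ?_
  calc ∑ j ∈ Finset.range (n + 1 + 1),
        |(truncLog δ (hatAvg H ε (n + 1) j ρ) - truncLog δ (p x ^ 2)) * hat (n + 1) j x|
      ≤ ∑ j ∈ Finset.range (n + 1 + 1), 2 / δ * (η * δ / 4) * hat (n + 1) j x := by
        refine Finset.sum_le_sum fun j hj => ?_
        rw [abs_mul, abs_of_nonneg (hat_nonneg _ _ _)]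
        rcases eq_or_ne (hat (n + 1) j x) 0 with h1 | h1
        · simp [h1]
        refine mul_le_mul_of_nonneg_right ?_ (hat_nonneg _ _ _)
        have h4 : |√(hatAvg H ε (n + 1) j ρ) - p x| ≤ η * δ / 4 :=
          h.abs_sqrt_hatAvg_sub_le hH n.succ_pos (by simpa using hj) hp fun y hy hne => by
            have h5 := abs_sub_le_of_hat n.succ_pos (abs_lt_of_hat_ne_zero h1).le hne
            exact (hpd hy (by rw [Real.dist_eq]; exact h5.trans_lt hsmall)).le
        have h5 := (truncLog_sq_lipschitz hδ (Real.sqrt_nonneg _) hp h4).1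
        rwa [Real.sq_sqrt (hatAvg_nonneg H ε _ j ρ)] at h5
    _ = η / 2 := by
        rw [← Finset.mul_sum, sum_hat hx]
        field_simp
        ring
    _ < η := half_lt_self hη

/-- The slopes are bounded in `L²(γ_ε)`, and their primitives are interpolations that converge
pointwise; this is enough for weak convergence. -/
lemma IsRoot.tendsto_entFlux (h : IsRoot H ε ρ p q) (hH : IsDoubleWell H)
    (hδ : δ ∈ Ioo (0 : ℝ) 1) (hf : fisher H ε ρ < ⊤) {w : ℝ → ℝ} (hw : MemLp w 2 (gam H ε)) :
    Tendsto (fun n => ∫ ξ, entFlux H ε δ (n + 1) ρ ξ * w ξ ∂(gam H ε)) atTop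
      (𝓝 (∫ ξ, truncSlope δ (p ξ) * q ξ * w ξ ∂(gam H ε))) := by
  obtain ⟨C, hC0, hC⟩ := exists_sq_bound hH ε
  have h0 := hδ.1
  have hq := h.memLp hH hf
  have hI : 0 ≤ ∫ ξ, q ξ ^ 2 ∂(gam H ε) := integral_nonneg fun _ => sq_nonneg _
  have hb := fun n : ℕ => hC (n + 1) n.succ_pos q hq (entFlux H ε δ (n + 1) ρ) (2 / δ)
    (measurable_entFlux H ε δ _ ρ).aestronglyMeasurable (by positivity)
    fun ξ hξ => (h.abs_entFlux_le hH hδ n.succ_pos hξ).1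
  refine tendsto_integral_mul_of_primitive hH (fun n => (hb n).1)
    (c := (2 / δ) ^ 2 * (C * ∫ ξ, q ξ ^ 2 ∂(gam H ε))) (by positivity) (fun n => (hb n).2)
    (h.memLp_truncSlope hH hδ hf) (fun x hx => ?_) hw
  have hl : (-1 : ℝ) ∈ Icc (-1 : ℝ) 1 := by norm_num
  rw [← (h.hasW11Deriv_truncLog hδ).sub_eq hl hx]
  refine ((h.tendsto_sum_hat hH hδ hx).sub (h.tendsto_sum_hat hH hδ hl)).congr fun n => ?_
  exact (hasW11Deriv_sum_hat n.succ_pos _).sub_eq hl hx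

end SpaceDiscretization

/-! ### Convergence of the discretized entropy -/

section EntropyDiscretization

variable {H : ℝ → ℝ} {ε δ : ℝ} {N : ℕ}

/-- The mean oscillation of `u` over the supports of the hat functions. -/
def hatOsc (H : ℝ → ℝ) (ε : ℝ) (N : ℕ) (u : ℝ → ℝ) : ℝ :=
  ∑ j ∈ Finset.range (N + 1), ∫ ξ, hat N j ξ *
    |u ξ - (∫ y, hat N j y * u y ∂(gam H ε)) / ∫ y, hat N j y ∂(gam H ε)| ∂(gam H ε)

lemma _root_.MeasureTheory.Integrable.hat_mul {μ : Measure ℝ} {u : ℝ → ℝ} (hu : Integrable u μ) (N j : ℕ) :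
    Integrable (fun ξ => hat N j ξ * u ξ) μ :=
  hu.bdd_mul (c := 1) (continuous_hat N j).aestronglyMeasurable (Eventually.of_forall fun ξ => by
    rw [Real.norm_of_nonneg (hat_nonneg N j ξ)]; exact hat_le_one N j ξ)

lemma sum_integral_hat_mul (H : ℝ → ℝ) (ε : ℝ) (N : ℕ) {u : ℝ → ℝ}
    (hu : Integrable u (gam H ε)) :
    ∑ j ∈ Finset.range (N + 1), ∫ ξ, hat N j ξ * u ξ ∂(gam H ε) = ∫ ξ, u ξ ∂(gam H ε) := by
  rw [← integral_finsetSum _ fun j _ => hu.hat_mul N j]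
  refine integral_congr_ae ((ae_gam_mem H ε).mono fun ξ hξ => ?_)
  simp only [← Finset.sum_mul, sum_hat hξ, one_mul]

/-- Replacing `u` by `w` changes the function and its averages; as the hats sum to one, each change
costs at most one `L¹` distance. The estimate reduces the limit of the oscillation to continuous
functions. -/
lemma hatOsc_le (hH : IsDoubleWell H) (hN : 0 < N) {u w : ℝ → ℝ} (hu : Integrable u (gam H ε))
    (hw : Integrable w (gam H ε)) :
    hatOsc H ε N u ≤ 2 * ∫ ξ, |u ξ - w ξ| ∂(gam H ε) + hatOsc H ε N w := by
  have := isProbabilityMeasure_gam hH ε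
  have hd := (hu.sub hw).abs
  have hd' : Integrable (fun ξ => |u ξ - w ξ|) (gam H ε) := hd
  rw [two_mul, hatOsc, hatOsc, ← sum_integral_hat_mul H ε N hd', ← Finset.sum_add_distrib,
    ← Finset.sum_add_distrib]
  refine Finset.sum_le_sum fun j hj => ?_
  have hm := integral_hat_pos hH ε hN (by simpa using hj : j ≤ N)
  set m := ∫ y, hat N j y ∂(gam H ε) with hmdef
  set a := (∫ y, hat N j y * u y ∂(gam H ε)) / m with ha
  set b := (∫ y, hat N j y * w y ∂(gam H ε)) / m with hb
  have hab : |b - a| * m ≤ ∫ ξ, hat N j ξ * |u ξ - w ξ| ∂(gam H ε) := by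
    have h1 : (b - a) * m = ∫ ξ, hat N j ξ * (w ξ - u ξ) ∂(gam H ε) := by
      rw [hb, ha]
      simp only [mul_sub]
      rw [integral_sub (hw.hat_mul N j) (hu.hat_mul N j)]
      field_simp
    have e : |b - a| * m = |(b - a) * m| := by rw [abs_mul, abs_of_pos hm]
    rw [e, h1]
    refine (abs_integral_le_integral_abs).trans (le_of_eq ?_)
    refine integral_congr_ae (Eventually.of_forall fun ξ => ?_)
    simp only [abs_mul, abs_of_nonneg (hat_nonneg N j ξ), abs_sub_comm]
  have hi1 := hd'.hat_mul N j
  have hi2 : Integrable (fun ξ => hat N j ξ * |w ξ - b|) (gam H ε) :=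
    ((hw.sub (integrable_const b)).abs).hat_mul N j
  have hi3 : Integrable (fun ξ => hat N j ξ * |b - a|) (gam H ε) :=
    (integrable_hat N j _).mul_const _
  have hi4 : Integrable (fun ξ => hat N j ξ * |u ξ - a|) (gam H ε) :=
    ((hu.sub (integrable_const a)).abs).hat_mul N j
  have h2 : ∫ ξ, hat N j ξ * |u ξ - a| ∂(gam H ε) ≤
      ∫ ξ, (hat N j ξ * |u ξ - w ξ| + hat N j ξ * |w ξ - b| + hat N j ξ * |b - a|) ∂(gam H ε) := by
    refine integral_mono hi4 ((hi1.add hi2).add hi3) fun ξ => ?_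
    simp only [← mul_add]
    refine mul_le_mul_of_nonneg_left ?_ (hat_nonneg N j ξ)
    have h3 := abs_sub_le (u ξ) (w ξ) a
    have h4 := abs_sub_le (w ξ) b a
    linarith
  have h3 : ∫ ξ, (hat N j ξ * |u ξ - w ξ| + hat N j ξ * |w ξ - b| + hat N j ξ * |b - a|) ∂(gam H ε)
      = ∫ ξ, hat N j ξ * |u ξ - w ξ| ∂(gam H ε) + ∫ ξ, hat N j ξ * |w ξ - b| ∂(gam H ε) +
        m * |b - a| := by
    rw [integral_add (f := fun ξ => hat N j ξ * |u ξ - w ξ| + hat N j ξ * |w ξ - b|)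
      (g := fun ξ => hat N j ξ * |b - a|) (hi1.add hi2) hi3,
      integral_add (f := fun ξ => hat N j ξ * |u ξ - w ξ|) (g := fun ξ => hat N j ξ * |w ξ - b|)
      hi1 hi2, integral_mul_const]
  linarith

lemma hatOsc_continuous (hH : IsDoubleWell H) {w : ℝ → ℝ} (hw : Continuous w) :
    Tendsto (fun n => hatOsc H ε (n + 1) w) atTop (𝓝 0) := by
  have := isProbabilityMeasure_gam hH ε
  have hwi := integrable_gam_of_continuousOn hH (hw.continuousOn (s := Icc (-1) 1)) ε
  have huc := isCompact_Icc.uniformContinuousOn_of_continuous (hw.continuousOn (s := Icc (-1) 1))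
  rw [Metric.tendsto_atTop]
  intro η hη
  obtain ⟨d, hd, hwd⟩ := Metric.uniformContinuousOn_iff.1 huc (η / 2) (by positivity)
  obtain ⟨n₀, hn₀⟩ := exists_nat_gt (4 / d)
  refine ⟨n₀, fun n hn => ?_⟩
  have hN : (0 : ℝ) < (n + 1 : ℕ) := by positivity
  have hsmall : 4 / ((n + 1 : ℕ) : ℝ) < d := by
    rw [div_lt_comm₀ hN hd]
    refine hn₀.trans ?_
    exact_mod_cast Nat.lt_succ_of_le hn
  have h0 : 0 ≤ hatOsc H ε (n + 1) w := Finset.sum_nonneg fun j _ => integral_nonneg fun ξ =>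
    mul_nonneg (hat_nonneg _ _ _) (abs_nonneg _)
  rw [Real.dist_eq, sub_zero, abs_of_nonneg h0]
  refine lt_of_le_of_lt (b := η / 2) ?_ (half_lt_self hη)
  have h1 : hatOsc H ε (n + 1) w ≤
      ∑ j ∈ Finset.range (n + 1 + 1), ∫ ξ, hat (n + 1) j ξ * (η / 2) ∂(gam H ε) := by
    refine Finset.sum_le_sum fun j hj => ?_
    have hm := integral_hat_pos hH ε n.succ_pos (by simpa using hj : j ≤ n + 1)
    have hih := integrable_hat (n + 1) j (gam H ε)
    refine integral_mono_ae (((hwi.sub (integrable_const _)).abs).hat_mul _ j)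
      (hih.mul_const _) ((ae_gam_mem H ε).mono fun ξ hξ => ?_)
    rcases eq_or_ne (hat (n + 1) j ξ) 0 with h2 | h2
    · simp [h2]
    refine mul_le_mul_of_nonneg_left ?_ (hat_nonneg _ _ _)
    set m := ∫ y, hat (n + 1) j y ∂(gam H ε) with hmdef
    have e : w ξ - (∫ y, hat (n + 1) j y * w y ∂(gam H ε)) / m =
        (∫ y, hat (n + 1) j y * (w ξ - w y) ∂(gam H ε)) / m := by
      simp only [mul_sub]
      rw [integral_sub (hih.mul_const _) (hwi.hat_mul _ j), integral_mul_const]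
      field_simp
      rw [hmdef]
    rw [e, abs_div, abs_of_pos hm, div_le_iff₀ hm, mul_comm (η / 2), hmdef, ← integral_mul_const]
    refine (abs_integral_le_integral_abs).trans (integral_mono_ae ?_ (hih.mul_const _)
      ((ae_gam_mem H ε).mono fun y hy => ?_))
    · exact ((((integrable_const (w ξ)).sub hwi)).hat_mul _ j).abs
    · simp only [abs_mul, abs_of_nonneg (hat_nonneg _ _ _)]
      rcases eq_or_ne (hat (n + 1) j y) 0 with h3 | h3
      · simp [h3]
      refine mul_le_mul_of_nonneg_left ?_ (hat_nonneg _ _ _)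
      have h5 := abs_sub_le_of_hat n.succ_pos (abs_lt_of_hat_ne_zero h3).le h2
      exact (hwd ξ hξ y hy (by rw [Real.dist_eq]; exact h5.trans_lt hsmall)).le
  have h2 := sum_integral_hat_mul H ε (n + 1) (integrable_const (η / 2))
  rw [h2] at h1
  simpa using h1

lemma tendsto_hatOsc (hH : IsDoubleWell H) {u : ℝ → ℝ} (hu : Integrable u (gam H ε)) :
    Tendsto (fun n => hatOsc H ε (n + 1) u) atTop (𝓝 0) := by
  have := isProbabilityMeasure_gam hH ε
  rw [Metric.tendsto_atTop]
  intro η hη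
  obtain ⟨w, hw1, hw2⟩ := hu.exists_boundedContinuous_integral_sub_le
    (show (0 : ℝ) < η / 4 by positivity)
  obtain ⟨n₀, hn₀⟩ := Metric.tendsto_atTop.1 (hatOsc_continuous (ε := ε) hH w.continuous) (η / 2)
    (by positivity)
  refine ⟨n₀, fun n hn => ?_⟩
  have h0 : ∀ f : ℝ → ℝ, 0 ≤ hatOsc H ε (n + 1) f := fun f => Finset.sum_nonneg fun j _ =>
    integral_nonneg fun ξ => mul_nonneg (hat_nonneg _ _ _) (abs_nonneg _)
  have h1 := hn₀ n hn
  have h2 := hatOsc_le hH n.succ_pos hu hw2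
  simp only [Real.norm_eq_abs] at hw1
  rw [Real.dist_eq, sub_zero, abs_of_nonneg (h0 _)] at *
  linarith

/-- The discretized truncated entropy. -/
def hatEnt (H : ℝ → ℝ) (ε δ : ℝ) (N : ℕ) (μ : Measure ℝ) : ℝ :=
  ∑ j ∈ Finset.range (N + 1), (∫ ξ, hat N j ξ ∂(gam H ε)) * truncEnt δ (hatAvg H ε N j μ)

/-- `truncEnt δ` is Lipschitz with constant `log (1 / δ)`, so the error is at most that constant
times the mean oscillation of the density. Integrability of `u` suffices; no entropy bound enters.
-/
lemma tendsto_hatEnt (hH : IsDoubleWell H) (hδ : δ ∈ Ioo (0 : ℝ) 1) {μ : Measure ℝ} {u : ℝ → ℝ}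
    (hu : Integrable u (gam H ε))
    (hμ : ∀ j N, ∫ ξ, hat N j ξ ∂μ = ∫ ξ, hat N j ξ * u ξ ∂(gam H ε)) :
    Tendsto (fun n => hatEnt H ε δ (n + 1) μ) atTop (𝓝 (∫ ξ, truncEnt δ (u ξ) ∂(gam H ε))) := by
  have := isProbabilityMeasure_gam hH ε
  have hA : 0 ≤ Real.log (1 / δ) := (abs_nonneg _).trans (abs_truncLog_le hδ 0)
  have hφi : Integrable (fun ξ => truncEnt δ (u ξ)) (gam H ε) := by
    have h1 : Integrable (fun ξ => truncEnt δ (u ξ) - truncEnt δ 0) (gam H ε) := by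
      refine (hu.norm.const_mul (Real.log (1 / δ))).mono'
        (((lipschitzWith_truncEnt hδ).continuous.comp_aestronglyMeasurable hu.1).sub
          aestronglyMeasurable_const) (Eventually.of_forall fun ξ => ?_)
      simpa using abs_truncEnt_sub_le hδ (u ξ) 0
    refine (h1.add (integrable_const (truncEnt δ 0))).congr (Eventually.of_forall fun ξ => ?_)
    simp
  rw [tendsto_iff_dist_tendsto_zero]
  have hlim := (tendsto_hatOsc hH hu).const_mul (Real.log (1 / δ))
  rw [mul_zero] at hlim
  refine squeeze_zero (fun _ => dist_nonneg) (fun n => ?_) hlim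
  rw [Real.dist_eq, hatEnt, ← sum_integral_hat_mul H ε (n + 1) hφi, ← Finset.sum_sub_distrib,
    hatOsc, Finset.mul_sum]
  refine (Finset.abs_sum_le_sum_abs _ _).trans (Finset.sum_le_sum fun j hj => ?_)
  set a := hatAvg H ε (n + 1) j μ with ha
  rw [← hμ j (n + 1), ← integral_mul_const, ← integral_sub ((integrable_hat _ j _).mul_const _)
    (hφi.hat_mul _ j), ← integral_const_mul]
  refine (abs_integral_le_integral_abs).trans (integral_mono ?_ ?_ fun ξ => ?_)
  · exact (((integrable_hat _ j _).mul_const _).sub (hφi.hat_mul _ j)).abs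
  · exact (((hu.sub (integrable_const _)).abs).hat_mul _ j).const_mul _
  · simp only [← mul_sub, abs_mul, abs_of_nonneg (hat_nonneg _ _ _)]
    rw [mul_left_comm]
    refine mul_le_mul_of_nonneg_left ?_ (hat_nonneg _ _ _)
    rw [abs_sub_comm]
    exact abs_truncEnt_sub_le hδ _ _

end EntropyDiscretization

/-! ### The chain rule for the entropy along curves of finite action -/

section ChainRule

variable {H : ℝ → ℝ} {ε δ T : ℝ} {N : ℕ} {ρ : ℝ → FiniteMeasure ℝ} {v : ℝ → ℝ → ℝ}

lemma IsCurve.aemeasurable_lintegral (h : IsCurve T ρ) {f : ℝ → ℝ → ℝ≥0∞}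
    (hf : Measurable (Function.uncurry f)) :
    AEMeasurable (fun t => ∫⁻ ξ, f t ξ ∂(ρ t : Measure ℝ)) (volume.restrict (Ioo 0 T)) := by
  refine ⟨_, Measurable.lintegral_kernel_prod_right (κ := h.kernel) hf, ?_⟩
  filter_upwards [ae_restrict_mem measurableSet_Ioo] with t ht
  rw [h.kernel_apply (Ioo_subset_Icc_self ht)]

/-- A curve with finite action, its velocity field and the square roots of its densities. -/
structure IsFiniteAction (H : ℝ → ℝ) (ε T : ℝ) (ρ : ℝ → FiniteMeasure ℝ) (v P Q : ℝ → ℝ → ℝ) :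
    Prop where
  curve : IsCurve T ρ
  velocity : IsVelocity T ρ v
  lintegral_sq : ∫⁻ t in Ioo 0 T, ∫⁻ ξ, ENNReal.ofReal (v t ξ ^ 2) ∂(ρ t : Measure ℝ) < ⊤
  lintegral_fisher : ∫⁻ t in Ioo 0 T, fisher H ε (ρ t : Measure ℝ) < ⊤
  root : ∀ t, fisher H ε (ρ t : Measure ℝ) < ⊤ → IsRoot H ε (ρ t : Measure ℝ) (P t) (Q t)

namespace IsFiniteAction

variable {P Q : ℝ → ℝ → ℝ}

lemma ae_fisher_lt_top (h : IsFiniteAction H ε T ρ v P Q) (hH : IsDoubleWell H) :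
    ∀ᵐ t ∂(volume.restrict (Ioo 0 T)), fisher H ε (ρ t : Measure ℝ) < ⊤ :=
  ae_lt_top' (h.curve.aemeasurable_fisher hH ε) h.lintegral_fisher.ne

lemma integrableOn_fisher (h : IsFiniteAction H ε T ρ v P Q) (hH : IsDoubleWell H) :
    IntegrableOn (fun t => (fisher H ε (ρ t : Measure ℝ)).toReal) (Ioo 0 T) :=
  integrable_toReal_of_lintegral_ne_top (h.curve.aemeasurable_fisher hH ε) h.lintegral_fisher.ne

lemma aemeasurable_lintegral_sq (h : IsFiniteAction H ε T ρ v P Q) :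
    AEMeasurable (fun t => ∫⁻ ξ, ENNReal.ofReal (v t ξ ^ 2) ∂(ρ t : Measure ℝ))
      (volume.restrict (Ioo 0 T)) :=
  h.curve.aemeasurable_lintegral (f := fun t ξ => ENNReal.ofReal (v t ξ ^ 2))
    (h.velocity.measurable.pow_const 2).ennreal_ofReal

lemma measurable_slice (h : IsFiniteAction H ε T ρ v P Q) (t : ℝ) : Measurable (v t) :=
  h.velocity.measurable.comp measurable_prodMk_left

lemma ae_integrable_sq (h : IsFiniteAction H ε T ρ v P Q) :
    ∀ᵐ t ∂(volume.restrict (Ioo 0 T)), Integrable (fun ξ => v t ξ ^ 2) (ρ t : Measure ℝ) := by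
  filter_upwards [ae_lt_top' h.aemeasurable_lintegral_sq h.lintegral_sq.ne] with t ht
  refine ⟨((h.measurable_slice t).pow_const 2).aestronglyMeasurable, ?_⟩
  rwa [hasFiniteIntegral_iff_ofReal (Eventually.of_forall fun _ => sq_nonneg _)]

lemma integrableOn_sq (h : IsFiniteAction H ε T ρ v P Q) :
    IntegrableOn (fun t => ∫ ξ, v t ξ ^ 2 ∂(ρ t : Measure ℝ)) (Ioo 0 T) := by
  refine (integrable_toReal_of_lintegral_ne_top h.aemeasurable_lintegral_sq
    h.lintegral_sq.ne).congr (Eventually.of_forall fun t => ?_)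
  simp only
  rw [integral_eq_lintegral_of_nonneg_ae (Eventually.of_forall fun _ => sq_nonneg _)
    ((h.measurable_slice t).pow_const 2).aestronglyMeasurable]

lemma memLp_mul (h : IsFiniteAction H ε T ρ v P Q) {t : ℝ}
    (hf : fisher H ε (ρ t : Measure ℝ) < ⊤)
    (hv : Integrable (fun ξ => v t ξ ^ 2) (ρ t : Measure ℝ)) :
    MemLp (fun ξ => P t ξ * v t ξ) 2 (gam H ε) ∧
      ∫ ξ, (P t ξ * v t ξ) ^ 2 ∂(gam H ε) = ∫ ξ, v t ξ ^ 2 ∂(ρ t : Measure ℝ) := by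
  have hr := h.root t hf
  have hpm := aemeasurable_gam_of_continuousOn (H := H) hr.continuousOn ε
  constructor
  · refine (memLp_two_iff_integrable_sq
      (hpm.mul (h.measurable_slice t).aemeasurable).aestronglyMeasurable).2 ?_
    simp only [Pi.mul_apply, mul_pow]
    rw [hr.eq] at hv
    exact (integrable_withDensity_gam (hr.continuousOn.pow 2) (fun _ _ => sq_nonneg _) _).1 hv
  · rw [hr.integral_sq]
    simp only [mul_pow]

lemma abs_pairing_le {μ : Measure ℝ} {a b : ℝ → ℝ} (ha : MemLp a 2 μ) (hb : MemLp b 2 μ) :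
    |∫ ξ, a ξ * b ξ ∂μ| ≤ 1 / 2 * (∫ ξ, a ξ ^ 2 ∂μ) + 1 / 2 * ∫ ξ, b ξ ^ 2 ∂μ := by
  have h1 := ha.integrable_sq
  have h2 := hb.integrable_sq
  rw [← integral_const_mul, ← integral_const_mul, ← integral_add (h1.const_mul _) (h2.const_mul _)]
  refine abs_integral_le_integral_abs.trans (integral_mono (ha.integrable_mul hb).abs
    ((h1.const_mul _).add (h2.const_mul _)) fun ξ => ?_)
  simp only
  rw [abs_le]
  constructor <;> nlinarith [sq_nonneg (a ξ - b ξ), sq_nonneg (a ξ + b ξ)]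

/-- The time derivative of the discretized truncated entropy. -/
def hatEntRate (H : ℝ → ℝ) (ε δ : ℝ) (N : ℕ) (ρ : ℝ → FiniteMeasure ℝ) (v : ℝ → ℝ → ℝ) (t : ℝ) :
    ℝ := ∑ j ∈ Finset.range (N + 1), truncLog δ (hatAvg H ε N j (ρ t : Measure ℝ)) *
      ∫ ξ, hatSlope N j ξ * v t ξ ∂(ρ t : Measure ℝ)

/-- The discretized entropy depends on finitely many pairings of the curve with hats. These are
absolutely continuous in time by the continuity equation, and `truncEnt` is Lipschitz and `C¹`. -/
lemma hasW11Deriv_hatEnt (h : IsFiniteAction H ε T ρ v P Q) (hH : IsDoubleWell H)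
    (hδ : δ ∈ Ioo (0 : ℝ) 1) (hN : 0 < N) :
    HasW11Deriv 0 T (fun t => hatEnt H ε δ N (ρ t : Measure ℝ)) (hatEntRate H ε δ N ρ v) := by
  have hT := h.curve.pos.le
  have key : ∀ j : Fin (N + 1), HasW11Deriv 0 T
      (fun t => (∫ ξ, hat N j ξ ∂(gam H ε)) * truncEnt δ (hatAvg H ε N j (ρ t : Measure ℝ)))
      (fun t => truncLog δ (hatAvg H ε N j (ρ t : Measure ℝ)) *
        ∫ ξ, hatSlope N j ξ * v t ξ ∂(ρ t : Measure ℝ)) := fun j => by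
    have hm := integral_hat_pos hH ε hN (Nat.lt_succ_iff.1 j.2)
    have h1 := (h.velocity.hasW11Deriv h.curve (hasW11Deriv_hat hN j) (measurable_hatSlope N j)
      fun ξ _ => abs_hatSlope_le N j ξ).const_mul (1 / ∫ ξ, hat N j ξ ∂(gam H ε))
    have h2 := (h1.comp hT (lipschitzWith_truncEnt hδ).lipschitzOnWith (mapsTo_univ _ _)
      fun y _ => hasDerivAt_truncEnt hδ.1 y).const_mul (∫ ξ, hat N j ξ ∂(gam H ε))
    have e : ∀ t, hatAvg H ε N j (ρ t : Measure ℝ) =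
        1 / (∫ ξ, hat N j ξ ∂(gam H ε)) * ∫ ξ, hat N j ξ ∂(ρ t : Measure ℝ) := fun t => by
      rw [hatAvg]; ring
    simp only [e]
    refine h2.congr_deriv hT (Eventually.of_forall fun t => ?_)
    field_simp
  have h3 := HasW11Deriv.sum Finset.univ key
  unfold hatEnt hatEntRate
  simp only [Finset.sum_range]
  exact h3

/-- The sum over the hats assembles `entFlux`. The density `P ^ 2` is split evenly, so that one
factor `P` tempers the slope and the other one puts the velocity into `L²(γ_ε)`. -/
lemma hatEntRate_eq (h : IsFiniteAction H ε T ρ v P Q) {t : ℝ}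
    (hf : fisher H ε (ρ t : Measure ℝ) < ⊤)
    (hv : Integrable (fun ξ => v t ξ ^ 2) (ρ t : Measure ℝ)) :
    hatEntRate H ε δ N ρ v t = ∫ ξ, P t ξ * entFlux H ε δ N (ρ t : Measure ℝ) ξ *
      (P t ξ * v t ξ) ∂(gam H ε) := by
  have hv1 : Integrable (v t) (ρ t : Measure ℝ) :=
    ((memLp_two_iff_integrable_sq (h.measurable_slice t).aestronglyMeasurable).2 hv).integrable
      (by norm_num)
  have hi : ∀ j, Integrable (fun ξ => hatSlope N j ξ * v t ξ) (ρ t : Measure ℝ) := fun j =>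
    hv1.bdd_mul (c := N) (measurable_hatSlope N j).aestronglyMeasurable
      (Eventually.of_forall fun ξ => abs_hatSlope_le N j ξ)
  have e : hatEntRate H ε δ N ρ v t =
      ∫ ξ, entFlux H ε δ N (ρ t : Measure ℝ) ξ * v t ξ ∂(ρ t : Measure ℝ) := by
    simp only [hatEntRate, entFlux, Finset.sum_mul, ← integral_const_mul]
    rw [integral_finsetSum _ fun j _ => by
      simpa only [mul_assoc] using (hi j).const_mul (truncLog δ (hatAvg H ε N j (ρ t : Measure ℝ)))]
    simp only [mul_assoc]
  rw [e, (h.root t hf).integral_sq]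
  refine integral_congr_ae (Eventually.of_forall fun ξ => ?_)
  simp only
  ring

/-- The limit of the time derivatives of the discretized truncated entropy. -/
def truncRate (H : ℝ → ℝ) (ε δ : ℝ) (v P Q : ℝ → ℝ → ℝ) (t : ℝ) : ℝ :=
  ∫ ξ, P t ξ * truncSlope δ (P t ξ) * (Q t ξ * (P t ξ * v t ξ)) ∂(gam H ε)

/-- The bound uses the weighted estimate for `P * entFlux`, whose constant depends neither on the
time nor on the grid. The limit uses weak convergence of the unweighted slopes against the fixed
function `P ^ 2 * v`. -/
lemma tendsto_hatEntRate (h : IsFiniteAction H ε T ρ v P Q) (hH : IsDoubleWell H)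
    (hδ : δ ∈ Ioo (0 : ℝ) 1) :
    ∃ C : ℝ, ∀ t, fisher H ε (ρ t : Measure ℝ) < ⊤ →
      Integrable (fun ξ => v t ξ ^ 2) (ρ t : Measure ℝ) →
      (∀ n : ℕ, |hatEntRate H ε δ (n + 1) ρ v t| ≤ C * (fisher H ε (ρ t : Measure ℝ)).toReal +
        1 / 2 * ∫ ξ, v t ξ ^ 2 ∂(ρ t : Measure ℝ)) ∧
      Tendsto (fun n : ℕ => hatEntRate H ε δ (n + 1) ρ v t) atTop
        (𝓝 (truncRate H ε δ v P Q t)) := by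
  obtain ⟨C, hC0, hC⟩ := exists_sq_bound hH ε
  refine ⟨1 / 2 * ((4 + 4 * Real.log (1 / δ)) ^ 2 * C), fun t hf hv => ?_⟩
  have hr := h.root t hf
  obtain ⟨hw, hweq⟩ := h.memLp_mul hf hv
  have hpm := aemeasurable_gam_of_continuousOn (H := H) hr.continuousOn ε
  constructor
  · intro n
    have hA : 0 ≤ Real.log (1 / δ) := (abs_nonneg _).trans (abs_truncLog_le hδ 0)
    have hb := hC (n + 1) n.succ_pos (Q t) (hr.memLp hH hf)
      (fun ξ => P t ξ * entFlux H ε δ (n + 1) (ρ t : Measure ℝ) ξ) (4 + 4 * Real.log (1 / δ))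
      (hpm.mul (measurable_entFlux H ε δ _ _).aemeasurable).aestronglyMeasurable (by positivity)
      fun ξ hξ => (hr.abs_entFlux_le hH hδ n.succ_pos hξ).2
    rw [h.hatEntRate_eq hf hv, hr.toReal_fisher hH, ← hweq]
    refine (abs_pairing_le hb.1 hw).trans ?_
    have := hb.2
    linarith
  -- At a fixed time the root is bounded, so its second factor can be moved into the test function
  -- without leaving `L²(γ_ε)`.
  · obtain ⟨K, hK⟩ := isCompact_Icc.exists_bound_of_continuousOn hr.continuousOn
    have hw2 : MemLp (fun ξ => P t ξ * (P t ξ * v t ξ)) 2 (gam H ε) :=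
      hw.of_le_mul (c := K) (hpm.aestronglyMeasurable.mul hw.1)
        ((ae_gam_mem H ε).mono fun ξ hξ => by
          rw [norm_mul]
          exact mul_le_mul_of_nonneg_right (hK ξ hξ) (norm_nonneg _))
    have h1 := hr.tendsto_entFlux hH hδ hf hw2
    have e : ∫ ξ, truncSlope δ (P t ξ) * Q t ξ * (P t ξ * (P t ξ * v t ξ)) ∂(gam H ε) =
        truncRate H ε δ v P Q t :=
      integral_congr_ae (Eventually.of_forall fun ξ => by simp only; ring)
    rw [e] at h1
    refine h1.congr fun n => ?_
    rw [h.hatEntRate_eq hf hv]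
    exact integral_congr_ae (Eventually.of_forall fun ξ => by simp only; ring)

lemma ae_Ioc_of_Ioo {p : ℝ → Prop} (h : ∀ᵐ t ∂(volume.restrict (Ioo 0 T)), p t) {s t : ℝ}
    (hs : 0 ≤ s) (ht : t ≤ T) : ∀ᵐ r ∂(volume.restrict (Ioc s t)), p r := by
  rw [restrict_Ioo_eq_restrict_Ioc] at h
  exact ae_restrict_of_ae_restrict_of_subset (Ioc_subset_Ioc hs ht) h

lemma integrableOn_Ioc_of_Ioo {f : ℝ → ℝ} (h : IntegrableOn f (Ioo 0 T)) {s t : ℝ}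
    (hs : 0 ≤ s) (ht : t ≤ T) : IntegrableOn f (Ioc s t) := by
  rw [IntegrableOn, restrict_Ioo_eq_restrict_Ioc] at h
  exact IntegrableOn.mono_set h (Ioc_subset_Ioc hs ht)

/-- `P * truncSlope δ P` is at most `2` whatever `δ` is, so the same bound dominates while the
truncation is removed. -/
lemma truncRate_bound (h : IsFiniteAction H ε T ρ v P Q) (hH : IsDoubleWell H)
    (hδ : δ ∈ Ioo (0 : ℝ) 1) {t : ℝ} (hf : fisher H ε (ρ t : Measure ℝ) < ⊤)
    (hv : Integrable (fun ξ => v t ξ ^ 2) (ρ t : Measure ℝ)) :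
    |truncRate H ε δ v P Q t| ≤ (fisher H ε (ρ t : Measure ℝ)).toReal +
        ∫ ξ, v t ξ ^ 2 ∂(ρ t : Measure ℝ) := by
  have hr := h.root t hf
  have hq := hr.memLp hH hf
  obtain ⟨hw, hweq⟩ := h.memLp_mul hf hv
  rw [hr.toReal_fisher hH, ← hweq, ← integral_add hq.integrable_sq hw.integrable_sq]
  refine abs_integral_le_integral_abs.trans (integral_mono_of_nonneg
    (Eventually.of_forall fun _ => abs_nonneg _) (hq.integrable_sq.add hw.integrable_sq)
    ((ae_gam_mem H ε).mono fun ξ hξ => ?_))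
  have h1 := truncSlope_bounds hδ (hr.nonneg ξ hξ)
  have h2 : 0 ≤ P t ξ * truncSlope δ (P t ξ) := mul_nonneg (hr.nonneg ξ hξ) h1.1
  simp only
  rw [abs_mul, abs_of_nonneg h2]
  have h3 : |Q t ξ * (P t ξ * v t ξ)| ≤ 1 / 2 * (Q t ξ ^ 2 + (P t ξ * v t ξ) ^ 2) := by
    rw [abs_le]
    constructor <;>
      nlinarith [sq_nonneg (Q t ξ - P t ξ * v t ξ), sq_nonneg (Q t ξ + P t ξ * v t ξ)]
  nlinarith [abs_nonneg (Q t ξ * (P t ξ * v t ξ))]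

lemma aestronglyMeasurable_truncRate (h : IsFiniteAction H ε T ρ v P Q) (hH : IsDoubleWell H)
    (hδ : δ ∈ Ioo (0 : ℝ) 1) :
    AEStronglyMeasurable (truncRate H ε δ v P Q) (volume.restrict (Ioo 0 T)) := by
  obtain ⟨C, hC⟩ := h.tendsto_hatEntRate hH hδ
  refine aestronglyMeasurable_of_tendsto_ae atTop (f := fun (n : ℕ) => hatEntRate H ε δ (n + 1) ρ v)
    (fun n => ?_) ?_
  · have := (h.hasW11Deriv_hatEnt (δ := δ) hH hδ n.succ_pos).integrableOn h.curve.pos.le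
    exact (this.mono_set Ioo_subset_Icc_self).1
  · filter_upwards [h.ae_fisher_lt_top hH, h.ae_integrable_sq] with t hf hv
    exact (hC t hf hv).2

lemma truncEnt_sub_eq (h : IsFiniteAction H ε T ρ v P Q) (hH : IsDoubleWell H)
    (hδ : δ ∈ Ioo (0 : ℝ) 1) {s t : ℝ} (hs : 0 ≤ s) (hst : s ≤ t) (ht : t ≤ T) {Φs Φt : ℝ}
    (hΦs : Tendsto (fun n : ℕ => hatEnt H ε δ (n + 1) (ρ s : Measure ℝ)) atTop (𝓝 Φs))
    (hΦt : Tendsto (fun n : ℕ => hatEnt H ε δ (n + 1) (ρ t : Measure ℝ)) atTop (𝓝 Φt)) :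
    Φt - Φs = ∫ r in s..t, truncRate H ε δ v P Q r := by
  obtain ⟨C, hC⟩ := h.tendsto_hatEntRate hH hδ
  have hae := ae_Ioc_of_Ioo ((h.ae_fisher_lt_top hH).and h.ae_integrable_sq) hs ht
  rw [intervalIntegral.integral_of_le hst]
  refine tendsto_nhds_unique (hΦt.sub hΦs) ?_
  have hlim : Tendsto (fun n : ℕ => ∫ r in Ioc s t, hatEntRate H ε δ (n + 1) ρ v r) atTop
      (𝓝 (∫ r in Ioc s t, truncRate H ε δ v P Q r)) := by
    refine tendsto_integral_of_dominated_convergence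
      (fun r => C * (fisher H ε (ρ r : Measure ℝ)).toReal +
        1 / 2 * ∫ ξ, v r ξ ^ 2 ∂(ρ r : Measure ℝ)) (fun n => ?_) ?_ (fun n => ?_) ?_
    · have := (h.hasW11Deriv_hatEnt (δ := δ) hH hδ n.succ_pos).integrableOn h.curve.pos.le
      exact (this.mono_set (Ioc_subset_Icc_self.trans (Icc_subset_Icc hs ht))).1
    · exact ((integrableOn_Ioc_of_Ioo (h.integrableOn_fisher hH) hs ht).const_mul _).add
        ((integrableOn_Ioc_of_Ioo h.integrableOn_sq hs ht).const_mul _)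
    · filter_upwards [hae] with r hr
      exact (hC r hr.1 hr.2).1 n
    · filter_upwards [hae] with r hr
      exact (hC r hr.1 hr.2).2
  refine hlim.congr fun n => ?_
  rw [(h.hasW11Deriv_hatEnt (δ := δ) hH hδ n.succ_pos).sub_eq ⟨hs, hst.trans ht⟩ ⟨hs.trans hst, ht⟩,
    intervalIntegral.integral_of_le hst]

/-- The time derivative of the entropy. -/
def entRate (H : ℝ → ℝ) (ε : ℝ) (v P Q : ℝ → ℝ → ℝ) (t : ℝ) : ℝ :=
  ∫ ξ, 2 * (Q t ξ * (P t ξ * v t ξ)) ∂(gam H ε)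

lemma tendsto_truncRate (h : IsFiniteAction H ε T ρ v P Q) (hH : IsDoubleWell H) {δ : ℕ → ℝ}
    (hδ : Tendsto δ atTop (𝓝 0)) (hδ' : ∀ n, δ n ∈ Ioo (0 : ℝ) 1) {t : ℝ}
    (hf : fisher H ε (ρ t : Measure ℝ) < ⊤)
    (hv : Integrable (fun ξ => v t ξ ^ 2) (ρ t : Measure ℝ)) :
    Tendsto (fun n => truncRate H ε (δ n) v P Q t) atTop (𝓝 (entRate H ε v P Q t)) := by
  have hr := h.root t hf
  have hq := hr.memLp hH hf
  obtain ⟨hw, -⟩ := h.memLp_mul hf hv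
  have hpm := aemeasurable_gam_of_continuousOn (H := H) hr.continuousOn ε
  refine tendsto_integral_of_dominated_convergence (fun ξ => 2 * |Q t ξ * (P t ξ * v t ξ)|)
    (fun n => ?_) ((hq.integrable_mul hw).abs.const_mul 2) (fun n => ?_) ?_
  · have hts : Measurable (truncSlope (δ n)) := by unfold truncSlope; fun_prop
    exact ((hpm.mul (hts.comp_aemeasurable hpm)).aestronglyMeasurable).mul
      (hq.1.mul hw.1)
  · filter_upwards [ae_gam_mem H ε] with ξ hξ
    have h1 := truncSlope_bounds (hδ' n) (hr.nonneg ξ hξ)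
    rw [norm_mul, Real.norm_eq_abs, Real.norm_eq_abs,
      abs_of_nonneg (mul_nonneg (hr.nonneg ξ hξ) h1.1)]
    exact mul_le_mul_of_nonneg_right h1.2.2 (abs_nonneg _)
  · refine Eventually.of_forall fun ξ => ?_
    have h1 := (tendsto_truncSlope hδ (P t ξ)).mul_const (Q t ξ * (P t ξ * v t ξ))
    convert h1 using 2
    split_ifs with h0
    · simp [h0]
    · rfl

lemma integrableOn_entRate (h : IsFiniteAction H ε T ρ v P Q) (hH : IsDoubleWell H) :
    IntegrableOn (entRate H ε v P Q) (Ioo 0 T) := by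
  have hδ : Tendsto (fun n : ℕ => 1 / ((n : ℝ) + 2)) atTop (𝓝 0) := by
    have := tendsto_const_div_atTop_nhds_zero_nat (1 : ℝ)
    simpa using (tendsto_add_atTop_iff_nat 2).2 this
  have hδ' : ∀ n : ℕ, 1 / ((n : ℝ) + 2) ∈ Ioo (0 : ℝ) 1 := fun n =>
    ⟨by positivity, by rw [div_lt_one (by positivity)]; linarith [Nat.cast_nonneg (α := ℝ) n]⟩
  have hlim : ∀ᵐ t ∂(volume.restrict (Ioo 0 T)), Tendsto
      (fun n : ℕ => truncRate H ε (1 / ((n : ℝ) + 2)) v P Q t) atTop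
      (𝓝 (entRate H ε v P Q t)) := by
    filter_upwards [h.ae_fisher_lt_top hH, h.ae_integrable_sq] with t hf hv
    exact h.tendsto_truncRate hH hδ hδ' hf hv
  refine ((h.integrableOn_fisher hH).add h.integrableOn_sq).mono'
    (aestronglyMeasurable_of_tendsto_ae atTop
      (fun n : ℕ => h.aestronglyMeasurable_truncRate hH (hδ' n)) hlim) ?_
  filter_upwards [h.ae_fisher_lt_top hH, h.ae_integrable_sq, hlim] with t hf hv hl
  exact le_of_tendsto' hl.norm fun n => h.truncRate_bound hH (hδ' n) hf hv

/-- The chain rule for the entropy along curves of finite action. -/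
lemma entropy_sub_eq (h : IsFiniteAction H ε T ρ v P Q) (hH : IsDoubleWell H) {s t : ℝ}
    (hs : 0 ≤ s) (hst : s ≤ t) (ht : t ≤ T) {u w : ℝ → ℝ}
    (hu0 : ∀ ξ, 0 ≤ u ξ) (hw0 : ∀ ξ, 0 ≤ w ξ)
    (hu : Integrable u (gam H ε)) (hw : Integrable w (gam H ε))
    (hul : Integrable (fun ξ => u ξ * Real.log (u ξ)) (gam H ε))
    (hwl : Integrable (fun ξ => w ξ * Real.log (w ξ)) (gam H ε))
    (hρs : (ρ s : Measure ℝ) = (gam H ε).withDensity fun ξ => ENNReal.ofReal (u ξ))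
    (hρt : (ρ t : Measure ℝ) = (gam H ε).withDensity fun ξ => ENNReal.ofReal (w ξ)) :
    ∫ ξ, w ξ * Real.log (w ξ) ∂(gam H ε) - ∫ ξ, u ξ * Real.log (u ξ) ∂(gam H ε) =
      ∫ r in s..t, entRate H ε v P Q r := by
  have := isProbabilityMeasure_gam hH ε
  have hδ : Tendsto (fun n : ℕ => 1 / ((n : ℝ) + 2)) atTop (𝓝 0) := by
    have := tendsto_const_div_atTop_nhds_zero_nat (1 : ℝ)
    simpa using (tendsto_add_atTop_iff_nat 2).2 this
  have hδ' : ∀ n : ℕ, 1 / ((n : ℝ) + 2) ∈ Ioo (0 : ℝ) 1 := fun n =>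
    ⟨by positivity, by rw [div_lt_one (by positivity)]; linarith [Nat.cast_nonneg (α := ℝ) n]⟩
  have hint : ∀ {μ : Measure ℝ} {f : ℝ → ℝ}, (∀ ξ, 0 ≤ f ξ) → Integrable f (gam H ε) →
      μ = (gam H ε).withDensity (fun ξ => ENNReal.ofReal (f ξ)) → ∀ φ : ℝ → ℝ,
      ∫ ξ, φ ξ ∂μ = ∫ ξ, φ ξ * f ξ ∂(gam H ε) := fun {μ f} hf0 hf hμ φ => by
    rw [hμ, integral_withDensity_eq_integral_toReal_smul₀ hf.aemeasurable.ennreal_ofReal (by simp)]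
    refine integral_congr_ae (Eventually.of_forall fun ξ => ?_)
    simp [ENNReal.toReal_ofReal (hf0 ξ), mul_comm]
  -- The truncated entropies converge to the integrals of `u log u - u + 1`; the additional linear
  -- terms cancel because both measures have the same mass.
  have hmass : ∫ ξ, w ξ ∂(gam H ε) = ∫ ξ, u ξ ∂(gam H ε) := by
    have e1 := hint hu0 hu hρs fun _ => 1
    have e2 := hint hw0 hw hρt fun _ => 1
    simp only [one_mul, integral_const, smul_eq_mul, mul_one] at e1 e2
    rw [← e1, ← e2]
    have e3 := h.velocity.mass_eq h.curve ⟨hs, hst.trans ht⟩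
    have e4 := h.velocity.mass_eq h.curve ⟨hs.trans hst, ht⟩
    have e5 := congrArg NNReal.toReal (e4.trans e3.symm)
    exact e5
  have hent : ∀ {f : ℝ → ℝ}, (∀ ξ, 0 ≤ f ξ) → Integrable f (gam H ε) →
      Integrable (fun ξ => f ξ * Real.log (f ξ)) (gam H ε) →
      Tendsto (fun n : ℕ => ∫ ξ, truncEnt (1 / ((n : ℝ) + 2)) (f ξ) ∂(gam H ε)) atTop
        (𝓝 (∫ ξ, f ξ * Real.log (f ξ) ∂(gam H ε) - ∫ ξ, f ξ ∂(gam H ε) + 1)) :=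
    fun {f} hf0 hf hfl => by
      have hb := (hfl.sub hf).add (integrable_const (1 : ℝ))
      have e : ∫ ξ, f ξ * Real.log (f ξ) ∂(gam H ε) - ∫ ξ, f ξ ∂(gam H ε) + 1 =
          ∫ ξ, (f ξ * Real.log (f ξ) - f ξ + 1) ∂(gam H ε) := by
        rw [integral_add (f := fun ξ => f ξ * Real.log (f ξ) - f ξ) (g := fun _ => (1 : ℝ))
          (hfl.sub hf) (integrable_const _), integral_sub hfl hf]
        simp
      rw [e]
      refine tendsto_integral_of_dominated_convergence _ (fun n => ?_) hb (fun n => ?_)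
        (Eventually.of_forall fun ξ => tendsto_truncEnt hδ hδ' (hf0 ξ))
      · exact (lipschitzWith_truncEnt (hδ' n)).continuous.comp_aestronglyMeasurable hf.1
      · refine Eventually.of_forall fun ξ => ?_
        have h1 := truncEnt_nonneg_le (hδ' n) (hf0 ξ)
        rw [Real.norm_of_nonneg h1.1]
        exact h1.2
  have hlim : Tendsto (fun n : ℕ => ∫ r in s..t, truncRate H ε (1 / ((n : ℝ) + 2)) v P Q r) atTop
      (𝓝 (∫ r in s..t, entRate H ε v P Q r)) := by
    have hae := ae_Ioc_of_Ioo ((h.ae_fisher_lt_top hH).and h.ae_integrable_sq) hs ht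
    simp only [intervalIntegral.integral_of_le hst]
    refine tendsto_integral_of_dominated_convergence
      (fun r => (fisher H ε (ρ r : Measure ℝ)).toReal + ∫ ξ, v r ξ ^ 2 ∂(ρ r : Measure ℝ))
      (fun n => ?_) ?_ (fun n => ?_) ?_
    · have := h.aestronglyMeasurable_truncRate hH (hδ' n)
      rw [restrict_Ioo_eq_restrict_Ioc] at this
      exact this.mono_set (Ioc_subset_Ioc hs ht)
    · exact (integrableOn_Ioc_of_Ioo (h.integrableOn_fisher hH) hs ht).add
        (integrableOn_Ioc_of_Ioo h.integrableOn_sq hs ht)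
    · filter_upwards [hae] with r hr
      exact h.truncRate_bound hH (hδ' n) hr.1 hr.2
    · filter_upwards [hae] with r hr
      exact h.tendsto_truncRate hH hδ hδ' hr.1 hr.2
  have e1 := (hent hw0 hw hwl).sub (hent hu0 hu hul)
  have e2 := tendsto_nhds_unique (e1.congr fun n => h.truncEnt_sub_eq hH (hδ' n) hs hst ht
    (tendsto_hatEnt hH (hδ' n) hu fun j N => hint hu0 hu hρs _)
    (tendsto_hatEnt hH (hδ' n) hw fun j N => hint hw0 hw hρt _)) hlim
  rw [hmass] at e2
  linarith

end IsFiniteAction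

end ChainRule

/-! ### From zero action to the gradient-flow equation -/

section Solution

variable {H : ℝ → ℝ} {ε T : ℝ} {ρ : ℝ → FiniteMeasure ℝ} {v : ℝ → ℝ → ℝ}

lemma energy_eq_of_withDensity (hH : IsDoubleWell H) {μ : FiniteMeasure ℝ} {u : ℝ → ℝ}
    (hu0 : ∀ ξ, 0 ≤ u ξ) (hu : Integrable u (gam H ε))
    (hul : Integrable (fun ξ => u ξ * Real.log (u ξ)) (gam H ε))
    (hμ : (μ : Measure ℝ) = (gam H ε).withDensity fun ξ => ENNReal.ofReal (u ξ)) :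
    energy H ε μ = ((∫ ξ, u ξ * Real.log (u ξ) ∂(gam H ε) - μ.mass * Real.log μ.mass : ℝ) : EReal) := by
  have := isProbabilityMeasure_gam hH ε
  have h1 : (fun ξ => ((μ : Measure ℝ).rnDeriv (gam H ε) ξ).toReal) =ᵐ[gam H ε] u := by
    rw [hμ]
    filter_upwards [Measure.rnDeriv_withDensity₀ (gam H ε) hu.aemeasurable.ennreal_ofReal] with ξ hξ
    rw [hξ, ENNReal.toReal_ofReal (hu0 ξ)]
  have h2 : (fun ξ => ((μ : Measure ℝ).rnDeriv (gam H ε) ξ).toReal *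
      Real.log ((μ : Measure ℝ).rnDeriv (gam H ε) ξ).toReal) =ᵐ[gam H ε]
      fun ξ => u ξ * Real.log (u ξ) := h1.mono fun ξ hξ => by simp only at hξ; simp only [hξ]
  have hac : (μ : Measure ℝ) ≪ gam H ε := hμ ▸ withDensity_absolutelyContinuous _ _
  rw [energy, if_pos ⟨hac, hul.congr h2.symm⟩, integral_congr_ae h2]

lemma exists_density_of_energy_lt_top (hH : IsDoubleWell H) {μ : FiniteMeasure ℝ}
    (h : energy H ε μ < ⊤) : ∃ u : ℝ → ℝ, (∀ ξ, 0 ≤ u ξ) ∧ Integrable u (gam H ε) ∧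
      Integrable (fun ξ => u ξ * Real.log (u ξ)) (gam H ε) ∧
      (μ : Measure ℝ) = (gam H ε).withDensity (fun ξ => ENNReal.ofReal (u ξ)) ∧
      energy H ε μ =
        ((∫ ξ, u ξ * Real.log (u ξ) ∂(gam H ε) - μ.mass * Real.log μ.mass : ℝ) : EReal) := by
  have := isProbabilityMeasure_gam hH ε
  have hcond : (μ : Measure ℝ) ≪ gam H ε ∧
      Integrable (fun ξ => ((μ : Measure ℝ).rnDeriv (gam H ε) ξ).toReal *
        Real.log ((μ : Measure ℝ).rnDeriv (gam H ε) ξ).toReal) (gam H ε) := by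
    by_contra hcon
    rw [energy, if_neg hcon] at h
    exact lt_irrefl _ h
  have hd : (μ : Measure ℝ) = (gam H ε).withDensity
      fun ξ => ENNReal.ofReal ((μ : Measure ℝ).rnDeriv (gam H ε) ξ).toReal := by
    conv_lhs => rw [← Measure.withDensity_rnDeriv_eq _ _ hcond.1]
    refine withDensity_congr_ae ?_
    filter_upwards [Measure.rnDeriv_lt_top (μ : Measure ℝ) (gam H ε)] with ξ hξ
    rw [ENNReal.ofReal_toReal hξ.ne]
  refine ⟨fun ξ => ((μ : Measure ℝ).rnDeriv (gam H ε) ξ).toReal,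
    fun _ => ENNReal.toReal_nonneg, Measure.integrable_toReal_rnDeriv, hcond.2, hd, ?_⟩
  exact energy_eq_of_withDensity hH (fun _ => ENNReal.toReal_nonneg)
    Measure.integrable_toReal_rnDeriv hcond.2 hd

/-- Jensen's inequality for the entropy. -/
lemma mass_mul_log_le (hH : IsDoubleWell H) {u : ℝ → ℝ} (hu0 : ∀ ξ, 0 ≤ u ξ)
    (hu : Integrable u (gam H ε)) (hul : Integrable (fun ξ => u ξ * Real.log (u ξ)) (gam H ε))
    {m : ℝ} (hm : 0 < m) (hum : ∫ ξ, u ξ ∂(gam H ε) = m) :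
    m * Real.log m ≤ ∫ ξ, u ξ * Real.log (u ξ) ∂(gam H ε) := by
  have := isProbabilityMeasure_gam hH ε
  have h1 : ∫ ξ, ((Real.log m + 1) * u ξ - m) ∂(gam H ε) ≤
      ∫ ξ, u ξ * Real.log (u ξ) ∂(gam H ε) := by
    refine integral_mono ((hu.const_mul _).sub (integrable_const _)) hul fun ξ => ?_
    simp only
    rcases (hu0 ξ).eq_or_lt with h | h
    · rw [← h]; simp [hm.le]
    · have h2 := Real.log_le_sub_one_of_pos (div_pos hm h)
      rw [Real.log_div hm.ne' h.ne'] at h2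
      have h3 : u ξ * (m / u ξ) = m := by field_simp
      nlinarith
  rw [integral_sub (hu.const_mul _) (integrable_const _), integral_const_mul, hum] at h1
  simp at h1
  linarith

/-- By uniqueness of the velocity all competitors in the infimum have the same value. -/
lemma dissipation_eq (hc : IsCurve T ρ) (hv : IsVelocity T ρ v) :
    dissipation H ε T ρ = ∫⁻ t in Ioo 0 T,
      ((∫⁻ ξ, ENNReal.ofReal (1 / (2 * tau H ε) * v t ξ ^ 2) ∂(ρ t : Measure ℝ)) +
        ENNReal.ofReal (2 * tau H ε) * fisher H ε (ρ t : Measure ℝ)) := by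
  refine le_antisymm (iInf_le_of_le v (iInf_le_of_le hv le_rfl)) ?_
  refine le_iInf fun v' => le_iInf fun hv' => le_of_eq (lintegral_congr_ae ?_)
  filter_upwards [hv.unique hv' hc] with t ht
  congr 1
  exact lintegral_congr_ae (ht.mono fun ξ hξ => by simp only [hξ])

lemma energy_ne_bot (μ : FiniteMeasure ℝ) : energy H ε μ ≠ ⊥ := by
  unfold energy
  split_ifs
  · exact EReal.coe_ne_bot _
  · exact top_ne_bot

/-- The energy-dissipation balance of a solution. -/
lemma IsSolution.balance (hs : IsSolution H ε T ρ) :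
    ∃ e₀ eT : ℝ, energy H ε (ρ 0) = e₀ ∧ energy H ε (ρ T) = eT ∧
      dissipation H ε T ρ < ⊤ ∧ (dissipation H ε T ρ).toReal = e₀ - eT := by
  have h0 := hs.energy_lt_top
  have ha := hs.action_eq_zero
  unfold action at ha
  obtain ⟨e₀, he₀⟩ : ∃ e₀ : ℝ, energy H ε (ρ 0) = e₀ :=
    ⟨_, (EReal.coe_toReal h0.ne (energy_ne_bot _)).symm⟩
  rw [he₀] at ha
  have hJb : (dissipation H ε T ρ : EReal) ≠ ⊥ := EReal.coe_ennreal_ne_bot _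
  -- An infinite final energy would make the action infinite, since the dissipation is never `⊥`.
  have hT : energy H ε (ρ T) ≠ ⊤ := fun h => by
    rw [h, EReal.top_sub_coe, EReal.top_add_of_ne_bot hJb] at ha
    exact EReal.top_ne_zero ha
  obtain ⟨eT, heT⟩ : ∃ eT : ℝ, energy H ε (ρ T) = eT :=
    ⟨_, (EReal.coe_toReal hT (energy_ne_bot _)).symm⟩
  rw [heT, ← EReal.coe_sub] at ha
  have hJ : dissipation H ε T ρ ≠ ⊤ := fun h => by
    rw [h, EReal.coe_ennreal_top, EReal.coe_add_top] at ha
    exact EReal.top_ne_zero ha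
  refine ⟨e₀, eT, he₀, heT, hJ.lt_top, ?_⟩
  rw [← ENNReal.ofReal_toReal hJ, EReal.coe_ennreal_ofReal,
    max_eq_left ENNReal.toReal_nonneg, ← EReal.coe_add] at ha
  have := EReal.coe_eq_zero.1 ha
  linarith

/-- The integrand of the dissipation. -/
def dissRate (H : ℝ → ℝ) (ε : ℝ) (ρ : ℝ → FiniteMeasure ℝ) (v : ℝ → ℝ → ℝ) (t : ℝ) : ℝ :=
  1 / (2 * tau H ε) * (∫ ξ, v t ξ ^ 2 ∂(ρ t : Measure ℝ)) +
    2 * tau H ε * (fisher H ε (ρ t : Measure ℝ)).toReal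

lemma dissRate_nonneg (hH : IsDoubleWell H) (t : ℝ) : 0 ≤ dissRate H ε ρ v t := by
  have h1 := tau_pos hH ε
  have h2 : 0 ≤ ∫ ξ, v t ξ ^ 2 ∂(ρ t : Measure ℝ) := integral_nonneg fun _ => sq_nonneg _
  have h3 : 0 ≤ (fisher H ε (ρ t : Measure ℝ)).toReal := ENNReal.toReal_nonneg
  unfold dissRate
  positivity

lemma IsSolution.isCurve (hs : IsSolution H ε T ρ) (hT : 0 < T) : IsCurve T ρ :=
  ⟨hT, hs.continuousOn, hs.supported⟩

lemma IsSolution.exists_isFiniteAction (hs : IsSolution H ε T ρ) (hH : IsDoubleWell H)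
    (hT : 0 < T) (hv : IsVelocity T ρ v) :
    ∃ P Q, IsFiniteAction H ε T ρ v P Q ∧ IntegrableOn (dissRate H ε ρ v) (Ioo 0 T) ∧
      (dissipation H ε T ρ).toReal = ∫ t in Ioo 0 T, dissRate H ε ρ v t := by
  have hc := hs.isCurve hT
  have hτ := tau_pos hH ε
  obtain ⟨e₀, eT, -, -, hJ, -⟩ := hs.balance
  rw [dissipation_eq hc hv] at hJ ⊢
  have hm1 : AEMeasurable (fun t => ∫⁻ ξ, ENNReal.ofReal (v t ξ ^ 2) ∂(ρ t : Measure ℝ))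
      (volume.restrict (Ioo 0 T)) :=
    hc.aemeasurable_lintegral (f := fun t ξ => ENNReal.ofReal (v t ξ ^ 2))
      (hv.measurable.pow_const 2).ennreal_ofReal
  have hm2 := hc.aemeasurable_fisher hH ε
  have e : ∀ t, ∫⁻ ξ, ENNReal.ofReal (1 / (2 * tau H ε) * v t ξ ^ 2) ∂(ρ t : Measure ℝ) =
      ENNReal.ofReal (1 / (2 * tau H ε)) *
        ∫⁻ ξ, ENNReal.ofReal (v t ξ ^ 2) ∂(ρ t : Measure ℝ) := fun t => by
    rw [← lintegral_const_mul' _ _ ENNReal.ofReal_ne_top]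
    exact lintegral_congr fun ξ => ENNReal.ofReal_mul (by positivity)
  simp only [e] at hJ ⊢
  rw [lintegral_add_left' (hm1.const_mul _), lintegral_const_mul'' _ hm1,
    lintegral_const_mul'' _ hm2] at hJ ⊢
  obtain ⟨hJ1, hJ2⟩ := ENNReal.add_lt_top.1 hJ
  have h1 : ∫⁻ t in Ioo 0 T, ∫⁻ ξ, ENNReal.ofReal (v t ξ ^ 2) ∂(ρ t : Measure ℝ) < ⊤ :=
    ENNReal.lt_top_of_mul_ne_top_right hJ1.ne (by simp [hτ])
  have h2 : ∫⁻ t in Ioo 0 T, fisher H ε (ρ t : Measure ℝ) < ⊤ :=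
    ENNReal.lt_top_of_mul_ne_top_right hJ2.ne (by simp [hτ])
  classical
  have hex : ∀ t, ∃ pq : (ℝ → ℝ) × (ℝ → ℝ), fisher H ε (ρ t : Measure ℝ) < ⊤ →
      IsRoot H ε (ρ t : Measure ℝ) pq.1 pq.2 := fun t => by
    by_cases hf : fisher H ε (ρ t : Measure ℝ) < ⊤
    · obtain ⟨p, q, h⟩ := exists_isRoot hf
      exact ⟨(p, q), fun _ => h⟩
    · exact ⟨(0, 0), fun h => absurd h hf⟩
  choose PQ hPQ using hex
  have hfa : IsFiniteAction H ε T ρ v (fun t => (PQ t).1) (fun t => (PQ t).2) :=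
    ⟨hc, hv, h1, h2, hPQ⟩
  have hi1 := hfa.integrableOn_sq
  have hi2 := hfa.integrableOn_fisher hH
  refine ⟨_, _, hfa, (hi1.const_mul _).add (hi2.const_mul _), ?_⟩
  rw [ENNReal.toReal_add hJ1.ne hJ2.ne, ENNReal.toReal_mul, ENNReal.toReal_mul,
    ENNReal.toReal_ofReal (by positivity), ENNReal.toReal_ofReal (by positivity)]
  unfold dissRate
  rw [integral_add (f := fun t => 1 / (2 * tau H ε) * ∫ ξ, v t ξ ^ 2 ∂(ρ t : Measure ℝ))
    (g := fun t => 2 * tau H ε * (fisher H ε (ρ t : Measure ℝ)).toReal)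
    (hi1.const_mul _) (hi2.const_mul _), integral_const_mul, integral_const_mul]
  congr 2
  · rw [← integral_toReal hfa.aemeasurable_lintegral_sq
      (ae_lt_top' hfa.aemeasurable_lintegral_sq h1.ne)]
    refine integral_congr_ae (Eventually.of_forall fun t => ?_)
    simp only
    rw [integral_eq_lintegral_of_nonneg_ae (Eventually.of_forall fun _ => sq_nonneg _)
      ((hfa.measurable_slice t).pow_const 2).aestronglyMeasurable]
  · rw [integral_toReal hm2 (hfa.ae_fisher_lt_top hH)]

/-- The gradient flow equation for the square roots of the densities of a solution. -/
structure IsFlow (H : ℝ → ℝ) (ε T : ℝ) (ρ : ℝ → FiniteMeasure ℝ) (v P Q : ℝ → ℝ → ℝ) (e₀ : ℝ) :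
    Prop where
  finiteAction : IsFiniteAction H ε T ρ v P Q
  eqn : ∀ᵐ t ∂(volume.restrict (Ioo 0 T)),
    ∀ᵐ ξ ∂(gam H ε), P t ξ * v t ξ = -(2 * tau H ε) * Q t ξ
  entropy_le : ∀ᵐ t ∂(volume.restrict (Ioo 0 T)),
    ∫ ξ, P t ξ ^ 2 * Real.log (P t ξ ^ 2) ∂(gam H ε) ≤
      e₀ + (ρ 0).mass * Real.log (ρ 0).mass
  fisher_le : ∫ t in Ioo 0 T, tau H ε * (fisher H ε (ρ t : Measure ℝ)).toReal ≤ e₀ / 2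

lemma IsRoot.integrable_mul_log (hH : IsDoubleWell H) {μ : Measure ℝ} {p q : ℝ → ℝ}
    (h : IsRoot H ε μ p q) :
    Integrable (fun ξ => p ξ ^ 2 * Real.log (p ξ ^ 2)) (gam H ε) :=
  integrable_gam_of_continuousOn hH
    (Real.continuous_mul_log.comp_continuousOn (h.continuousOn.pow 2)) ε

lemma integral_complete_square {μ : Measure ℝ} {a b : ℝ → ℝ} (ha : MemLp a 2 μ) (hb : MemLp b 2 μ)
    {c : ℝ} (hc : c ≠ 0) :
    ∫ ξ, 2 * (a ξ * b ξ) ∂μ + (1 / (2 * c) * ∫ ξ, b ξ ^ 2 ∂μ + 2 * c * ∫ ξ, a ξ ^ 2 ∂μ) =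
      1 / (2 * c) * ∫ ξ, (b ξ + 2 * c * a ξ) ^ 2 ∂μ := by
  have h1 : Integrable (fun ξ => b ξ ^ 2) μ := hb.integrable_sq
  have h2 : Integrable (fun ξ => a ξ ^ 2) μ := ha.integrable_sq
  have h3 : Integrable (fun ξ => a ξ * b ξ) μ := ha.integrable_mul hb
  have e : ∀ ξ, (b ξ + 2 * c * a ξ) ^ 2 =
      (b ξ ^ 2 + 4 * c ^ 2 * a ξ ^ 2) + 4 * c * (a ξ * b ξ) := fun ξ => by ring
  simp only [e]
  rw [integral_add (f := fun ξ => b ξ ^ 2 + 4 * c ^ 2 * a ξ ^ 2)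
      (g := fun ξ => 4 * c * (a ξ * b ξ)) (h1.add (h2.const_mul _)) (h3.const_mul _),
    integral_add (f := fun ξ => b ξ ^ 2) (g := fun ξ => 4 * c ^ 2 * a ξ ^ 2) h1 (h2.const_mul _),
    integral_const_mul, integral_const_mul, integral_const_mul]
  field_simp
  ring

/-- By the chain rule, zero action means that `entRate + dissRate` has zero integral over `(0, T)`.
At almost every time this sum is `1 / (2 τ)` times the integral of `(P v + 2 τ Q) ^ 2`, so the
square vanishes almost everywhere. Consequently `entRate = -dissRate ≤ 0` and the entropy does not
exceed its initial value. -/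
lemma IsSolution.exists_isFlow (hs : IsSolution H ε T ρ) (hH : IsDoubleWell H) (hT : 0 < T)
    (hv : IsVelocity T ρ v) (hm : 0 < (ρ 0).mass) :
    ∃ (P Q : ℝ → ℝ → ℝ) (e₀ : ℝ), energy H ε (ρ 0) = e₀ ∧ IsFlow H ε T ρ v P Q e₀ := by
  have := isProbabilityMeasure_gam hH ε
  have hτ := tau_pos hH ε
  have hc := hs.isCurve hT
  obtain ⟨e₀, eT, he₀, heT, hJ, hJeq⟩ := hs.balance
  obtain ⟨P, Q, hfa, hdi, hdeq⟩ := hs.exists_isFiniteAction hH hT hv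
  obtain ⟨u, hu0, hu, hul, hρu, hue⟩ := exists_density_of_energy_lt_top hH hs.energy_lt_top
  obtain ⟨w, hw0, hw, hwl, hρw, hwe⟩ := exists_density_of_energy_lt_top (ε := ε) (μ := ρ T) hH
    (by rw [heT]; exact EReal.coe_lt_top _)
  have hmT : (ρ T).mass = (ρ 0).mass := hv.mass_eq hc (right_mem_Icc.2 hT.le)
  rw [he₀, EReal.coe_eq_coe_iff] at hue
  rw [heT, EReal.coe_eq_coe_iff, hmT] at hwe
  have hm' : (0 : ℝ) < (ρ 0).mass := by exact_mod_cast hm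
  have hmass : ∀ {μ : FiniteMeasure ℝ} {f : ℝ → ℝ}, (∀ ξ, 0 ≤ f ξ) → Integrable f (gam H ε) →
      (μ : Measure ℝ) = (gam H ε).withDensity (fun ξ => ENNReal.ofReal (f ξ)) →
      ∫ ξ, f ξ ∂(gam H ε) = μ.mass := fun {μ f} hf0 hf hμ => by
    have h1 : (μ : Measure ℝ) univ = ENNReal.ofReal (∫ ξ, f ξ ∂(gam H ε)) := by
      rw [hμ, withDensity_apply _ MeasurableSet.univ, Measure.restrict_univ,
        ofReal_integral_eq_lintegral_ofReal hf (Eventually.of_forall hf0)]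
    have h2 : (μ.mass : ℝ) = ((μ : Measure ℝ) univ).toReal := rfl
    rw [h2, h1, ENNReal.toReal_ofReal (integral_nonneg hf0)]
  -- By Jensen's inequality the final energy is nonnegative and can be dropped, which leaves `e₀ /
  -- 2` as the bound for the Fisher information.
  have heT0 : 0 ≤ eT := by
    have := mass_mul_log_le hH hw0 hw hwl hm' (by rw [hmass hw0 hw hρw, hmT])
    linarith
  have hnn : ∀ᵐ t ∂(volume.restrict (Ioo 0 T)), 0 ≤ IsFiniteAction.entRate H ε v P Q t + dissRate H ε ρ v t ∧
      (IsFiniteAction.entRate H ε v P Q t + dissRate H ε ρ v t = 0 →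
        ∀ᵐ ξ ∂(gam H ε), P t ξ * v t ξ = -(2 * tau H ε) * Q t ξ) := by
    filter_upwards [hfa.ae_fisher_lt_top hH, hfa.ae_integrable_sq] with t hf hvt
    have hr := hfa.root t hf
    have hq := hr.memLp hH hf
    obtain ⟨hpv, hpveq⟩ := hfa.memLp_mul hf hvt
    have hsq : MemLp (fun ξ => P t ξ * v t ξ + 2 * tau H ε * Q t ξ) 2 (gam H ε) :=
      hpv.add (hq.const_mul _)
    have e : IsFiniteAction.entRate H ε v P Q t + dissRate H ε ρ v t =
        1 / (2 * tau H ε) * ∫ ξ, (P t ξ * v t ξ + 2 * tau H ε * Q t ξ) ^ 2 ∂(gam H ε) := by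
      rw [IsFiniteAction.entRate, dissRate, ← hpveq, hr.toReal_fisher hH]
      exact integral_complete_square hq hpv hτ.ne'
    rw [e]
    have hnn : 0 ≤ ∫ ξ, (P t ξ * v t ξ + 2 * tau H ε * Q t ξ) ^ 2 ∂(gam H ε) :=
      integral_nonneg fun _ => sq_nonneg _
    refine ⟨by positivity, fun h0 => ?_⟩
    have h1 := (mul_eq_zero.1 h0).resolve_left (by positivity)
    rw [integral_eq_zero_iff_of_nonneg (fun _ => sq_nonneg _) hsq.integrable_sq] at h1
    filter_upwards [h1] with ξ hξ
    have := pow_eq_zero_iff (two_ne_zero) |>.1 hξ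
    linarith
  have hei := hfa.integrableOn_entRate hH
  have hsum0 : ∫ t in Ioo 0 T, (IsFiniteAction.entRate H ε v P Q t + dissRate H ε ρ v t) = 0 := by
    have h1 := hfa.entropy_sub_eq hH le_rfl hT.le le_rfl hu0 hw0 hu hw hul hwl hρu hρw
    rw [intervalIntegral.integral_of_le hT.le, ← integral_Ioc_eq_integral_Ioo.symm] at h1
    rw [integral_add hei hdi, ← hdeq, hJeq]
    linarith
  have hzero : ∀ᵐ t ∂(volume.restrict (Ioo 0 T)),
      IsFiniteAction.entRate H ε v P Q t + dissRate H ε ρ v t = 0 :=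
    (integral_eq_zero_iff_of_nonneg_ae (hnn.mono fun t ht => ht.1) (hei.add hdi)).1 hsum0
  refine ⟨P, Q, e₀, he₀, hfa, ?_, ?_, ?_⟩
  · filter_upwards [hnn, hzero] with t h1 h2
    exact h1.2 h2
  · filter_upwards [hfa.ae_fisher_lt_top hH, ae_restrict_mem measurableSet_Ioo] with t hf ht
    have hr := hfa.root t hf
    have hpc : ContinuousOn (fun ξ => P t ξ ^ 2) (Icc (-1) 1) := hr.continuousOn.pow 2
    have h1 := hfa.entropy_sub_eq hH le_rfl ht.1.le ht.2.le hu0 (fun _ => sq_nonneg _) hu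
      (integrable_gam_of_continuousOn hH hpc ε) hul (hr.integrable_mul_log hH) hρu hr.eq
    have h2 : ∫ r in (0 : ℝ)..t, IsFiniteAction.entRate H ε v P Q r ≤ 0 := by
      rw [intervalIntegral.integral_of_le ht.1.le]
      refine integral_nonpos_of_ae ?_
      filter_upwards [IsFiniteAction.ae_Ioc_of_Ioo hzero le_rfl ht.2.le] with r hr
      have := dissRate_nonneg (ε := ε) (ρ := ρ) (v := v) hH r
      simp only [Pi.zero_apply]
      linarith
    linarith
  · have h1 : ∫ t in Ioo 0 T, 2 * (tau H ε * (fisher H ε (ρ t : Measure ℝ)).toReal) ≤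
        ∫ t in Ioo 0 T, dissRate H ε ρ v t := by
      refine integral_mono (((hfa.integrableOn_fisher hH).const_mul _).const_mul _) hdi fun t => ?_
      have h2 : 0 ≤ ∫ ξ, v t ξ ^ 2 ∂(ρ t : Measure ℝ) := integral_nonneg fun _ => sq_nonneg _
      have h3 : 0 ≤ 1 / (2 * tau H ε) * ∫ ξ, v t ξ ^ 2 ∂(ρ t : Measure ℝ) := by positivity
      simp only [dissRate]
      linarith
    rw [integral_const_mul] at h1
    linarith

end Solution

/-! ### Concentration of the mass in the wells -/

section Concentration

variable {H : ℝ → ℝ} {ε T e₀ : ℝ} {ρ : ℝ → FiniteMeasure ℝ} {v P Q : ℝ → ℝ → ℝ}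

/-- Young's inequality for the conjugate pair `u log u - u` and `exp`. -/
lemma mul_le_entropy_add_exp {u : ℝ} (hu : 0 ≤ u) (b : ℝ) :
    b * u ≤ u * Real.log u - u + Real.exp b := by
  rcases hu.eq_or_lt with rfl | h
  · simp [(Real.exp_pos b).le]
  · have h1 := Real.add_one_le_exp (b - Real.log u)
    rw [Real.exp_sub, Real.exp_log h, le_div_iff₀ h] at h1
    linarith

/-- Convexity: on `[0, 1]` the function `x ↦ exp (Λ x)` lies below its chord. -/
lemma exp_mul_le {Λ x : ℝ} (hx : x ∈ Icc (0 : ℝ) 1) :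
    Real.exp (Λ * x) ≤ 1 + (Real.exp Λ - 1) * x := by
  have := convexOn_exp.2 (mem_univ Λ) (mem_univ 0) hx.1 (sub_nonneg.2 hx.2) (by ring)
  simp only [smul_eq_mul, mul_zero, add_zero, Real.exp_zero, mul_one] at this
  rw [mul_comm Λ]
  linarith

/-- Young's inequality with the slope `Λ * (1 - |ξ|)`, whose exponential is replaced by its chord.
The parameter `Λ` stays free: divided by `Λ`, the entropy contributes as little as desired, while
the last term vanishes with `ε` at fixed `Λ`. -/
lemma IsRoot.integral_le {μ : Measure ℝ} {p q : ℝ → ℝ} (h : IsRoot H ε μ p q)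
    (hH : IsDoubleWell H) (Λ : ℝ) :
    Λ * ∫ ξ, (1 - |ξ|) ∂μ ≤ ∫ ξ, p ξ ^ 2 * Real.log (p ξ ^ 2) ∂(gam H ε) - μ.real univ + 1 +
      (Real.exp Λ - 1) * ∫ ξ, (1 - |ξ|) ∂(gam H ε) := by
  have := isProbabilityMeasure_gam hH ε
  have hpc : ContinuousOn (fun ξ => p ξ ^ 2) (Icc (-1) 1) := h.continuousOn.pow 2
  have habs : ContinuousOn (fun ξ : ℝ => 1 - |ξ|) (Icc (-1) 1) := by fun_prop
  have hlc : ContinuousOn (fun ξ => p ξ ^ 2 * Real.log (p ξ ^ 2)) (Icc (-1) 1) :=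
    Real.continuous_mul_log.comp_continuousOn hpc
  have hi := integrable_gam_of_continuousOn hH (f := fun ξ => Λ * (p ξ ^ 2 * (1 - |ξ|)))
    (continuousOn_const.mul (hpc.mul habs)) ε
  have hi1 := integrable_gam_of_continuousOn hH
    (f := fun ξ => p ξ ^ 2 * Real.log (p ξ ^ 2) - p ξ ^ 2) (hlc.sub hpc) ε
  have hi2 := integrable_gam_of_continuousOn hH
    (f := fun ξ => 1 + (Real.exp Λ - 1) * (1 - |ξ|))
    (continuousOn_const.add (continuousOn_const.mul habs)) ε
  have hle : ∀ᵐ ξ ∂(gam H ε), Λ * (p ξ ^ 2 * (1 - |ξ|)) ≤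
      p ξ ^ 2 * Real.log (p ξ ^ 2) - p ξ ^ 2 + (1 + (Real.exp Λ - 1) * (1 - |ξ|)) :=
    (ae_gam_mem H ε).mono fun ξ hξ => by
      have h2 := mul_le_entropy_add_exp (sq_nonneg (p ξ)) (Λ * (1 - |ξ|))
      have h3 := exp_mul_le (Λ := Λ) (x := 1 - |ξ|)
        ⟨by linarith [abs_le.2 hξ], by linarith [abs_nonneg ξ]⟩
      linarith
  have e1 : ∫ ξ, (p ξ ^ 2 * Real.log (p ξ ^ 2) - p ξ ^ 2) ∂(gam H ε) =
      ∫ ξ, p ξ ^ 2 * Real.log (p ξ ^ 2) ∂(gam H ε) - μ.real univ := by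
    rw [integral_sub (integrable_gam_of_continuousOn hH hlc ε)
      (integrable_gam_of_continuousOn hH hpc ε), ← h.mass_eq]
  have e2 : ∫ ξ, (1 + (Real.exp Λ - 1) * (1 - |ξ|)) ∂(gam H ε) =
      1 + (Real.exp Λ - 1) * ∫ ξ, (1 - |ξ|) ∂(gam H ε) := by
    rw [integral_add (integrable_const _)
      ((integrable_gam_of_continuousOn hH habs ε).const_mul _), integral_const_mul]
    simp
  have h1 := integral_mono_ae hi (hi1.add hi2) hle
  rw [integral_add' hi1 hi2, e1, e2, integral_const_mul] at h1
  rw [h.integral_sq]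
  linarith

/-- The energy bound forces the mass into the wells. -/
lemma IsFlow.integral_le (h : IsFlow H ε T ρ v P Q e₀) (hH : IsDoubleWell H) (Λ : ℝ)
    {t : ℝ} (ht : t ∈ Icc 0 T) :
    Λ * ∫ ξ, (1 - |ξ|) ∂(ρ t : Measure ℝ) ≤
      e₀ + (ρ 0).mass * Real.log (ρ 0).mass - (ρ 0).mass + 1 +
        (Real.exp Λ - 1) * ∫ ξ, (1 - |ξ|) ∂(gam H ε) := by
  have hfa := h.finiteAction
  have hT := hfa.curve.pos
  have habs : Continuous fun ξ : ℝ => 1 - |ξ| := by fun_prop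
  set R := e₀ + (ρ 0).mass * Real.log (ρ 0).mass - (ρ 0).mass + 1 +
        (Real.exp Λ - 1) * ∫ ξ, (1 - |ξ|) ∂(gam H ε) with hR
  set F : ℝ → ℝ := fun t => Λ * ∫ ξ, (1 - |ξ|) ∂(ρ t : Measure ℝ) with hF
  have hFc : ContinuousOn F (Icc 0 T) :=
    continuousOn_const.mul (hfa.curve.continuousOn_integral habs.continuousOn)
  have hae : ∀ᵐ t ∂(volume.restrict (Ioo 0 T)), F t ≤ R := by
    filter_upwards [hfa.ae_fisher_lt_top hH, h.entropy_le, ae_restrict_mem measurableSet_Ioo]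
      with t hf hent htm
    have h1 := (hfa.root t hf).integral_le hH Λ
    have hmass : (ρ t : Measure ℝ).real univ = (ρ 0).mass := by
      rw [← hfa.velocity.mass_eq hfa.curve (Ioo_subset_Icc_self htm)]
      rfl
    rw [hmass] at h1
    simp only [hF, hR]
    linarith
  rw [restrict_Ioo_eq_restrict_Icc] at hae
  -- The inequality extends from almost every time to every time by continuity, written as the
  -- identity of the continuous functions `max (F t) R` and `R`.
  have heq := Measure.eqOn_Icc_of_ae_eq volume hT.ne (f := fun t => max (F t) R) (g := fun _ => R)
    (hae.mono fun t ht => max_eq_right ht) (hFc.sup continuousOn_const) continuousOn_const ht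
  exact max_eq_right_iff.1 heq

end Concentration

/-! ### Estimates at almost every time and affine interpolation -/

section Regular

variable {H : ℝ → ℝ} {ε : ℝ} {μ : Measure ℝ} {v : ℝ → ℝ} {m W : ℝ}

/-- Estimates satisfied by a solution at almost every time. -/
structure IsRegular (H : ℝ → ℝ) (ε : ℝ) (μ : Measure ℝ) (v : ℝ → ℝ) (m W : ℝ) : Prop where
  contDensity : IsContDensity H ε μ (density H ε μ)
  deriv : HasW11Deriv (-1) 1 (density H ε μ) (fun ξ => -(density H ε μ ξ * v ξ / tau H ε))
  integral_le : ∀ x y, -1 ≤ x → x ≤ y → y ≤ 1 →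
    ∫ ξ in x..y, |density H ε μ ξ * v ξ / tau H ε| ≤ √(sHat H ε y - sHat H ε x) * W
  le : ∀ ξ ∈ Icc (-1 : ℝ) 1, density H ε μ ξ ≤ W
  mass : μ.real univ = m

lemma IsContDensity.density {f : ℝ → ℝ} (h : IsContDensity H ε μ f) :
    IsContDensity H ε μ (density H ε μ) := by
  have hex : ∃ f, IsContDensity H ε μ f := ⟨f, h⟩
  rw [Kramers.density, dif_pos hex]
  exact hex.choose_spec

lemma IsContDensity.eqOn (hH : IsDoubleWell H) {f₁ f₂ : ℝ → ℝ} (h₁ : IsContDensity H ε μ f₁)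
    (h₂ : IsContDensity H ε μ f₂) : EqOn f₁ f₂ (Icc (-1) 1) :=
  eqOn_of_withDensity_eq hH h₁.continuousOn h₂.continuousOn h₁.nonneg h₂.nonneg
    (h₁.eq_withDensity.symm.trans h₂.eq_withDensity)

/-- For `u = p ^ 2` the equation `p v = -2 τ q` reads `u' = 2 p q = -u v / τ`. The integral of `|2 p
q|` is estimated by `2 √U` times that of `|q|`, and `2 √U √D ≤ U + D` merges the bounds into one
constant `U + D`, which is affine in the Fisher information and therefore integrable in time. -/
lemma IsRoot.isRegular {p q : ℝ → ℝ} (h : IsRoot H ε μ p q) (hH : IsDoubleWell H)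
    (hf : fisher H ε μ < ⊤) (hv : ∀ᵐ ξ ∂(gam H ε), p ξ * v ξ = -(2 * tau H ε) * q ξ) :
    IsRegular H ε μ v (μ.real univ)
      (2 * μ.real univ + (1 + 4 * kap H) * (tau H ε * (fisher H ε μ).toReal)) := by
  have hτ := tau_pos hH ε
  have hκ := kap_pos hH
  have hd := h.isContDensity.density
  have heq : EqOn (density H ε μ) (fun ξ => p ξ ^ 2) (Icc (-1) 1) :=
    hd.eqOn hH h.isContDensity
  set D := tau H ε * (fisher H ε μ).toReal with hD
  have hD0 : 0 ≤ D := mul_nonneg hτ.le ENNReal.toReal_nonneg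
  set U := 2 * μ.real univ + 4 * kap H * D with hU
  have hU0 : 0 ≤ U := by
    have : 0 ≤ μ.real univ := measureReal_nonneg
    positivity
  have hpU : ∀ ξ ∈ Icc (-1 : ℝ) 1, p ξ ^ 2 ≤ U := fun ξ hξ => h.sq_le hH hf hξ
  have hvI : ∀ᵐ ξ ∂(volume.restrict (Icc (-1) 1)), p ξ * v ξ = -(2 * tau H ε) * q ξ :=
    (absolutelyContinuous_gam hH ε).ae_le hv
  have hflux : ∀ᵐ ξ ∂(volume.restrict (Icc (-1) 1)),
      2 * p ξ * q ξ = -(density H ε μ ξ * v ξ / tau H ε) := by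
    filter_upwards [hvI, ae_restrict_mem measurableSet_Icc] with ξ h1 hξ
    rw [heq hξ]
    field_simp
    linear_combination (p ξ) * h1
  have hderiv := ((h.deriv.sq (by norm_num)).congr_fun (by norm_num)
    (fun ξ hξ => (heq hξ).symm)).congr_deriv (by norm_num) hflux
  have hW : U + D = 2 * μ.real univ + (1 + 4 * kap H) * D := by rw [hU]; ring
  refine ⟨hd, hderiv, fun x y hx hxy hy => ?_, fun ξ hξ => ?_, rfl⟩
  · have hsub : Ioc x y ⊆ Icc (-1 : ℝ) 1 := fun z hz => ⟨by linarith [hz.1], hz.2.trans hy⟩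
    have hqi := h.deriv.integrableOn (by norm_num)
    have h1 : ∫ ξ in x..y, |density H ε μ ξ * v ξ / tau H ε| ≤ ∫ ξ in x..y, 2 * √U * |q ξ| := by
      simp only [intervalIntegral.integral_of_le hxy]
      refine integral_mono_ae ?_ ((hqi.mono_set hsub).abs.const_mul _) ?_
      · have := ((hderiv.integrableOn (by norm_num)).mono_set hsub).abs
        simpa using this
      · filter_upwards [ae_restrict_of_ae_restrict_of_subset hsub hflux,
          ae_restrict_mem measurableSet_Ioc] with ξ h2 hξ
        rw [← abs_neg, ← h2, abs_mul, abs_mul, abs_two, abs_of_nonneg (h.nonneg ξ (hsub hξ))]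
        gcongr
        exact Real.le_sqrt_of_sq_le (hpU ξ (hsub hξ))
    have hss : 0 ≤ sHat H ε y - sHat H ε x :=
      sub_nonneg.2 ((strictMono_sHat hH ε).monotone hxy)
    have h2 : ∫ ξ in x..y, |q ξ| ≤ √D * √(sHat H ε y - sHat H ε x) := by
      rw [← Real.sqrt_mul hD0]
      exact Real.le_sqrt_of_sq_le (h.sq_integral_le hH hf hx hxy hy)
    rw [intervalIntegral.integral_const_mul] at h1
    refine h1.trans ?_
    have h3 : 2 * √U * √D ≤ U + D := by
      have := sq_nonneg (√U - √D)
      nlinarith [Real.sq_sqrt hU0, Real.sq_sqrt hD0]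
    rw [← hW]
    calc 2 * √U * ∫ ξ in x..y, |q ξ| ≤ 2 * √U * (√D * √(sHat H ε y - sHat H ε x)) := by gcongr
      _ = √(sHat H ε y - sHat H ε x) * (2 * √U * √D) := by ring
      _ ≤ _ := by gcongr
  · rw [heq hξ, ← hW]
    exact (hpU ξ hξ).trans (by linarith)

/-- The time-dependent constant in the estimates of `IsRegular`. -/
def boundRate (H : ℝ → ℝ) (ε : ℝ) (μ : FiniteMeasure ℝ) (m : ℝ) : ℝ :=
  2 * m + (1 + 4 * kap H) * (tau H ε * (fisher H ε (μ : Measure ℝ)).toReal)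

lemma IsFlow.ae_isRegular {T e₀ : ℝ} {ρ : ℝ → FiniteMeasure ℝ} {v P Q : ℝ → ℝ → ℝ}
    (h : IsFlow H ε T ρ v P Q e₀) (hH : IsDoubleWell H) :
    ∀ᵐ t ∂(volume.restrict (Ioo 0 T)), IsRegular H ε (ρ t : Measure ℝ) (v t) (ρ 0).mass
      (boundRate H ε (ρ t) (ρ 0).mass) := by
  filter_upwards [h.finiteAction.ae_fisher_lt_top hH, h.eqn, ae_restrict_mem measurableSet_Ioo]
    with t hf he ht
  have h1 := (h.finiteAction.root t hf).isRegular hH hf he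
  have h2 : (ρ t : Measure ℝ).real univ = (ρ 0).mass := by
    rw [← h.finiteAction.velocity.mass_eq h.finiteAction.curve (Ioo_subset_Icc_self ht)]
    rfl
  rw [h2] at h1
  exact h1

namespace IsRegular

lemma nonneg (h : IsRegular H ε μ v m W) {ξ : ℝ} (hξ : ξ ∈ Icc (-1 : ℝ) 1) :
    0 ≤ density H ε μ ξ := h.contDensity.nonneg ξ hξ

lemma bound_nonneg (h : IsRegular H ε μ v m W) : 0 ≤ W :=
  (h.nonneg (right_mem_Icc.2 (by norm_num))).trans (h.le 1 (by norm_num))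

lemma abs_sub_le (h : IsRegular H ε μ v m W) {x y : ℝ} (hx : -1 ≤ x) (hxy : x ≤ y) (hy : y ≤ 1) :
    |density H ε μ y - density H ε μ x| ≤ √(sHat H ε y - sHat H ε x) * W := by
  rw [h.deriv.sub_eq ⟨hx, hxy.trans hy⟩ ⟨hx.trans hxy, hy⟩]
  refine (intervalIntegral.abs_integral_le_integral_abs hxy).trans ?_
  simp only [abs_neg]
  exact h.integral_le x y hx hxy hy

lemma integral_eq (h : IsRegular H ε μ v m W) (f : ℝ → ℝ) :
    ∫ ξ, f ξ ∂μ = ∫ ξ, density H ε μ ξ * f ξ ∂(gam H ε) := by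
  conv_lhs => rw [h.contDensity.eq_withDensity]
  exact integral_withDensity_gam h.contDensity.continuousOn h.contDensity.nonneg f

end IsRegular

/-- The mean defect of `ŝ_ε` from `±κ`. -/
def wellDefect (H : ℝ → ℝ) (ε : ℝ) : ℝ := ∫ ξ, (kap H ^ 2 - sHat H ε ξ ^ 2) ∂(gam H ε)

/-- `γ_ε` is symmetric and `sHat` is odd. -/
lemma integral_sHat_gam (hH : IsDoubleWell H) (ε : ℝ) : ∫ ξ, sHat H ε ξ ∂(gam H ε) = 0 := by
  have h := intervalIntegral.integral_comp_neg (a := -1) (b := 1)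
    (fun ξ => g H ε ξ * sHat H ε ξ)
  simp only [g_neg hH, sHat_neg hH, neg_neg, mul_neg, intervalIntegral.integral_neg] at h
  rw [integral_gam hH, integral_Icc_eq_integral_Ioc, ← intervalIntegral.integral_of_le (by norm_num)]
  linarith

lemma wellDefect_nonneg (hH : IsDoubleWell H) (ε : ℝ) : 0 ≤ wellDefect H ε :=
  integral_nonneg_of_ae ((ae_gam_mem H ε).mono fun ξ hξ => by
    have := sHat_mem hH ε hξ
    simp only [Pi.zero_apply]
    nlinarith [this.1, this.2])

/-- The bound for the distance of the density from its affine interpolation. -/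
def wellError (H : ℝ → ℝ) (ε : ℝ) : ℝ :=
  (1 + kap H) * (√(2 * kap H) / kap H * √(wellDefect H ε)) + wellDefect H ε / (2 * kap H)

/-- The Hölder bound from both end points shows that the density differs from its affine
interpolation `l` by at most a multiple of `√(κ² - s²) W`. The `γ_ε`-mean of this root is at most
`√(wellDefect H ε)` by Cauchy-Schwarz. For `l` itself mass and first moment are explicit, because
`sHat` has mean zero and second moment `κ² - wellDefect H ε`. -/
lemma IsRegular.affine (h : IsRegular H ε μ v m W) (hH : IsDoubleWell H) :
    |m - (density H ε μ 1 + density H ε μ (-1)) / 2| ≤ wellError H ε * W ∧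
      |∫ ξ, sHat H ε ξ ∂μ - kap H * (density H ε μ 1 - density H ε μ (-1)) / 2| ≤
        wellError H ε * W := by
  have := isProbabilityMeasure_gam hH ε
  have hκ := kap_pos hH
  have hW := h.bound_nonneg
  set f := density H ε μ with hf
  have hfc := h.contDensity.continuousOn
  have hsc := (continuous_sHat hH ε).continuousOn (s := Icc (-1) 1)
  set l : ℝ → ℝ := fun ξ => ((kap H + sHat H ε ξ) * f 1 + (kap H - sHat H ε ξ) * f (-1)) /
    (2 * kap H) with hl
  have hlc : ContinuousOn l (Icc (-1) 1) := by fun_prop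
  have hdc : ContinuousOn (fun ξ => √(kap H ^ 2 - sHat H ε ξ ^ 2)) (Icc (-1) 1) :=
    (continuousOn_const.sub (hsc.pow 2)).sqrt
  have hdi := integrable_gam_of_continuousOn hH hdc ε
  have hint : ∫ ξ, √(kap H ^ 2 - sHat H ε ξ ^ 2) ∂(gam H ε) ≤ √(wellDefect H ε) := by
    refine Real.le_sqrt_of_sq_le ?_
    have hL : MemLp (fun ξ => √(kap H ^ 2 - sHat H ε ξ ^ 2)) 2 (gam H ε) := by
      refine (memLp_two_iff_integrable_sq hdi.1).2 ?_
      exact integrable_gam_of_continuousOn hH (hdc.pow 2) ε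
    have h1 := sq_integral_mul_le hL (memLp_const (1 : ℝ))
    simp only [mul_one, one_pow, integral_const, probReal_univ, smul_eq_mul] at h1
    refine h1.trans (le_of_eq (integral_congr_ae ((ae_gam_mem H ε).mono fun ξ hξ => ?_)))
    have := sHat_mem hH ε hξ
    exact Real.sq_sqrt (by nlinarith [this.1, this.2])
  have hpt : ∀ ξ ∈ Icc (-1 : ℝ) 1, |f ξ - l ξ| ≤
      √(2 * kap H) / kap H * W * √(kap H ^ 2 - sHat H ε ξ ^ 2) := fun ξ hξ => by
    have hs := sHat_mem hH ε hξ
    have hA : 0 ≤ kap H + sHat H ε ξ := by linarith [hs.1]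
    have hB : 0 ≤ kap H - sHat H ε ξ := by linarith [hs.2]
    have h1 : |f 1 - f ξ| ≤ √(kap H - sHat H ε ξ) * W := by
      have := h.abs_sub_le hξ.1 hξ.2 le_rfl
      rwa [sHat_one hH] at this
    have h2 : |f ξ - f (-1)| ≤ √(kap H + sHat H ε ξ) * W := by
      have := h.abs_sub_le le_rfl hξ.1 hξ.2
      rwa [sHat_neg_one hH, sub_neg_eq_add, add_comm (sHat H ε ξ)] at this
    set A := kap H + sHat H ε ξ
    set B := kap H - sHat H ε ξ
    -- The weight of each end value vanishes at the opposite end point; pairing it with the Hölder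
    -- bound for the difference from that end value produces the factor `√A * √B`.
    have e1 : f ξ - l ξ = (A * (f ξ - f 1) + B * (f ξ - f (-1))) / (2 * kap H) := by
      simp only [hl, A, B]
      field_simp
      ring
    have e2 : kap H ^ 2 - sHat H ε ξ ^ 2 = A * B := by simp only [A, B]; ring
    have e3 : A + B = 2 * kap H := by simp only [A, B]; ring
    have hsA : √A ≤ √(2 * kap H) := Real.sqrt_le_sqrt (by linarith)
    have hsB : √B ≤ √(2 * kap H) := Real.sqrt_le_sqrt (by linarith)
    rw [e1, abs_div, abs_of_pos (by positivity : 0 < 2 * kap H), div_le_iff₀ (by positivity), e2,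
      Real.sqrt_mul hA]
    calc |A * (f ξ - f 1) + B * (f ξ - f (-1))| ≤ A * (√B * W) + B * (√A * W) := by
          refine (abs_add_le _ _).trans ?_
          rw [abs_mul, abs_mul, abs_of_nonneg hA, abs_of_nonneg hB, abs_sub_comm (f ξ) (f 1)]
          gcongr
      _ = √A * √B * W * (√A + √B) := by
          linear_combination (-(√B * W)) * Real.mul_self_sqrt hA -
            (√A * W) * Real.mul_self_sqrt hB
      _ ≤ √A * √B * W * (√(2 * kap H) + √(2 * kap H)) := by gcongr
      _ = √(2 * kap H) / kap H * W * (√A * √B) * (2 * kap H) := by field_simp; ring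
  have hfi := integrable_gam_of_continuousOn hH hfc ε
  have hli := integrable_gam_of_continuousOn hH hlc ε
  have hsi := integrable_gam_of_continuousOn hH hsc ε
  have hsfi := integrable_gam_of_continuousOn hH (f := fun ξ => sHat H ε ξ * f ξ)
    (hsc.mul hfc) ε
  have hsli := integrable_gam_of_continuousOn hH (f := fun ξ => sHat H ε ξ * l ξ)
    (hsc.mul hlc) ε
  have hs2 := integrable_gam_of_continuousOn hH (f := fun ξ => sHat H ε ξ ^ 2) (hsc.pow 2) ε
  have hf1 := h.nonneg (ξ := 1) (by norm_num)
  have hf2 := h.nonneg (ξ := -1) (by norm_num)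
  have hd0 := wellDefect_nonneg hH ε
  set c := √(2 * kap H) / kap H with hc
  have hc0 : 0 ≤ c := by positivity
  have hcW : 0 ≤ c * W := mul_nonneg hc0 hW
  have hfl : ∫ ξ, |f ξ - l ξ| ∂(gam H ε) ≤ c * √(wellDefect H ε) * W := by
    calc ∫ ξ, |f ξ - l ξ| ∂(gam H ε)
        ≤ ∫ ξ, c * W * √(kap H ^ 2 - sHat H ε ξ ^ 2) ∂(gam H ε) :=
          integral_mono_ae (hfi.sub hli).abs (hdi.const_mul _) ((ae_gam_mem H ε).mono hpt)
      _ = c * W * ∫ ξ, √(kap H ^ 2 - sHat H ε ξ ^ 2) ∂(gam H ε) := integral_const_mul _ _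
      _ ≤ c * W * √(wellDefect H ε) := by gcongr
      _ = c * √(wellDefect H ε) * W := by ring
  have hkf : 0 ≤ kap H * (c * √(wellDefect H ε) * W) := by positivity
  have hdW : 0 ≤ wellDefect H ε / (2 * kap H) * W := by positivity
  have hcd : 0 ≤ c * √(wellDefect H ε) * W := by positivity
  have hs0 := integral_sHat_gam hH ε
  have hl1 : ∫ ξ, l ξ ∂(gam H ε) = (f 1 + f (-1)) / 2 := by
    have e : ∀ ξ, l ξ = (f 1 - f (-1)) / (2 * kap H) * sHat H ε ξ + (f 1 + f (-1)) / 2 := fun ξ => by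
      simp only [hl]; field_simp; ring
    simp only [e]
    rw [integral_add (hsi.const_mul _) (integrable_const _), integral_const_mul, hs0]
    simp
  have hl2 : ∫ ξ, sHat H ε ξ * l ξ ∂(gam H ε) =
      (f 1 - f (-1)) / (2 * kap H) * (kap H ^ 2 - wellDefect H ε) := by
    have e : ∀ ξ, sHat H ε ξ * l ξ = (f 1 - f (-1)) / (2 * kap H) * sHat H ε ξ ^ 2 +
        (f 1 + f (-1)) / 2 * sHat H ε ξ := fun ξ => by
      simp only [hl]; field_simp; ring
    have e2 : wellDefect H ε = kap H ^ 2 - ∫ ξ, sHat H ε ξ ^ 2 ∂(gam H ε) := by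
      rw [wellDefect, integral_sub (integrable_const _) hs2]
      simp
    simp only [e]
    rw [integral_add (hs2.const_mul _) (hsi.const_mul _), integral_const_mul, integral_const_mul,
      hs0, e2]
    ring
  constructor
  · have hm : m = ∫ ξ, f ξ ∂(gam H ε) := by
      have := h.integral_eq fun _ => 1
      simp only [integral_const, smul_eq_mul, mul_one] at this
      rw [← this, h.mass]
    rw [hm, ← hl1, ← integral_sub hfi hli, wellError]
    refine abs_integral_le_integral_abs.trans (hfl.trans ?_)
    linarith
  · have e3 : ∫ ξ, sHat H ε ξ ∂μ = ∫ ξ, sHat H ε ξ * f ξ ∂(gam H ε) := by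
      rw [h.integral_eq]
      simp only [mul_comm, hf]
    have h1 : |∫ ξ, sHat H ε ξ * f ξ ∂(gam H ε) - ∫ ξ, sHat H ε ξ * l ξ ∂(gam H ε)| ≤
        kap H * (c * √(wellDefect H ε) * W) := by
      rw [← integral_sub hsfi hsli]
      refine abs_integral_le_integral_abs.trans (le_trans ?_
        (mul_le_mul_of_nonneg_left hfl hκ.le))
      rw [← integral_const_mul]
      refine integral_mono_ae (hsfi.sub hsli).abs ((hfi.sub hli).abs.const_mul _)
        ((ae_gam_mem H ε).mono fun ξ hξ => ?_)
      simp only [← mul_sub, abs_mul]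
      exact mul_le_mul_of_nonneg_right (abs_le.2 (sHat_mem hH ε hξ)) (abs_nonneg _)
    have h2 : |∫ ξ, sHat H ε ξ * l ξ ∂(gam H ε) - kap H * (f 1 - f (-1)) / 2| ≤
        wellDefect H ε / (2 * kap H) * W := by
      have e4 : ∫ ξ, sHat H ε ξ * l ξ ∂(gam H ε) - kap H * (f 1 - f (-1)) / 2 =
          -(wellDefect H ε / (2 * kap H) * (f 1 - f (-1))) := by
        rw [hl2]; field_simp; ring
      rw [e4, abs_neg, abs_mul, abs_of_nonneg (by positivity)]
      gcongr
      have h3 := h.le 1 (by norm_num)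
      have h4 := h.le (-1) (by norm_num)
      rw [abs_le]
      constructor <;> linarith
    rw [e3, wellError]
    refine (_root_.abs_sub_le _ (∫ ξ, sHat H ε ξ * l ξ ∂(gam H ε)) _).trans ?_
    linarith

/-- The rescaled flux in the original variables. -/
lemma wHat_sHat (hH : IsDoubleWell H) {ξ : ℝ} (hξ : ξ ∈ Icc (-1 : ℝ) 1) :
    wHat H ε μ v (sHat H ε ξ) = density H ε μ ξ * v ξ * g H ε ξ := by
  have h1 := (tau_pos hH ε).ne'
  have h2 := (g_pos hH ε ξ).ne'
  rw [wHat, uHat, vHat, gHat, xiHat_sHat hH ε hξ]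
  field_simp

lemma integral_wHat (hH : IsDoubleWell H) {x y : ℝ} (hx : -1 ≤ x) (hxy : x ≤ y) (hy : y ≤ 1)
    (χ : ℝ → ℝ → ℝ) : ∫ s in Icc (sHat H ε x) (sHat H ε y), χ s (wHat H ε μ v s) =
      ∫ ξ in Icc x y, 1 / (tau H ε * g H ε ξ) *
        χ (sHat H ε ξ) (density H ε μ ξ * v ξ * g H ε ξ) := by
  rw [← sHat_image hH ε hxy, setIntegral_sHat hH ε measurableSet_Icc]
  refine setIntegral_congr_fun measurableSet_Icc fun ξ hξ => ?_
  rw [wHat_sHat hH ⟨hx.trans hξ.1, hξ.2.trans hy⟩]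

lemma IsRegular.integrableOn_wHat (h : IsRegular H ε μ v m W) (hH : IsDoubleWell H) :
    IntegrableOn (wHat H ε μ v) (Icc (-kap H) (kap H)) := by
  rw [← sHat_image_Icc hH ε, integrableOn_sHat_image hH ε measurableSet_Icc]
  refine ((h.deriv.integrableOn (by norm_num)).neg).congr_fun (fun ξ hξ => ?_) measurableSet_Icc
  have h1 := (tau_pos hH ε).ne'
  have h2 := (g_pos hH ε ξ).ne'
  simp only [Pi.neg_apply, neg_neg]
  rw [wHat_sHat hH hξ]
  field_simp

lemma IsRegular.integral_abs_wHat_le (h : IsRegular H ε μ v m W) (hH : IsDoubleWell H) :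
    ∫ s in Icc (-kap H) (kap H), |wHat H ε μ v s| ≤ √(2 * kap H) * W := by
  have h1 := integral_wHat (ε := ε) (μ := μ) (v := v) hH le_rfl (by norm_num : (-1 : ℝ) ≤ 1) le_rfl
    fun _ w => |w|
  rw [sHat_one hH, sHat_neg_one hH] at h1
  have h2 := h.integral_le (-1) 1 le_rfl (by norm_num) le_rfl
  rw [sHat_one hH, sHat_neg_one hH, intervalIntegral.integral_of_le (by norm_num),
    ← integral_Icc_eq_integral_Ioc, sub_neg_eq_add, ← two_mul] at h2
  rw [h1]
  refine le_trans (le_of_eq ?_) h2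
  refine setIntegral_congr_fun measurableSet_Icc fun ξ _ => ?_
  have h3 := tau_pos hH ε
  have h4 := g_pos hH ε ξ
  simp only [abs_mul, abs_div, abs_of_pos h3, abs_of_pos h4]
  field_simp

/-- The right-hand side is the flux term of the continuity equation tested with a primitive of `θ`
composed with `sHat`. -/
lemma IsRegular.integral_mul_wHat (h : IsRegular H ε μ v m W) (hH : IsDoubleWell H) (θ : ℝ → ℝ) :
    ∫ s in Icc (-kap H) (kap H), θ s * wHat H ε μ v s =
      ∫ ξ, 1 / (tau H ε * g H ε ξ) * θ (sHat H ε ξ) * v ξ ∂μ := by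
  have h1 := integral_wHat (ε := ε) (μ := μ) (v := v) hH le_rfl (by norm_num : (-1 : ℝ) ≤ 1) le_rfl
    fun s w => θ s * w
  rw [sHat_one hH, sHat_neg_one hH] at h1
  rw [h1, h.integral_eq, integral_gam hH]
  refine setIntegral_congr_fun measurableSet_Icc fun ξ _ => ?_
  ring

/-- The Jacobian `1 / (τ g)` of `sHat` turns the rescaled flux `u v g` into `u v / τ`, which is
minus the derivative of the density. In the rescaled variable slope and flux thus agree up to sign.
-/
lemma IsRegular.hasW11Deriv_uHat (h : IsRegular H ε μ v m W) (hH : IsDoubleWell H) :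
    HasW11Deriv (-kap H) (kap H) (uHat H ε μ) (fun s => -wHat H ε μ v s) := by
  have hκ := kap_pos hH
  refine ⟨(intervalIntegrable_iff_integrableOn_Icc_of_le (by linarith)).2
    (h.integrableOn_wHat hH).neg, fun s hs => ?_⟩
  have hx := xiHat_mem hH ε hs
  have h1 := integral_wHat (ε := ε) (μ := μ) (v := v) hH le_rfl hx.1 hx.2 fun _ w => -w
  rw [sHat_neg_one hH, sHat_xiHat hH ε hs] at h1
  rw [uHat, uHat, xiHat_neg_kap hH, h.deriv.2 _ hx, intervalIntegral.integral_of_le hx.1,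
    intervalIntegral.integral_of_le hs.1, ← integral_Icc_eq_integral_Ioc,
    ← integral_Icc_eq_integral_Ioc, h1]
  congr 1
  refine setIntegral_congr_fun measurableSet_Icc fun ξ _ => ?_
  have h3 := (tau_pos hH ε).ne'
  have h4 := (g_pos hH ε ξ).ne'
  field_simp

end Regular

/-! ### Joint measurability and integrability -/

section Measurability

variable {H : ℝ → ℝ} {ε T e₀ : ℝ} {ρ : ℝ → FiniteMeasure ℝ} {v P Q : ℝ → ℝ → ℝ}

namespace IsFlow

lemma integrableOn_boundRate (h : IsFlow H ε T ρ v P Q e₀) (hH : IsDoubleWell H) :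
    IntegrableOn (fun t => boundRate H ε (ρ t) (ρ 0).mass) (Ioo 0 T) := by
  have h1 := h.finiteAction.integrableOn_fisher hH
  have h2 : IntegrableOn (fun _ : ℝ => 2 * ((ρ 0).mass : ℝ)) (Ioo 0 T) :=
    integrableOn_const (by simp)
  exact Integrable.add h2 ((h1.const_mul (tau H ε)).const_mul (1 + 4 * kap H))

lemma integral_boundRate_le (h : IsFlow H ε T ρ v P Q e₀) (hH : IsDoubleWell H) :
    ∫ t in Ioo 0 T, boundRate H ε (ρ t) (ρ 0).mass ≤
      2 * (ρ 0).mass * T + (1 + 4 * kap H) * (e₀ / 2) := by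
  have h1 := h.finiteAction.integrableOn_fisher hH
  have hT := h.finiteAction.curve.pos
  have h2 : IntegrableOn (fun _ : ℝ => 2 * ((ρ 0).mass : ℝ)) (Ioo 0 T) :=
    integrableOn_const (by simp)
  have hκ := kap_pos hH
  simp only [boundRate]
  rw [integral_add (f := fun _ : ℝ => 2 * ((ρ 0).mass : ℝ)) h2
    ((h1.const_mul (tau H ε)).const_mul (1 + 4 * kap H)), integral_const_mul (1 + 4 * kap H)]
  refine add_le_add (le_of_eq ?_) (mul_le_mul_of_nonneg_left h.fisher_le (by positivity))
  simp [hT.le, mul_comm]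

/-- The density has a jointly measurable version. -/
lemma exists_measurable_density (h : IsFlow H ε T ρ v P Q e₀) (hH : IsDoubleWell H) :
    ∃ U : ℝ × ℝ → ℝ, Measurable U ∧ ∀ᵐ t ∂(volume.restrict (Ioo 0 T)),
      ∀ ξ ∈ Icc (-1 : ℝ) 1, density H ε (ρ t : Measure ℝ) ξ = U (t, ξ) := by
  have := isProbabilityMeasure_gam hH ε
  have hc := h.finiteAction.curve
  have hvm := h.finiteAction.velocity.measurable
  -- Integrated against `ρ_t`, this function gives the increment of the density from `-1` to `ξ`:
  -- the roots were chosen separately for each time, but the velocity is jointly measurable.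
  set f : (ℝ × ℝ) × ℝ → ℝ := fun x =>
    (Iic x.1.2).indicator (fun η => -(1 / (tau H ε * g H ε η)) * v x.1.1 η) x.2 with hf
  have hfm : Measurable f := by
    have e : f = {x : (ℝ × ℝ) × ℝ | x.2 ≤ x.1.2}.indicator
        (fun x => -(1 / (tau H ε * g H ε x.2)) * Function.uncurry v (x.1.1, x.2)) := by
      funext x
      simp only [hf, indicator, mem_Iic, mem_ofPred_eq]
      rfl
    rw [e]
    refine Measurable.indicator ?_ (measurableSet_le measurable_snd (by fun_prop))
    exact (((continuous_one_div_tau_g hH ε).measurable.comp measurable_snd).neg).mul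
      (hvm.comp (by fun_prop))
  set D : ℝ × ℝ → ℝ := fun x => ∫ η, f (x, η) ∂(hc.kernel x.1) with hD
  have hDm : StronglyMeasurable D :=
    hfm.stronglyMeasurable.integral_kernel_prod_right'
      (κ := ProbabilityTheory.Kernel.prodMkRight ℝ hc.kernel)
  have hDm2 : StronglyMeasurable fun t => ∫ η, D (t, η) ∂(gam H ε) :=
    hDm.integral_prod_right'
  -- The value at `-1` is recovered from the mass, since the `γ_ε`-mean of the increments is the
  -- mass minus that value.
  refine ⟨fun x => (ρ 0).mass - ∫ η, D (x.1, η) ∂(gam H ε) + D x,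
    (measurable_const.sub (hDm2.measurable.comp measurable_fst)).add hDm.measurable, ?_⟩
  filter_upwards [h.ae_isRegular hH, ae_restrict_mem measurableSet_Ioo] with t hr ht
  have hDt : ∀ ξ ∈ Icc (-1 : ℝ) 1,
      D (t, ξ) = density H ε (ρ t : Measure ℝ) ξ - density H ε (ρ t : Measure ℝ) (-1) :=
    fun ξ hξ => by
      simp only [hD, hc.kernel_apply (Ioo_subset_Icc_self ht)]
      rw [hr.integral_eq, integral_gam hH, hr.deriv.2 ξ hξ, intervalIntegral.integral_of_le hξ.1,
        ← integral_Icc_eq_integral_Ioc, add_sub_cancel_left]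
      have e : Icc (-1) ξ = Icc (-1) 1 ∩ Iic ξ := by
        ext x; simp only [mem_Icc, mem_inter_iff, mem_Iic]; constructor
        · exact fun hx => ⟨⟨hx.1, hx.2.trans hξ.2⟩, hx.2⟩
        · exact fun hx => ⟨hx.1.1, hx.2⟩
      rw [e, ← setIntegral_indicator measurableSet_Iic]
      refine setIntegral_congr_fun measurableSet_Icc fun η _ => ?_
      have h3 := (tau_pos hH ε).ne'
      have h4 := (g_pos hH ε η).ne'
      by_cases hη : η ∈ Iic ξ
      · simp only [hf, indicator_of_mem hη]
        field_simp
      · simp [hf, indicator_of_notMem hη]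
  intro ξ hξ
  have hi := integrable_gam_of_continuousOn hH hr.contDensity.continuousOn ε
  have hm : ∫ η, D (t, η) ∂(gam H ε) = (ρ 0).mass - density H ε (ρ t : Measure ℝ) (-1) := by
    have h1 := hr.integral_eq fun _ => 1
    simp only [integral_const, smul_eq_mul, mul_one, hr.mass] at h1
    rw [integral_congr_ae ((ae_gam_mem H ε).mono hDt), integral_sub hi (integrable_const _), ← h1]
    simp
  rw [hm, hDt ξ hξ]
  ring

lemma aemeasurable_density (h : IsFlow H ε T ρ v P Q e₀) (hH : IsDoubleWell H) {ξ : ℝ}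
    (hξ : ξ ∈ Icc (-1 : ℝ) 1) : AEMeasurable (fun t => density H ε (ρ t : Measure ℝ) ξ)
      (volume.restrict (Ioo 0 T)) := by
  obtain ⟨U, hU, hUd⟩ := h.exists_measurable_density hH
  exact ⟨fun t => U (t, ξ), hU.comp (by fun_prop), hUd.mono fun t ht => ht ξ hξ⟩

lemma integrableOn_density (h : IsFlow H ε T ρ v P Q e₀) (hH : IsDoubleWell H) {ξ : ℝ}
    (hξ : ξ ∈ Icc (-1 : ℝ) 1) :
    IntegrableOn (fun t => density H ε (ρ t : Measure ℝ) ξ) (Ioo 0 T) :=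
  (h.integrableOn_boundRate hH).mono' (h.aemeasurable_density hH hξ).aestronglyMeasurable
    ((h.ae_isRegular hH).mono fun t ht => by
      rw [Real.norm_eq_abs, abs_of_nonneg (ht.nonneg hξ)]
      exact ht.le ξ hξ)

end IsFlow

/-- For a continuous function the essential supremum is a supremum over rational points, and a
countable supremum stays measurable in a parameter. -/
lemma eLpNorm_top_eq_iSup {f : ℝ → ℝ} {a b : ℝ} (hf : ContinuousOn f (Ioo a b)) :
    eLpNorm f ⊤ (volume.restrict (Ioo a b)) =
      ⨆ q : ℚ, if (q : ℝ) ∈ Ioo a b then ‖f q‖ₑ else 0 := by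
  have hc : ContinuousOn (fun x => ‖f x‖ₑ) (Ioo a b) := hf.enorm
  rw [eLpNorm_exponent_top, eLpNormEssSup]
  refine le_antisymm ?_ (iSup_le fun q => ?_)
  · refine essSup_le_of_ae_le _ ?_
    filter_upwards [ae_restrict_mem measurableSet_Ioo] with x hx
    by_contra! hlt
    have ho := hc.isOpen_inter_preimage isOpen_Ioo
      (isOpen_Ioi (a := ⨆ q : ℚ, if (q : ℝ) ∈ Ioo a b then ‖f q‖ₑ else 0))
    obtain ⟨q, hq⟩ := Rat.denseRange_cast.exists_mem_open ho ⟨x, hx, hlt⟩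
    have h1 := le_iSup (fun q : ℚ => if (q : ℝ) ∈ Ioo a b then ‖f q‖ₑ else 0) q
    simp only [if_pos hq.1] at h1
    exact absurd hq.2 (not_lt.2 h1)
  · split_ifs with hq
    · set S := essSup (fun x => ‖f x‖ₑ) (volume.restrict (Ioo a b))
      have h1 : ∀ᵐ x ∂(volume.restrict (Ioo a b)), ‖f x‖ₑ ≤ S := ae_le_essSup
      have h2 := Measure.eqOn_open_of_ae_eq (f := fun x => max ‖f x‖ₑ S) (g := fun _ => S)
        (h1.mono fun x hx => max_eq_right hx) isOpen_Ioo (hc.sup continuousOn_const)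
        continuousOn_const hq
      exact max_eq_right_iff.1 h2
    · exact zero_le

namespace IsFlow

lemma aemeasurable_eLpNorm_density (h : IsFlow H ε T ρ v P Q e₀) (hH : IsDoubleWell H) {a b : ℝ}
    (ha : -1 ≤ a) (hb : b ≤ 1) {c : ℝ → ℝ}
    (hc : AEMeasurable c (volume.restrict (Ioo 0 T))) :
    AEMeasurable (fun t => eLpNorm (fun ξ => density H ε (ρ t : Measure ℝ) ξ - c t) ⊤
      (volume.restrict (Ioo a b))) (volume.restrict (Ioo 0 T)) := by
  have hsub : Ioo a b ⊆ Icc (-1) 1 := fun x hx => ⟨ha.trans hx.1.le, hx.2.le.trans hb⟩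
  have h1 : ∀ q : ℚ, AEMeasurable (fun t => if (q : ℝ) ∈ Ioo a b then
      ‖density H ε (ρ t : Measure ℝ) q - c t‖ₑ else 0) (volume.restrict (Ioo 0 T)) := fun q => by
    split_ifs with hq
    · exact ((h.aemeasurable_density hH (hsub hq)).sub hc).enorm
    · exact aemeasurable_const
  refine (AEMeasurable.iSup h1).congr ((h.ae_isRegular hH).mono fun t ht => ?_)
  exact (eLpNorm_top_eq_iSup (f := fun ξ => density H ε (ρ t : Measure ℝ) ξ - c t)
    ((ht.contDensity.continuousOn.mono hsub).sub continuousOn_const)).symm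

end IsFlow

lemma ae_prod_of_ae {α β : Type*} [MeasurableSpace α] [MeasurableSpace β] {μ : Measure α}
    {ν : Measure β} [SFinite ν] {s : Set β} (hs : ∀ᵐ y ∂ν, y ∈ s) {p : α → β → Prop}
    (hp : ∀ᵐ x ∂μ, ∀ y ∈ s, p x y) : ∀ᵐ z ∂(μ.prod ν), p z.1 z.2 := by
  filter_upwards [Measure.quasiMeasurePreserving_fst.ae hp,
    Measure.quasiMeasurePreserving_snd.ae hs] with z h1 h2 using h1 _ h2

lemma restrict_prod_eq (A B : Set ℝ) : (volume : Measure (ℝ × ℝ)).restrict (A ×ˢ B) =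
    (volume.restrict A).prod (volume.restrict B) := by
  rw [Measure.volume_eq_prod, Measure.prod_restrict]

lemma integrableOn_prod_of_bound {A B : Set ℝ} {f : ℝ × ℝ → ℝ} {W : ℝ → ℝ}
    (hf : AEStronglyMeasurable f ((volume.restrict A).prod (volume.restrict B)))
    (hi : ∀ᵐ t ∂(volume.restrict A), IntegrableOn (fun s => f (t, s)) B)
    (hle : ∀ᵐ t ∂(volume.restrict A), ∫ s in B, |f (t, s)| ≤ W t) (hW : IntegrableOn W A) :
    IntegrableOn f (A ×ˢ B) ∧ ∫ x in A ×ˢ B, |f x| ≤ ∫ t in A, W t := by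
  rw [IntegrableOn, restrict_prod_eq]
  have h1 : IntegrableOn (fun t => ∫ s in B, ‖f (t, s)‖) A := by
    refine hW.mono' hf.norm.integral_prod_right' (hle.mono fun t ht => ?_)
    rw [Real.norm_of_nonneg (integral_nonneg fun _ => norm_nonneg _)]
    exact ht
  have h2 := (integrable_prod_iff hf).2 ⟨hi, h1⟩
  refine ⟨h2, ?_⟩
  rw [integral_prod _ h2.abs]
  exact integral_mono_ae h1 hW hle

namespace IsFlow

lemma aestronglyMeasurable_uHat (h : IsFlow H ε T ρ v P Q e₀) (hH : IsDoubleWell H) :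
    AEStronglyMeasurable (fun x : ℝ × ℝ => uHat H ε (ρ x.1 : Measure ℝ) x.2)
      ((volume.restrict (Ioo 0 T)).prod (volume.restrict (Icc (-kap H) (kap H)))) := by
  obtain ⟨U, hU, hUd⟩ := h.exists_measurable_density hH
  have hX := (measurable_xiHat hH ε).comp_quasiMeasurePreserving
    (Measure.quasiMeasurePreserving_snd (μ := volume.restrict (Ioo 0 T)))
  refine ((hU.comp_aemeasurable (measurable_fst.aemeasurable.prodMk hX)).congr ?_).aestronglyMeasurable
  refine ae_prod_of_ae (ae_restrict_mem measurableSet_Icc) (p := fun t s =>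
    U (t, xiHat H ε s) = uHat H ε (ρ t : Measure ℝ) s) (hUd.mono fun t ht s hs => ?_)
  rw [uHat, ht _ (xiHat_mem hH ε hs)]

lemma aestronglyMeasurable_wHat (h : IsFlow H ε T ρ v P Q e₀) (hH : IsDoubleWell H) :
    AEStronglyMeasurable (fun x : ℝ × ℝ => wHat H ε (ρ x.1 : Measure ℝ) (v x.1) x.2)
      ((volume.restrict (Ioo 0 T)).prod (volume.restrict (Icc (-kap H) (kap H)))) := by
  have hX := (measurable_xiHat hH ε).comp_quasiMeasurePreserving
    (Measure.quasiMeasurePreserving_snd (μ := volume.restrict (Ioo 0 T)))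
  have hg : AEMeasurable (fun x : ℝ × ℝ => g H ε (xiHat H ε x.2))
      ((volume.restrict (Ioo 0 T)).prod (volume.restrict (Icc (-kap H) (kap H)))) :=
    (continuous_g hH ε).measurable.comp_aemeasurable hX
  have hv := h.finiteAction.velocity.measurable.comp_aemeasurable
    (measurable_fst.aemeasurable.prodMk hX)
  exact (((h.aestronglyMeasurable_uHat hH).aemeasurable.mul
    (hv.div (hg.const_mul _))).mul ((hg.pow_const 2).const_mul _)).aestronglyMeasurable

lemma integrableOn_uHat_and_le (h : IsFlow H ε T ρ v P Q e₀) (hH : IsDoubleWell H) :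
    IntegrableOn (fun x : ℝ × ℝ => uHat H ε (ρ x.1 : Measure ℝ) x.2)
        (Ioo 0 T ×ˢ Icc (-kap H) (kap H)) ∧
      ∫ x in Ioo 0 T ×ˢ Icc (-kap H) (kap H), |uHat H ε (ρ x.1 : Measure ℝ) x.2| ≤
        ∫ t in Ioo 0 T, 2 * kap H * boundRate H ε (ρ t) (ρ 0).mass := by
  have hκ := kap_pos hH
  refine integrableOn_prod_of_bound (h.aestronglyMeasurable_uHat hH)
    (W := fun t => 2 * kap H * boundRate H ε (ρ t) (ρ 0).mass) ?_ ?_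
    ((h.integrableOn_boundRate hH).const_mul _)
  · exact (h.ae_isRegular hH).mono fun t ht =>
      ((ht.hasW11Deriv_uHat hH).continuousOn (by linarith)).integrableOn_Icc
  · filter_upwards [h.ae_isRegular hH] with t ht
    have hc := (ht.hasW11Deriv_uHat hH).continuousOn (by linarith)
    have h1 : ∫ s in Icc (-kap H) (kap H), |uHat H ε (ρ t : Measure ℝ) s| ≤
        ∫ _ in Icc (-kap H) (kap H), boundRate H ε (ρ t) (ρ 0).mass := by
      refine setIntegral_mono_on hc.abs.integrableOn_Icc (integrableOn_const (by simp))
        measurableSet_Icc fun s hs => ?_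
      have := xiHat_mem hH ε hs
      rw [uHat, abs_of_nonneg (ht.nonneg this)]
      exact ht.le _ this
    refine h1.trans (le_of_eq ?_)
    rw [setIntegral_const, Real.volume_real_Icc_of_le (by linarith), smul_eq_mul]
    ring

lemma integrableOn_uHat (h : IsFlow H ε T ρ v P Q e₀) (hH : IsDoubleWell H) :
    IntegrableOn (fun x : ℝ × ℝ => uHat H ε (ρ x.1 : Measure ℝ) x.2)
      (Ioo 0 T ×ˢ Icc (-kap H) (kap H)) := (h.integrableOn_uHat_and_le hH).1

lemma integral_abs_uHat_le (h : IsFlow H ε T ρ v P Q e₀) (hH : IsDoubleWell H) :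
    ∫ x in Ioo 0 T ×ˢ Icc (-kap H) (kap H), |uHat H ε (ρ x.1 : Measure ℝ) x.2| ≤
      ∫ t in Ioo 0 T, 2 * kap H * boundRate H ε (ρ t) (ρ 0).mass :=
  (h.integrableOn_uHat_and_le hH).2

lemma integrableOn_wHat (h : IsFlow H ε T ρ v P Q e₀) (hH : IsDoubleWell H) :
    IntegrableOn (fun x : ℝ × ℝ => wHat H ε (ρ x.1 : Measure ℝ) (v x.1) x.2)
        (Ioo 0 T ×ˢ Icc (-kap H) (kap H)) ∧
      ∫ x in Ioo 0 T ×ˢ Icc (-kap H) (kap H), |wHat H ε (ρ x.1 : Measure ℝ) (v x.1) x.2| ≤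
        ∫ t in Ioo 0 T, √(2 * kap H) * boundRate H ε (ρ t) (ρ 0).mass :=
  integrableOn_prod_of_bound (h.aestronglyMeasurable_wHat hH)
    ((h.ae_isRegular hH).mono fun _ ht => ht.integrableOn_wHat hH)
    ((h.ae_isRegular hH).mono fun _ ht => ht.integral_abs_wHat_le hH)
    ((h.integrableOn_boundRate hH).const_mul _)

end IsFlow

end Measurability

/-! ### The equation for the first moment -/

section LongTime

variable {H : ℝ → ℝ} {ε T e₀ : ℝ} {ρ : ℝ → FiniteMeasure ℝ} {v P Q : ℝ → ℝ → ℝ}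

/-- Duhamel's formula with the integrating factor `exp (c t)`; for `r ≤ t` the weight `exp (c r)` is
at most `exp (c t)`, which the prefactor cancels. -/
lemma HasW11Deriv.abs_sub_exp_le {y q : ℝ → ℝ} (h : HasW11Deriv 0 T y q) (hT : 0 ≤ T) {c : ℝ}
    (hc : 0 ≤ c) {B : ℝ → ℝ} (hB : IntegrableOn B (Ioo 0 T))
    (hle : ∀ᵐ t ∂(volume.restrict (Ioo 0 T)), |q t + c * y t| ≤ B t) {t : ℝ} (ht : t ∈ Icc 0 T) :
    |y t - Real.exp (-(c * t)) * y 0| ≤ ∫ r in Ioo 0 T, B r := by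
  have hd : ∀ x, HasDerivAt (fun r => Real.exp (c * r)) (c * Real.exp (c * x)) x := fun x => by
    have := ((hasDerivAt_id x).const_mul c).exp
    simpa [mul_comm] using this
  have hec : Continuous fun r => Real.exp (c * r) := by fun_prop
  have hexp : HasW11Deriv 0 T (fun r => Real.exp (c * r)) fun r => c * Real.exp (c * r) :=
    HasW11Deriv.of_hasDerivAt_off_countable hT countable_empty hec.continuousOn
      (fun x _ => hd x) (Continuous.integrableOn_Icc (by fun_prop))
  have hprod : HasW11Deriv 0 T (fun r => Real.exp (c * r) * y r)
      (fun r => Real.exp (c * r) * (q r + c * y r)) := by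
    refine HasW11Deriv.of_absCont ((hexp.absCont hT).mul (h.absCont hT)) hT ?_
    filter_upwards [h.ae_hasDerivAt] with r hr
    refine ((hd r).mul hr).congr_deriv ?_
    ring
  have h1 := hprod.2 t ht
  simp only [mul_zero, Real.exp_zero, one_mul] at h1
  have hB0 : ∀ᵐ r ∂(volume.restrict (Ioo 0 T)), 0 ≤ B r :=
    hle.mono fun r hr => (abs_nonneg _).trans hr
  have hsub : Ioo 0 t ⊆ Ioo 0 T := Ioo_subset_Ioo_right ht.2
  have h2 : |∫ r in 0..t, Real.exp (c * r) * (q r + c * y r)| ≤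
      Real.exp (c * t) * ∫ r in Ioo 0 T, B r := by
    refine (intervalIntegral.abs_integral_le_integral_abs ht.1).trans ?_
    rw [intervalIntegral.integral_of_le ht.1, integral_Ioc_eq_integral_Ioo, ← integral_const_mul]
    refine le_trans ?_ (setIntegral_mono_set (hB.const_mul _) (hB0.mono fun r hr =>
      mul_nonneg (Real.exp_pos _).le hr) hsub.eventuallyLE)
    have hi := ((hprod.integrableOn hT).mono_set (hsub.trans Ioo_subset_Icc_self)).abs
    refine integral_mono_ae hi ((hB.mono_set hsub).const_mul _) ?_
    filter_upwards [ae_restrict_of_ae_restrict_of_subset hsub hle, ae_restrict_mem measurableSet_Ioo]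
      with r hr hrt
    rw [abs_mul, abs_of_pos (Real.exp_pos _)]
    gcongr
    exact hrt.2.le
  have h3 : y t - Real.exp (-(c * t)) * y 0 =
      Real.exp (-(c * t)) * ∫ r in 0..t, Real.exp (c * r) * (q r + c * y r) := by
    rw [show ∫ r in 0..t, Real.exp (c * r) * (q r + c * y r) = Real.exp (c * t) * y t - y 0 by
      linarith, mul_sub, ← mul_assoc, ← Real.exp_add]
    simp
  rw [h3, abs_mul, abs_of_pos (Real.exp_pos _)]
  calc _ ≤ Real.exp (-(c * t)) * (Real.exp (c * t) * ∫ r in Ioo 0 T, B r) := by gcongr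
    _ = _ := by rw [← mul_assoc, ← Real.exp_add]; simp

namespace IsFlow

/-- The continuity equation in the rescaled variables. -/
lemma hasW11Deriv_flux (h : IsFlow H ε T ρ v P Q e₀) (hH : IsDoubleWell H) {θ : ℝ → ℝ}
    (hθ : Continuous θ) :
    HasW11Deriv 0 T (fun t => ∫ ξ, (∫ s in (0 : ℝ)..sHat H ε ξ, θ s) ∂(ρ t : Measure ℝ))
      (fun t => ∫ s in Icc (-kap H) (kap H), θ s * wHat H ε (ρ t : Measure ℝ) (v t) s) := by
  have hd : ∀ ξ, HasDerivAt (fun ξ => ∫ s in (0 : ℝ)..sHat H ε ξ, θ s)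
      (1 / (tau H ε * g H ε ξ) * θ (sHat H ε ξ)) ξ := fun ξ => by
    have := (hθ.integral_hasStrictDerivAt 0 (sHat H ε ξ)).hasDerivAt.comp ξ (hasDerivAt_sHat hH ε ξ)
    rw [mul_comm] at this
    exact this
  have hc : Continuous fun ξ => 1 / (tau H ε * g H ε ξ) * θ (sHat H ε ξ) :=
    (continuous_one_div_tau_g hH ε).mul (hθ.comp (continuous_sHat hH ε))
  have hψ : HasW11Deriv (-1) 1 (fun ξ => ∫ s in (0 : ℝ)..sHat H ε ξ, θ s)
      (fun ξ => 1 / (tau H ε * g H ε ξ) * θ (sHat H ε ξ)) :=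
    HasW11Deriv.of_hasDerivAt_off_countable (by norm_num) countable_empty
      (fun ξ _ => (hd ξ).continuousAt.continuousWithinAt) (fun ξ _ => hd ξ) hc.integrableOn_Icc
  obtain ⟨C, hC⟩ := isCompact_Icc.exists_bound_of_continuousOn (hc.continuousOn (s := Icc (-1) 1))
  have hT := h.finiteAction.curve.pos
  refine (h.finiteAction.velocity.hasW11Deriv h.finiteAction.curve hψ hc.measurable hC).congr_deriv
    hT.le ?_
  rw [← restrict_Ioo_eq_restrict_Icc (a := 0) (b := T)]
  filter_upwards [h.ae_isRegular hH] with t ht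
  rw [ht.integral_mul_wHat hH]

lemma ae_integral_wHat (h : IsFlow H ε T ρ v P Q e₀) (hH : IsDoubleWell H) :
    ∀ᵐ t ∂(volume.restrict (Ioo 0 T)),
      ∫ s in Icc (-kap H) (kap H), wHat H ε (ρ t : Measure ℝ) (v t) s =
        -(density H ε (ρ t : Measure ℝ) 1 - density H ε (ρ t : Measure ℝ) (-1)) := by
  have hκ := kap_pos hH
  filter_upwards [h.ae_isRegular hH] with t ht
  have h1 := (ht.hasW11Deriv_uHat hH).2 (kap H) ⟨by linarith, le_rfl⟩
  rw [intervalIntegral.integral_neg, intervalIntegral.integral_of_le (by linarith),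
    ← integral_Icc_eq_integral_Ioc, uHat, uHat, xiHat_kap hH, xiHat_neg_kap hH] at h1
  linarith

/-- The first moment of the rescaled measure decays exponentially, up to a small error. -/
lemma abs_moment_sub_le (h : IsFlow H ε T ρ v P Q e₀) (hH : IsDoubleWell H) {t : ℝ}
    (ht : t ∈ Icc 0 T) :
    |∫ ξ, sHat H ε ξ ∂(ρ t : Measure ℝ) -
        Real.exp (-(2 / kap H * t)) * ∫ ξ, sHat H ε ξ ∂(ρ 0 : Measure ℝ)| ≤
      2 / kap H * wellError H ε * ∫ r in Ioo 0 T, boundRate H ε (ρ r) (ρ 0).mass := by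
  have hκ := kap_pos hH
  have hT := h.finiteAction.curve.pos
  have h1 : HasW11Deriv 0 T (fun t => ∫ ξ, sHat H ε ξ ∂(ρ t : Measure ℝ))
      (fun t => ∫ s in Icc (-kap H) (kap H), wHat H ε (ρ t : Measure ℝ) (v t) s) := by
    simpa using h.hasW11Deriv_flux hH (continuous_const (y := (1 : ℝ)))
  rw [← integral_const_mul (2 / kap H * wellError H ε)]
  refine h1.abs_sub_exp_le hT.le (c := 2 / kap H) (by positivity) ((h.integrableOn_boundRate hH).const_mul _) ?_ ht
  filter_upwards [h.ae_isRegular hH, h.ae_integral_wHat hH] with r hr hw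
  -- The derivative of the moment is minus the difference of the traces, which the affine
  -- approximation expresses by the moment itself: this closes the equation.
  have h2 := (hr.affine hH).2
  rw [hw]
  have e : -(density H ε (ρ r : Measure ℝ) 1 - density H ε (ρ r : Measure ℝ) (-1)) +
      2 / kap H * ∫ ξ, sHat H ε ξ ∂(ρ r : Measure ℝ) =
      2 / kap H * (∫ ξ, sHat H ε ξ ∂(ρ r : Measure ℝ) -
        kap H * (density H ε (ρ r : Measure ℝ) 1 - density H ε (ρ r : Measure ℝ) (-1)) / 2) := by
    field_simp
    ring
  rw [e, abs_mul, abs_of_pos (by positivity), mul_assoc]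
  gcongr

end IsFlow

end LongTime

/-! ### Vanishing of the interpolation error -/

section Scaling

variable {H : ℝ → ℝ}

/-- For `|ξ| ≥ 1 / 2` monotonicity gives the first term; for `|ξ| ≤ 1 / 2` the second term alone is
at least `kap H`. -/
lemma kap_sub_abs_sHat_le (hH : IsDoubleWell H) (ε : ℝ) {ξ : ℝ} (hξ : ξ ∈ Icc (-1 : ℝ) 1) :
    kap H - |sHat H ε ξ| ≤ (kap H - sHat H ε (1 / 2)) + 2 * kap H * (1 - |ξ|) := by
  have hκ := kap_pos hH
  have h0 : sHat H ε (1 / 2) ≤ kap H := by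
    rw [← sHat_one hH ε]; exact (strictMono_sHat hH ε).monotone (by norm_num)
  have hodd : |sHat H ε ξ| = sHat H ε |ξ| := by
    have hmono := (strictMono_sHat hH ε).monotone
    rcases le_total 0 ξ with h | h
    · have := hmono h
      rw [sHat_zero] at this
      rw [abs_of_nonneg this, abs_of_nonneg h]
    · have := hmono h
      rw [sHat_zero] at this
      rw [abs_of_nonpos this, abs_of_nonpos h, sHat_neg hH]
  have hle := abs_le.2 hξ
  rcases le_total (1 / 2) |ξ| with h | h
  · have := (strictMono_sHat hH ε).monotone h
    rw [hodd]
    nlinarith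
  · nlinarith [abs_nonneg (sHat H ε ξ)]

variable {ε : ℕ → ℝ}

lemma tendsto_wellDefect (hH : IsDoubleWell H) (hε : ∀ n, 0 < ε n) (hε0 : Tendsto ε atTop (𝓝 0)) :
    Tendsto (fun n => wellDefect H (ε n)) atTop (𝓝 0) := by
  have hκ := kap_pos hH
  have h1 := tendsto_sHat hH hε hε0 (δ := 1 / 2) (by norm_num)
  have h2 := tendsto_integral_gam hH hε hε0
  have h3 : Tendsto (fun n => 2 * kap H * ((kap H - sHat H (ε n) (1 / 2)) +
      2 * kap H * ∫ ξ, (1 - |ξ|) ∂(gam H (ε n)))) atTop (𝓝 0) := by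
    have := ((h1.const_sub (kap H)).add (h2.const_mul (2 * kap H))).const_mul (2 * kap H)
    simpa using this
  refine squeeze_zero (fun n => wellDefect_nonneg hH _) (fun n => ?_) h3
  have := isProbabilityMeasure_gam hH (ε n)
  have hsc := (continuous_sHat hH (ε n)).continuousOn (s := Icc (-1) 1)
  have hdc : ContinuousOn (fun ξ => kap H ^ 2 - sHat H (ε n) ξ ^ 2) (Icc (-1) 1) :=
    continuousOn_const.sub (hsc.pow 2)
  have hac : ContinuousOn (fun ξ : ℝ => 1 - |ξ|) (Icc (-1) 1) := by fun_prop
  have hai := integrable_gam_of_continuousOn hH hac (ε n)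
  have e : 2 * kap H * ((kap H - sHat H (ε n) (1 / 2)) + 2 * kap H * ∫ ξ, (1 - |ξ|) ∂(gam H (ε n))) =
      ∫ ξ, 2 * kap H * ((kap H - sHat H (ε n) (1 / 2)) + 2 * kap H * (1 - |ξ|)) ∂(gam H (ε n)) := by
    rw [integral_const_mul, integral_add (integrable_const _) (hai.const_mul _),
      integral_const_mul]
    simp
  rw [e, wellDefect]
  refine integral_mono_ae (integrable_gam_of_continuousOn hH hdc _)
    (((integrable_const _).add (hai.const_mul _)).const_mul _) ((ae_gam_mem H _).mono fun ξ hξ => ?_)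
  have h4 := kap_sub_abs_sHat_le hH (ε n) hξ
  have h5 := abs_le.2 (sHat_mem hH (ε n) hξ)
  have h6 : sHat H (ε n) ξ ^ 2 = |sHat H (ε n) ξ| ^ 2 := (sq_abs _).symm
  have h7 := abs_nonneg (sHat H (ε n) ξ)
  change kap H ^ 2 - sHat H (ε n) ξ ^ 2 ≤ 2 * kap H * _
  rw [h6]
  calc kap H ^ 2 - |sHat H (ε n) ξ| ^ 2
      = (kap H + |sHat H (ε n) ξ|) * (kap H - |sHat H (ε n) ξ|) := by ring
    _ ≤ (2 * kap H) * (kap H - |sHat H (ε n) ξ|) := by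
        gcongr
        linarith
    _ ≤ _ := by gcongr

lemma tendsto_wellError (hH : IsDoubleWell H) (hε : ∀ n, 0 < ε n) (hε0 : Tendsto ε atTop (𝓝 0)) :
    Tendsto (fun n => wellError H (ε n)) atTop (𝓝 0) := by
  have h := tendsto_wellDefect hH hε hε0
  have h1 := ((h.sqrt.const_mul (√(2 * kap H) / kap H)).const_mul (1 + kap H)).add
    (h.div_const (2 * kap H))
  simpa [wellError] using h1

lemma wellError_nonneg (hH : IsDoubleWell H) (ε : ℝ) : 0 ≤ wellError H ε := by
  have := kap_pos hH
  have := wellDefect_nonneg hH ε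
  unfold wellError
  positivity

end Scaling

/-! ### Two criteria for weak convergence -/

section WeakLimits

/-- Near the end points `G` is small by continuity; elsewhere `b - |x|` is bounded below and a large
multiple of it exceeds `|G|`. -/
lemma exists_le_add_mul {G : ℝ → ℝ} (hG : Continuous G) {b : ℝ} (hb : 0 < b) (h1 : G b = 0)
    (h2 : G (-b) = 0) {η : ℝ} (hη : 0 < η) :
    ∃ C, 0 ≤ C ∧ ∀ x, |x| ≤ b → |G x| ≤ η + C * (b - |x|) := by
  obtain ⟨K, hK⟩ := isCompact_Icc.exists_bound_of_continuousOn (hG.continuousOn (s := Icc (-b) b))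
  have hK0 : 0 ≤ K := (norm_nonneg _).trans (hK b ⟨by linarith, le_rfl⟩)
  obtain ⟨δ₁, hδ₁, hd₁⟩ := Metric.continuous_iff.1 hG b η hη
  obtain ⟨δ₂, hδ₂, hd₂⟩ := Metric.continuous_iff.1 hG (-b) η hη
  have hδ : 0 < min δ₁ δ₂ := lt_min hδ₁ hδ₂
  refine ⟨K / min δ₁ δ₂, by positivity, fun x hx => ?_⟩
  have hC : 0 ≤ K / min δ₁ δ₂ * (b - |x|) := mul_nonneg (by positivity) (sub_nonneg.2 hx)
  by_cases hlt : b - |x| < min δ₁ δ₂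
  · have : |G x| < η := by
      rcases le_total 0 x with h | h
      · have := hd₁ x (by
          rw [Real.dist_eq, abs_sub_comm, abs_of_nonneg (by linarith [abs_le.1 hx])]
          rw [abs_of_nonneg h] at hlt
          exact hlt.trans_le (min_le_left _ _))
        rwa [h1, Real.dist_eq, sub_zero] at this
      · have := hd₂ x (by
          rw [Real.dist_eq, sub_neg_eq_add, abs_of_nonneg (by linarith [abs_le.1 hx])]
          rw [abs_of_nonpos h] at hlt
          linarith [min_le_right δ₁ δ₂])
        rwa [h2, Real.dist_eq, sub_zero] at this
    linarith
  · have h3 := hK x (abs_le.1 hx)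
    rw [Real.norm_eq_abs] at h3
    have : K ≤ K / min δ₁ δ₂ * (b - |x|) := by
      rw [div_mul_eq_mul_div, le_div_iff₀ hδ]
      exact mul_le_mul_of_nonneg_left (not_lt.1 hlt) hK0
    linarith

/-- A sequence of measures on `[-b, b]` that concentrates at the end points converges as soon as
its mass and its first moment converge. -/
lemma tendsto_integral_of_concentration {μ : ℕ → Measure ℝ} [∀ n, IsFiniteMeasure (μ n)]
    {X : ℕ → ℝ → ℝ} {b m A : ℝ} (hb : 0 < b) (hX : ∀ n, AEMeasurable (X n) (μ n))
    (hXb : ∀ n, ∀ᵐ ξ ∂(μ n), |X n ξ| ≤ b) (hm : ∀ n, (μ n).real univ = m)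
    (h1 : Tendsto (fun n => ∫ ξ, (b - |X n ξ|) ∂(μ n)) atTop (𝓝 0))
    (h2 : Tendsto (fun n => ∫ ξ, X n ξ ∂(μ n)) atTop (𝓝 (b * A))) {F : ℝ → ℝ}
    (hF : Continuous F) :
    Tendsto (fun n => ∫ ξ, F (X n ξ) ∂(μ n)) atTop
      (𝓝 (((m - A) * F (-b) + (m + A) * F b) / 2)) := by
  have hm0 : 0 ≤ m := (hm 0) ▸ measureReal_nonneg
  have hint : ∀ {G : ℝ → ℝ}, Continuous G → ∀ n, Integrable (fun ξ => G (X n ξ)) (μ n) :=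
    fun {G} hG n => by
      obtain ⟨K, hK⟩ := isCompact_Icc.exists_bound_of_continuousOn
        (hG.continuousOn (s := Icc (-b) b))
      exact Integrable.of_bound (hG.measurable.comp_aemeasurable (hX n)).aestronglyMeasurable K
        ((hXb n).mono fun ξ hξ => hK _ (abs_le.1 hξ))
  -- The affine function `c₁ x + c₀` agrees with `F` at both end points, and its integral involves
  -- only mass and first moment. The remainder `G` vanishes at the end points, so concentration
  -- disposes of it.
  set c₁ := (F b - F (-b)) / (2 * b) with hc₁
  set c₀ := (F b + F (-b)) / 2 with hc₀
  set G : ℝ → ℝ := fun x => F x - (c₁ * x + c₀) with hGdef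
  have hG : Continuous G := by fun_prop
  have hGb : G b = 0 := by simp only [hGdef, hc₁, hc₀]; field_simp; ring
  have hGb' : G (-b) = 0 := by simp only [hGdef, hc₁, hc₀]; field_simp; ring
  have hG0 : Tendsto (fun n => ∫ ξ, G (X n ξ) ∂(μ n)) atTop (𝓝 0) := by
    rw [Metric.tendsto_atTop]
    intro e he
    obtain ⟨C, hC, hCG⟩ := exists_le_add_mul hG hb hGb hGb' (η := e / (2 * (m + 1))) (by positivity)
    obtain ⟨N, hN⟩ := Metric.tendsto_atTop.1 (h1.const_mul C) (e / 2) (by positivity)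
    refine ⟨N, fun n hn => ?_⟩
    have h3 := hN n hn
    rw [mul_zero, Real.dist_eq, sub_zero] at h3
    have hi := hint (G := fun x => b - |x|) (by fun_prop) n
    have h4 : |∫ ξ, G (X n ξ) ∂(μ n)| ≤ ∫ ξ, (e / (2 * (m + 1)) + C * (b - |X n ξ|)) ∂(μ n) :=
      abs_integral_le_integral_abs.trans (integral_mono_ae (hint hG n).abs
        ((integrable_const _).add (hi.const_mul C)) ((hXb n).mono fun ξ hξ => hCG _ hξ))
    rw [integral_add (integrable_const _) (hi.const_mul C), integral_const, integral_const_mul,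
      hm n, smul_eq_mul] at h4
    have h5 : m * (e / (2 * (m + 1))) ≤ e / 2 := by
      rw [← mul_div_assoc, div_le_div_iff₀ (by positivity) (by positivity)]
      nlinarith
    rw [Real.dist_eq, sub_zero]
    linarith [le_abs_self (C * ∫ ξ, (b - |X n ξ|) ∂(μ n))]
  have hlim := hG0.add ((h2.const_mul c₁).add_const (c₀ * m))
  have e : 0 + (c₁ * (b * A) + c₀ * m) = ((m - A) * F (-b) + (m + A) * F b) / 2 := by
    simp only [hc₁, hc₀]; field_simp; ring
  rw [e] at hlim
  refine hlim.congr fun n => ?_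
  have hXi := hint (G := fun x => x) continuous_id n
  have e2 : ∫ ξ, G (X n ξ) ∂(μ n) = ∫ ξ, F (X n ξ) ∂(μ n) - ∫ ξ, (c₁ * X n ξ + c₀) ∂(μ n) :=
    integral_sub (hint hF n) ((hXi.const_mul c₁).add (integrable_const c₀))
  rw [e2, integral_add (hXi.const_mul c₁) (integrable_const c₀), integral_const_mul,
    integral_const, hm n, smul_eq_mul]
  ring

/-- For sequences that are bounded in `L¹`, weak convergence needs to be tested with products of
intervals in time and continuous functions in space only. -/
lemma tendsto_integral_of_step {T κ C : ℝ} (hT : 0 < T) {w : ℕ → ℝ × ℝ → ℝ} {w₀ : ℝ × ℝ → ℝ}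
    (hw : ∀ n, IntegrableOn (w n) (Icc 0 T ×ˢ Icc (-κ) κ))
    (hC : ∀ n, ∫ x in Icc 0 T ×ˢ Icc (-κ) κ, |w n x| ≤ C)
    (hw₀ : IntegrableOn w₀ (Icc 0 T ×ˢ Icc (-κ) κ))
    (hlim : ∀ θ : ℝ → ℝ, ContinuousOn θ (Icc (-κ) κ) → ∀ a b, 0 ≤ a → a ≤ b → b ≤ T →
      Tendsto (fun n => ∫ x in Ioc a b ×ˢ Icc (-κ) κ, θ x.2 * w n x) atTop
        (𝓝 (∫ x in Ioc a b ×ˢ Icc (-κ) κ, θ x.2 * w₀ x)))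
    {φ : ℝ × ℝ → ℝ} (hφ : ContinuousOn φ (Icc 0 T ×ˢ Icc (-κ) κ)) :
    Tendsto (fun n => ∫ x in Icc 0 T ×ˢ Icc (-κ) κ, φ x * w n x) atTop
      (𝓝 (∫ x in Icc 0 T ×ˢ Icc (-κ) κ, φ x * w₀ x)) := by
  set S := Icc (-κ) κ with hS
  have hK : IsCompact (Icc 0 T ×ˢ S) := isCompact_Icc.prod isCompact_Icc
  have hsub : ∀ {a b : ℝ}, 0 ≤ a → b ≤ T → Ioc a b ×ˢ S ⊆ Icc 0 T ×ˢ S := fun {a b} ha hb =>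
    prod_mono (fun x hx => ⟨ha.trans hx.1.le, hx.2.trans hb⟩) Subset.rfl
  have hms : ∀ {a b : ℝ}, MeasurableSet (Ioc a b ×ˢ S) := fun {a b} =>
    measurableSet_Ioc.prod measurableSet_Icc
  have hC0 : 0 ≤ C := (integral_nonneg fun _ => abs_nonneg _).trans (hC 0)
  set C₀ := (∫ x in Icc 0 T ×ˢ S, |w₀ x|) with hC₀
  have hC₀0 : 0 ≤ C₀ := integral_nonneg fun _ => abs_nonneg _
  -- comparison on a short time interval
  have hstep : ∀ {f : ℝ × ℝ → ℝ}, IntegrableOn f (Icc 0 T ×ˢ S) → ∀ {a b η : ℝ}, 0 ≤ a → a ≤ b →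
      b ≤ T → (∀ x ∈ Ioc a b ×ˢ S, |φ x - φ (a, x.2)| ≤ η) →
      |(∫ x in Ioc a b ×ˢ S, φ x * f x) - (∫ x in Ioc a b ×ˢ S, φ (a, x.2) * f x)| ≤
        η * (∫ x in Ioc a b ×ˢ S, |f x|) := fun {f} hf {a b η} ha hab hb hη => by
    have h1 := (hf.continuousOn_mul hφ hK).mono_set (hsub ha hb)
    have hc : ContinuousOn (fun x : ℝ × ℝ => φ (a, x.2)) (Icc 0 T ×ˢ S) :=
      hφ.comp (by fun_prop) fun x hx => ⟨⟨ha, hab.trans hb⟩, hx.2⟩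
    have h2 := (hf.continuousOn_mul hc hK).mono_set (hsub ha hb)
    rw [← integral_sub h1 h2, ← integral_const_mul]
    refine abs_integral_le_integral_abs.trans (setIntegral_mono_on (h1.sub h2).abs
      ((hf.mono_set (hsub ha hb)).abs.const_mul η) hms fun x hx => ?_)
    rw [← sub_mul, abs_mul]
    exact mul_le_mul_of_nonneg_right (hη x hx) (abs_nonneg _)
  have hsplit : ∀ {f : ℝ × ℝ → ℝ}, IntegrableOn f (Icc 0 T ×ˢ S) → ∀ {a b : ℝ}, 0 ≤ a → a ≤ b →
      b ≤ T → (∫ x in Ioc 0 b ×ˢ S, f x) = (∫ x in Ioc 0 a ×ˢ S, f x) + (∫ x in Ioc a b ×ˢ S, f x) :=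
    fun {f} hf {a b} ha hab hb => by
      rw [← Ioc_union_Ioc_eq_Ioc ha hab, union_prod]
      refine setIntegral_union ?_ hms (hf.mono_set (hsub le_rfl (hab.trans hb)))
        (hf.mono_set (hsub ha hb))
      refine Set.disjoint_left.2 fun x hx hx' => ?_
      exact absurd hx.1.2 (not_le.2 hx'.1.1)
  -- On each of the `N + 1` time cells the test function is frozen at the left end point. Freezing
  -- costs `η` times the local `L¹` norms, which add up over the cells; the frozen parts converge by
  -- hypothesis and are collected in `r`.
  have hind : ∀ η > 0, ∀ N : ℕ, (∀ x ∈ Icc 0 T ×ˢ S, ∀ y ∈ Icc 0 T ×ˢ S,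
      dist x y ≤ T / (N + 1) → |φ x - φ y| ≤ η) → ∀ j : ℕ, j ≤ N + 1 →
      ∃ r : ℕ → ℝ, Tendsto r atTop (𝓝 0) ∧ ∀ n,
        |(∫ x in Ioc 0 (j * (T / (N + 1))) ×ˢ S, φ x * w n x) -
          (∫ x in Ioc 0 (j * (T / (N + 1))) ×ˢ S, φ x * w₀ x)| ≤
        η * ((∫ x in Ioc 0 (j * (T / (N + 1))) ×ˢ S, |w n x|) +
          (∫ x in Ioc 0 (j * (T / (N + 1))) ×ˢ S, |w₀ x|)) + r n := by
    intro η hη N hN j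
    induction j with
    | zero => exact fun _ => ⟨fun _ => 0, tendsto_const_nhds, fun n => by simp⟩
    | succ j ih =>
      intro hj
      obtain ⟨r, hr, hrb⟩ := ih (by omega)
      set a := (j : ℝ) * (T / (N + 1)) with ha
      set b := ((j + 1 : ℕ) : ℝ) * (T / (N + 1)) with hb
      have hba : b = a + T / (N + 1) := by rw [ha, hb]; push_cast; ring
      have ha0 : 0 ≤ a := by positivity
      have hab : a ≤ b := by rw [hba]; linarith [show 0 ≤ T / ((N : ℝ) + 1) by positivity]
      have hbT : b ≤ T := by
        have : ((j + 1 : ℕ) : ℝ) ≤ N + 1 := by exact_mod_cast hj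
        calc b ≤ (N + 1) * (T / (N + 1)) := by rw [hb]; gcongr
          _ = T := by field_simp
      have haT : a ∈ Icc 0 T := ⟨ha0, hab.trans hbT⟩
      have hosc : ∀ x ∈ Ioc a b ×ˢ S, |φ x - φ (a, x.2)| ≤ η := fun x hx => by
        refine hN x (hsub ha0 hbT hx) (a, x.2) ⟨haT, hx.2⟩ ?_
        have : dist x (a, x.2) = |x.1 - a| := by
          rw [Prod.dist_eq, dist_self, max_eq_left dist_nonneg, Real.dist_eq]
        rw [this, abs_of_nonneg (by linarith [hx.1.1])]
        linarith [hx.1.2]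
      have hθ : ContinuousOn (fun s => φ (a, s)) S :=
        hφ.comp (by fun_prop) fun s hs => ⟨haT, hs⟩
      have h0 := hlim _ hθ a b ha0 hab hbT
      refine ⟨fun n => r n + |(∫ x in Ioc a b ×ˢ S, φ (a, x.2) * w n x) -
        (∫ x in Ioc a b ×ˢ S, φ (a, x.2) * w₀ x)|, ?_, fun n => ?_⟩
      · have := hr.add (h0.sub_const (∫ x in Ioc a b ×ˢ S, φ (a, x.2) * w₀ x)).abs
        simpa using this
      · rw [hsplit ((hw n).continuousOn_mul hφ hK) ha0 hab hbT,
          hsplit (hw₀.continuousOn_mul hφ hK) ha0 hab hbT,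
          hsplit (hw n).abs ha0 hab hbT, hsplit hw₀.abs ha0 hab hbT]
        have h1 := hstep (hw n) ha0 hab hbT hosc
        have h2 := hstep hw₀ ha0 hab hbT hosc
        have h3 := hrb n
        rw [abs_le] at h1 h2 h3
        have h4 := neg_abs_le ((∫ x in Ioc a b ×ˢ S, φ (a, x.2) * w n x) -
          (∫ x in Ioc a b ×ˢ S, φ (a, x.2) * w₀ x))
        have h5 := le_abs_self ((∫ x in Ioc a b ×ˢ S, φ (a, x.2) * w n x) -
          (∫ x in Ioc a b ×ˢ S, φ (a, x.2) * w₀ x))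
        rw [abs_le]
        constructor <;> linarith [h1.1, h1.2, h2.1, h2.2, h3.1, h3.2]
  have hIoc : (volume : Measure (ℝ × ℝ)).restrict (Icc 0 T ×ˢ S) =
      (volume : Measure (ℝ × ℝ)).restrict (Ioc 0 T ×ˢ S) := by
    rw [restrict_prod_eq, restrict_prod_eq, ← restrict_Ioc_eq_restrict_Icc]
  rw [Metric.tendsto_atTop]
  intro e he
  -- Chosen so that the freezing error, `η` times at most `C + C₀`, does not exceed `e / 2`.
  set η := e / (2 * (C + C₀ + 1)) with hη
  have hη0 : 0 < η := by positivity
  obtain ⟨δ, hδ, hd⟩ := Metric.uniformContinuousOn_iff.1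
    (hK.uniformContinuousOn_of_continuous hφ) η hη0
  obtain ⟨N, hN⟩ := exists_nat_gt (T / δ)
  have hNδ : T / (N + 1) < δ := by
    rw [div_lt_iff₀ hδ] at hN
    rw [div_lt_iff₀ (by positivity)]
    nlinarith
  obtain ⟨r, hr, hrb⟩ := hind η hη0 N (fun x hx y hy hxy => (hd x hx y hy (hxy.trans_lt hNδ)).le)
    (N + 1) le_rfl
  have hT' : ((N + 1 : ℕ) : ℝ) * (T / (N + 1)) = T := by push_cast; field_simp
  rw [hT', ← hIoc] at hrb
  obtain ⟨N', hN'⟩ := Metric.tendsto_atTop.1 hr (e / 2) (by positivity)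
  refine ⟨N', fun n hn => ?_⟩
  have h1 := hN' n hn
  rw [Real.dist_eq, sub_zero] at h1
  have h2 : η * ((∫ x in Icc 0 T ×ˢ S, |w n x|) + C₀) ≤ e / 2 := by
    calc η * ((∫ x in Icc 0 T ×ˢ S, |w n x|) + C₀) ≤ η * (C + C₀ + 1) := by
          refine mul_le_mul_of_nonneg_left ?_ hη0.le
          linarith [hC n]
      _ = e / 2 := by rw [hη]; field_simp
  rw [Real.dist_eq]
  linarith [hrb n, le_abs_self (r n)]

end WeakLimits

/-! ### Convergence of the measures -/

section Limits

variable {H : ℝ → ℝ} {T m C α : ℝ} {ε : ℕ → ℝ} {ρ : ℕ → ℝ → FiniteMeasure ℝ}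
  {v P Q : ℕ → ℝ → ℝ → ℝ} {e₀ : ℕ → ℝ}

/-- A sequence of solutions of mass `m` and bounded energy whose rescaled first moments converge
initially. -/
structure IsFlowSeq (H : ℝ → ℝ) (T m C α : ℝ) (ε : ℕ → ℝ) (ρ : ℕ → ℝ → FiniteMeasure ℝ)
    (v P Q : ℕ → ℝ → ℝ → ℝ) (e₀ : ℕ → ℝ) : Prop where
  pos : ∀ n, 0 < ε n
  tendsto_zero : Tendsto ε atTop (𝓝 0)
  flow : ∀ n, IsFlow H (ε n) T (ρ n) (v n) (P n) (Q n) (e₀ n)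
  mass : ∀ n, ((ρ n 0).mass : ℝ) = m
  energy_le : ∀ n, e₀ n ≤ C
  moment : Tendsto (fun n => ∫ ξ, sHat H (ε n) ξ ∂(ρ n 0 : Measure ℝ)) atTop (𝓝 α)

/-- Half the difference of the limit masses at time `t`. -/
def gap (H : ℝ → ℝ) (α t : ℝ) : ℝ := α / kap H * Real.exp (-(2 / kap H * t))

lemma continuous_gap : Continuous (gap H α) := by unfold gap; fun_prop

namespace IsFlowSeq

/-- The uniform bound for `∫ boundRate`. -/
def bound (H : ℝ → ℝ) (T m C : ℝ) : ℝ := 2 * m * T + (1 + 4 * kap H) * (C / 2)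

lemma isCurve (h : IsFlowSeq H T m C α ε ρ v P Q e₀) (n : ℕ) : IsCurve T (ρ n) :=
  (h.flow n).finiteAction.curve

lemma regular (h : IsFlowSeq H T m C α ε ρ v P Q e₀) (hH : IsDoubleWell H) (n : ℕ) :
    ∀ᵐ t ∂(volume.restrict (Ioo 0 T)), IsRegular H (ε n) (ρ n t : Measure ℝ) (v n t) m
      (boundRate H (ε n) (ρ n t) m) := by
  have := (h.flow n).ae_isRegular hH
  rwa [h.mass n] at this

lemma integrableOn_boundRate (h : IsFlowSeq H T m C α ε ρ v P Q e₀) (hH : IsDoubleWell H)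
    (n : ℕ) : IntegrableOn (fun t => boundRate H (ε n) (ρ n t) m) (Ioo 0 T) := by
  have := (h.flow n).integrableOn_boundRate hH
  rwa [h.mass n] at this

lemma integral_boundRate_le (h : IsFlowSeq H T m C α ε ρ v P Q e₀) (hH : IsDoubleWell H)
    (n : ℕ) : ∫ t in Ioo 0 T, boundRate H (ε n) (ρ n t) m ≤ bound H T m C := by
  have h1 := (h.flow n).integral_boundRate_le hH
  rw [h.mass n] at h1
  have := kap_pos hH
  refine h1.trans ?_
  unfold bound
  gcongr
  exact h.energy_le n

lemma real_univ (h : IsFlowSeq H T m C α ε ρ v P Q e₀) (n : ℕ) {t : ℝ} (ht : t ∈ Icc 0 T) :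
    (ρ n t : Measure ℝ).real univ = m := by
  rw [← h.mass n, ← (h.flow n).finiteAction.velocity.mass_eq (h.isCurve n) ht]
  rfl

lemma integrable_of_continuousOn (h : IsFlowSeq H T m C α ε ρ v P Q e₀) (n : ℕ) {t : ℝ}
    (ht : t ∈ Icc 0 T) {f : ℝ → ℝ} (hf : ContinuousOn f (Icc (-1) 1)) :
    Integrable f (ρ n t : Measure ℝ) := by
  rw [← Measure.restrict_eq_self_of_ae_mem ((h.isCurve n).ae_mem ht)]
  exact hf.integrableOn_compact isCompact_Icc

/-- The order of the choices matters: `Λ` is fixed first, large enough to make the energy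
contribution small, and only then does `ε → 0` remove the term with the factor `exp Λ - 1`. -/
lemma tendsto_concentration (h : IsFlowSeq H T m C α ε ρ v P Q e₀) (hH : IsDoubleWell H) {t : ℝ}
    (ht : t ∈ Icc 0 T) :
    Tendsto (fun n => ∫ ξ, (1 - |ξ|) ∂(ρ n t : Measure ℝ)) atTop (𝓝 0) := by
  set K := C + m * Real.log m - m + 1 with hK
  have h0 : ∀ n, 0 ≤ ∫ ξ, (1 - |ξ|) ∂(ρ n t : Measure ℝ) := fun n =>
    integral_nonneg_of_ae (((h.isCurve n).ae_mem ht).mono fun ξ hξ => sub_nonneg.2 (abs_le.2 hξ))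
  rw [Metric.tendsto_atTop]
  intro e he
  set Λ := 2 * (|K| + 1) / e with hΛ
  have hΛ0 : 0 < Λ := by positivity
  have hΛe : Λ * e = 2 * (|K| + 1) := by rw [hΛ]; field_simp
  obtain ⟨N, hN⟩ := Metric.tendsto_atTop.1
    ((tendsto_integral_gam hH h.pos h.tendsto_zero).const_mul (Real.exp Λ - 1)) 1 one_pos
  refine ⟨N, fun n hn => ?_⟩
  have h1 := hN n hn
  rw [mul_zero, Real.dist_eq, sub_zero] at h1
  have h2 := (h.flow n).integral_le hH Λ ht
  rw [h.mass n] at h2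
  have h3 := h.energy_le n
  rw [Real.dist_eq, sub_zero, abs_of_nonneg (h0 n)]
  refine lt_of_mul_lt_mul_left ?_ hΛ0.le
  rw [hΛe]
  linarith [le_abs_self K, le_abs_self ((Real.exp Λ - 1) * ∫ ξ, (1 - |ξ|) ∂(gam H (ε n))),
    abs_nonneg K]

lemma tendsto_concentration_sHat (h : IsFlowSeq H T m C α ε ρ v P Q e₀) (hH : IsDoubleWell H)
    {t : ℝ} (ht : t ∈ Icc 0 T) :
    Tendsto (fun n => ∫ ξ, (kap H - |sHat H (ε n) ξ|) ∂(ρ n t : Measure ℝ)) atTop (𝓝 0) := by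
  have h1 := tendsto_sHat hH h.pos h.tendsto_zero (δ := 1 / 2) (by norm_num)
  have h2 : Tendsto (fun n => m * (kap H - sHat H (ε n) (1 / 2)) +
      2 * kap H * ∫ ξ, (1 - |ξ|) ∂(ρ n t : Measure ℝ)) atTop (𝓝 0) := by
    have := ((h1.const_sub (kap H)).const_mul m).add
      ((h.tendsto_concentration hH ht).const_mul (2 * kap H))
    simpa using this
  refine squeeze_zero (fun n => integral_nonneg_of_ae (((h.isCurve n).ae_mem ht).mono fun ξ hξ =>
    sub_nonneg.2 (abs_le.2 (sHat_mem hH (ε n) hξ)))) (fun n => ?_) h2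
  have hac : ContinuousOn (fun ξ : ℝ => 1 - |ξ|) (Icc (-1) 1) := by fun_prop
  have hai := h.integrable_of_continuousOn n ht hac
  have hsc : ContinuousOn (fun ξ => kap H - |sHat H (ε n) ξ|) (Icc (-1) 1) :=
    continuousOn_const.sub (continuous_sHat hH (ε n)).continuousOn.abs
  have e : m * (kap H - sHat H (ε n) (1 / 2)) + 2 * kap H * ∫ ξ, (1 - |ξ|) ∂(ρ n t : Measure ℝ) =
      ∫ ξ, ((kap H - sHat H (ε n) (1 / 2)) + 2 * kap H * (1 - |ξ|)) ∂(ρ n t : Measure ℝ) := by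
    rw [integral_add (integrable_const _) (hai.const_mul _), integral_const_mul, integral_const,
      h.real_univ n ht, smul_eq_mul]
  rw [e]
  exact integral_mono_ae (h.integrable_of_continuousOn n ht hsc)
    ((integrable_const _).add (hai.const_mul _))
    (((h.isCurve n).ae_mem ht).mono fun ξ hξ => kap_sub_abs_sHat_le hH (ε n) hξ)

/-- The error in the first moments. -/
def momentError (H : ℝ → ℝ) (T m C α : ℝ) (ε : ℕ → ℝ) (ρ : ℕ → ℝ → FiniteMeasure ℝ) (n : ℕ) : ℝ :=
  |∫ ξ, sHat H (ε n) ξ ∂(ρ n 0 : Measure ℝ) - α| +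
    2 / kap H * wellError H (ε n) * bound H T m C

lemma tendsto_momentError (h : IsFlowSeq H T m C α ε ρ v P Q e₀) (hH : IsDoubleWell H) :
    Tendsto (momentError H T m C α ε ρ) atTop (𝓝 0) := by
  have h1 := ((h.moment.sub_const α).abs).add (((tendsto_wellError hH h.pos
    h.tendsto_zero).const_mul (2 / kap H)).mul_const (bound H T m C))
  simp only [sub_self, abs_zero, mul_zero, zero_mul, add_zero] at h1
  exact h1

lemma abs_moment_sub_le (h : IsFlowSeq H T m C α ε ρ v P Q e₀) (hH : IsDoubleWell H) (n : ℕ)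
    {t : ℝ} (ht : t ∈ Icc 0 T) :
    |∫ ξ, sHat H (ε n) ξ ∂(ρ n t : Measure ℝ) - kap H * gap H α t| ≤
      momentError H T m C α ε ρ n := by
  have hκ := kap_pos hH
  have h1 := (h.flow n).abs_moment_sub_le hH ht
  rw [h.mass n] at h1
  have h2 : 2 / kap H * wellError H (ε n) * ∫ r in Ioo 0 T, boundRate H (ε n) (ρ n r) m ≤
      2 / kap H * wellError H (ε n) * bound H T m C := by
    have := wellError_nonneg hH (ε n)
    exact mul_le_mul_of_nonneg_left (h.integral_boundRate_le hH n) (by positivity)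
  set E := Real.exp (-(2 / kap H * t)) with hE
  have hE1 : E ≤ 1 := Real.exp_le_one_iff.2 (by
    have := ht.1
    have : 0 ≤ 2 / kap H * t := by positivity
    linarith)
  have e : kap H * gap H α t = E * α := by
    rw [gap, ← hE]; field_simp
  set a := ∫ ξ, sHat H (ε n) ξ ∂(ρ n 0 : Measure ℝ) with ha
  have h3 : |E * a - E * α| ≤ |a - α| := by
    rw [← mul_sub, abs_mul, abs_of_pos (Real.exp_pos _)]
    exact mul_le_of_le_one_left (abs_nonneg _) hE1
  rw [e, momentError]
  refine (_root_.abs_sub_le _ (E * a) _).trans ?_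
  linarith

lemma tendsto_moment (h : IsFlowSeq H T m C α ε ρ v P Q e₀) (hH : IsDoubleWell H) {t : ℝ}
    (ht : t ∈ Icc 0 T) : Tendsto (fun n => ∫ ξ, sHat H (ε n) ξ ∂(ρ n t : Measure ℝ)) atTop
      (𝓝 (kap H * gap H α t)) :=
  tendsto_iff_norm_sub_tendsto_zero.2 (squeeze_zero (fun _ => norm_nonneg _)
    (fun n => h.abs_moment_sub_le hH n ht) (h.tendsto_momentError hH))

/-- Convergence of the rescaled measures. -/
lemma tendsto_integral_sHat (h : IsFlowSeq H T m C α ε ρ v P Q e₀) (hH : IsDoubleWell H) {t : ℝ}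
    (ht : t ∈ Icc 0 T) {F : ℝ → ℝ} (hF : Continuous F) :
    Tendsto (fun n => ∫ ξ, F (sHat H (ε n) ξ) ∂(ρ n t : Measure ℝ)) atTop
      (𝓝 (((m - gap H α t) * F (-kap H) + (m + gap H α t) * F (kap H)) / 2)) :=
  tendsto_integral_of_concentration (kap_pos hH)
    (fun n => (continuous_sHat hH (ε n)).measurable.aemeasurable)
    (fun n => ((h.isCurve n).ae_mem ht).mono fun _ hξ => abs_le.2 (sHat_mem hH (ε n) hξ))
    (fun n => h.real_univ n ht) (h.tendsto_concentration_sHat hH ht) (h.tendsto_moment hH ht) hF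

/-- `sHat` has the sign of `ξ`, so both `ξ` and `sHat / κ` can be compared with the same end point
`1` or `-1`. This transfers the limit of the first moments from the rescaled to the original
variable. -/
lemma abs_sub_sHat_div_le (hH : IsDoubleWell H) (ε : ℝ) {ξ : ℝ} (hξ : ξ ∈ Icc (-1 : ℝ) 1) :
    |ξ - sHat H ε ξ / kap H| ≤ (1 - |ξ|) + (kap H - |sHat H ε ξ|) / kap H := by
  have hκ := kap_pos hH
  have hs := sHat_mem hH ε hξ
  have hmono := (strictMono_sHat hH ε).monotone
  have e : (kap H - |sHat H ε ξ|) / kap H = 1 - |sHat H ε ξ / kap H| := by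
    rw [abs_div, abs_of_pos hκ]; field_simp
  rw [e]
  have h1 : |sHat H ε ξ / kap H| ≤ 1 := by
    rw [abs_div, abs_of_pos hκ, div_le_one hκ]; exact abs_le.2 hs
  rcases le_total 0 ξ with h | h
  · have h2 := hmono h
    rw [sHat_zero] at h2
    have h3 : 0 ≤ sHat H ε ξ / kap H := by positivity
    rw [abs_of_nonneg h, abs_of_nonneg h3, abs_le]
    rw [abs_of_nonneg h3] at h1
    constructor <;> linarith [hξ.2]
  · have h2 := hmono h
    rw [sHat_zero] at h2
    have h3 : sHat H ε ξ / kap H ≤ 0 := div_nonpos_of_nonpos_of_nonneg h2 hκ.le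
    rw [abs_of_nonpos h, abs_of_nonpos h3, abs_le]
    rw [abs_of_nonpos h3] at h1
    constructor <;> linarith [hξ.1]

/-- Convergence of the measures. -/
lemma tendsto_integral (h : IsFlowSeq H T m C α ε ρ v P Q e₀) (hH : IsDoubleWell H) {t : ℝ}
    (ht : t ∈ Icc 0 T) {F : ℝ → ℝ} (hF : Continuous F) :
    Tendsto (fun n => ∫ ξ, F ξ ∂(ρ n t : Measure ℝ)) atTop
      (𝓝 (((m - gap H α t) * F (-1) + (m + gap H α t) * F 1) / 2)) := by
  have hκ := kap_pos hH
  refine tendsto_integral_of_concentration (X := fun _ ξ => ξ) one_pos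
    (fun n => measurable_id.aemeasurable)
    (fun n => ((h.isCurve n).ae_mem ht).mono fun _ hξ => abs_le.2 hξ)
    (fun n => h.real_univ n ht) (h.tendsto_concentration hH ht) ?_ hF
  have h1 := (h.tendsto_moment hH ht).div_const (kap H)
  rw [mul_div_cancel_left₀ _ hκ.ne'] at h1
  rw [one_mul]
  refine h1.congr_dist ?_
  have h2 : Tendsto (fun n => ∫ ξ, (1 - |ξ|) ∂(ρ n t : Measure ℝ) +
      (∫ ξ, (kap H - |sHat H (ε n) ξ|) ∂(ρ n t : Measure ℝ)) / kap H) atTop (𝓝 0) := by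
    have := (h.tendsto_concentration hH ht).add
      ((h.tendsto_concentration_sHat hH ht).div_const (kap H))
    simpa using this
  refine squeeze_zero (fun _ => dist_nonneg) (fun n => ?_) h2
  have hac : ContinuousOn (fun ξ : ℝ => 1 - |ξ|) (Icc (-1) 1) := by fun_prop
  have hai := h.integrable_of_continuousOn n ht hac
  have hs := (continuous_sHat hH (ε n)).continuousOn (s := Icc (-1) 1)
  have hsc : ContinuousOn (fun ξ => kap H - |sHat H (ε n) ξ|) (Icc (-1) 1) :=
    continuousOn_const.sub hs.abs
  have hsi := h.integrable_of_continuousOn n ht hsc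
  have hxi := h.integrable_of_continuousOn n ht (f := fun ξ => ξ) continuousOn_id
  have hdi := (h.integrable_of_continuousOn n ht hs).div_const (kap H)
  rw [dist_comm, Real.dist_eq, ← integral_div, ← integral_div, ← integral_sub hxi hdi,
    ← integral_add hai (hsi.div_const _)]
  exact abs_integral_le_integral_abs.trans (integral_mono_ae (hxi.sub hdi).abs
    (hai.add (hsi.div_const _)) (((h.isCurve n).ae_mem ht).mono fun ξ hξ =>
      abs_sub_sHat_div_le hH (ε n) hξ))

end IsFlowSeq

end Limits

/-! ### Strong convergence of the traces and away from the barrier -/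

section Strong

variable {H : ℝ → ℝ} {T m C α : ℝ} {ε : ℕ → ℝ} {ρ : ℕ → ℝ → FiniteMeasure ℝ}
  {v P Q : ℕ → ℝ → ℝ → ℝ} {e₀ : ℕ → ℝ}

namespace IsFlowSeq

lemma momentError_nonneg (h : IsFlowSeq H T m C α ε ρ v P Q e₀) (hH : IsDoubleWell H) (n : ℕ) :
    0 ≤ momentError H T m C α ε ρ n :=
  (abs_nonneg _).trans (h.abs_moment_sub_le hH n (left_mem_Icc.2 (h.isCurve 0).pos.le))

/-- The traces are close to the limit masses. -/
lemma ae_abs_density_sub_le (h : IsFlowSeq H T m C α ε ρ v P Q e₀) (hH : IsDoubleWell H) (n : ℕ) :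
    ∀ᵐ t ∂(volume.restrict (Ioo 0 T)),
      |density H (ε n) (ρ n t : Measure ℝ) (-1) - (m - gap H α t)| ≤
          (1 + 1 / kap H) * wellError H (ε n) * boundRate H (ε n) (ρ n t) m +
            momentError H T m C α ε ρ n / kap H ∧
        |density H (ε n) (ρ n t : Measure ℝ) 1 - (m + gap H α t)| ≤
          (1 + 1 / kap H) * wellError H (ε n) * boundRate H (ε n) (ρ n t) m +
            momentError H T m C α ε ρ n / kap H := by
  have hκ := kap_pos hH
  filter_upwards [h.regular hH n, ae_restrict_mem measurableSet_Ioo] with t ht htm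
  obtain ⟨h1, h2⟩ := ht.affine hH
  have h3 := h.abs_moment_sub_le hH n (Ioo_subset_Icc_self htm)
  set f1 := density H (ε n) (ρ n t : Measure ℝ) 1
  set f2 := density H (ε n) (ρ n t : Measure ℝ) (-1)
  set E := wellError H (ε n) * boundRate H (ε n) (ρ n t) m
  set a := ∫ ξ, sHat H (ε n) ξ ∂(ρ n t : Measure ℝ)
  -- The half-difference of the traces is compared with `gap` through the first moment, and `h1`
  -- compares their half-sum with `m`; adding and subtracting gives both traces.
  have h4 : |(f1 - f2) / 2 - gap H α t| ≤ E / kap H + momentError H T m C α ε ρ n / kap H := by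
    rw [← add_div, le_div_iff₀ hκ]
    have e : |(f1 - f2) / 2 - gap H α t| * kap H =
        |(a - kap H * gap H α t) - (a - kap H * (f1 - f2) / 2)| := by
      rw [← abs_of_pos hκ, ← abs_mul, abs_of_pos hκ]
      congr 1
      ring
    rw [e]
    refine (abs_sub _ _).trans ?_
    linarith
  have e2 : (1 + 1 / kap H) * wellError H (ε n) * boundRate H (ε n) (ρ n t) m = E + E / kap H := by
    simp only [E]; ring
  rw [e2]
  rw [abs_le] at h1 h4
  constructor <;> rw [abs_le] <;> constructor <;> linarith [h1.1, h1.2, h4.1, h4.2]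

lemma tendsto_rate (h : IsFlowSeq H T m C α ε ρ v P Q e₀) (hH : IsDoubleWell H) {c : ℕ → ℝ}
    (hc : Tendsto c atTop (𝓝 0)) :
    Tendsto (fun n => (c n + (1 + 1 / kap H) * wellError H (ε n)) * bound H T m C +
      momentError H T m C α ε ρ n / kap H * T) atTop (𝓝 0) := by
  have h1 := ((hc.add ((tendsto_wellError hH h.pos h.tendsto_zero).const_mul
    (1 + 1 / kap H))).mul_const (bound H T m C)).add
    (((h.tendsto_momentError hH).div_const (kap H)).mul_const T)
  simpa using h1

lemma integral_rate_le (h : IsFlowSeq H T m C α ε ρ v P Q e₀) (hH : IsDoubleWell H) (n : ℕ)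
    {c : ℝ} (hc : 0 ≤ c) :
    IntegrableOn (fun t => (c + (1 + 1 / kap H) * wellError H (ε n)) *
        boundRate H (ε n) (ρ n t) m + momentError H T m C α ε ρ n / kap H) (Ioo 0 T) ∧
      ∫ t in Ioo 0 T, ((c + (1 + 1 / kap H) * wellError H (ε n)) *
        boundRate H (ε n) (ρ n t) m + momentError H T m C α ε ρ n / kap H) ≤
      (c + (1 + 1 / kap H) * wellError H (ε n)) * bound H T m C +
      momentError H T m C α ε ρ n / kap H * T := by
  have hκ := kap_pos hH
  have hw := wellError_nonneg hH (ε n)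
  have hT := (h.isCurve n).pos
  have h1 : IntegrableOn (fun t => (c + (1 + 1 / kap H) * wellError H (ε n)) *
      boundRate H (ε n) (ρ n t) m) (Ioo 0 T) := (h.integrableOn_boundRate hH n).const_mul _
  have h2 : IntegrableOn (fun _ : ℝ => momentError H T m C α ε ρ n / kap H) (Ioo 0 T) :=
    integrableOn_const (by simp)
  refine ⟨Integrable.add h1 h2, ?_⟩
  rw [integral_add h1 h2, integral_const_mul, setIntegral_const,
    Real.volume_real_Ioo_of_le hT.le, sub_zero, smul_eq_mul, mul_comm T]
  gcongr
  exact h.integral_boundRate_le hH n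

lemma tendsto_trace (h : IsFlowSeq H T m C α ε ρ v P Q e₀) (hH : IsDoubleWell H) :
    Tendsto (fun n => ∫ t in Ioo 0 T,
        |density H (ε n) (ρ n t : Measure ℝ) (-1) - (m - gap H α t)|) atTop (𝓝 0) ∧
      Tendsto (fun n => ∫ t in Ioo 0 T,
        |density H (ε n) (ρ n t : Measure ℝ) 1 - (m + gap H α t)|) atTop (𝓝 0) := by
  have hr := h.tendsto_rate hH (tendsto_const_nhds (x := (0 : ℝ)))
  constructor
  · refine squeeze_zero (fun n => integral_nonneg fun _ => abs_nonneg _) (fun n => ?_) hr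
    obtain ⟨h1, h2⟩ := h.integral_rate_le hH n le_rfl
    refine (integral_mono_of_nonneg (Eventually.of_forall fun _ => abs_nonneg _) h1 ?_).trans h2
    filter_upwards [h.ae_abs_density_sub_le hH n] with t ht
    simpa only [zero_add] using ht.1
  · refine squeeze_zero (fun n => integral_nonneg fun _ => abs_nonneg _) (fun n => ?_) hr
    obtain ⟨h1, h2⟩ := h.integral_rate_le hH n le_rfl
    refine (integral_mono_of_nonneg (Eventually.of_forall fun _ => abs_nonneg _) h1 ?_).trans h2
    filter_upwards [h.ae_abs_density_sub_le hH n] with t ht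
    simpa only [zero_add] using ht.2

/-- Each well has length `kap H - sHat δ` in the rescaled variable, which tends to zero, so the
Hölder bound reduces uniform convergence in the well to that of the trace. The two wells are treated
by one statement, with `x` the end point in question. -/
lemma tendsto_lintegral_eLpNorm (h : IsFlowSeq H T m C α ε ρ v P Q e₀) (hH : IsDoubleWell H)
    {δ : ℝ} (hδ : δ ∈ Ioo (0 : ℝ) 1) {a b x : ℝ} {l : ℝ → ℝ}
    (hx : ∀ n, ∀ᵐ t ∂(volume.restrict (Ioo 0 T)),
      |density H (ε n) (ρ n t : Measure ℝ) x - l t| ≤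
          (1 + 1 / kap H) * wellError H (ε n) * boundRate H (ε n) (ρ n t) m +
            momentError H T m C α ε ρ n / kap H)
    (hd : ∀ n, ∀ t, IsRegular H (ε n) (ρ n t : Measure ℝ) (v n t) m (boundRate H (ε n) (ρ n t) m) →
      ∀ ξ ∈ Ioo a b, |density H (ε n) (ρ n t : Measure ℝ) ξ -
        density H (ε n) (ρ n t : Measure ℝ) x| ≤
          √(kap H - sHat H (ε n) δ) * boundRate H (ε n) (ρ n t) m) :
    Tendsto (fun n => ∫⁻ t in Ioo 0 T,
      eLpNorm (fun ξ => density H (ε n) (ρ n t : Measure ℝ) ξ - l t) ⊤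
        (volume.restrict (Ioo a b))) atTop (𝓝 0) := by
  have hc : Tendsto (fun n => √(kap H - sHat H (ε n) δ)) atTop (𝓝 0) := by
    have := ((tendsto_sHat hH h.pos h.tendsto_zero hδ).const_sub (kap H)).sqrt
    simpa using this
  have hr := ENNReal.tendsto_ofReal (h.tendsto_rate hH hc)
  rw [ENNReal.ofReal_zero] at hr
  refine tendsto_of_tendsto_of_tendsto_of_le_of_le tendsto_const_nhds hr (fun n => zero_le)
    fun n => ?_
  obtain ⟨h1, h2⟩ := h.integral_rate_le hH n (Real.sqrt_nonneg (kap H - sHat H (ε n) δ))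
  have hpt : ∀ᵐ t ∂(volume.restrict (Ioo 0 T)), ∀ ξ ∈ Ioo a b,
      |density H (ε n) (ρ n t : Measure ℝ) ξ - l t| ≤
        (√(kap H - sHat H (ε n) δ) + (1 + 1 / kap H) * wellError H (ε n)) *
        boundRate H (ε n) (ρ n t) m + momentError H T m C α ε ρ n / kap H := by
    filter_upwards [hx n, h.regular hH n] with t ht htr ξ hξ
    have := hd n t htr ξ hξ
    refine (_root_.abs_sub_le _ (density H (ε n) (ρ n t : Measure ℝ) x) _).trans ?_
    linarith
  have hnn : ∀ᵐ t ∂(volume.restrict (Ioo 0 T)),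
      0 ≤ (√(kap H - sHat H (ε n) δ) + (1 + 1 / kap H) * wellError H (ε n)) *
        boundRate H (ε n) (ρ n t) m + momentError H T m C α ε ρ n / kap H := by
    filter_upwards [h.regular hH n] with t ht
    have h3 := ht.bound_nonneg
    have h4 := wellError_nonneg hH (ε n)
    have h5 := h.momentError_nonneg hH n
    have h6 := kap_pos hH
    positivity
  calc _ ≤ ∫⁻ t in Ioo 0 T, ENNReal.ofReal
        ((√(kap H - sHat H (ε n) δ) + (1 + 1 / kap H) * wellError H (ε n)) *
        boundRate H (ε n) (ρ n t) m + momentError H T m C α ε ρ n / kap H) := by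
        refine lintegral_mono_ae (hpt.mono fun t ht => ?_)
        rw [eLpNorm_exponent_top]
        exact eLpNormEssSup_le_of_ae_bound ((ae_restrict_mem measurableSet_Ioo).mono ht)
    _ = _ := (ofReal_integral_eq_lintegral_ofReal h1 hnn).symm
    _ ≤ _ := ENNReal.ofReal_le_ofReal h2

lemma tendsto_uniform (h : IsFlowSeq H T m C α ε ρ v P Q e₀) (hH : IsDoubleWell H)
    {δ : ℝ} (hδ : δ ∈ Ioo (0 : ℝ) 1) :
    Tendsto (fun n => ∫⁻ t in Ioo 0 T,
        eLpNorm (fun ξ => density H (ε n) (ρ n t : Measure ℝ) ξ - (m - gap H α t)) ⊤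
          (volume.restrict (Ioo (-1) (-δ)))) atTop (𝓝 0) ∧
      Tendsto (fun n => ∫⁻ t in Ioo 0 T,
        eLpNorm (fun ξ => density H (ε n) (ρ n t : Measure ℝ) ξ - (m + gap H α t)) ⊤
          (volume.restrict (Ioo δ 1))) atTop (𝓝 0) := by
  have hmono : ∀ n, Monotone (sHat H (ε n)) := fun n => (strictMono_sHat hH (ε n)).monotone
  constructor
  · refine h.tendsto_lintegral_eLpNorm hH hδ (x := -1)
      (fun n => (h.ae_abs_density_sub_le hH n).mono fun t ht => ht.1) fun n t ht ξ hξ => ?_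
    refine (ht.abs_sub_le le_rfl hξ.1.le (by linarith [hξ.2, hδ.1])).trans
      (mul_le_mul_of_nonneg_right (Real.sqrt_le_sqrt ?_) ht.bound_nonneg)
    have := hmono n hξ.2.le
    rw [sHat_neg hH] at this
    rw [sHat_neg_one hH]
    linarith
  · refine h.tendsto_lintegral_eLpNorm hH hδ (x := 1)
      (fun n => (h.ae_abs_density_sub_le hH n).mono fun t ht => ht.2) fun n t ht ξ hξ => ?_
    rw [abs_sub_comm]
    refine (ht.abs_sub_le (by linarith [hξ.1, hδ.1]) hξ.2.le le_rfl).trans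
      (mul_le_mul_of_nonneg_right (Real.sqrt_le_sqrt ?_) ht.bound_nonneg)
    have := hmono n hξ.1.le
    rw [sHat_one hH]
    linarith

end IsFlowSeq

end Strong

/-! ### Weak convergence of rescaled fluxes and densities -/

section WeakFlux

lemma HasW11Deriv.mul {a b : ℝ} {p q r s : ℝ → ℝ} (hp : HasW11Deriv a b p q)
    (hr : HasW11Deriv a b r s) (hab : a ≤ b) :
    HasW11Deriv a b (fun x => p x * r x) (fun x => q x * r x + p x * s x) := by
  refine of_absCont ((hp.absCont hab).mul (hr.absCont hab)) hab ?_
  filter_upwards [hp.ae_hasDerivAt, hr.ae_hasDerivAt] with x h1 h2 using h1.mul h2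

/-- Integration by parts with the primitive of `θ` that vanishes at `κ`, so that only the trace at
`-κ` appears. It recovers a density from its left trace and its slope. -/
lemma HasW11Deriv.integral_mul_eq {κ : ℝ} {p q θ : ℝ → ℝ} (h : HasW11Deriv (-κ) κ p q)
    (hκ : 0 ≤ κ) (hθ : Continuous θ) :
    ∫ s in Icc (-κ) κ, θ s * p s = (∫ s in (-κ)..κ, θ s) * p (-κ) +
      ∫ s in Icc (-κ) κ, (∫ r in s..κ, θ r) * q s := by
  have hle : -κ ≤ κ := by linarith
  have hd : ∀ s, HasDerivAt (fun s => ∫ r in s..κ, θ r) (-θ s) s := fun s =>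
    intervalIntegral.integral_hasDerivAt_left (hθ.intervalIntegrable _ _)
      (hθ.stronglyMeasurableAtFilter _ _) hθ.continuousAt
  have hΘ : HasW11Deriv (-κ) κ (fun s => ∫ r in s..κ, θ r) (fun s => -θ s) :=
    HasW11Deriv.of_hasDerivAt_off_countable hle countable_empty
      (fun s _ => (hd s).continuousAt.continuousWithinAt) (fun s _ => hd s)
      hθ.neg.integrableOn_Icc
  have h1 := (hΘ.mul h hle).2 κ (right_mem_Icc.2 hle)
  have h2 : IntegrableOn (fun s => θ s * p s) (Icc (-κ) κ) :=
    (hθ.continuousOn.mul (h.continuousOn hle)).integrableOn_Icc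
  have h3 : IntegrableOn (fun s => (∫ r in s..κ, θ r) * q s) (Icc (-κ) κ) :=
    (h.integrableOn hle).continuousOn_mul (hΘ.continuousOn hle) isCompact_Icc
  rw [intervalIntegral.integral_of_le hle, ← integral_Icc_eq_integral_Ioc] at h1
  simp only [neg_mul] at h1
  rw [integral_add (f := fun s => -(θ s * p s)) h2.neg h3, integral_neg, intervalIntegral.integral_same] at h1
  linarith

variable {H : ℝ → ℝ} {T m C α : ℝ} {ε : ℕ → ℝ} {ρ : ℕ → ℝ → FiniteMeasure ℝ}
  {v P Q : ℕ → ℝ → ℝ → ℝ} {e₀ : ℕ → ℝ}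

lemma hasDerivAt_gap (H : ℝ → ℝ) (α t : ℝ) :
    HasDerivAt (gap H α) (-(2 / kap H) * gap H α t) t := by
  have : HasDerivAt (fun r => -(2 / kap H * r)) (-(2 / kap H)) t := by
    simpa using (((hasDerivAt_id t).const_mul (2 / kap H)).fun_neg)
  refine (this.exp.const_mul (α / kap H)).congr_deriv ?_
  simp only [gap]
  ring

lemma integrableOn_prod_Icc {A B : ℝ} {f : ℝ × ℝ → ℝ} {S : Set ℝ} :
    IntegrableOn f (Icc A B ×ˢ S) ↔ IntegrableOn f (Ioo A B ×ˢ S) := by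
  rw [IntegrableOn, IntegrableOn, restrict_prod_eq, restrict_prod_eq, restrict_Ioo_eq_restrict_Icc]

lemma integral_prod_Icc {A B : ℝ} (f : ℝ × ℝ → ℝ) (S : Set ℝ) :
    ∫ x in Icc A B ×ˢ S, f x = ∫ x in Ioo A B ×ˢ S, f x := by
  rw [restrict_prod_eq, restrict_prod_eq, restrict_Ioo_eq_restrict_Icc]

lemma setIntegral_prod_Ioo {a b : ℝ} {S : Set ℝ} {f : ℝ × ℝ → ℝ}
    (hf : IntegrableOn f (Ioc a b ×ˢ S)) :
    ∫ x in Ioc a b ×ˢ S, f x = ∫ t in Ioo a b, ∫ s in S, f (t, s) := by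
  rw [← integral_Ioc_eq_integral_Ioo]
  exact setIntegral_prod f hf

lemma integrableOn_mul_snd {f : ℝ × ℝ → ℝ} {T κ a b : ℝ}
    (hf : IntegrableOn f (Icc 0 T ×ˢ Icc (-κ) κ)) {θ : ℝ → ℝ} (hθ : ContinuousOn θ (Icc (-κ) κ))
    (ha : 0 ≤ a) (hb : b ≤ T) :
    IntegrableOn (fun x => θ x.2 * f x) (Ioc a b ×ˢ Icc (-κ) κ) := by
  have hc : ContinuousOn (fun x : ℝ × ℝ => θ x.2) (Icc 0 T ×ˢ Icc (-κ) κ) :=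
    hθ.comp (by fun_prop) fun x hx => hx.2
  exact (hf.continuousOn_mul hc (isCompact_Icc.prod isCompact_Icc)).mono_set
    (prod_mono (fun x hx => ⟨ha.trans hx.1.le, hx.2.trans hb⟩) Subset.rfl)

namespace IsFlowSeq

/-- By the continuity equation, the integral over `(a, b]` is the difference of the pairings of the
rescaled measures with the primitive `Ψ` of `θ` at the times `b` and `a`, and these measures
converge at every time. -/
lemma tendsto_wHat_step (h : IsFlowSeq H T m C α ε ρ v P Q e₀) (hH : IsDoubleWell H) {θ : ℝ → ℝ}
    (hθ : Continuous θ) {a b : ℝ} (ha : 0 ≤ a) (hab : a ≤ b) (hb : b ≤ T) :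
    Tendsto (fun n => ∫ x in Ioc a b ×ˢ Icc (-kap H) (kap H),
        θ x.2 * wHat H (ε n) (ρ n x.1 : Measure ℝ) (v n x.1) x.2) atTop
      (𝓝 (∫ x in Ioc a b ×ˢ Icc (-kap H) (kap H), θ x.2 * -(gap H α x.1 / kap H))) := by
  have hκ := kap_pos hH
  have hle : -kap H ≤ kap H := by linarith
  have hT := (h.isCurve 0).pos
  set Ψ : ℝ → ℝ := fun x => ∫ s in (0 : ℝ)..x, θ s with hΨ
  have hΨc : Continuous Ψ := intervalIntegral.continuous_primitive
    (fun _ _ => hθ.intervalIntegrable _ _) 0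
  have haT : a ∈ Icc 0 T := ⟨ha, hab.trans hb⟩
  have hbT : b ∈ Icc 0 T := ⟨ha.trans hab, hb⟩
  have hgc : ContinuousOn (fun x : ℝ × ℝ => -(gap H α x.1 / kap H))
      (Icc 0 T ×ˢ Icc (-kap H) (kap H)) :=
    ((((continuous_gap (H := H) (α := α)).comp continuous_fst).div_const _).neg).continuousOn
  have hS : ∫ s in Icc (-kap H) (kap H), θ s = Ψ (kap H) - Ψ (-kap H) := by
    rw [integral_Icc_eq_integral_Ioc, ← intervalIntegral.integral_of_le hle,
      intervalIntegral.integral_interval_sub_left (hθ.intervalIntegrable _ _)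
        (hθ.intervalIntegrable _ _)]
  have hlim : ∫ x in Ioc a b ×ˢ Icc (-kap H) (kap H), θ x.2 * -(gap H α x.1 / kap H) =
      ((m - gap H α b) * Ψ (-kap H) + (m + gap H α b) * Ψ (kap H)) / 2 -
        ((m - gap H α a) * Ψ (-kap H) + (m + gap H α a) * Ψ (kap H)) / 2 := by
    rw [setIntegral_prod_Ioo (integrableOn_mul_snd (hgc.integrableOn_compact
      (isCompact_Icc.prod isCompact_Icc)) hθ.continuousOn ha hb)]
    simp only [integral_mul_const, hS]
    rw [integral_const_mul, ← integral_Ioc_eq_integral_Ioo, ← intervalIntegral.integral_of_le hab,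
      intervalIntegral.integral_eq_sub_of_hasDerivAt (f := fun t => gap H α t / 2)]
    · ring
    · intro t _
      refine ((hasDerivAt_gap H α t).div_const 2).congr_deriv ?_
      field_simp
    · exact (((continuous_gap.div_const _).neg).intervalIntegrable _ _)
  rw [hlim]
  refine ((h.tendsto_integral_sHat hH hbT hΨc).sub (h.tendsto_integral_sHat hH haT hΨc)).congr
    fun n => ?_
  have hwi := integrableOn_prod_Icc.2 ((h.flow n).integrableOn_wHat hH).1
  rw [setIntegral_prod_Ioo (integrableOn_mul_snd hwi hθ.continuousOn ha hb),
    ((h.flow n).hasW11Deriv_flux hH hθ).sub_eq haT hbT, intervalIntegral.integral_of_le hab,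
    integral_Ioc_eq_integral_Ioo]

/-- An extension of a continuous function from an interval. -/
lemma exists_continuous_extend {κ : ℝ} (hκ : 0 ≤ κ) {θ : ℝ → ℝ}
    (hθ : ContinuousOn θ (Icc (-κ) κ)) :
    ∃ θ' : ℝ → ℝ, Continuous θ' ∧ EqOn θ θ' (Icc (-κ) κ) :=
  ⟨IccExtend (by linarith : -κ ≤ κ) (domRestrict (Icc (-κ) κ) θ),
    (continuousOn_iff_continuous_domRestrict.1 hθ).Icc_extend',
    fun s hs => by rw [IccExtend_of_mem _ _ hs]; rfl⟩

/-- Weak convergence of the rescaled fluxes. -/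
lemma tendsto_wHat (h : IsFlowSeq H T m C α ε ρ v P Q e₀) (hH : IsDoubleWell H)
    {φ : ℝ × ℝ → ℝ} (hφ : ContinuousOn φ (Icc 0 T ×ˢ Icc (-kap H) (kap H))) :
    Tendsto (fun n => ∫ x in Ioo 0 T ×ˢ Icc (-kap H) (kap H),
        φ x * wHat H (ε n) (ρ n x.1 : Measure ℝ) (v n x.1) x.2) atTop
      (𝓝 (∫ x in Ioo 0 T ×ˢ Icc (-kap H) (kap H), φ x * -(gap H α x.1 / kap H))) := by
  have hκ := kap_pos hH
  have hT := (h.isCurve 0).pos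
  simp only [← integral_prod_Icc]
  refine tendsto_integral_of_step (C := √(2 * kap H) * bound H T m C) hT
    (fun n => integrableOn_prod_Icc.2 ((h.flow n).integrableOn_wHat hH).1) (fun n => ?_) ?_ ?_ hφ
  · rw [integral_prod_Icc]
    refine ((h.flow n).integrableOn_wHat hH).2.trans ?_
    rw [integral_const_mul, h.mass n]
    exact mul_le_mul_of_nonneg_left (h.integral_boundRate_le hH n) (Real.sqrt_nonneg _)
  · exact ContinuousOn.integrableOn_compact (isCompact_Icc.prod isCompact_Icc)
      ((((continuous_gap (H := H) (α := α)).comp continuous_fst).div_const _).neg).continuousOn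
  · intro θ hθ a b ha hab hb
    obtain ⟨θ', hθ', he⟩ := exists_continuous_extend hκ.le hθ
    have hms : MeasurableSet (Ioc a b ×ˢ Icc (-kap H) (kap H)) :=
      measurableSet_Ioc.prod measurableSet_Icc
    rw [setIntegral_congr_fun hms (g := fun x => θ' x.2 * -(gap H α x.1 / kap H))
      fun x hx => by simp only [he hx.2]]
    refine (h.tendsto_wHat_step hH hθ' ha hab hb).congr fun n => ?_
    exact setIntegral_congr_fun hms fun x hx => by simp only [he hx.2]

lemma tendsto_setIntegral_trace (h : IsFlowSeq H T m C α ε ρ v P Q e₀) (hH : IsDoubleWell H)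
    {a b : ℝ} (ha : 0 ≤ a) (hb : b ≤ T) :
    Tendsto (fun n => ∫ t in Ioo a b, density H (ε n) (ρ n t : Measure ℝ) (-1)) atTop
      (𝓝 (∫ t in Ioo a b, (m - gap H α t))) := by
  have hsub : Ioo a b ⊆ Ioo 0 T := Ioo_subset_Ioo ha hb
  have hgi : IntegrableOn (fun t => m - gap H α t) (Ioo 0 T) :=
    ((continuous_const.sub continuous_gap).integrableOn_Icc (a := 0) (b := T)).mono_set
      Ioo_subset_Icc_self
  rw [tendsto_iff_norm_sub_tendsto_zero]
  refine squeeze_zero (fun _ => norm_nonneg _) (fun n => ?_) (h.tendsto_trace hH).1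
  have hfi := (h.flow n).integrableOn_density hH (ξ := -1) (by norm_num)
  rw [← integral_sub (hfi.mono_set hsub) (hgi.mono_set hsub)]
  exact (norm_integral_le_integral_norm _).trans (setIntegral_mono_set (hfi.sub hgi).norm
    (Eventually.of_forall fun _ => norm_nonneg _) hsub.eventuallyLE)

lemma hasW11Deriv_limit (H : ℝ → ℝ) (m α t κ : ℝ) :
    HasW11Deriv (-κ) κ (fun s => m + gap H α t / kap H * s) (fun _ => gap H α t / kap H) := by
  refine ⟨intervalIntegrable_const, fun s hs => ?_⟩
  simp only [intervalIntegral.integral_const, smul_eq_mul]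
  ring

/-- After the integration by parts the trace converges strongly in `L¹`, and the slope, which is
minus the flux, converges weakly against the continuous function `Θ`. The limit is a function, so no
singular part arises. -/
lemma tendsto_uHat_step (h : IsFlowSeq H T m C α ε ρ v P Q e₀) (hH : IsDoubleWell H) {θ : ℝ → ℝ}
    (hθ : Continuous θ) {a b : ℝ} (ha : 0 ≤ a) (hab : a ≤ b) (hb : b ≤ T) :
    Tendsto (fun n => ∫ x in Ioc a b ×ˢ Icc (-kap H) (kap H),
        θ x.2 * uHat H (ε n) (ρ n x.1 : Measure ℝ) x.2) atTop
      (𝓝 (∫ x in Ioc a b ×ˢ Icc (-kap H) (kap H), θ x.2 * (m + gap H α x.1 / kap H * x.2))) := by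
  have hκ := kap_pos hH
  have hle : -kap H ≤ kap H := by linarith
  have hsub : Ioo a b ⊆ Ioo 0 T := Ioo_subset_Ioo ha hb
  have hK : IsCompact (Icc 0 T ×ˢ Icc (-kap H) (kap H)) := isCompact_Icc.prod isCompact_Icc
  set Θ : ℝ → ℝ := fun s => ∫ r in s..kap H, θ r with hΘ
  have hΘc : Continuous Θ := by
    have : Θ = fun s => -∫ r in kap H..s, θ r := by
      funext s; exact intervalIntegral.integral_symm _ _
    rw [this]
    exact (intervalIntegral.continuous_primitive (fun _ _ => hθ.intervalIntegrable _ _) _).neg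
  have hg1 : Continuous fun x : ℝ × ℝ => gap H α x.1 / kap H :=
    ((continuous_gap (H := H) (α := α)).comp continuous_fst).div_const _
  have hu0 : IntegrableOn (fun x : ℝ × ℝ => m + gap H α x.1 / kap H * x.2)
      (Icc 0 T ×ˢ Icc (-kap H) (kap H)) :=
    (continuous_const.add (hg1.mul continuous_snd)).continuousOn.integrableOn_compact hK
  have hw0 : IntegrableOn (fun x : ℝ × ℝ => -(gap H α x.1 / kap H))
      (Icc 0 T ×ˢ Icc (-kap H) (kap H)) := hg1.neg.continuousOn.integrableOn_compact hK
  have hlim : ∫ x in Ioc a b ×ˢ Icc (-kap H) (kap H), θ x.2 * (m + gap H α x.1 / kap H * x.2) =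
      (∫ s in (-kap H)..kap H, θ s) * (∫ t in Ioo a b, (m - gap H α t)) -
        ∫ x in Ioc a b ×ˢ Icc (-kap H) (kap H), Θ x.2 * -(gap H α x.1 / kap H) := by
    have hi := integrableOn_mul_snd hw0 hΘc.continuousOn ha hb
    have hi' : IntegrableOn (fun t => ∫ s in Icc (-kap H) (kap H), Θ s * -(gap H α t / kap H))
        (Ioo a b) := by
      have : Continuous fun t => (∫ s in Icc (-kap H) (kap H), Θ s) * -(gap H α t / kap H) :=
        continuous_const.mul (continuous_gap.div_const _).neg
      simp only [integral_mul_const]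
      exact (this.integrableOn_Icc (a := a) (b := b)).mono_set Ioo_subset_Icc_self
    have hgi : IntegrableOn (fun t => m - gap H α t) (Ioo a b) :=
      ((continuous_const.sub continuous_gap).integrableOn_Icc (a := a) (b := b)).mono_set
        Ioo_subset_Icc_self
    rw [setIntegral_prod_Ioo (integrableOn_mul_snd hu0 hθ.continuousOn ha hb),
      setIntegral_prod_Ioo hi, ← integral_const_mul, ← integral_sub (hgi.const_mul _) hi']
    refine setIntegral_congr_fun measurableSet_Ioo fun t _ => ?_
    have h1 := (hasW11Deriv_limit H m α t (kap H)).integral_mul_eq hκ.le hθ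
    simp only at h1 ⊢
    rw [h1, mul_neg, div_mul_cancel₀ _ hκ.ne', ← sub_eq_add_neg]
    simp only [mul_neg, integral_neg, sub_neg_eq_add, hΘ]
  rw [hlim]
  refine (((h.tendsto_setIntegral_trace hH ha hb).const_mul _).sub
    (h.tendsto_wHat_step hH hΘc ha hab hb)).congr fun n => ?_
  have hwi := integrableOn_mul_snd (integrableOn_prod_Icc.2 ((h.flow n).integrableOn_wHat hH).1)
    hΘc.continuousOn ha hb
  have hwi' : IntegrableOn (fun t => ∫ s in Icc (-kap H) (kap H),
      Θ s * wHat H (ε n) (ρ n t : Measure ℝ) (v n t) s) (Ioo a b) := by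
    rw [IntegrableOn, restrict_prod_eq, ← restrict_Ioo_eq_restrict_Ioc] at hwi
    exact hwi.integral_prod_left
  have hfi := ((h.flow n).integrableOn_density hH (ξ := -1) (by norm_num)).mono_set hsub
  rw [setIntegral_prod_Ioo (integrableOn_mul_snd (integrableOn_prod_Icc.2
      ((h.flow n).integrableOn_uHat hH)) hθ.continuousOn ha hb),
    setIntegral_prod_Ioo hwi, ← integral_const_mul, ← integral_sub (hfi.const_mul _) hwi']
  refine integral_congr_ae ?_
  filter_upwards [ae_restrict_of_ae_restrict_of_subset hsub (h.regular hH n)] with t ht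
  have h1 := (ht.hasW11Deriv_uHat hH).integral_mul_eq hκ.le hθ
  simp only at h1 ⊢
  rw [h1, uHat, xiHat_neg_kap hH]
  simp only [mul_neg, integral_neg, hΘ, sub_eq_add_neg]

/-- Weak convergence of the rescaled densities. -/
lemma tendsto_uHat (h : IsFlowSeq H T m C α ε ρ v P Q e₀) (hH : IsDoubleWell H)
    {φ : ℝ × ℝ → ℝ} (hφ : ContinuousOn φ (Icc 0 T ×ˢ Icc (-kap H) (kap H))) :
    Tendsto (fun n => ∫ x in Ioo 0 T ×ˢ Icc (-kap H) (kap H),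
        φ x * uHat H (ε n) (ρ n x.1 : Measure ℝ) x.2) atTop
      (𝓝 (∫ x in Ioo 0 T ×ˢ Icc (-kap H) (kap H), φ x * (m + gap H α x.1 / kap H * x.2))) := by
  have hκ := kap_pos hH
  have hT := (h.isCurve 0).pos
  simp only [← integral_prod_Icc]
  refine tendsto_integral_of_step (C := 2 * kap H * bound H T m C) hT
    (fun n => integrableOn_prod_Icc.2 ((h.flow n).integrableOn_uHat hH)) (fun n => ?_) ?_ ?_ hφ
  · rw [integral_prod_Icc]
    have h1 := (h.flow n).integral_abs_uHat_le hH
    rw [integral_const_mul, h.mass n] at h1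
    exact h1.trans (mul_le_mul_of_nonneg_left (h.integral_boundRate_le hH n) (by positivity))
  · refine ContinuousOn.integrableOn_compact (isCompact_Icc.prod isCompact_Icc)
      (Continuous.continuousOn ?_)
    exact continuous_const.add
      ((((continuous_gap (H := H) (α := α)).comp continuous_fst).div_const _).mul continuous_snd)
  · intro θ hθ a b ha hab hb
    obtain ⟨θ', hθ', he⟩ := exists_continuous_extend hκ.le hθ
    have hms : MeasurableSet (Ioc a b ×ˢ Icc (-kap H) (kap H)) :=
      measurableSet_Ioc.prod measurableSet_Icc
    rw [setIntegral_congr_fun hms (g := fun x => θ' x.2 * (m + gap H α x.1 / kap H * x.2))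
      fun x hx => by simp only [he hx.2]]
    refine (h.tendsto_uHat_step hH hθ' ha hab hb).congr fun n => ?_
    exact setIntegral_congr_fun hms fun x hx => by simp only [he hx.2]

end IsFlowSeq

end WeakFlux

/-! ### The limit dissipation and the limit action -/

section LimitAction

lemma ofReal_integral_le_lintegral {μ : Measure ℝ} {f : ℝ → ℝ} (hf : Integrable f μ) :
    ENNReal.ofReal (∫ x, f x ∂μ) ≤ ∫⁻ x, ENNReal.ofReal (f x) ∂μ := by
  have h1 : ∫ x, f x ∂μ ≤ ∫ x, max (f x) 0 ∂μ :=
    integral_mono hf hf.pos_part fun x => le_max_left _ _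
  refine (ENNReal.ofReal_le_ofReal h1).trans ?_
  rw [ofReal_integral_eq_lintegral_ofReal hf.pos_part
    (Eventually.of_forall fun x => le_max_right _ _)]
  refine lintegral_mono fun x => ?_
  rcases le_total (f x) 0 with h | h
  · simp [max_eq_right h]
  · simp [max_eq_left h]

/-- Young's inequality for `w q`. The shift `δ` keeps the left side meaningful where `u = 0`; there
the right side is infinite unless `w = 0`. -/
lemma ofReal_mul_div_le {w q u δ : ℝ} (hu : 0 ≤ u) (hδ : 0 < δ) :
    ENNReal.ofReal (w * (1 / (u + δ) * q)) ≤ ENNReal.ofReal (w ^ 2) / ENNReal.ofReal (2 * u) +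
      ENNReal.ofReal (q ^ 2) / ENNReal.ofReal (2 * u) := by
  by_cases hw : w = 0
  · simp [hw]
  rcases hu.eq_or_lt with rfl | hu
  · have : ENNReal.ofReal (w ^ 2) ≠ 0 := by
      rw [Ne, ENNReal.ofReal_eq_zero, not_le]; positivity
    simp [ENNReal.div_zero this]
  · rw [← ENNReal.ofReal_div_of_pos (by positivity), ← ENNReal.ofReal_div_of_pos (by positivity),
      ← ENNReal.ofReal_add (by positivity) (by positivity)]
    refine ENNReal.ofReal_le_ofReal ?_
    rw [← add_div]
    have h1 : w * q ≤ (w ^ 2 + q ^ 2) / 2 := by nlinarith [sq_nonneg (w - q)]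
    calc w * (1 / (u + δ) * q) = w * q / (u + δ) := by ring
      _ ≤ (w ^ 2 + q ^ 2) / 2 / (u + δ) := by gcongr
      _ ≤ (w ^ 2 + q ^ 2) / 2 / u := by
          gcongr
          linarith
      _ = _ := by field_simp

lemma HasW11Deriv.log_add {a b δ : ℝ} {p q : ℝ → ℝ} (h : HasW11Deriv a b p q) (hab : a ≤ b)
    (hp : ∀ s ∈ Icc a b, 0 ≤ p s) (hδ : 0 < δ) :
    HasW11Deriv a b (fun s => Real.log (p s + δ)) (fun s => 1 / (p s + δ) * q s) := by
  have hd : ∀ y ∈ Ici (0 : ℝ), HasDerivAt (fun y => Real.log (y + δ)) (1 / (y + δ)) y :=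
    fun y hy => by
      have hy' : y + δ ≠ 0 := by have : 0 ≤ y := hy; positivity
      exact ((hasDerivAt_id y).add_const δ).log hy'
  have hL : LipschitzOnWith (Real.toNNReal (1 / δ)) (fun y => Real.log (y + δ)) (Ici 0) := by
    refine (convex_Ici 0).lipschitzOnWith_of_nnnorm_hasDerivWithin_le
      (fun y hy => (hd y hy).hasDerivWithinAt) fun y hy => ?_
    have hy0 : 0 ≤ y := hy
    rw [← NNReal.coe_le_coe, coe_nnnorm, Real.coe_toNNReal _ (by positivity), Real.norm_eq_abs,
      abs_of_nonneg (by positivity)]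
    gcongr
    linarith
  exact h.comp hab hL hp hd

/-- The value of `M` at the optimal flux. -/
lemma M_eq {κ w a b : ℝ} (hκ : 0 < κ) (ha : 0 < a) (hb : 0 < b) (hw : w = (b - a) / (2 * κ)) :
    M κ w a b = ENNReal.ofReal (w * (Real.log b - Real.log a)) := by
  have hle : -κ ≤ κ := by linarith
  refine le_antisymm ?_ ?_
  -- The affine profile has the constant slope `w`, equal to the flux, which is the case of equality
  -- in Young's inequality.
  · set u : ℝ → ℝ := fun s => a + w * (s + κ) with hu
    have hW : HasW11Deriv (-κ) κ u (fun _ => w) := by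
      refine ⟨intervalIntegrable_const, fun s hs => ?_⟩
      simp only [hu, intervalIntegral.integral_const, smul_eq_mul]
      ring
    have hu1 : u (-κ) = a := by simp [hu]
    have hu2 : u κ = b := by simp only [hu, hw]; field_simp; ring
    have hpos : ∀ s ∈ Icc (-κ) κ, 0 < u s := fun s hs => by
      have e : u s = (a * (κ - s) + b * (κ + s)) / (2 * κ) := by
        simp only [hu, hw]; field_simp; ring
      rw [e]
      refine div_pos ?_ (by positivity)
      rcases hs.2.eq_or_lt with h | h
      · rw [h, sub_self, mul_zero, zero_add]; positivity
      · have h1 : 0 < a * (κ - s) := mul_pos ha (by linarith)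
        have h2 : 0 ≤ b * (κ + s) := mul_nonneg hb.le (by linarith [hs.1])
        linarith
    have hd : ∀ s ∈ Icc (-κ) κ, HasDerivAt (fun s => w * Real.log (u s)) (w ^ 2 / u s) s :=
      fun s hs => by
        have h1 : HasDerivAt u w s :=
          ((((hasDerivAt_id s).add_const κ).const_mul w).const_add a).congr_deriv (by simp)
        refine ((h1.log (hpos s hs).ne').const_mul w).congr_deriv ?_
        ring
    have hc : ContinuousOn (fun s => w ^ 2 / u s) (Icc (-κ) κ) :=
      continuousOn_const.div (by simp only [hu]; fun_prop) fun s hs => (hpos s hs).ne'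
    have hint : ∫ s in Icc (-κ) κ, w ^ 2 / u s = w * (Real.log b - Real.log a) := by
      rw [integral_Icc_eq_integral_Ioc, ← intervalIntegral.integral_of_le hle,
        intervalIntegral.integral_eq_sub_of_hasDerivAt
          (fun s hs => hd s (by rwa [uIcc_of_le hle] at hs))
          (by rw [intervalIntegrable_iff_integrableOn_Icc_of_le hle]; exact hc.integrableOn_Icc),
        hu1, hu2]
      ring
    have hMle : M κ w a b ≤ ∫⁻ s in Icc (-κ) κ, (ENNReal.ofReal (w ^ 2) / ENNReal.ofReal (2 * u s) +
        ENNReal.ofReal (w ^ 2) / ENNReal.ofReal (2 * u s)) :=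
      iInf_le_of_le u <| iInf_le_of_le (fun _ => w) <| iInf_le_of_le hW <|
        iInf_le_of_le (memLp_const w) <| iInf_le_of_le (fun s hs => (hpos s hs).le) <|
        iInf_le_of_le hu1 <| iInf_le_of_le hu2 le_rfl
    refine hMle.trans ?_
    rw [← hint, ofReal_integral_eq_lintegral_ofReal hc.integrableOn_Icc
      ((ae_restrict_mem measurableSet_Icc).mono fun s hs => div_nonneg (sq_nonneg w) (hpos s hs).le)]
    refine le_of_eq (setLIntegral_congr_fun measurableSet_Icc fun s hs => ?_)
    have h1 := hpos s hs
    rw [← ENNReal.ofReal_div_of_pos (by positivity),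
      ← ENNReal.ofReal_add (by positivity) (by positivity)]
    congr 1
    field_simp
    ring
  · refine le_iInf fun p => le_iInf fun q => le_iInf fun h => le_iInf fun _ => le_iInf fun hp =>
      le_iInf fun h1 => le_iInf fun h2 => ?_
    -- For any competitor the integrand dominates `w` times the derivative of `log (p + δ)`, whose
    -- integral depends on the boundary values only. The shift avoids the zeros of `p` and is
    -- removed at the end.
    have key : ∀ δ > 0, ENNReal.ofReal (w * (Real.log (b + δ) - Real.log (a + δ))) ≤
        ∫⁻ s in Icc (-κ) κ, (ENNReal.ofReal (w ^ 2) / ENNReal.ofReal (2 * p s) +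
          ENNReal.ofReal (q s ^ 2) / ENNReal.ofReal (2 * p s)) := fun δ hδ => by
      have hl := h.log_add hle hp hδ
      have h3 := hl.2 κ (right_mem_Icc.2 hle)
      simp only [h1, h2] at h3
      rw [intervalIntegral.integral_of_le hle, ← integral_Icc_eq_integral_Ioc] at h3
      rw [h3, add_sub_cancel_left, ← integral_const_mul]
      exact (ofReal_integral_le_lintegral ((hl.integrableOn hle).const_mul w)).trans
        (setLIntegral_mono' measurableSet_Icc fun s hs => ofReal_mul_div_le (hp s hs) hδ)
    have hlim : Tendsto (fun δ : ℝ => ENNReal.ofReal (w * (Real.log (b + δ) - Real.log (a + δ))))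
        (𝓝[>] 0) (𝓝 (ENNReal.ofReal (w * (Real.log b - Real.log a)))) := by
      refine (ENNReal.continuous_ofReal.tendsto _).comp ?_
      have hc : ContinuousAt (fun δ : ℝ => w * (Real.log (b + δ) - Real.log (a + δ))) 0 := by
        refine continuousAt_const.mul (ContinuousAt.sub ?_ ?_)
        · exact ContinuousAt.log (by fun_prop) (by simpa using hb.ne')
        · exact ContinuousAt.log (by fun_prop) (by simpa using ha.ne')
      have := hc.tendsto
      simp only [add_zero] at this
      exact this.mono_left nhdsWithin_le_nhds
    exact le_of_tendsto hlim (eventually_mem_nhdsWithin.mono fun δ hδ => key δ hδ)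

variable {κ T m : ℝ} {G : ℝ → ℝ}

lemma limitEnergy_eq (m x : ℝ) : limitEnergy (m - x) (m + x) =
    1 / 2 * ((m + x) * Real.log (m + x) + (m - x) * Real.log (m - x)) - m * Real.log m := by
  rw [limitEnergy]
  ring_nf

lemma hasDerivAt_limitEnergy (hG : ∀ t, HasDerivAt G (-(2 / κ) * G t) t) {t : ℝ} (ht : |G t| < m) :
    HasDerivAt (fun t => limitEnergy (m - G t) (m + G t))
      (-(G t / κ * (Real.log (m + G t) - Real.log (m - G t)))) t := by
  rw [abs_lt] at ht
  have h1 := (Real.hasDerivAt_mul_log (by linarith : m + G t ≠ 0)).comp t ((hG t).const_add m)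
  have h2 := (Real.hasDerivAt_mul_log (by linarith : m - G t ≠ 0)).comp t ((hG t).const_sub m)
  have h3 := ((h1.add h2).const_mul (1 / 2)).sub_const (m * Real.log m)
  refine (h3.congr_deriv ?_).congr_of_eventuallyEq (Eventually.of_forall fun r => ?_)
  · ring
  · simp only [limitEnergy_eq, Pi.add_apply, Function.comp]

/-- The limit curve dissipates its energy at the optimal rate. -/
lemma limitAction_eq_zero (hκ : 0 < κ) (hT : 0 < T)
    (hG : ∀ t, HasDerivAt G (-(2 / κ) * G t) t) (hlt : ∀ t ∈ Ioo 0 T, |G t| < m)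
    {um up : ℝ → ℝ} (hum : ∀ t ∈ Icc 0 T, um t = m - G t) (hup : ∀ t ∈ Icc 0 T, up t = m + G t) :
    limitAction κ T um up = 0 := by
  have hGc : Continuous G := continuous_iff_continuousAt.2 fun t => (hG t).continuousAt
  have hqc : Continuous fun t => -(2 / κ) * G t := continuous_const.mul hGc
  have hW1 : HasW11Deriv 0 T um (fun t => -(-(2 / κ) * G t)) :=
    (HasW11Deriv.of_hasDerivAt_off_countable hT.le countable_empty
      (continuous_const.sub hGc).continuousOn (fun t _ => (hG t).const_sub m)
      hqc.neg.integrableOn_Icc).congr_fun hT.le fun t ht => (hum t ht).symm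
  have hW2 : HasW11Deriv 0 T up (fun t => -(2 / κ) * G t) :=
    (HasW11Deriv.of_hasDerivAt_off_countable hT.le countable_empty
      (continuous_const.add hGc).continuousOn (fun t _ => (hG t).const_add m)
      hqc.integrableOn_Icc).congr_fun hT.le fun t ht => (hup t ht).symm
  have hev : ∀ t ∈ Ioo 0 T, ∀ᶠ r in 𝓝 t, r ∈ Icc 0 T := fun t ht => Icc_mem_nhds ht.1 ht.2
  have hd1 : ∀ t ∈ Ioo 0 T, deriv um t = 2 / κ * G t := fun t ht => by
    rw [(((hG t).const_sub m).congr_of_eventuallyEq ((hev t ht).mono fun r hr => hum r hr)).deriv]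
    ring
  have hd2 : ∀ t ∈ Ioo 0 T, deriv up t = -(2 / κ * G t) := fun t ht => by
    rw [(((hG t).const_add m).congr_of_eventuallyEq ((hev t ht).mono fun r hr => hup r hr)).deriv]
    ring
  set D : ℝ → ℝ := fun t => G t / κ * (Real.log (m + G t) - Real.log (m - G t)) with hD
  have hM : ∀ t ∈ Ioo 0 T, M κ (1 / 2 * deriv um t) (um t) (up t) = ENNReal.ofReal (D t) :=
    fun t ht => by
      have h1 := abs_lt.1 (hlt t ht)
      have htc := Ioo_subset_Icc_self ht
      have e : 1 / 2 * (2 / κ * G t) = G t / κ := by ring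
      rw [hd1 t ht, hum t htc, hup t htc, e,
        M_eq hκ (by linarith) (by linarith) (by field_simp; ring)]
  have hD0 : ∀ t ∈ Ioo 0 T, 0 ≤ D t := fun t ht => by
    have h1 := abs_lt.1 (hlt t ht)
    simp only [hD]
    rcases le_total 0 (G t) with h | h
    · refine mul_nonneg (by positivity) (sub_nonneg.2 (Real.log_le_log (by linarith) (by linarith)))
    · refine mul_nonneg_of_nonpos_of_nonpos (div_nonpos_of_nonpos_of_nonneg h hκ.le)
        (sub_nonpos.2 (Real.log_le_log (by linarith) (by linarith)))
  have hEc : Continuous fun t => -limitEnergy (m - G t) (m + G t) := by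
    simp only [limitEnergy_eq]
    exact ((((Real.continuous_mul_log.comp (continuous_const.add hGc)).add
      (Real.continuous_mul_log.comp (continuous_const.sub hGc))).const_mul _).sub
        continuous_const).neg
  have hEd : ∀ t ∈ Ioo 0 T, HasDerivAt (fun t => -limitEnergy (m - G t) (m + G t)) (D t) t :=
    fun t ht => by
      simpa using (hasDerivAt_limitEnergy hG (hlt t ht)).fun_neg
  -- `D` may be unbounded near `t = 0`, when one of the wells is initially empty; its integrability
  -- follows from its sign and the continuity of the energy on `[0, T]`.
  have hDi : IntegrableOn D (Ioc 0 T) :=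
    intervalIntegral.integrableOn_deriv_of_nonneg hEc.continuousOn hEd hD0
  have hint := intervalIntegral.integral_eq_sub_of_hasDerivAt_of_le hT.le hEc.continuousOn hEd
    ((intervalIntegrable_iff_integrableOn_Ioc_of_le hT.le).2 hDi)
  rw [intervalIntegral.integral_of_le hT.le, integral_Ioc_eq_integral_Ioo] at hint
  have hint0 : 0 ≤ ∫ t in Ioo 0 T, D t := setIntegral_nonneg measurableSet_Ioo hD0
  have hdis : limitDissipation κ T um up = ENNReal.ofReal (∫ t in Ioo 0 T, D t) := by
    rw [limitDissipation, if_pos ⟨hW1.absCont hT.le, hW2.absCont hT.le,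
      (ae_restrict_mem measurableSet_Ioo).mono fun t ht => by rw [hd1 t ht, hd2 t ht, neg_neg]⟩,
      setLIntegral_congr_fun measurableSet_Ioo hM,
      ofReal_integral_eq_lintegral_ofReal (hDi.mono_set Ioo_subset_Ioc_self)
        ((ae_restrict_mem measurableSet_Ioo).mono hD0)]
  have h0 := left_mem_Icc.2 hT.le
  have h1 := right_mem_Icc.2 hT.le
  rw [limitAction, hdis, EReal.coe_ennreal_ofReal, max_eq_left hint0, hum 0 h0, hum T h1, hup 0 h0,
    hup T h1, ← EReal.coe_add, hint]
  norm_num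

end LimitAction

/-! ### Two-point measures and the limit continuity equation -/

section TwoPoint

lemma integral_twoPoint (a : ℝ) (um up : ℝ≥0) (f : ℝ → ℝ) :
    ∫ x, f x ∂(twoPoint a um up : Measure ℝ) = um / 2 * f (-a) + up / 2 * f a := by
  change ∫ x, f x ∂((um / 2) • Measure.dirac (-a) + (up / 2) • Measure.dirac a) = _
  rw [integral_add_measure ((integrable_dirac (by simp)).smul_measure_nnreal)
    ((integrable_dirac (by simp)).smul_measure_nnreal), integral_smul_nnreal_measure,
    integral_smul_nnreal_measure, integral_dirac, integral_dirac]
  simp [NNReal.smul_def]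

lemma continuous_twoPoint (a : ℝ) {um up : ℝ → ℝ≥0} (hum : Continuous um) (hup : Continuous up) :
    Continuous fun t => twoPoint a (um t) (up t) := by
  refine continuous_iff_continuousAt.2 fun t => ?_
  rw [ContinuousAt, FiniteMeasure.tendsto_iff_forall_integral_tendsto]
  intro f
  simp only [integral_twoPoint]
  have : Continuous fun t => (um t : ℝ) / 2 * f (-a) + up t / 2 * f a := by fun_prop
  exact this.tendsto t

/-- The flux is constant in space, so its term integrates to `φ (t, κ) - φ (t, -κ)` times the flux
and matches the rate at which mass is exchanged. The integrand is thus the time derivative of the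
pairing `Y` of `φ` with the two-point measures, and `Y` vanishes at both end times. -/
lemma continuityEq_twoPoint {κ T m : ℝ} {G : ℝ → ℝ} (hκ : 0 < κ) (hT : 0 < T)
    (hG : ∀ t, HasDerivAt G (-(2 / κ) * G t) t) {um up : ℝ → ℝ≥0}
    (hum : ∀ t ∈ Icc 0 T, (um t : ℝ) = m - G t) (hup : ∀ t ∈ Icc 0 T, (up t : ℝ) = m + G t) :
    ContinuityEq T (fun t => twoPoint κ (um t) (up t))
      (fun _ => volume.restrict (Icc (-κ) κ)) (fun t _ => -(G t / κ)) := by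
  intro φ hφ _ hsupp
  have hle : -κ ≤ κ := by linarith
  have hGc : Continuous G := continuous_iff_continuousAt.2 fun t => (hG t).continuousAt
  have hφd : Differentiable ℝ φ := hφ.differentiable (by simp)
  have hfc : Continuous (fderiv ℝ φ) := hφ.continuous_fderiv (by simp)
  have hdt : ∀ t s, HasDerivAt (fun t => φ (t, s)) (fderiv ℝ φ (t, s) (1, 0)) t := fun t s =>
    (hφd (t, s)).hasFDerivAt.comp_hasDerivAt t ((hasDerivAt_id t).prodMk (hasDerivAt_const t s))
  have hds : ∀ t s, HasDerivAt (fun s => φ (t, s)) (fderiv ℝ φ (t, s) (0, 1)) s := fun t s =>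
    (hφd (t, s)).hasFDerivAt.comp_hasDerivAt s ((hasDerivAt_const s t).prodMk (hasDerivAt_id s))
  have hz : ∀ t ∉ Ioo 0 T, ∀ s, φ (t, s) = 0 := fun t ht s =>
    image_eq_zero_of_notMem_tsupport fun h => ht (hsupp h).1
  set Y : ℝ → ℝ := fun t => (m - G t) / 2 * φ (t, -κ) + (m + G t) / 2 * φ (t, κ) with hY
  set Y' : ℝ → ℝ := fun t => (m - G t) / 2 * fderiv ℝ φ (t, -κ) (1, 0) +
    (m + G t) / 2 * fderiv ℝ φ (t, κ) (1, 0) - G t / κ * (φ (t, κ) - φ (t, -κ)) with hY'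
  have hYd : ∀ t, HasDerivAt Y (Y' t) t := fun t => by
    have h1 := (((hG t).const_sub m).div_const 2).mul (hdt t (-κ))
    have h2 := (((hG t).const_add m).div_const 2).mul (hdt t κ)
    refine (h1.add h2).congr_deriv ?_
    simp only [hY']
    field_simp
    ring
  have hc : ∀ s, Continuous fun t : ℝ => φ (t, s) := fun s => hφ.continuous.comp (by fun_prop)
  have hfc1 : ∀ s, Continuous fun t : ℝ => fderiv ℝ φ (t, s) (1, 0) := fun s =>
    (hfc.comp (by fun_prop : Continuous fun t : ℝ => (t, s))).clm_apply continuous_const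
  have hYc : Continuous Y' := by
    refine Continuous.sub (Continuous.add ?_ ?_) ?_
    · exact ((continuous_const.sub hGc).div_const _).mul (hfc1 _)
    · exact ((continuous_const.add hGc).div_const _).mul (hfc1 _)
    · exact (hGc.div_const _).mul ((hc _).sub (hc _))
  have hint := intervalIntegral.integral_eq_sub_of_hasDerivAt (a := 0) (b := T)
    (fun t _ => hYd t) (hYc.intervalIntegrable 0 T)
  rw [intervalIntegral.integral_of_le hT.le, integral_Ioc_eq_integral_Ioo] at hint
  have h0 : Y T - Y 0 = 0 := by
    simp only [hY, hz 0 (by simp), hz T (by simp)]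
    ring
  rw [h0] at hint
  refine Eq.trans (setIntegral_congr_fun measurableSet_Ioo fun t ht => ?_) hint
  have htc := Ioo_subset_Icc_self ht
  have hs : ∫ s in Icc (-κ) κ, fderiv ℝ φ (t, s) (0, 1) = φ (t, κ) - φ (t, -κ) := by
    rw [integral_Icc_eq_integral_Ioc, ← intervalIntegral.integral_of_le hle]
    refine intervalIntegral.integral_eq_sub_of_hasDerivAt (fun s _ => hds t s)
      (Continuous.intervalIntegrable ?_ _ _)
    exact (hfc.comp (by fun_prop : Continuous fun s : ℝ => (t, s))).clm_apply continuous_const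
  simp only [integral_twoPoint, integral_mul_const, hs, hum t htc, hup t htc, hY']
  ring

lemma abs_gap_le {H : ℝ → ℝ} {α m t : ℝ} (hκ : 0 < kap H) (hα : |α| ≤ kap H * m) (ht : 0 ≤ t) :
    |gap H α t| ≤ m := by
  have h1 : |α / kap H| ≤ m := by
    rw [abs_div, abs_of_pos hκ, div_le_iff₀ hκ]; linarith
  have h2 : Real.exp (-(2 / kap H * t)) ≤ 1 :=
    Real.exp_le_one_iff.2 (neg_nonpos.2 (by positivity))
  rw [gap, abs_mul, abs_of_pos (Real.exp_pos _)]
  exact (mul_le_of_le_one_right (abs_nonneg _) h2).trans h1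

/-- Both wells have positive mass at positive times, even if one is empty initially; the logarithms
in the dissipation need this strict inequality. -/
lemma abs_gap_lt {H : ℝ → ℝ} {α m t : ℝ} (hκ : 0 < kap H) (hm : 0 < m) (hα : |α| ≤ kap H * m)
    (ht : 0 < t) : |gap H α t| < m := by
  have h1 : |α / kap H| ≤ m := by
    rw [abs_div, abs_of_pos hκ, div_le_iff₀ hκ]; linarith
  have h2 : Real.exp (-(2 / kap H * t)) < 1 :=
    by
    rw [← Real.exp_zero]
    exact Real.exp_lt_exp.2 (neg_neg_of_pos (by positivity))
  rw [gap, abs_mul, abs_of_pos (Real.exp_pos _)]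
  calc _ ≤ m * Real.exp (-(2 / kap H * t)) := by gcongr
    _ < m := mul_lt_of_lt_one_right hm h2

lemma abs_moment_le {H : ℝ → ℝ} (hH : IsDoubleWell H) {ε T t : ℝ} {ρ : ℝ → FiniteMeasure ℝ}
    (hc : IsCurve T ρ) (ht : t ∈ Icc 0 T) :
    |∫ ξ, sHat H ε ξ ∂(ρ t : Measure ℝ)| ≤ kap H * (ρ t).mass :=
  norm_integral_le_of_norm_le_const (f := sHat H ε) (C := kap H) ((hc.ae_mem ht).mono fun _ hξ => abs_le.2 (sHat_mem hH ε hξ))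

end TwoPoint

end Kramers

end

/-! ### Assembly of the main theorem -/

theorem mainTheorem7 (H : ℝ → ℝ) (hH : IsDoubleWell H) (T : ℝ) (hT : 0 < T)
    (m : ℝ≥0) (hm : 0 < m)
    (ε : ℕ → ℝ) (hε : ∀ n, 0 < ε n) (hε0 : Tendsto ε atTop (𝓝 0))
    (ρ : ℕ → ℝ → FiniteMeasure ℝ) (hρ : ∀ n, IsSolution H (ε n) T (ρ n))
    (hmass : ∀ n, (ρ n 0).mass = m)
    (e : ℝ) (hE : Tendsto (fun n => energy H (ε n) (ρ n 0)) atTop (𝓝 (e : EReal)))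
    -- the velocity fields of the curves, which define the rescaled fluxes
    (v : ℕ → ℝ → ℝ → ℝ) (hv : ∀ n, IsVelocity T (ρ n) (v n)) :
    ∃ (sub : ℕ → ℕ) (um up : ℝ → ℝ≥0) (u0 du0 w0 : ℝ → ℝ → ℝ) (du : ℕ → ℝ → ℝ → ℝ)
      (lam : Measure ℝ) (m0 dm0 : ℝ → ℝ → ℝ),
      StrictMono sub ∧
      -- convergence of the measures
      ContinuousOn (fun t => twoPoint 1 (um t) (up t)) (Icc 0 T) ∧
      (∀ t ∈ Icc 0 T, Tendsto (fun n => ρ (sub n) t) atTop (𝓝 (twoPoint 1 (um t) (up t)))) ∧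
      -- the traces are well defined and converge strongly
      (∀ n, ∀ᵐ t ∂(volume.restrict (Ioo 0 T)), ∃ f, IsContDensity H (ε n) (ρ n t) f) ∧
      (∀ n, IntegrableOn (fun t => density H (ε n) (ρ n t) (-1)) (Ioo 0 T)) ∧
      (∀ n, IntegrableOn (fun t => density H (ε n) (ρ n t) 1) (Ioo 0 T)) ∧
      Tendsto (fun n => ∫ t in Ioo 0 T, |density H (ε (sub n)) (ρ (sub n) t) (-1) - um t|)
        atTop (𝓝 0) ∧
      Tendsto (fun n => ∫ t in Ioo 0 T, |density H (ε (sub n)) (ρ (sub n) t) 1 - up t|)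
        atTop (𝓝 0) ∧
      -- convergence to the traces, uniformly in space away from `0`
      (∀ δ ∈ Ioo (0 : ℝ) 1,
        (∀ n, AEMeasurable (fun t => eLpNorm (fun ξ => density H (ε n) (ρ n t) ξ - um t) ⊤
          (volume.restrict (Ioo (-1) (-δ)))) (volume.restrict (Ioo 0 T))) ∧
        (∀ n, AEMeasurable (fun t => eLpNorm (fun ξ => density H (ε n) (ρ n t) ξ - up t) ⊤
          (volume.restrict (Ioo δ 1))) (volume.restrict (Ioo 0 T))) ∧
        Tendsto (fun n => ∫⁻ t in Ioo 0 T,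
          eLpNorm (fun ξ => density H (ε (sub n)) (ρ (sub n) t) ξ - um t) ⊤
            (volume.restrict (Ioo (-1) (-δ)))) atTop (𝓝 0) ∧
        Tendsto (fun n => ∫⁻ t in Ioo 0 T,
          eLpNorm (fun ξ => density H (ε (sub n)) (ρ (sub n) t) ξ - up t) ⊤
            (volume.restrict (Ioo δ 1))) atTop (𝓝 0)) ∧
      -- the rescaled densities, their weak space derivatives and the rescaled fluxes
      (∀ n, IntegrableOn (fun x : ℝ × ℝ => uHat H (ε n) (ρ n x.1) x.2)
        (Ioo 0 T ×ˢ Icc (-kap H) (kap H))) ∧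
      (∀ n, IntegrableOn (fun x : ℝ × ℝ => du n x.1 x.2) (Ioo 0 T ×ˢ Icc (-kap H) (kap H))) ∧
      (∀ n, IntegrableOn (fun x : ℝ × ℝ => wHat H (ε n) (ρ n x.1) (v n x.1) x.2)
        (Ioo 0 T ×ˢ Icc (-kap H) (kap H))) ∧
      (∀ n, ∀ᵐ t ∂(volume.restrict (Ioo 0 T)),
        HasW11Deriv (-kap H) (kap H) (uHat H (ε n) (ρ n t)) (du n t)) ∧
      -- the limit `u0` lies in `L¹(0, T; W^{1,1})`, and `w0` in `L¹`
      IntegrableOn (fun x : ℝ × ℝ => u0 x.1 x.2) (Ioo 0 T ×ˢ Icc (-kap H) (kap H)) ∧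
      IntegrableOn (fun x : ℝ × ℝ => du0 x.1 x.2) (Ioo 0 T ×ˢ Icc (-kap H) (kap H)) ∧
      (∀ᵐ t ∂(volume.restrict (Ioo 0 T)), HasW11Deriv (-kap H) (kap H) (u0 t) (du0 t)) ∧
      IntegrableOn (fun x : ℝ × ℝ => w0 x.1 x.2) (Ioo 0 T ×ˢ Icc (-kap H) (kap H)) ∧
      -- the singular measure and the singular part of the limit
      IsFiniteMeasure lam ∧ lam (Icc 0 T)ᶜ = 0 ∧ lam ⟂ₘ volume ∧
      MemLp (fun x : ℝ × ℝ => m0 x.1 x.2) ⊤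
        (lam.prod (volume.restrict (Icc (-kap H) (kap H)))) ∧
      MemLp (fun x : ℝ × ℝ => dm0 x.1 x.2) 2
        (lam.prod (volume.restrict (Icc (-kap H) (kap H)))) ∧
      (∀ᵐ t ∂lam, HasW11Deriv (-kap H) (kap H) (m0 t) (dm0 t)) ∧
      -- weak convergence in the duality with continuous functions
      (∀ φ : ℝ × ℝ → ℝ, ContinuousOn φ (Icc 0 T ×ˢ Icc (-kap H) (kap H)) →
        Tendsto (fun n => ∫ x in Ioo 0 T ×ˢ Icc (-kap H) (kap H),
            φ x * uHat H (ε (sub n)) (ρ (sub n) x.1) x.2) atTop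
          (𝓝 ((∫ x in Ioo 0 T ×ˢ Icc (-kap H) (kap H), φ x * u0 x.1 x.2) +
            ∫ x, φ x * m0 x.1 x.2 ∂(lam.prod (volume.restrict (Icc (-kap H) (kap H)))))) ∧
        Tendsto (fun n => ∫ x in Ioo 0 T ×ˢ Icc (-kap H) (kap H),
            φ x * du (sub n) x.1 x.2) atTop
          (𝓝 ((∫ x in Ioo 0 T ×ˢ Icc (-kap H) (kap H), φ x * du0 x.1 x.2) +
            ∫ x, φ x * dm0 x.1 x.2 ∂(lam.prod (volume.restrict (Icc (-kap H) (kap H)))))) ∧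
        Tendsto (fun n => ∫ x in Ioo 0 T ×ˢ Icc (-kap H) (kap H),
            φ x * wHat H (ε (sub n)) (ρ (sub n) x.1) (v (sub n) x.1) x.2) atTop
          (𝓝 (∫ x in Ioo 0 T ×ˢ Icc (-kap H) (kap H), φ x * w0 x.1 x.2))) ∧
      -- identification of the traces
      (∀ᵐ t ∂(volume.restrict (Ioo 0 T)), u0 t (-kap H) = um t ∧ u0 t (kap H) = up t) ∧
      (∀ᵐ t ∂lam, m0 t (-kap H) = 0 ∧ m0 t (kap H) = 0) ∧
      -- convergence of the rescaled measures
      (∀ t ∈ Icc 0 T, Tendsto (fun n => (ρ (sub n) t).map (sHat H (ε (sub n)))) atTop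
        (𝓝 (twoPoint (kap H) (um t) (up t)))) ∧
      -- structure of the limit flux, and the limit continuity equation
      (∀ᵐ t ∂(volume.restrict (Ioo 0 T)), ∀ᵐ s ∂(volume.restrict (Icc (-kap H) (kap H))),
        w0 t s = 1 / 2 * deriv (fun r => (up r : ℝ)) t) ∧
      ContinuityEq T (fun t => twoPoint (kap H) (um t) (up t))
        (fun _ => volume.restrict (Icc (-kap H) (kap H))) w0 ∧
      -- the rescaled limit is affine in space
      (∀ᵐ t ∂(volume.restrict (Ioo 0 T)), ∀ s ∈ Icc (-kap H) (kap H),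
        u0 t s = (kap H + s) / (2 * kap H) * u0 t (kap H) +
          (kap H - s) / (2 * kap H) * u0 t (-kap H)) ∧
      -- the limit has zero action and solves the reaction equations
      limitAction (kap H) T (fun t => um t) (fun t => up t) = 0 ∧
      (∀ t ∈ Icc 0 T,
        HasDerivWithinAt (fun r => (um r : ℝ)) (rate H * (up t - um t)) (Icc 0 T) t ∧
        HasDerivWithinAt (fun r => (up r : ℝ)) (rate H * (um t - up t)) (Icc 0 T) t) := by
  have hκ := kap_pos hH
  have hm' : (0 : ℝ) < m := hm
  choose P Q e₀ he₀ hflow using fun n => (hρ n).exists_isFlow hH hT (hv n) (by rw [hmass n]; exact hm)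
  have hcurve : ∀ n, IsCurve T (ρ n) := fun n => (hflow n).finiteAction.curve
  have hE' : Tendsto e₀ atTop (𝓝 e) := by
    simp only [he₀] at hE
    exact EReal.tendsto_coe.1 hE
  obtain ⟨C, hC⟩ := hE'.bddAbove_range
  -- the subsequence
  have hmom : ∀ n, ∫ ξ, sHat H (ε n) ξ ∂(ρ n 0 : Measure ℝ) ∈
      Icc (-(kap H * m)) (kap H * m) := fun n => by
    have := abs_moment_le (ε := ε n) hH (hcurve n) (left_mem_Icc.2 hT.le)
    rw [hmass n] at this
    exact abs_le.1 this
  -- The initial first moments lie in a compact interval. Their limit `α` determines all limit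
  -- objects, so no further subsequence is extracted.
  obtain ⟨α, hα, sub, hsub, hlim⟩ := isCompact_Icc.tendsto_subseq hmom
  have hα' : |α| ≤ kap H * m := abs_le.2 hα
  have hseq : IsFlowSeq H T m C α (fun n => ε (sub n)) (fun n => ρ (sub n)) (fun n => v (sub n))
      (fun n => P (sub n)) (fun n => Q (sub n)) (fun n => e₀ (sub n)) :=
    ⟨fun n => hε _, hε0.comp hsub.tendsto_atTop, fun n => hflow _, fun n => by rw [hmass],
      fun n => hC ⟨_, rfl⟩, hlim⟩
  -- the limit
  have hG : ∀ t, HasDerivAt (gap H α) (-(2 / kap H) * gap H α t) t := hasDerivAt_gap H α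
  have hGc : Continuous (gap H α) := continuous_gap
  -- `Real.toNNReal` changes nothing on `[0, T]`, where `|gap H α t| ≤ m`; it only supplies values
  -- outside of the interval.
  obtain ⟨um, hum_def⟩ : ∃ um : ℝ → ℝ≥0, um = fun t => Real.toNNReal (m - gap H α t) := ⟨_, rfl⟩
  obtain ⟨up, hup_def⟩ : ∃ up : ℝ → ℝ≥0, up = fun t => Real.toNNReal (m + gap H α t) := ⟨_, rfl⟩
  have humc : Continuous um := by
    rw [hum_def]; exact continuous_real_toNNReal.comp (continuous_const.sub hGc)
  have hupc : Continuous up := by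
    rw [hup_def]; exact continuous_real_toNNReal.comp (continuous_const.add hGc)
  have hum : ∀ t ∈ Icc 0 T, (um t : ℝ) = m - gap H α t := fun t ht => by
    rw [hum_def]
    exact Real.coe_toNNReal _ (by linarith [abs_le.1 (abs_gap_le hκ hα' ht.1)])
  have hup : ∀ t ∈ Icc 0 T, (up t : ℝ) = m + gap H α t := fun t ht => by
    rw [hup_def]
    exact Real.coe_toNNReal _ (by linarith [abs_le.1 (abs_gap_le hκ hα' ht.1)])
  have hum' : ∀ t ∈ Ioo 0 T, (um t : ℝ) = m - gap H α t := fun t ht =>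
    hum t (Ioo_subset_Icc_self ht)
  have hup' : ∀ t ∈ Ioo 0 T, (up t : ℝ) = m + gap H α t := fun t ht =>
    hup t (Ioo_subset_Icc_self ht)
  have hrate : rate H = 1 / kap H := by rw [kap, one_div_one_div]
  have hdup : ∀ t ∈ Ioo 0 T, deriv (fun r => (up r : ℝ)) t = -(2 / kap H) * gap H α t :=
    fun t ht => (((hG t).const_add (m : ℝ)).congr_of_eventuallyEq
      (Filter.mem_of_superset (Icc_mem_nhds ht.1 ht.2) hup)).deriv
  have hg1 : Continuous fun x : ℝ × ℝ => gap H α x.1 / kap H :=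
    (hGc.comp continuous_fst).div_const _
  have hprod : ∀ {f : ℝ × ℝ → ℝ}, Continuous f →
      IntegrableOn f (Ioo 0 T ×ˢ Icc (-kap H) (kap H)) := fun {f} hf =>
    integrableOn_prod_Icc.1 (hf.continuousOn.integrableOn_compact
      (isCompact_Icc.prod isCompact_Icc))
  have hmem : ∀ᵐ t ∂(volume.restrict (Ioo 0 T)), t ∈ Ioo 0 T := ae_restrict_mem measurableSet_Ioo
  -- The slope of the rescaled density is minus the rescaled flux, before and in the limit. The
  -- singular measure and its densities are zero.
  refine ⟨sub, um, up, fun t s => m + gap H α t / kap H * s, fun t _ => gap H α t / kap H,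
    fun t _ => -(gap H α t / kap H),
    fun n t s => -wHat H (ε n) (ρ n t : Measure ℝ) (v n t) s, 0, fun _ _ => 0, fun _ _ => 0,
    hsub, (continuous_twoPoint 1 humc hupc).continuousOn, fun t ht => ?_,
    fun n => ((hflow n).ae_isRegular hH).mono fun t ht => ⟨_, ht.contDensity⟩,
    fun n => (hflow n).integrableOn_density hH (by norm_num),
    fun n => (hflow n).integrableOn_density hH (by norm_num), ?_, ?_, fun δ hδ => ⟨fun n => ?_,
    fun n => ?_, ?_, ?_⟩, fun n => (hflow n).integrableOn_uHat hH,
    fun n => ((hflow n).integrableOn_wHat hH).1.neg, fun n => ((hflow n).integrableOn_wHat hH).1,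
    fun n => ((hflow n).ae_isRegular hH).mono fun t ht => ht.hasW11Deriv_uHat hH,
    hprod (continuous_const.add (hg1.mul continuous_snd)), hprod hg1,
    Eventually.of_forall fun t => IsFlowSeq.hasW11Deriv_limit H m α t (kap H), hprod hg1.neg,
    inferInstance, by simp, Measure.MutuallySingular.zero_left, MemLp.zero', MemLp.zero', by simp,
    fun φ hφ => ⟨?_, ?_, hseq.tendsto_wHat hH hφ⟩, ?_, by simp, fun t ht => ?_, ?_,
    continuityEq_twoPoint hκ hT hG hum hup, Eventually.of_forall fun t s _ => ?_,
    limitAction_eq_zero hκ hT hG (fun t ht => abs_gap_lt hκ hm' hα' ht.1) hum hup,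
    fun t ht => ⟨?_, ?_⟩⟩
  · rw [FiniteMeasure.tendsto_iff_forall_integral_tendsto]
    intro f
    have h1 := hseq.tendsto_integral hH ht f.continuous
    rw [integral_twoPoint, hum t ht, hup t ht]
    refine h1.trans (le_of_eq ?_)
    congr 1
    ring
  · refine (hseq.tendsto_trace hH).1.congr fun n => ?_
    exact setIntegral_congr_fun measurableSet_Ioo fun t ht => by simp only [hum' t ht]
  · refine (hseq.tendsto_trace hH).2.congr fun n => ?_
    exact setIntegral_congr_fun measurableSet_Ioo fun t ht => by simp only [hup' t ht]
  · exact (hflow n).aemeasurable_eLpNorm_density hH le_rfl (by linarith [hδ.1])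
      (NNReal.continuous_coe.comp humc).measurable.aemeasurable
  · exact (hflow n).aemeasurable_eLpNorm_density hH (by linarith [hδ.1]) le_rfl
      (NNReal.continuous_coe.comp hupc).measurable.aemeasurable
  · refine (hseq.tendsto_uniform hH hδ).1.congr fun n => ?_
    exact setLIntegral_congr_fun measurableSet_Ioo fun t ht => by simp only [hum' t ht]
  · refine (hseq.tendsto_uniform hH hδ).2.congr fun n => ?_
    exact setLIntegral_congr_fun measurableSet_Ioo fun t ht => by simp only [hup' t ht]
  · simpa using hseq.tendsto_uHat hH hφ
  · have h1 := (hseq.tendsto_wHat hH hφ).neg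
    simp only [mul_neg, integral_neg, neg_neg] at h1
    simpa only [mul_neg, integral_neg, Measure.zero_prod, integral_zero_measure, add_zero] using h1
  · filter_upwards [hmem] with t ht
    rw [hum' t ht, hup' t ht]
    constructor <;> field_simp
    ring
  · rw [FiniteMeasure.tendsto_iff_forall_integral_tendsto]
    intro f
    have h1 := hseq.tendsto_integral_sHat hH ht f.continuous
    rw [integral_twoPoint, hum t ht, hup t ht]
    have e1 : ((m - gap H α t) * f (-kap H) + (m + gap H α t) * f (kap H)) / 2 =
        (m - gap H α t) / 2 * f (-kap H) + (m + gap H α t) / 2 * f (kap H) := by ring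
    rw [← e1]
    refine h1.congr fun n => ?_
    rw [FiniteMeasure.toMeasure_map, integral_map (continuous_sHat hH _).measurable.aemeasurable
      f.continuous.measurable.aestronglyMeasurable]
  · filter_upwards [hmem] with t ht
    refine Eventually.of_forall fun s => ?_
    rw [hdup t ht]
    ring
  · field_simp
    ring
  · rw [hum t ht, hup t ht, hrate]
    exact ((((hG t).const_sub (m : ℝ)).congr_deriv (by ring)).hasDerivWithinAt).congr hum (hum t ht)
  · rw [hum t ht, hup t ht, hrate]
    exact ((((hG t).const_add (m : ℝ)).congr_deriv (by ring)).hasDerivWithinAt).congr hup (hup t ht)
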